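/- \textbf{Setting.} A deterministic nested weighted automaton (NWA) $\mathbb{A}$ over a finite alphabet $\Sigma$ consists of a deterministic master automaton with a Büchi acceptance condition, whose transitions are labeled by indices $1,\dots,k$, and of deterministic finite-word automata $\mathfrak{B}_1,\dots,\mathfrak{B}_k$ (slave automata) with integer weights on transitions, each recognizing a prefix-free language. On an infinite word $w$, at every position $i$ the slave automaton $\mathfrak{B}_j$, where $j$ is the label of the $i$-th transition of the master automaton, is started and runs on a finite (possibly empty) factor of $w$ that starts at position $i$. A run is accepting if the run of the master automaton and all runs of slave automata are accepting and infinitely many runs of slave automata are on nonempty factors. For a value function $g$ on nonempty finite weight sequences, a slave run on a nonempty factor returns $g$ of its weight sequence; a slave run on the empty factor is silent and returns nothing. The value of an accepting run of the $(\textsc{LimAvg};g)$-automaton $\mathbb{A}$ is $\limsup_{m\to\infty}\frac1m\sum_{l=1}^m a_l$, where $a_1a_2\dots$ is the sequence of returned values; the value $\mathbb{A}(w)$ of a word $w$ is the infimum of the values of its accepting runs ($+\infty$ if there is none). Here $g$ is one of $\textsc{Max}$, $\textsc{Min}$, $\textsc{Sum}$, $\textsc{Sum}^+$ (the sum of absolute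 values), or the bounded sum $\textsc{Sum}^B$ with $B\in\mathbb{N}$ (the sum if all partial sums lie in $[-B,B]$, and otherwise $B$ or $-B$ according to the sign of the first partial sum outside $[-B,B]$). A labeled Markov chain $\mathcal{M}$ with finite state set $S$, initial state $s_0$ and rational edge probabilities $E(s,a,s')\ge 0$, where $\sum_{a,s'}E(s,a,s')=1$ for every $s$, defines a probability measure on its infinite paths from $s_0$ and, through the labels of the paths, a probability measure $\mathbb{P}_{\mathcal{M}}$ on $\Sigma^\omega$. The product of the master automaton and $\mathcal{M}$ has an edge from $(q,s)$ to $(q',s')$ if for some letter $a$ the master automaton moves from $q$ to $q'$ on $a$ and $E(s,a,s')>0$; an end SCC is a nonempty strongly connected set of states of the product with no leaving edges. Each path of $\mathcal{M}$ induces a path in the product (from the pair of initial states). \textbf{Theorem.} Consider as inputs a Markov chain $\mathcal{M}$, a value function $g$ as above, a deterministic $(\textsc{LimAvg};g)$-automaton $\mathbb{A}$ such that $\mathbb{P}_{\mathcal{M}}$-almost every word has an accepting run, and a threshold $\lambda\in\mathbb{Q}$, where probabilities and $\lambda$ are given in binary (numerators and denominators), and the weights of slave automata and the bound $B$ in unary.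 (1) The value of the cumulative distribution \[\mathbb{D}_{\mathcal{M},\mathbb{A}}(\lambda)=\mathbb{P}_{\mathcal{M}}(\{w : \mathbb{A}(w)\le\lambda\})\] is rational and can be computed exactly from the input in polynomial time. (2) Moreover, for every end SCC $C$ of the product of the master automaton and $\mathcal{M}$ such that a path of $\mathcal{M}$ ends up in $C$ with positive probability, the value of the word is integrable conditionally on the event that the path ends up in $C$, and for almost all paths that end up in $C$ the value of the word is equal to the conditional expected value of $\mathbb{A}$ given this event. -/

import Mathlib

open MeasureTheory ProbabilityTheory Filter
open scoped ENNReal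

noncomputable section

namespace NestedWeighted

/-! ### Words and deterministic labeled automata -/

/-- The factor of length `n` of the infinite word `w` that starts at position `i`
(positions are counted from `0`). -/
def factor {A : Type} (w : ℕ → A) (i n : ℕ) : List A :=
  List.ofFn fun j : Fin n => w (i + j)

theorem factor_snoc {B : Type} (w : ℕ → B) (n : ℕ) : factor w 0 (n + 1) = factor w 0 n ++ [w n] := by
  simp only [factor, List.ofFn_succ_last]
  simp

/-- A deterministic (complete) `X`-labeled automaton over the alphabet `A` with state set `Q`.
The transitions are `(q, a, next q a)`, so labels of transitions are indexed by `(q, a)`. -/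
structure DetAutomaton (A Q X : Type) where
  init : Q
  next : Q → A → Q
  accept : Q → Bool
  label : Q → A → X

namespace DetAutomaton

/-- The last state of the run on the finite word `u`. -/
def stateAfter {A Q X : Type} (M : DetAutomaton A Q X) (u : List A) : Q :=
  u.foldl M.next M.init

/-- The sequence of labels of the transitions taken on the finite word `u` from the state `q`. -/
def labelsFrom {A Q X : Type} (M : DetAutomaton A Q X) : Q → List A → List X
  | _, [] => []
  | q, a :: u => M.label q a :: M.labelsFrom (M.next q a) u

/-- The sequence of labels of the run on the finite word `u`. -/
def labels {A Q X : Type} (M : DetAutomaton A Q X) (u : List A) : List X :=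
  M.labelsFrom M.init u

/-- The set of finite words whose run is accepting. -/
def language {A Q X : Type} (M : DetAutomaton A Q X) : Language A :=
  {u | M.accept (M.stateAfter u) = true}

/-- No proper extension of an accepted finite word is accepted. -/
def PrefixFree {A Q X : Type} (M : DetAutomaton A Q X) : Prop :=
  ∀ u ∈ M.language, ∀ v ∈ M.language, u <+: v → u = v

/-- The state in position `n` of the run on the infinite word `w`. -/
def stateAt {A Q X : Type} (M : DetAutomaton A Q X) (w : ℕ → A) (n : ℕ) : Q :=
  M.stateAfter (factor w 0 n)

/-- The run on the infinite word `w` visits accepting states infinitely often. -/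
def AcceptsInf {A Q X : Type} (M : DetAutomaton A Q X) (w : ℕ → A) : Prop :=
  ∃ᶠ n in atTop, M.accept (M.stateAt w n) = true

end DetAutomaton

/-! ### Value functions -/

/-- Bounded sum with accumulator `s`: the sum of the sequence if every partial sum lies in
`[-B, B]`, and otherwise `B` with the sign of the first partial sum outside `[-B, B]`. -/
def boundedSumFrom (B : ℕ) : ℤ → List ℤ → ℤ
  | s, [] => s
  | s, x :: l => if |s + x| ≤ (B : ℤ) then boundedSumFrom B (s + x) l else (s + x).sign * B

/-- The value functions for finite sequences of weights. -/
inductive FinVal where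
  | max
  | min
  | boundedSum (B : ℕ)
  | absSum
  | sum

/-- The value of a sequence of weights. It is only used for nonempty sequences; the entries
for the empty list are irrelevant. -/
def FinVal.eval : FinVal → List ℤ → ℤ
  | .max, [] => 0
  | .max, x :: l => l.foldl (fun y z => Max.max y z) x
  | .min, [] => 0
  | .min, x :: l => l.foldl (fun y z => Min.min y z) x
  | .boundedSum B, l => boundedSumFrom B 0 l
  | .absSum, l => (l.map fun x => |x|).sum
  | .sum, l => l.sum

/-- The limit average of an infinite sequence, as an extended real number. -/
def limAvg (a : ℕ → ℤ) : EReal :=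
  limsup (fun k : ℕ => (((∑ i ∈ Finset.range k, (a i : ℝ)) / (k : ℝ) : ℝ) : EReal)) atTop

/-- The limit average with silent moves: `limAvg` of the sequence that remains when the symbols
`none` are removed. It is only used when infinitely many entries are different from `none`. -/
def silentLimAvg (v : ℕ → Option ℤ) : EReal :=
  limAvg fun k => (v (Nat.nth (fun i => (v i).isSome = true) k)).getD 0

/-! ### Deterministic nested weighted automata with master value function limit average -/

/-- A deterministic nested weighted automaton over the alphabet `A`: a deterministic master
automaton labeled by indices of slave automata, and deterministic weighted slave automata that
recognize prefix-free languages. -/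
structure DetNWA (A Q : Type) (k : ℕ) (P : Fin k → Type) where
  master : DetAutomaton A Q (Fin k)
  slave : (i : Fin k) → DetAutomaton A (P i) ℤ
  prefixFree : ∀ i, (slave i).PrefixFree

namespace DetNWA

/-- The index of the slave automaton invoked in position `i` of the word `w`. -/
def invoked {A Q : Type} {k : ℕ} {P : Fin k → Type} (N : DetNWA A Q k P) (w : ℕ → A) (i : ℕ) :
    Fin k :=
  N.master.label (N.master.stateAt w i) (w i)

/-- Since all the automata are deterministic, a run on `w` is given by the lengths `len i` of the
factors of `w` on which the slave automata run: the slave invoked in position `i` runs on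
`factor w i (len i)`. The run is accepting if the run of the master automaton and the runs of all
slave automata are accepting, and infinitely many slave automata take at least one transition. -/
def IsAcceptingRun {A Q : Type} {k : ℕ} {P : Fin k → Type} (N : DetNWA A Q k P)
    (w : ℕ → A) (len : ℕ → ℕ) : Prop :=
  N.master.AcceptsInf w ∧
  (∀ i, factor w i (len i) ∈ (N.slave (N.invoked w i)).language) ∧
  ∃ᶠ i in atTop, 0 < len i

/-- The value returned by the slave automaton invoked in position `i` when it runs on
`factor w i n`; the value `none` (silent) is returned by a run on the empty word. -/
def slaveValue {A Q : Type} {k : ℕ} {P : Fin k → Type} (N : DetNWA A Q k P) (g : FinVal)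
    (w : ℕ → A) (i n : ℕ) : Option ℤ :=
  if n = 0 then none else some (g.eval ((N.slave (N.invoked w i)).labels (factor w i n)))

/-- The value of the word `w` for `N` regarded as a `(LimAvg; g)`-automaton: the infimum of the
values of all accepting runs (`⊤` if there is none). -/
def value {A Q : Type} {k : ℕ} {P : Fin k → Type} (N : DetNWA A Q k P) (g : FinVal)
    (w : ℕ → A) : EReal :=
  ⨅ (len : ℕ → ℕ) (_ : N.IsAcceptingRun w len), silentLimAvg fun i => N.slaveValue g w i (len i)

end DetNWA

/-! ### Labeled Markov chains -/

/-- A labeled Markov chain with alphabet `A`, state set `S` and rational probabilities. -/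
structure MarkovChain (A S : Type) [Fintype A] [Fintype S] where
  init : S
  prob : S → A → S → ℚ
  prob_nonneg : ∀ s a s', 0 ≤ prob s a s'
  prob_sum : ∀ s, ∑ a, ∑ s', prob s a s' = 1

namespace MarkovChain

variable {A S : Type} [Fintype A] [Fintype S]

/-- The distribution of the next letter and the next state in the state `s`. -/
def stepPMF (M : MarkovChain A S) (s : S) : PMF (A × S) :=
  PMF.ofFintype (fun x => ENNReal.ofReal ((M.prob s x.1 x.2 : ℚ) : ℝ)) (by
    rw [← ENNReal.ofReal_sum_of_nonneg
      (fun x _ => by exact_mod_cast M.prob_nonneg s x.1 x.2), Fintype.sum_prod_type]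
    have h := M.prob_sum s
    rw [show (∑ a, ∑ s', ((M.prob s a s' : ℚ) : ℝ)) = 1 by exact_mod_cast h]
    simp)

variable [MeasurableSpace A] [MeasurableSpace S] [MeasurableSingletonClass S]

/-- The transition kernel from the current state to the pairs (next letter, next state). -/
def stepKernel (M : MarkovChain A S) : Kernel S (A × S) :=
  Kernel.ofFunOfCountable fun s => (M.stepPMF s).toMeasure

instance (M : MarkovChain A S) : IsMarkovKernel M.stepKernel :=
  ⟨fun s => by change IsProbabilityMeasure ((M.stepPMF s).toMeasure); infer_instance⟩

/-- The probability measure on infinite paths from the initial state. The entry `ω n = (a, s)` of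
a path is the `n`-th letter together with the state that is entered with this letter. -/
def pathMeasure (M : MarkovChain A S) : Measure (ℕ → A × S) :=
  Kernel.trajMeasure (X := fun _ => A × S) (M.stepPMF M.init).toMeasure
    fun n => M.stepKernel.comap
      (fun x : (Finset.Iic n) → A × S => (x ⟨n, Finset.mem_Iic.2 le_rfl⟩).2)
      (measurable_snd.comp (measurable_pi_apply _))

end MarkovChain

/-- The infinite word that labels a path. -/
def wordOf {A S : Type} (ω : ℕ → A × S) : ℕ → A := fun n => (ω n).1

namespace MarkovChain

/-- The probability measure on infinite words given by the Markov chain. -/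
def wordMeasure {A S : Type} [Fintype A] [Fintype S] [MeasurableSpace A] [MeasurableSpace S]
    [MeasurableSingletonClass S] (M : MarkovChain A S) : Measure (ℕ → A) :=
  M.pathMeasure.map wordOf

/-- The state in position `n` of a path from the initial state. -/
def chainState {A S : Type} [Fintype A] [Fintype S] (M : MarkovChain A S) (ω : ℕ → A × S) : ℕ → S
  | 0 => M.init
  | n + 1 => (ω n).2

section Cylinder

variable {A S : Type} [Fintype A] [Fintype S]

/-- The probability of emitting the finite word `u` from the state `s`: the sum, over all paths
labeled by `u`, of the products of the edge probabilities. -/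
def wordProb (M : MarkovChain A S) : S → List A → ℚ
  | _, [] => 1
  | s, a :: u => ∑ s', M.prob s a s' * M.wordProb s' u

theorem wordProb_nonneg (M : MarkovChain A S) (u : List A) : ∀ s, 0 ≤ M.wordProb s u := by
  induction u with
  | nil => intro s; simp [wordProb]
  | cons a u ih =>
    intro s
    exact Finset.sum_nonneg fun s' _ => mul_nonneg (M.prob_nonneg _ _ _) (ih s')

variable [MeasurableSpace A] [MeasurableSpace S] [MeasurableSingletonClass S] [MeasurableSingletonClass A]

/-- `wordProb` as an extended nonnegative real number. -/
def wordWeight (M : MarkovChain A S) (s : S) (u : List A) : ℝ≥0∞ := ENNReal.ofReal ((M.wordProb s u : ℚ) : ℝ)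

open Classical in
theorem step_lintegral (M : MarkovChain A S) (s : S) (a : A) (v : List A) :
    ∫⁻ x, (if x.1 = a then M.wordWeight x.2 v else 0) ∂(M.stepPMF s).toMeasure = M.wordWeight s (a :: v) := by
  rw [lintegral_fintype]
  simp_rw [PMF.toMeasure_apply_singleton _ _ (MeasurableSet.singleton _)]
  simp only [stepPMF, PMF.ofFintype_apply, Fintype.sum_prod_type, ite_mul, zero_mul]
  rw [Finset.sum_eq_single a]
  · simp only [if_true, wordWeight, wordProb]
    push_cast
    rw [ENNReal.ofReal_sum_of_nonneg]
    · refine Finset.sum_congr rfl fun s' _ => ?_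
      rw [mul_comm, ENNReal.ofReal_mul]
      exact_mod_cast M.prob_nonneg _ _ _
    · intro s' _
      exact_mod_cast mul_nonneg (M.prob_nonneg _ _ _) (M.wordProb_nonneg _ _)
  · intro b _ hb; simp [hb]
  · simp

open Classical in
theorem lintegral_prefix_step (M : MarkovChain A S) (u : List A) (a : A) (v : List A) :
    ∫⁻ ω, (if factor (wordOf ω) 0 u.length = u then M.wordWeight (M.chainState ω u.length) (a :: v) else 0)
      ∂M.pathMeasure =
    ∫⁻ ω, (if factor (wordOf ω) 0 (u.length + 1) = u ++ [a] then
      M.wordWeight (M.chainState ω (u.length+1)) v else 0) ∂M.pathMeasure := by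
  rcases hn : u.length with _ | m
  · obtain rfl : u = [] := List.length_eq_zero_iff.1 hn
    have h0 : M.pathMeasure.map (fun ω => ω 0) = (M.stepPMF M.init).toMeasure := by
      have h1 : M.pathMeasure.map (Preorder.frestrictLe (π := fun _ => A × S) 0) =
          (M.stepPMF M.init).toMeasure.map (MeasurableEquiv.piUnique (fun _ : (Finset.Iic 0) => A × S)).symm := by
        unfold pathMeasure
        rw [Kernel.trajMeasure, Measure.map_comp _ _ (by fun_prop), Kernel.traj_map_frestrictLe,
          Kernel.partialTraj_self, Measure.id_comp]
      have h2 := congrArg (fun ν => Measure.map (fun x : (Finset.Iic 0) → A × S => x ⟨0, by simp⟩) ν) h1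
      beta_reduce at h2
      rw [Measure.map_map (by fun_prop) (by fun_prop), Measure.map_map (by fun_prop) (by fun_prop)] at h2
      exact h2.trans Measure.map_id
    have : ∀ ω : ℕ → A × S, (factor (wordOf ω) 0 (0 + 1) = [] ++ [a]) ↔ (ω 0).1 = a := by
      intro ω; rw [factor_snoc]; simp [factor, wordOf]
    simp_rw [this]
    have e := step_lintegral M M.init a v
    rw [← h0, lintegral_map (measurable_of_countable _) (by fun_prop)] at e
    have : IsProbabilityMeasure M.pathMeasure := by unfold pathMeasure; infer_instance
    simp [chainState, factor, e]
  · have h1 := Kernel.map_frestrictLe_trajMeasure_compProd_eq_map_trajMeasure (X := fun _ => A × S)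
      (μ₀ := (M.stepPMF M.init).toMeasure) (κ := fun n => M.stepKernel.comap
      (fun x : (Finset.Iic n) → A × S => (x ⟨n, Finset.mem_Iic.2 le_rfl⟩).2)
      (measurable_snd.comp (measurable_pi_apply _))) (a := m)
    change (M.pathMeasure.map (Preorder.frestrictLe (π := fun _ => A × S) m)) ⊗ₘ _ = M.pathMeasure.map _ at h1
    have : IsProbabilityMeasure M.pathMeasure := by unfold pathMeasure; infer_instance
    let f : ((Finset.Iic m) → A × S) → List A := fun x => List.ofFn fun j : Fin (m+1) => (x ⟨j, Finset.mem_Iic.2 (by omega)⟩).1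
    have hf : ∀ ω : ℕ → A × S, f (Preorder.frestrictLe (π := fun _ => A × S) m ω) = factor (wordOf ω) 0 (m+1) := by
      intro ω; simp [f, factor, wordOf]
    let G : ((Finset.Iic m) → A × S) × (A × S) → ℝ≥0∞ := fun z =>
      if f z.1 = u then (if z.2.1 = a then M.wordWeight z.2.2 v else 0) else 0
    have e := congrArg (fun ν => ∫⁻ z, G z ∂ν) h1
    beta_reduce at e
    rw [lintegral_map (measurable_of_countable _) (by fun_prop), Measure.lintegral_compProd (measurable_of_countable _), lintegral_map (measurable_of_countable _) (by fun_prop)] at e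
    have L : ∀ ω : ℕ → A × S, (if factor (wordOf ω) 0 (m+1) = u then M.wordWeight (M.chainState ω (m+1)) (a :: v) else 0) = ∫⁻ y, G (Preorder.frestrictLe (π := fun _ => A × S) m ω, y) ∂ (M.stepPMF (ω m).2).toMeasure := by
      intro ω
      simp only [G, hf]
      split_ifs
      · rw [step_lintegral]; rfl
      · simp
    have R : ∀ ω : ℕ → A × S, (if factor (wordOf ω) 0 (m+1+1) = u ++ [a] then M.wordWeight (M.chainState ω (m+1+1)) v else 0) = G (Preorder.frestrictLe (π := fun _ => A × S) m ω, ω (m+1)) := by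
      intro ω
      simp only [G, hf]
      rw [factor_snoc]
      have : factor (wordOf ω) 0 (m+1) ++ [wordOf ω (m+1)] = u ++ [a] ↔ factor (wordOf ω) 0 (m+1) = u ∧ (ω (m+1)).1 = a := by
        constructor
        · intro h
          have h3 := List.append_inj h (by simp [factor, hn])
          exact ⟨h3.1, by simpa [wordOf] using h3.2⟩
        · rintro ⟨h3, h4⟩
          rw [h3, ← h4]; rfl
      simp only [this, chainState, ite_and]
    simp_rw [L, R]
    exact e

open Classical in
theorem lintegral_prefix (M : MarkovChain A S) (u : List A) : ∀ v : List A,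
    ∫⁻ ω, (if factor (wordOf ω) 0 u.length = u then M.wordWeight (M.chainState ω u.length) v else 0)
      ∂M.pathMeasure = M.wordWeight M.init (u ++ v) := by
  have : IsProbabilityMeasure M.pathMeasure := by unfold pathMeasure; infer_instance
  induction u using List.reverseRecOn with
  | nil => intro v; simp [factor, chainState]
  | append_singleton u a ih =>
    intro v
    have := M.lintegral_prefix_step u a v
    rw [ih] at this
    rw [List.append_assoc, List.singleton_append, this, List.length_append, List.length_singleton]

/-- The probability of the words that start with `u` is the probability of `u`, so `wordMeasure`
is the unique extension of these values to a measure on infinite words. -/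
theorem wordMeasure_cylinder (M : MarkovChain A S) (u : List A) :
    M.wordMeasure {w | factor w 0 u.length = u} = ENNReal.ofReal ((M.wordProb M.init u : ℚ) : ℝ) := by
  classical
  have hw : Measurable (wordOf : (ℕ → A × S) → ℕ → A) := by unfold wordOf; fun_prop
  have hf : Measurable (fun w : ℕ → A => fun j : Fin u.length => w (0 + j)) := by fun_prop
  have hs : MeasurableSet {w : ℕ → A | factor w 0 u.length = u} :=
    hf (Set.toFinite {x | List.ofFn x = u}).measurableSet
  have h := M.lintegral_prefix u []
  rw [List.append_nil] at h
  change _ = M.wordWeight M.init u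
  rw [← h, wordMeasure, Measure.map_apply hw hs, ← lintegral_indicator_one (hw hs)]
  refine lintegral_congr fun ω => ?_
  simp [Set.indicator, wordWeight, wordProb]

end Cylinder

end MarkovChain

/-! ### The product of the master automaton and the Markov chain -/

section Product

variable {A S Q X : Type} [Fintype A] [Fintype S]

/-- The edges of positive probability of the product of a deterministic automaton and a
Markov chain. -/
def ProductEdge (D : DetAutomaton A Q X) (M : MarkovChain A S) (x y : Q × S) : Prop :=
  ∃ a, D.next x.1 a = y.1 ∧ 0 < M.prob x.2 a y.2

/-- `C` is an end SCC of the product: nonempty, strongly connected, and without leaving edges. -/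
def IsEndSCC (D : DetAutomaton A Q X) (M : MarkovChain A S) (C : Set (Q × S)) : Prop :=
  C.Nonempty ∧
  (∀ x ∈ C, ∀ y ∈ C, Relation.ReflTransGen (ProductEdge D M) x y) ∧
  ∀ x ∈ C, ∀ y, ProductEdge D M x y → y ∈ C

/-- The set of paths of the Markov chain whose run in the product ends up in `C`. -/
def endsIn (D : DetAutomaton A Q X) (M : MarkovChain A S) (C : Set (Q × S)) :
    Set (ℕ → A × S) :=
  {ω | ∀ᶠ n in atTop, (D.stateAt (wordOf ω) n, M.chainState ω n) ∈ C}

end Product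

/-! ### Programs with logarithmic cost, polynomial time

The machine model is a random access machine with integer arrays, in structured form: while
programs with indirect addressing. Every operation is charged the binary length of all the numbers
and addresses that it involves (logarithmic cost criterion), so that polynomial time is the same
as on Turing machines. -/

/-- The number of binary digits of an integer. -/
def bitLength (z : ℤ) : ℕ := z.natAbs.size

/-- The memory: the array with name `a` holds the integer `σ a i` in its cell `i`. -/
abbrev Store : Type := ℕ → ℤ → ℤ

/-- Arithmetical expressions. -/
inductive RamExpr where
  | const (z : ℤ)
  | read (arr : ℕ) (idx : RamExpr)
  | add (e₁ e₂ : RamExpr)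
  | sub (e₁ e₂ : RamExpr)
  | mul (e₁ e₂ : RamExpr)
  | div (e₁ e₂ : RamExpr)

/-- The value of an expression. -/
def RamExpr.eval (σ : Store) : RamExpr → ℤ
  | .const z => z
  | .read arr idx => σ arr (idx.eval σ)
  | .add e₁ e₂ => e₁.eval σ + e₂.eval σ
  | .sub e₁ e₂ => e₁.eval σ - e₂.eval σ
  | .mul e₁ e₂ => e₁.eval σ * e₂.eval σ
  | .div e₁ e₂ => e₁.eval σ / e₂.eval σ

/-- The cost of evaluating an expression: for every node of the expression, one plus the binary
length of its value. -/
def RamExpr.cost (σ : Store) : RamExpr → ℕ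
  | .const z => 1 + bitLength z
  | .read arr idx => idx.cost σ + (1 + bitLength ((RamExpr.read arr idx).eval σ))
  | .add e₁ e₂ => e₁.cost σ + e₂.cost σ + (1 + bitLength ((RamExpr.add e₁ e₂).eval σ))
  | .sub e₁ e₂ => e₁.cost σ + e₂.cost σ + (1 + bitLength ((RamExpr.sub e₁ e₂).eval σ))
  | .mul e₁ e₂ => e₁.cost σ + e₂.cost σ + (1 + bitLength ((RamExpr.mul e₁ e₂).eval σ))
  | .div e₁ e₂ => e₁.cost σ + e₂.cost σ + (1 + bitLength ((RamExpr.div e₁ e₂).eval σ))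

/-- Programs. A guard `e` of a conditional or of a loop holds if the value of `e` is positive. -/
inductive RamProg where
  | skip
  | write (arr : ℕ) (idx val : RamExpr)
  | seq (c₁ c₂ : RamProg)
  | cond (e : RamExpr) (c₁ c₂ : RamProg)
  | loop (e : RamExpr) (c : RamProg)

/-- `Exec c σ σ' t`: the program `c` started in the memory `σ` halts in the memory `σ'`, at
total cost `t`. -/
inductive Exec : RamProg → Store → Store → ℕ → Prop where
  | skip (σ : Store) : Exec .skip σ σ 1
  | write (σ : Store) (arr : ℕ) (idx val : RamExpr) :
      Exec (.write arr idx val) σ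
        (Function.update σ arr (Function.update (σ arr) (idx.eval σ) (val.eval σ)))
        (idx.cost σ + val.cost σ + 1)
  | seq {c₁ c₂ : RamProg} {σ σ' σ'' : Store} {t₁ t₂ : ℕ} :
      Exec c₁ σ σ' t₁ → Exec c₂ σ' σ'' t₂ → Exec (.seq c₁ c₂) σ σ'' (t₁ + t₂ + 1)
  | cond_pos {e : RamExpr} {c₁ c₂ : RamProg} {σ σ' : Store} {t : ℕ} :
      0 < e.eval σ → Exec c₁ σ σ' t → Exec (.cond e c₁ c₂) σ σ' (e.cost σ + t + 1)
  | cond_neg {e : RamExpr} {c₁ c₂ : RamProg} {σ σ' : Store} {t : ℕ} :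
      ¬ 0 < e.eval σ → Exec c₂ σ σ' t → Exec (.cond e c₁ c₂) σ σ' (e.cost σ + t + 1)
  | loop_stop {e : RamExpr} {c : RamProg} {σ : Store} :
      ¬ 0 < e.eval σ → Exec (.loop e c) σ σ (e.cost σ + 1)
  | loop_step {e : RamExpr} {c : RamProg} {σ σ' σ'' : Store} {t₁ t₂ : ℕ} :
      0 < e.eval σ → Exec c σ σ' t₁ → Exec (.loop e c) σ' σ'' t₂ →
      Exec (.loop e c) σ σ'' (e.cost σ + t₁ + t₂ + 1)

/-- A number in the input, given in binary or in unary notation. -/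
inductive InputNumber where
  | binary (z : ℤ)
  | unary (z : ℤ)

/-- The integer that is represented. -/
def InputNumber.val : InputNumber → ℤ
  | .binary z => z
  | .unary z => z

/-- The length of the representation. -/
def InputNumber.size : InputNumber → ℕ
  | .binary z => 1 + bitLength z
  | .unary z => 1 + z.natAbs

/-- The initial memory for an input: array `0` holds the numbers of the input in its cells
`0, 1, 2, …`, and all the other cells hold `0`. -/
def inputStore (l : List InputNumber) : Store := fun arr i =>
  if arr = 0 ∧ 0 ≤ i then ((l.map InputNumber.val)[i.toNat]?).getD 0 else 0

/-- A number-valued function on a set of encoded inputs is computable in polynomial time: for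
some program and some polynomial, on every input the program halts within a cost bounded by the
polynomial in the size of the input, with the numerator and the (positive) denominator of a
fraction equal to the value of the function in the cells `0` and `1` of array `0`. -/
def PolyTimeComputable {α : Type} (encode : α → List InputNumber) (f : α → ℝ) : Prop :=
  ∃ (c : RamProg) (p : Polynomial ℕ), ∀ x : α, ∃ (σ : Store) (t : ℕ),
    Exec c (inputStore (encode x)) σ t ∧
    t ≤ p.eval ((encode x).map InputNumber.size).sum ∧
    0 < σ 0 1 ∧ f x = (σ 0 0 : ℝ) / (σ 0 1 : ℝ)

/-! ### Inputs of the distribution question -/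

/-- An input of the distribution question: a Markov chain, a deterministic `(LimAvg; g)`-automaton
that accepts almost all words of the Markov chain, and a rational threshold. -/
structure DistributionInput where
  letters : ℕ
  chainStates : ℕ
  masterStates : ℕ
  slaves : ℕ
  slaveStates : Fin slaves → ℕ
  chain : MarkovChain (Fin letters) (Fin chainStates)
  nwa : DetNWA (Fin letters) (Fin masterStates) slaves fun i => Fin (slaveStates i)
  g : FinVal
  threshold : ℚ
  accepts_ae : ∀ᵐ w ∂chain.wordMeasure, ∃ len, nwa.IsAcceptingRun w len

/-- A rational number is given by its numerator and denominator in binary. -/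
def encodeRat (r : ℚ) : List InputNumber := [.binary r.num, .binary r.den]

/-- A chain is given by its initial state and the table of its probabilities. -/
def encodeChain {a n : ℕ} (M : MarkovChain (Fin a) (Fin n)) : List InputNumber :=
  .binary (M.init : ℕ) ::
    (List.finRange n).flatMap fun s => (List.finRange a).flatMap fun b =>
      (List.finRange n).flatMap fun s' => encodeRat (M.prob s b s')

/-- An automaton is given by its initial state, the accepting states, and the tables of
its transitions and of its labels. -/
def encodeAutomaton {a n : ℕ} {X : Type} (encodeLabel : X → InputNumber)
    (D : DetAutomaton (Fin a) (Fin n) X) : List InputNumber :=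
  .binary (D.init : ℕ) ::
    (List.finRange n).flatMap fun q =>
      .binary (if D.accept q then 1 else 0) ::
        (List.finRange a).flatMap fun b => [.binary (D.next q b : ℕ), encodeLabel (D.label q b)]

/-- The value function is given by a tag and the bound `B` in unary (`0` if there is no bound). -/
def encodeFinVal : FinVal → List InputNumber
  | .max => [.binary 0, .unary 0]
  | .min => [.binary 1, .unary 0]
  | .boundedSum B => [.binary 2, .unary B]
  | .absSum => [.binary 3, .unary 0]
  | .sum => [.binary 4, .unary 0]

namespace DistributionInput

/-- The list of numbers that represents the input; weights are in unary notation. -/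
def encode (I : DistributionInput) : List InputNumber :=
  [.unary I.letters, .unary I.chainStates, .unary I.masterStates, .unary I.slaves] ++
  encodeChain I.chain ++
  encodeAutomaton (fun j : Fin I.slaves => .binary (j : ℕ)) I.nwa.master ++
  ((List.finRange I.slaves).flatMap fun j =>
    .unary (I.slaveStates j) :: encodeAutomaton (fun z : ℤ => .unary z) (I.nwa.slave j)) ++
  encodeFinVal I.g ++
  encodeRat I.threshold

/-- The value of a word. -/
def value (I : DistributionInput) (w : ℕ → Fin I.letters) : EReal :=
  I.nwa.value I.g w

/-- The cumulative distribution: the probability that the value of a word is at most the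
threshold. -/
def distribution (I : DistributionInput) : ℝ :=
  I.chain.wordMeasure.real {w | I.value w ≤ (((I.threshold : ℚ) : ℝ) : EReal)}

end DistributionInput

end NestedWeighted

end

open MeasureTheory ProbabilityTheory Filter
open scoped ENNReal

noncomputable section

namespace NestedWeighted

set_option linter.unusedSectionVars false


/-! Prefix-freeness leaves at most one factor on which a slave started at a given position can
accept. Hence almost every word has exactly one accepting run, and its value is the limit, once this
is shown to exist, of the sum of the values returned by slaves started before position `n`, divided
by the number of non-silent slaves among them. A returned value is a sum of increments produced by a
finite device: for the maximum, the minimum and the bounded sum an accumulator in `[-K, K]`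
suffices, while the sum and the absolute sum add their weights directly. As weights and bounds are
in unary, `K` is polynomial in the size of the input. So there is a finite chain, the product of
master and Markov chain, which in its active steps launches a finite reward system that reads the
same word and stops almost surely.

The analytic core is elementary. A linear operator `T` on functions on a finite set that does not
increase the sup norm satisfies `ker (1 - T) ⊕ range (1 - T) = ⊤`
(`SupContraction.exists_decomposition`). Hence the Poisson equation `T g = g`, `g + h = v + T h` has
a solution for every reward `v`, with no assumption on periodicity or on recurrent classes. For a
system that stops almost surely the gain `g` vanishes, the bias `h` is the expected total reward,
and second moments are finite. For the launching chain, the deviations payoff + `h`(next) - `g` -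
`h` have mean zero given the present. They are not martingale differences, because a payoff looks
into the future, but a slave correlates with later deviations only while it runs. Therefore sums of
`n` deviations have second moment `O(n)` (`Sound.exists_second_moment_le`), which is enough for a
strong law. Moreover a harmonic function is eventually constant along almost every path. So the
value of a word is the quotient of the eventual values of two gains, that of the payoffs and that of
the active steps, the latter being positive. On an end SCC harmonic functions are constant by the
maximum principle, which is the second claim.

For the first claim write the threshold as `num / den`. The value is at most the threshold iff the
gain `ν` of the payoff `den * value - num` per active step is eventually nonpositive, and the
probability of this event is the gain, at the initial pair, of the indicator of `ν ≤ 0`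
(`measureReal_value_le`). Thus two linear systems with one common matrix have to be solved, in which
the equations of slaves and master are coupled. The matrix is singular, and no SCC or reachability
analysis is made: on the pairs that matter any solution of the equations gives the right answer.

The systems are solved by fraction-free Gauss-Jordan elimination, whose intermediate entries are
minors of the extended matrix and so have polynomial length (`Elim.Inv`). The program is a sequence
of loops, each filling one array, so its correctness is a description of the final arrays, and its
running time is controlled by the numbers of cells and the bit lengths of their contents. -/

/-! ### The path measures of a Markov chain and the first step decomposition -/

/-- The sequence `e, ω 0, ω 1, …`. -/
def consSeq {B : Type} (e : B) (ω : ℕ → B) : ℕ → B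
  | 0 => e
  | n + 1 => ω n

/-- The sequence without its first entry. -/
def tailSeq {B : Type} (ω : ℕ → B) : ℕ → B := fun n => ω (n + 1)

@[simp] theorem consSeq_zero {B : Type} (e : B) (ω : ℕ → B) : consSeq e ω 0 = e := rfl
@[simp] theorem consSeq_succ {B : Type} (e : B) (ω : ℕ → B) (n : ℕ) :
    consSeq e ω (n + 1) = ω n := rfl
@[simp] theorem tailSeq_consSeq {B : Type} (e : B) (ω : ℕ → B) : tailSeq (consSeq e ω) = ω := rfl
@[simp] theorem consSeq_tailSeq {B : Type} (ω : ℕ → B) : consSeq (ω 0) (tailSeq ω) = ω := by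
  funext n; cases n <;> rfl
@[simp] theorem wordOf_consSeq {A S : Type} (e : A × S) (ω : ℕ → A × S) :
    wordOf (consSeq e ω) = consSeq e.1 (wordOf ω) := by
  funext n; cases n <;> rfl

theorem measurable_consSeq {B : Type} [MeasurableSpace B] (e : B) : Measurable (consSeq e) := by
  refine measurable_pi_lambda _ fun n => ?_
  cases n with
  | zero => exact measurable_const
  | succ n => exact measurable_pi_apply n

theorem measurable_tailSeq {B : Type} [MeasurableSpace B] :
    Measurable (tailSeq : (ℕ → B) → ℕ → B) :=
  measurable_pi_lambda _ fun n => measurable_pi_apply (n + 1)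

theorem measurable_wordOf {A S : Type} [MeasurableSpace A] [MeasurableSpace S] :
    Measurable (wordOf : (ℕ → A × S) → ℕ → A) := by unfold wordOf; fun_prop

/-- A function of the first entry and the tail is measurable if it is measurable in the tail. -/
theorem measurable_first_tail {B E : Type} [MeasurableSpace B] [Countable B]
    [MeasurableSingletonClass B] [MeasurableSpace E] {F : B → (ℕ → B) → E}
    (hF : ∀ e, Measurable (F e)) : Measurable fun ω : ℕ → B => F (ω 0) (tailSeq ω) := by
  have h : Measurable fun p : B × (ℕ → B) => F p.1 p.2 :=
    measurable_from_prod_countable_right hF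
  exact h.comp ((measurable_pi_apply 0).prodMk measurable_tailSeq)

/-- Finite measures on sequences over a finite set are determined by the cylinders. -/
theorem measure_ext_cylinder {B : Type} [Finite B] [MeasurableSpace B]
    [MeasurableSingletonClass B] {μ ν : Measure (ℕ → B)} [IsFiniteMeasure μ] [IsFiniteMeasure ν]
    (h : ∀ (n : ℕ) (c : ℕ → B), μ {ω | ∀ i < n, ω i = c i} = ν {ω | ∀ i < n, ω i = c i}) :
    μ = ν := by
  have key : ∀ n, μ.map (Preorder.frestrictLe (π := fun _ => B) n) =
      ν.map (Preorder.frestrictLe (π := fun _ => B) n) := by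
    intro n
    refine Measure.ext_of_singleton fun x => ?_
    rw [Measure.map_apply (by fun_prop) (measurableSet_singleton _),
      Measure.map_apply (by fun_prop) (measurableSet_singleton _)]
    -- The minimum only extends `x` to all indices; the values beyond `n` play no role.
    let c : ℕ → B := fun i => x ⟨min i n, Finset.mem_Iic.2 (min_le_right _ _)⟩
    have : (Preorder.frestrictLe (π := fun _ => B) n) ⁻¹' {x} = {ω | ∀ i < n + 1, ω i = c i} := by
      ext ω
      simp only [Set.mem_preimage, Set.mem_singleton_iff, Set.mem_ofPred_eq, funext_iff]
      constructor
      · intro hx i hi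
        have := hx ⟨i, Finset.mem_Iic.2 (by omega)⟩
        simp only [Preorder.frestrictLe_apply] at this
        rw [this]
        simp only [c]
        congr 1
        exact Subtype.ext (by simp; omega)
      · rintro hx ⟨i, hi⟩
        have hi' := Finset.mem_Iic.1 hi
        simp only [Preorder.frestrictLe_apply]
        rw [hx i (by omega)]
        simp only [c]
        congr 1
        exact Subtype.ext (by simp; omega)
    rw [this, h]
  -- Every finite index set lies in an initial segment, where the marginals agree; a projective
  -- limit of finite measures is unique.
  refine IsProjectiveLimit.unique (P := fun I => ν.map I.restrict) (fun I => ?_) (fun I => rfl)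
  have hI : I ⊆ Finset.Iic (I.sup id) := I.subset_Iic_sup_id
  have e : (I.restrict : (ℕ → B) → I → B) =
      Finset.restrict₂ (π := fun _ => B) hI ∘ Preorder.frestrictLe (π := fun _ => B) (I.sup id) := rfl
  rw [e, ← Measure.map_map (by fun_prop) (by fun_prop), key,
    Measure.map_map (by fun_prop) (by fun_prop), ← e]


namespace MarkovChain

variable {A S : Type} [Fintype A] [Fintype S]

/-- The chain with another initial state. -/
def startAt (M : MarkovChain A S) (s : S) : MarkovChain A S := { M with init := s }

/-- The probability of an edge as a real number. -/
def edge (M : MarkovChain A S) (s : S) (e : A × S) : ℝ := ((M.prob s e.1 e.2 : ℚ) : ℝ)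

theorem edge_nonneg (M : MarkovChain A S) (s : S) (e : A × S) : 0 ≤ M.edge s e := by
  unfold edge; exact_mod_cast M.prob_nonneg s e.1 e.2

theorem sum_edge (M : MarkovChain A S) (s : S) : ∑ e, M.edge s e = 1 := by
  have h := M.prob_sum s
  rw [Fintype.sum_prod_type]
  unfold edge
  exact_mod_cast h

variable [MeasurableSpace A] [MeasurableSpace S] [MeasurableSingletonClass S]

/-- The measure on infinite paths from the state `s`. -/
def pathFrom (M : MarkovChain A S) (s : S) : Measure (ℕ → A × S) := (M.startAt s).pathMeasure

theorem pathFrom_init (M : MarkovChain A S) : M.pathFrom M.init = M.pathMeasure := rfl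

instance (M : MarkovChain A S) : IsProbabilityMeasure M.pathMeasure := by
  unfold pathMeasure; infer_instance

instance (M : MarkovChain A S) (s : S) : IsProbabilityMeasure (M.pathFrom s) := by
  unfold pathFrom; infer_instance

variable [MeasurableSingletonClass A]

theorem pathMeasure_zero (M : MarkovChain A S) :
    M.pathMeasure.map (fun ω => ω 0) = (M.stepPMF M.init).toMeasure := by
  have h1 : M.pathMeasure.map (Preorder.frestrictLe (π := fun _ => A × S) 0) =
      (M.stepPMF M.init).toMeasure.map
        (MeasurableEquiv.piUnique (fun _ : (Finset.Iic 0) => A × S)).symm := by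
    unfold pathMeasure
    rw [Kernel.trajMeasure, Measure.map_comp _ _ (by fun_prop), Kernel.traj_map_frestrictLe,
      Kernel.partialTraj_self, Measure.id_comp]
  have h2 := congrArg (fun ν => Measure.map
    (fun x : (Finset.Iic 0) → A × S => x ⟨0, by simp⟩) ν) h1
  beta_reduce at h2
  rw [Measure.map_map (by fun_prop) (by fun_prop), Measure.map_map (by fun_prop) (by fun_prop)]
    at h2
  exact h2.trans Measure.map_id

/-- The kernel at each time depends only on the last entry, so prescribing one more coordinate
multiplies by one edge probability. -/
theorem pathMeasure_cylinder (M : MarkovChain A S) (c : ℕ → A × S) (n : ℕ) :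
    M.pathMeasure {ω | ∀ i < n, ω i = c i} =
      ∏ i ∈ Finset.range n, M.stepPMF (M.chainState c i) (c i) := by
  induction n with
  | zero => simp
  | succ n ih =>
    rw [Finset.prod_range_succ, ← ih]
    rcases n with _ | m
    · have h0 := M.pathMeasure_zero
      have : {ω : ℕ → A × S | ∀ i < 0 + 1, ω i = c i} = (fun ω => ω 0) ⁻¹' {c 0} := by
        ext ω; simp
      rw [this, ← Measure.map_apply (by fun_prop) (measurableSet_singleton _), h0,
        PMF.toMeasure_apply_singleton _ _ (measurableSet_singleton _)]
      simp [chainState]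
    · have h1 := Kernel.map_frestrictLe_trajMeasure_compProd_eq_map_trajMeasure
        (X := fun _ => A × S) (μ₀ := (M.stepPMF M.init).toMeasure)
        (κ := fun n => M.stepKernel.comap
          (fun x : (Finset.Iic n) → A × S => (x ⟨n, Finset.mem_Iic.2 le_rfl⟩).2)
          (measurable_snd.comp (measurable_pi_apply _))) (a := m)
      change (M.pathMeasure.map (Preorder.frestrictLe (π := fun _ => A × S) m)) ⊗ₘ _ =
        M.pathMeasure.map _ at h1
      let x : (Finset.Iic m) → A × S := fun i => c i
      have e := congrArg (fun ν => ν ({x} ×ˢ {c (m + 1)})) h1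
      beta_reduce at e
      rw [Measure.compProd_apply_prod (measurableSet_singleton _) (measurableSet_singleton _),
        Measure.map_apply (by fun_prop)
          ((measurableSet_singleton _).prod (measurableSet_singleton _)),
        lintegral_singleton, Measure.map_apply (by fun_prop) (measurableSet_singleton _)] at e
      have hx : ∀ ω : ℕ → A × S, Preorder.frestrictLe (π := fun _ => A × S) m ω = x ↔
          ∀ i < m + 1, ω i = c i := by
        intro ω
        constructor
        · intro h i hi
          exact congrFun h ⟨i, Finset.mem_Iic.2 (by omega)⟩
        · intro h
          funext i
          exact h i (by have := Finset.mem_Iic.1 i.2; omega)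
      have s1 : (Preorder.frestrictLe (π := fun _ => A × S) m) ⁻¹' {x} =
          {ω | ∀ i < m + 1, ω i = c i} := by
        ext ω; exact hx ω
      have s2 : (fun ω : ℕ → A × S => (Preorder.frestrictLe (π := fun _ => A × S) m ω, ω (m + 1))) ⁻¹'
          ({x} ×ˢ {c (m + 1)}) = {ω | ∀ i < m + 1 + 1, ω i = c i} := by
        ext ω
        simp only [Set.mem_preimage, Set.mem_prod, Set.mem_singleton_iff, hx, Set.mem_ofPred_eq]
        constructor
        · rintro ⟨h, h'⟩ i hi
          rcases Nat.lt_succ_iff_lt_or_eq.1 hi with h2 | rfl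
          · exact h i h2
          · exact h'
        · exact fun h => ⟨fun i hi => h i (by omega), h _ (by omega)⟩
      rw [s1, s2] at e
      rw [← e, mul_comm]
      congr 1
      change (M.stepPMF (c m).2).toMeasure {c (m + 1)} = _
      rw [PMF.toMeasure_apply_singleton _ _ (measurableSet_singleton _)]
      rfl

/-- The first step decomposition of the path measure. -/
theorem pathFrom_eq_sum (M : MarkovChain A S) (s : S) :
    M.pathFrom s = ∑ e : A × S, M.stepPMF s e • (M.pathFrom e.2).map (consSeq e) := by
  have hfin : IsFiniteMeasure (∑ e : A × S, M.stepPMF s e • (M.pathFrom e.2).map (consSeq e)) := by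
    refine ⟨?_⟩
    rw [Measure.finsetSum_apply]
    refine ENNReal.sum_lt_top.2 fun e _ => ?_
    rw [Measure.smul_apply, Measure.map_apply (measurable_consSeq e) MeasurableSet.univ]
    exact ENNReal.mul_lt_top ((M.stepPMF s).apply_lt_top e) (measure_lt_top _ _)
  -- On a cylinder of positive length only the summand `e = c 0` contributes, and the remaining
  -- product is that of the shifted cylinder.
  refine measure_ext_cylinder fun n c => ?_
  rw [pathFrom, pathMeasure_cylinder, Measure.finsetSum_apply]
  have hms : MeasurableSet {ω : ℕ → A × S | ∀ i < n, ω i = c i} := by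
    have : {ω : ℕ → A × S | ∀ i < n, ω i = c i} =
        ⋂ i ∈ Finset.range n, (fun ω => ω i) ⁻¹' {c i} := by
      ext ω; simp
    rw [this]
    exact Finset.measurableSet_biInter _ fun i _ => measurable_pi_apply i (measurableSet_singleton _)
  simp_rw [Measure.smul_apply, Measure.map_apply (measurable_consSeq _) hms]
  rcases n with _ | n
  · simp only [Finset.range_zero, Finset.prod_empty, not_lt_zero, IsEmpty.forall_iff, implies_true,
      Set.ofPred_true, Set.preimage_univ, measure_univ, smul_eq_mul, mul_one]
    rw [← tsum_fintype (L := .unconditional _), PMF.tsum_coe]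
  · rw [Finset.sum_eq_single (c 0)]
    · have : consSeq (c 0) ⁻¹' {ω | ∀ i < n + 1, ω i = c i} = {ω | ∀ i < n, ω i = tailSeq c i} := by
        ext ω
        simp only [Set.mem_preimage, Set.mem_ofPred_eq]
        constructor
        · exact fun h i hi => h (i + 1) (by omega)
        · rintro h (_ | i) hi
          · rfl
          · exact h i (by omega)
      rw [this, pathFrom, pathMeasure_cylinder, Finset.prod_range_succ', mul_comm]
      refine congrArg₂ _ rfl (Finset.prod_congr rfl fun i _ => ?_)
      cases i <;> rfl
    · intro e _ he
      have : consSeq e ⁻¹' {ω | ∀ i < n + 1, ω i = c i} = ∅ := by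
        ext ω
        simp only [Set.mem_preimage, Set.mem_ofPred_eq, Set.mem_empty_iff_false, iff_false]
        exact fun h => he (h 0 (by omega))
      rw [this]; simp
    · simp

theorem lintegral_pathFrom (M : MarkovChain A S) (s : S) {F : (ℕ → A × S) → ℝ≥0∞}
    (hF : Measurable F) :
    ∫⁻ ω, F ω ∂M.pathFrom s =
      ∑ e : A × S, M.stepPMF s e * ∫⁻ ω, F (consSeq e ω) ∂M.pathFrom e.2 := by
  conv_lhs => rw [pathFrom_eq_sum]
  rw [lintegral_finsetSum_measure]
  refine Finset.sum_congr rfl fun e _ => ?_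
  rw [lintegral_smul_measure, lintegral_map hF (measurable_consSeq e), smul_eq_mul]

theorem stepPMF_apply (M : MarkovChain A S) (s : S) (e : A × S) :
    M.stepPMF s e = ENNReal.ofReal (M.edge s e) := rfl

/-- No measurability of `p` is needed, because `consSeq e` is a measurable embedding and the image
measure is therefore computed by preimages of arbitrary sets. -/
theorem ae_pathFrom_iff (M : MarkovChain A S) (s : S) {p : (ℕ → A × S) → Prop} :
    (∀ᵐ ω ∂M.pathFrom s, p ω) ↔
      ∀ e, 0 < M.edge s e → ∀ᵐ ω ∂M.pathFrom e.2, p (consSeq e ω) := by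
  have hemb : ∀ e : A × S, MeasurableEmbedding (consSeq e) := fun e =>
    MeasurableEmbedding.of_measurable_inverse (g := tailSeq) (measurable_consSeq e) (by
      have : Set.range (consSeq e) = (fun ω => ω 0) ⁻¹' {e} := by
        ext ω
        constructor
        · rintro ⟨ω', rfl⟩; rfl
        · rintro h
          exact ⟨tailSeq ω, by rw [← (show ω 0 = e from h), consSeq_tailSeq]⟩
      rw [this]
      exact measurable_pi_apply 0 (measurableSet_singleton _)) measurable_tailSeq
      (fun ω => rfl)
  rw [ae_iff, pathFrom_eq_sum, Measure.finsetSum_apply, Finset.sum_eq_zero_iff]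
  refine ⟨fun h e he => ?_, fun h e _ => ?_⟩
  · have := h e (Finset.mem_univ _)
    rw [Measure.smul_apply, smul_eq_mul, mul_eq_zero, (hemb e).map_apply] at this
    rcases this with h0 | h0
    · rw [stepPMF_apply, ENNReal.ofReal_eq_zero] at h0
      exact absurd h0 (not_le.2 he)
    · exact h0
  · rw [Measure.smul_apply, smul_eq_mul, mul_eq_zero, (hemb e).map_apply]
    rcases (M.edge_nonneg s e).eq_or_lt with h0 | h0
    · left; rw [stepPMF_apply, ← h0, ENNReal.ofReal_zero]
    · right; exact h e h0

/-- Integrability is only required along edges of positive probability, since the other summands are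
zero measures. This is what allows arguments on sets closed under such edges. -/
theorem integral_pathFrom (M : MarkovChain A S) (s : S) {F : (ℕ → A × S) → ℝ}
    (hF : Measurable F) (hi : ∀ e, 0 < M.edge s e →
      Integrable (fun ω => F (consSeq e ω)) (M.pathFrom e.2)) :
    Integrable F (M.pathFrom s) ∧ ∫ ω, F ω ∂M.pathFrom s =
      ∑ e : A × S, M.edge s e * ∫ ω, F (consSeq e ω) ∂M.pathFrom e.2 := by
  have hi' : ∀ e ∈ Finset.univ, Integrable F (M.stepPMF s e • (M.pathFrom e.2).map (consSeq e)) := by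
    intro e _
    rcases (M.edge_nonneg s e).eq_or_lt with h0 | h0
    · rw [stepPMF_apply, ← h0, ENNReal.ofReal_zero, zero_smul]; exact integrable_zero_measure
    · refine Integrable.smul_measure ?_ (PMF.apply_ne_top _ _)
      rw [integrable_map_measure hF.aestronglyMeasurable (measurable_consSeq e).aemeasurable]
      exact hi e h0
  constructor
  · rw [pathFrom_eq_sum]
    exact integrable_finsetSum_measure.2 hi'
  · conv_lhs => rw [pathFrom_eq_sum]
    rw [integral_finsetSum_measure hi']
    refine Finset.sum_congr rfl fun e _ => ?_
    rw [integral_smul_measure, integral_map (measurable_consSeq e).aemeasurable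
      hF.aestronglyMeasurable, stepPMF_apply, ENNReal.toReal_ofReal (M.edge_nonneg s e), smul_eq_mul]

end MarkovChain


/-! ### Contractions of the sup norm in finite dimension -/

/-- A linear operator on real functions that does not increase the sup norm. -/
def SupContraction {X : Type} (T : (X → ℝ) →ₗ[ℝ] (X → ℝ)) : Prop :=
  ∀ (f : X → ℝ) (c : ℝ), (∀ x, |f x| ≤ c) → ∀ x, |T f x| ≤ c

namespace SupContraction

variable {X : Type} [Finite X] {T : (X → ℝ) →ₗ[ℝ] (X → ℝ)}

/-- Iterating gives `(T ^ n) h = h - n • g`, and the left side stays bounded. So the kernel and the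
range of `1 - T` meet only in `0`. -/
theorem eq_zero_of_fixed_of_mem_range (hT : SupContraction T) {g h : X → ℝ} (hg : T g = g)
    (hgh : h - T h = g) : g = 0 := by
  have hpow : ∀ n : ℕ, (T ^ n) h = h - (n : ℝ) • g := by
    intro n
    induction n with
    | zero => simp
    | succ n ih =>
      rw [pow_succ', Module.End.mul_apply, ih, map_sub, map_smul, hg]
      rw [show T h = h - g by rw [← hgh]; abel]
      push_cast
      rw [add_smul, one_smul]; abel
  obtain ⟨c, hc⟩ : ∃ c, ∀ x, |h x| ≤ c := by
    obtain ⟨c, hc⟩ := (Set.finite_range fun x => |h x|).bddAbove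
    exact ⟨c, fun x => hc ⟨x, rfl⟩⟩
  have hb : ∀ (n : ℕ) x, |(T ^ n) h x| ≤ c := by
    intro n
    induction n with
    | zero => exact hc
    | succ n ih =>
      intro x
      rw [pow_succ', Module.End.mul_apply]
      exact hT _ _ ih x
  funext x
  by_contra hx
  have hx' : 0 < |g x| := abs_pos.2 hx
  -- Both `h x` and `h x - n * g x` are at most `c` in absolute value, which forces `n * |g x| ≤ 2 *
  -- c`.
  obtain ⟨n, hn⟩ := exists_nat_gt (2 * c / |g x|)
  rw [div_lt_iff₀ hx'] at hn
  have h1 := hb n x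
  rw [hpow] at h1
  simp only [Pi.sub_apply, Pi.smul_apply, smul_eq_mul] at h1
  have h2 : (n : ℝ) * |g x| = |(n : ℝ) * g x| := by
    rw [abs_mul, Nat.abs_cast]
  have h3 := hc x
  have h4 : |(n : ℝ) * g x| ≤ |h x| + |h x - n * g x| := by
    have := abs_sub (h x) (h x - n * g x)
    rwa [sub_sub_cancel] at this
  linarith

/-- Every function is the sum of a fixed point and of an element of the range of `1 - T`. -/
theorem exists_decomposition (hT : SupContraction T) (v : X → ℝ) :
    ∃ g h : X → ℝ, T g = g ∧ v = g + (h - T h) := by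
  let L : (X → ℝ) →ₗ[ℝ] (X → ℝ) := LinearMap.id - T
  have hdis : Disjoint (LinearMap.ker L) (LinearMap.range L) := by
    rw [Submodule.disjoint_def]
    rintro g hg ⟨h, hh⟩
    refine hT.eq_zero_of_fixed_of_mem_range (g := g) (h := h) ?_ hh
    have : g - T g = 0 := hg
    exact (sub_eq_zero.1 this).symm
  -- Rank-nullity: the dimensions of the disjoint kernel and range add up to that of the whole
  -- space.
  have htop : LinearMap.ker L ⊔ LinearMap.range L = ⊤ := by
    refine Submodule.eq_top_of_disjoint _ _ ?_ hdis
    have := LinearMap.finrank_range_add_finrank_ker L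
    omega
  have hv : v ∈ LinearMap.ker L ⊔ LinearMap.range L := by rw [htop]; trivial
  obtain ⟨g, hg, u, ⟨h, rfl⟩, rfl⟩ := Submodule.mem_sup.1 hv
  refine ⟨g, h, ?_, rfl⟩
  have : g - T g = 0 := hg
  exact (sub_eq_zero.1 this).symm

end SupContraction

/-! ### A strong law for sequences with bounded correlations -/

/-- The average converges along the squares `k ^ 2` because its second moments there are summable.
Between consecutive squares there are only `2 * k + 1` terms, whose contribution is controlled by
Cauchy-Schwarz and the individual second moments. -/
theorem tendsto_average_of_second_moments {Ω : Type} [MeasurableSpace Ω] {μ : Measure Ω}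
    {ζ : ℕ → Ω → ℝ} {C : ℝ} (hm : ∀ i, Measurable (ζ i))
    (h1 : ∀ i, ∫⁻ ω, ENNReal.ofReal (ζ i ω ^ 2) ∂μ ≤ ENNReal.ofReal C)
    (h2 : ∀ n : ℕ, ∫⁻ ω, ENNReal.ofReal ((∑ i ∈ Finset.range n, ζ i ω) ^ 2) ∂μ ≤
      ENNReal.ofReal (C * n)) :
    ∀ᵐ ω ∂μ, Tendsto (fun n : ℕ => (∑ i ∈ Finset.range n, ζ i ω) / n) atTop (nhds 0) := by
  -- `ENNReal.ofReal` of a negative number is `0`, so a negative `C` may be replaced by `0`.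
  wlog hC : 0 ≤ C generalizing C
  · refine this (C := 0) (fun i => (h1 i).trans ?_) (fun n => (h2 n).trans ?_) le_rfl
    · exact ENNReal.ofReal_le_ofReal (not_le.1 hC).le
    · exact ENNReal.ofReal_le_ofReal
        (mul_le_mul_of_nonneg_right (not_le.1 hC).le (Nat.cast_nonneg n))
  let J : ℕ → Finset ℕ := fun k => Finset.Ico (k ^ 2) ((k + 1) ^ 2)
  -- Up to a factor `2`, `F k` dominates the squared average at every time between `k ^ 2` and `(k +
  -- 1) ^ 2`.
  let F : ℕ → Ω → ℝ := fun k ω =>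
    ((∑ i ∈ Finset.range (k ^ 2), ζ i ω) ^ 2 + (2 * k + 1) * ∑ i ∈ J k, ζ i ω ^ 2) / k ^ 4
  have hJ : ∀ k, (J k).card = 2 * k + 1 := by
    intro k
    simp only [J, Nat.card_Ico]
    have : (k + 1) ^ 2 = k ^ 2 + (2 * k + 1) := by ring
    omega
  have hF0 : ∀ k ω, 0 ≤ F k ω := fun k ω => by
    have : 0 ≤ ∑ i ∈ J k, ζ i ω ^ 2 := Finset.sum_nonneg fun i _ => sq_nonneg _
    positivity
  have hFm : ∀ k, Measurable (F k) := fun k => by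
    have : ∀ s : Finset ℕ, Measurable fun ω => ∑ i ∈ s, ζ i ω := fun s =>
      Finset.measurable_sum _ fun i _ => hm i
    have h' : Measurable fun ω => ∑ i ∈ J k, ζ i ω ^ 2 :=
      Finset.measurable_sum _ fun i _ => (hm i).pow_const 2
    exact ((((this _).pow_const 2).add (h'.const_mul _))).div_const _
  -- The constant comes from `m ^ 2 + (2 * m + 1) ^ 2 ≤ 10 * m ^ 2` for `m ≥ 1`. The index is
  -- shifted because `F 0` has denominator `0`.
  have hFi : ∀ k : ℕ, ∫⁻ ω, ENNReal.ofReal (F (k + 1) ω) ∂μ ≤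
      ENNReal.ofReal (10 * C / ((k + 1 : ℕ) : ℝ) ^ 2) := by
    intro k
    set m : ℕ := k + 1 with hmk
    have hm1 : (1 : ℝ) ≤ m := by exact_mod_cast Nat.succ_le_succ (Nat.zero_le k)
    have hm0 : (0 : ℝ) < (m : ℝ) ^ 4 := by positivity
    have e : ∀ ω, ENNReal.ofReal (F m ω) = ENNReal.ofReal (((m : ℝ) ^ 4)⁻¹) *
        (ENNReal.ofReal ((∑ i ∈ Finset.range (m ^ 2), ζ i ω) ^ 2) +
          ENNReal.ofReal (2 * m + 1) * ∑ i ∈ J m, ENNReal.ofReal (ζ i ω ^ 2)) := by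
      intro ω
      rw [← ENNReal.ofReal_sum_of_nonneg (fun i _ => sq_nonneg _),
        ← ENNReal.ofReal_mul (by positivity), ← ENNReal.ofReal_add (sq_nonneg _),
        ← ENNReal.ofReal_mul (by positivity)]
      · congr 1
        simp only [F]
        field_simp
      · have : 0 ≤ ∑ i ∈ J m, ζ i ω ^ 2 := Finset.sum_nonneg fun i _ => sq_nonneg _
        positivity
    simp_rw [e]
    have mm : ∀ i, Measurable fun ω => ENNReal.ofReal (ζ i ω ^ 2) := fun i =>
      ((hm i).pow_const 2).ennreal_ofReal
    have mJ : Measurable fun ω => ∑ i ∈ J m, ENNReal.ofReal (ζ i ω ^ 2) :=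
      Finset.measurable_sum _ fun i _ => mm i
    have mS : Measurable fun ω => ENNReal.ofReal ((∑ i ∈ Finset.range (m ^ 2), ζ i ω) ^ 2) :=
      ((Finset.measurable_sum _ fun i _ => hm i).pow_const 2).ennreal_ofReal
    have mA : Measurable fun ω =>
        ENNReal.ofReal ((∑ i ∈ Finset.range (m ^ 2), ζ i ω) ^ 2) +
          ENNReal.ofReal (2 * m + 1) * ∑ i ∈ J m, ENNReal.ofReal (ζ i ω ^ 2) :=
      mS.add (mJ.const_mul _)
    rw [lintegral_const_mul _ mA, lintegral_add_left mS,
      lintegral_const_mul _ mJ, lintegral_finsetSum _ fun i _ => mm i]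
    calc _ ≤ ENNReal.ofReal (((m : ℝ) ^ 4)⁻¹) * (ENNReal.ofReal (C * (m ^ 2 : ℕ)) +
          ENNReal.ofReal (2 * m + 1) * ∑ i ∈ J m, ENNReal.ofReal C) := by
          gcongr
          · exact h2 _
          · exact h1 _
      _ = ENNReal.ofReal (((m : ℝ) ^ 4)⁻¹ * (C * m ^ 2 + (2 * m + 1) * ((2 * m + 1) * C))) := by
          rw [Finset.sum_const, hJ, nsmul_eq_mul, ← ENNReal.ofReal_natCast,
            ← ENNReal.ofReal_mul (by positivity), ← ENNReal.ofReal_mul (by positivity),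
            ← ENNReal.ofReal_add (by positivity) (by positivity),
            ← ENNReal.ofReal_mul (by positivity)]
          push_cast; rfl
      _ ≤ _ := by
          refine ENNReal.ofReal_le_ofReal ?_
          rw [inv_mul_le_iff₀ hm0]
          have : (m : ℝ) ^ 4 * (10 * C / m ^ 2) = 10 * C * m ^ 2 := by field_simp
          rw [this]
          nlinarith [mul_nonneg hC (sub_nonneg.2 hm1), mul_nonneg hC (sq_nonneg ((m : ℝ) - 1)),
            mul_nonneg (mul_nonneg hC (sub_nonneg.2 hm1)) (by linarith : (0 : ℝ) ≤ m)]
  have hsum : ∫⁻ ω, ∑' k, ENNReal.ofReal (F (k + 1) ω) ∂μ ≠ ⊤ := by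
    rw [lintegral_tsum fun k => (hFm _).ennreal_ofReal.aemeasurable]
    refine ne_top_of_le_ne_top ?_ (ENNReal.tsum_le_tsum hFi)
    have hs : Summable fun k : ℕ => 10 * C / ((k + 1 : ℕ) : ℝ) ^ 2 := by
      have h0 : Summable fun k : ℕ => 10 * C * (1 / (k : ℝ) ^ 2) :=
        (Real.summable_one_div_nat_pow.2 (by norm_num)).mul_left _
      refine ((summable_nat_add_iff 1).2 h0).congr fun k => ?_
      rw [mul_one_div]
    rw [← ENNReal.ofReal_tsum_of_nonneg (fun k => by positivity) hs]
    exact ENNReal.ofReal_ne_top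
  have hae := ae_lt_top (Measurable.tsum fun k => (hFm (k + 1)).ennreal_ofReal) hsum
  filter_upwards [hae] with ω hω
  have ht := ENNReal.tendsto_atTop_zero_of_tsum_ne_top hω.ne
  have hF : Tendsto (fun k => F k ω) atTop (nhds 0) := by
    refine (tendsto_add_atTop_iff_nat 1).1 ?_
    have := (ENNReal.tendsto_toReal ENNReal.zero_ne_top).comp ht
    refine this.congr fun k => ?_
    simp [ENNReal.toReal_ofReal (hF0 _ _)]
  have hsq : Tendsto Nat.sqrt atTop atTop :=
    Filter.tendsto_atTop_atTop.2 fun b => ⟨b ^ 2, fun a ha => by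
      rw [Nat.le_sqrt']; exact ha⟩
  have hF2 : Tendsto (fun n : ℕ => Real.sqrt (2 * F (Nat.sqrt n) ω)) atTop (nhds 0) := by
    have := ((hF.comp hsq).const_mul 2).sqrt
    simpa using this
  refine squeeze_zero_norm' ?_ hF2
  filter_upwards [eventually_ge_atTop 1] with n hn
  -- The sum up to `n` is split at `k ^ 2`, the last square not exceeding `n`.
  set k := Nat.sqrt n with hk
  have hk1 : 1 ≤ k := by rw [hk, Nat.le_sqrt']; simpa using hn
  have hkn : k ^ 2 ≤ n := Nat.sqrt_le' n
  have hnk : n < (k + 1) ^ 2 := Nat.lt_succ_sqrt' n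
  refine Real.le_sqrt_of_sq_le ?_
  have hk0 : (0 : ℝ) < k := by exact_mod_cast hk1
  have hsplit : ∑ i ∈ Finset.range n, ζ i ω =
      ∑ i ∈ Finset.range (k ^ 2), ζ i ω + ∑ i ∈ Finset.Ico (k ^ 2) n, ζ i ω :=
    (Finset.sum_range_add_sum_Ico _ hkn).symm
  have hcs : (∑ i ∈ Finset.Ico (k ^ 2) n, ζ i ω) ^ 2 ≤
      (2 * k + 1) * ∑ i ∈ J k, ζ i ω ^ 2 := by
    have hsub : Finset.Ico (k ^ 2) n ⊆ J k := Finset.Ico_subset_Ico_right hnk.le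
    calc _ ≤ ((Finset.Ico (k ^ 2) n).card : ℝ) * ∑ i ∈ Finset.Ico (k ^ 2) n, ζ i ω ^ 2 :=
          sq_sum_le_card_mul_sum_sq
      _ ≤ _ := by
          have h3 : ((Finset.Ico (k ^ 2) n).card : ℝ) ≤ 2 * k + 1 := by
            have := Finset.card_le_card hsub
            rw [hJ] at this
            exact_mod_cast this
          have h4 : ∑ i ∈ Finset.Ico (k ^ 2) n, ζ i ω ^ 2 ≤ ∑ i ∈ J k, ζ i ω ^ 2 :=
            Finset.sum_le_sum_of_subset_of_nonneg hsub fun i _ _ => sq_nonneg _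
          exact mul_le_mul h3 h4 (Finset.sum_nonneg fun i _ => sq_nonneg _) (by positivity)
  rw [Real.norm_eq_abs, sq_abs, div_pow]
  have hn2 : ((k : ℝ) ^ 2) ^ 2 ≤ (n : ℝ) ^ 2 := by
    have : ((k ^ 2 : ℕ) : ℝ) ≤ n := by exact_mod_cast hkn
    push_cast at this
    exact pow_le_pow_left₀ (by positivity) this 2
  have hn0 : (0 : ℝ) < (n : ℝ) ^ 2 := lt_of_lt_of_le (by positivity) hn2
  calc (∑ i ∈ Finset.range n, ζ i ω) ^ 2 / (n : ℝ) ^ 2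
      ≤ (∑ i ∈ Finset.range n, ζ i ω) ^ 2 / ((k : ℝ) ^ 2) ^ 2 := by gcongr
    _ ≤ 2 * ((∑ i ∈ Finset.range (k ^ 2), ζ i ω) ^ 2 + (2 * k + 1) * ∑ i ∈ J k, ζ i ω ^ 2) /
        ((k : ℝ) ^ 2) ^ 2 := by
        gcongr
        rw [hsplit]
        refine add_sq_le.trans ?_
        linarith
    _ = 2 * F k ω := by simp only [F]; ring



/-! ### Accumulating rewards until a stopping state is reached -/

/-- A finite-state device that reads a word and collects rewards until it stops. -/
structure RewardSystem (A Z : Type) where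
  next : Z → A → Z
  halt : Z → Bool
  reward : Z → A → ℝ

namespace RewardSystem

variable {A S Z : Type}

/-- The number of steps until `D` stops, truncated at `n`. -/
def stepsUpTo (D : RewardSystem A Z) : ℕ → Z → (ℕ → A) → ℕ
  | 0, _, _ => 0
  | n + 1, z, w => if D.halt z then 0 else 1 + D.stepsUpTo n (D.next z (w 0)) (tailSeq w)

/-- The reward that `D` collects in the first `n` steps. -/
def rewardUpTo (D : RewardSystem A Z) : ℕ → Z → (ℕ → A) → ℝ
  | 0, _, _ => 0
  | n + 1, z, w =>
    if D.halt z then 0 else D.reward z (w 0) + D.rewardUpTo n (D.next z (w 0)) (tailSeq w)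

/-- `D` stops after at most `n` steps. -/
def StopsBy (D : RewardSystem A Z) : ℕ → Z → (ℕ → A) → Prop
  | 0, z, _ => D.halt z = true
  | n + 1, z, w => D.halt z = true ∨ D.StopsBy n (D.next z (w 0)) (tailSeq w)

def Terminates (D : RewardSystem A Z) (z : Z) (w : ℕ → A) : Prop := ∃ n, D.StopsBy n z w

open Classical in
/-- The total reward, `0` if `D` does not halt. -/
def total (D : RewardSystem A Z) (z : Z) (w : ℕ → A) : ℝ :=
  if h : D.Terminates z w then D.rewardUpTo (Nat.find h) z w else 0

variable {D : RewardSystem A Z}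

theorem StopsBy.mono {n m : ℕ} (hnm : n ≤ m) : ∀ {z : Z} {w : ℕ → A},
    D.StopsBy n z w → D.StopsBy m z w := by
  induction n generalizing m with
  | zero =>
    intro z w h
    cases m with
    | zero => exact h
    | succ m => exact Or.inl h
  | succ n ih =>
    intro z w h
    obtain ⟨m, rfl⟩ : ∃ k, m = k + 1 := ⟨m - 1, by omega⟩
    exact h.imp id fun h => ih (by omega) h

theorem StopsBy.rewardUpTo_eq {n m : ℕ} (hnm : n ≤ m) : ∀ {z : Z} {w : ℕ → A},
    D.StopsBy n z w → D.rewardUpTo m z w = D.rewardUpTo n z w := by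
  induction n generalizing m with
  | zero =>
    intro z w h
    cases m with
    | zero => rfl
    | succ m => simp only [rewardUpTo]; exact if_pos h
  | succ n ih =>
    intro z w h
    obtain ⟨m, rfl⟩ : ∃ k, m = k + 1 := ⟨m - 1, by omega⟩
    simp only [rewardUpTo]
    split_ifs with hz
    · rfl
    · rw [ih (by omega) (h.resolve_left hz)]

theorem StopsBy.total_eq {n : ℕ} {z : Z} {w : ℕ → A} (h : D.StopsBy n z w) :
    D.total z w = D.rewardUpTo n z w := by
  classical
  have hT : D.Terminates z w := ⟨n, h⟩
  rw [total, dif_pos hT]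
  exact ((Nat.find_spec hT).rewardUpTo_eq (Nat.find_min' hT h)).symm

theorem total_of_not_terminates {z : Z} {w : ℕ → A} (h : ¬ D.Terminates z w) :
    D.total z w = 0 := dif_neg h

theorem terminates_of_stop {z : Z} (h : D.halt z = true) (w : ℕ → A) : D.Terminates z w := ⟨0, h⟩

theorem total_of_stop {z : Z} (h : D.halt z = true) (w : ℕ → A) : D.total z w = 0 :=
  StopsBy.total_eq (n := 0) h

theorem terminates_iff {z : Z} {w : ℕ → A} (hz : ¬ D.halt z = true) :
    D.Terminates z w ↔ D.Terminates (D.next z (w 0)) (tailSeq w) := by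
  constructor
  · rintro ⟨n, hn⟩
    cases n with
    | zero => exact absurd hn hz
    | succ n => exact ⟨n, hn.resolve_left hz⟩
  · rintro ⟨n, hn⟩
    exact ⟨n + 1, Or.inr hn⟩

theorem total_step {z : Z} {w : ℕ → A} (hz : ¬ D.halt z = true)
    (h : D.Terminates (D.next z (w 0)) (tailSeq w)) :
    D.total z w = D.reward z (w 0) + D.total (D.next z (w 0)) (tailSeq w) := by
  obtain ⟨n, hn⟩ := h
  rw [hn.total_eq, StopsBy.total_eq (n := n + 1) (Or.inr hn)]
  simp only [rewardUpTo]
  rw [if_neg hz]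

theorem abs_rewardUpTo_le {c : ℝ} (hc : ∀ z a, |D.reward z a| ≤ c) (n : ℕ) : ∀ (z : Z) (w : ℕ → A),
    |D.rewardUpTo n z w| ≤ c * D.stepsUpTo n z w := by
  induction n with
  | zero => intro z w; simp [rewardUpTo, stepsUpTo]
  | succ n ih =>
    intro z w
    simp only [rewardUpTo, stepsUpTo]
    split_ifs
    · simp
    · push_cast
      have := abs_add_le (D.reward z (w 0)) (D.rewardUpTo n (D.next z (w 0)) (tailSeq w))
      linarith [hc z (w 0), ih (D.next z (w 0)) (tailSeq w)]

theorem stepsUpTo_le (n : ℕ) : ∀ (z : Z) (w : ℕ → A), D.stepsUpTo n z w ≤ n := by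
  induction n with
  | zero => intro z w; simp [stepsUpTo]
  | succ n ih =>
    intro z w
    simp only [stepsUpTo]
    split_ifs
    · omega
    · have := ih (D.next z (w 0)) (tailSeq w); omega

section Measurable

variable [MeasurableSpace A] [MeasurableSingletonClass A] [Countable A]

theorem measurable_rewardUpTo (n : ℕ) : ∀ z, Measurable (D.rewardUpTo n z) := by
  induction n with
  | zero => intro z; exact measurable_const
  | succ n ih =>
    intro z
    by_cases hz : D.halt z = true
    · have : D.rewardUpTo (n + 1) z = fun _ => 0 := by
        funext w; simp only [rewardUpTo]; rw [if_pos hz]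
      rw [this]; exact measurable_const
    · have : D.rewardUpTo (n + 1) z = fun w =>
          D.reward z (w 0) + D.rewardUpTo n (D.next z (w 0)) (tailSeq w) := by
        funext w; simp only [rewardUpTo]; rw [if_neg hz]
      rw [this]
      exact measurable_first_tail (F := fun a w => D.reward z a + D.rewardUpTo n (D.next z a) w)
        fun a => (ih _).const_add _

theorem measurable_stepsUpTo (n : ℕ) : ∀ z, Measurable (D.stepsUpTo n z) := by
  induction n with
  | zero => intro z; exact measurable_const
  | succ n ih =>
    intro z
    by_cases hz : D.halt z = true
    · have : D.stepsUpTo (n + 1) z = fun _ => 0 := by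
        funext w; simp only [stepsUpTo]; rw [if_pos hz]
      rw [this]; exact measurable_const
    · have : D.stepsUpTo (n + 1) z = fun w =>
          1 + D.stepsUpTo n (D.next z (w 0)) (tailSeq w) := by
        funext w; simp only [stepsUpTo]; rw [if_neg hz]
      rw [this]
      exact measurable_first_tail (F := fun a w => 1 + D.stepsUpTo n (D.next z a) w)
        fun a => (ih _).const_add _

theorem measurable_stopsBy (n : ℕ) : ∀ z, Measurable (D.StopsBy n z) := by
  induction n with
  | zero => intro z; exact measurable_const
  | succ n ih =>
    intro z
    exact measurable_first_tail (F := fun a w => D.halt z = true ∨ D.StopsBy n (D.next z a) w)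
      fun a => (measurable_const (a := D.halt z = true)).or (ih _)

theorem measurable_total (z : Z) : Measurable (D.total z) := by
  classical
  -- On each word these functions are eventually equal to the total: constant from the stopping time
  -- on, and identically `0` if the system never stops.
  let f : ℕ → (ℕ → A) → ℝ := fun n w => if D.StopsBy n z w then D.rewardUpTo n z w else 0
  have hf : ∀ n, Measurable (f n) := fun n =>
    Measurable.ite (measurable_stopsBy n z).setOf (measurable_rewardUpTo n z) measurable_const
  refine measurable_of_tendsto_metrizable hf (tendsto_pi_nhds.2 fun w => ?_)
  by_cases h : D.Terminates z w
  · obtain ⟨n, hn⟩ := h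
    refine tendsto_const_nhds.congr' ?_
    filter_upwards [eventually_ge_atTop n] with m hm
    simp only [f]
    rw [if_pos (hn.mono hm), (hn.mono hm).total_eq]
  · have : ∀ n, f n w = 0 := fun n => if_neg fun hn => h ⟨n, hn⟩
    simp only [this, total_of_not_terminates h, tendsto_const_nhds_iff]

end Measurable

variable (D)
variable [Fintype A] [Fintype S] [Fintype Z] (M : MarkovChain A S)

/-- The expectation of a function of the state after the next step; `D` does not move when it has
stopped. -/
def stoppedOp : ((Z × S) → ℝ) →ₗ[ℝ] ((Z × S) → ℝ) where
  toFun f x := if D.halt x.1 then f x else ∑ e, M.edge x.2 e * f (D.next x.1 e.1, e.2)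
  map_add' f g := by
    funext x
    simp only [Pi.add_apply]
    split_ifs
    · rfl
    · simp only [mul_add, Finset.sum_add_distrib]
  map_smul' c f := by
    funext x
    simp only [Pi.smul_apply, smul_eq_mul, RingHom.id_apply]
    split_ifs
    · rfl
    · rw [Finset.mul_sum]
      exact Finset.sum_congr rfl fun e _ => by ring

theorem stoppedOp_apply (f : Z × S → ℝ) (x : Z × S) : D.stoppedOp M f x =
    if D.halt x.1 then f x else ∑ e, M.edge x.2 e * f (D.next x.1 e.1, e.2) := rfl

variable {M} in
theorem abs_sum_edge_le (s : S) {f : A × S → ℝ} {c : ℝ}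
    (h : ∀ e, 0 < M.edge s e → |f e| ≤ c) : |∑ e, M.edge s e * f e| ≤ c := by
  calc |∑ e, M.edge s e * f e| ≤ ∑ e, |M.edge s e * f e| := Finset.abs_sum_le_sum_abs _ _
    _ ≤ ∑ e, M.edge s e * c := by
      refine Finset.sum_le_sum fun e _ => ?_
      rw [abs_mul, abs_of_nonneg (M.edge_nonneg s e)]
      rcases (M.edge_nonneg s e).eq_or_lt with h0 | h0
      · rw [← h0]; simp
      · exact mul_le_mul_of_nonneg_left (h e h0) h0.le
    _ = c := by rw [← Finset.sum_mul, M.sum_edge, one_mul]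

theorem supContraction_stoppedOp : SupContraction (D.stoppedOp M) := by
  intro f c hf x
  rw [stoppedOp_apply]
  split_ifs
  · exact hf x
  · exact abs_sum_edge_le x.2 fun e _ => hf _

variable [MeasurableSpace A] [MeasurableSpace S] [MeasurableSingletonClass S]
  [MeasurableSingletonClass A]

/-- A set of pairs of states that is closed under transitions of positive probability and from
which `D` stops almost surely. -/
structure Good (G : Set (Z × S)) : Prop where
  closed : ∀ x ∈ G, ¬ D.halt x.1 = true → ∀ e, 0 < M.edge x.2 e → (D.next x.1 e.1, e.2) ∈ G
  ae : ∀ x ∈ G, ∀ᵐ ω ∂M.pathFrom x.2, D.Terminates x.1 (wordOf ω)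

/-- The probability that `D` has not stopped after `n` steps. -/
def survival (n : ℕ) (x : Z × S) : ℝ :=
  (M.pathFrom x.2).real {ω | ¬ D.StopsBy n x.1 (wordOf ω)}

theorem measurableSet_not_stopsBy (n : ℕ) (z : Z) :
    MeasurableSet {ω : ℕ → A × S | ¬ D.StopsBy n z (wordOf ω)} :=
  ((measurable_stopsBy n z).comp measurable_wordOf).not.setOf

theorem survival_succ (n : ℕ) (x : Z × S) (hx : ¬ D.halt x.1 = true) :
    D.survival M (n + 1) x = ∑ e, M.edge x.2 e * D.survival M n (D.next x.1 e.1, e.2) := by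
  classical
  have h := M.integral_pathFrom x.2
    (F := {ω : ℕ → A × S | ¬ D.StopsBy (n + 1) x.1 (wordOf ω)}.indicator 1)
    (measurable_one.indicator (D.measurableSet_not_stopsBy _ _)) (fun e _ => by
      refine Integrable.of_bound (C := 1) ?_ (ae_of_all _ fun ω => ?_)
      · exact ((measurable_one.indicator (D.measurableSet_not_stopsBy _ _)).comp
          (measurable_consSeq e)).aestronglyMeasurable
      · simp only [Set.indicator]; split_ifs <;> simp)
  have h2 := h.2
  rw [integral_indicator_one (D.measurableSet_not_stopsBy _ _)] at h2
  rw [survival, h2]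
  refine Finset.sum_congr rfl fun e _ => ?_
  congr 1
  rw [survival, ← integral_indicator_one (D.measurableSet_not_stopsBy _ _)]
  refine integral_congr_ae (ae_of_all _ fun ω => ?_)
  simp only [Set.indicator, Set.mem_ofPred_eq, StopsBy, wordOf_consSeq, hx, Bool.false_eq_true, false_or,
    consSeq_zero, tailSeq_consSeq]
  by_cases h3 : D.StopsBy n (D.next x.1 e.1) (wordOf ω) <;> simp [h3]

variable {D M} {G : Set (Z × S)}

/-- Continuity from above: the events decrease to the event of never stopping, which is null on a
good set. -/
theorem Good.tendsto_survival (hG : D.Good M G) {x : Z × S} (hx : x ∈ G) :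
    Tendsto (fun n => D.survival M n x) atTop (nhds 0) := by
  have h := tendsto_measure_iInter_atTop (μ := M.pathFrom x.2)
    (s := fun n => {ω | ¬ D.StopsBy n x.1 (wordOf ω)})
    (fun n => (D.measurableSet_not_stopsBy n x.1).nullMeasurableSet)
    (fun n m hnm ω hω h' => hω (StopsBy.mono hnm h')) ⟨0, measure_ne_top _ _⟩
  have h0 : M.pathFrom x.2 (⋂ n, {ω | ¬ D.StopsBy n x.1 (wordOf ω)}) = 0 := by
    have := hG.ae x hx
    rw [ae_iff] at this
    refine measure_mono_null (fun ω hω => ?_) this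
    rintro ⟨n, hn⟩
    exact Set.mem_iInter.1 hω n hn
  rw [h0] at h
  have := (ENNReal.tendsto_toReal ENNReal.zero_ne_top).comp h
  exact this

/-- A function on a good set that vanishes where `D` has stopped and is harmonic elsewhere
vanishes. -/
theorem Good.eq_zero (hG : D.Good M G) {f : Z × S → ℝ}
    (h0 : ∀ x ∈ G, D.halt x.1 = true → f x = 0)
    (h1 : ∀ x ∈ G, ¬ D.halt x.1 = true → f x = ∑ e, M.edge x.2 e * f (D.next x.1 e.1, e.2)) :
    ∀ x ∈ G, f x = 0 := by
  obtain ⟨c, hc⟩ : ∃ c, ∀ x, |f x| ≤ c := by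
    obtain ⟨c, hc⟩ := (Set.finite_range fun x => |f x|).bddAbove
    exact ⟨c, fun x => hc ⟨x, rfl⟩⟩
  -- When harmonicity is unrolled for `n` steps, only paths that have not stopped contribute, each
  -- with at most `c`.
  have key : ∀ n, ∀ x ∈ G, |f x| ≤ c * D.survival M n x := by
    intro n
    induction n with
    | zero =>
      intro x hx
      by_cases hs : D.halt x.1 = true
      · rw [h0 x hx hs, abs_zero]
        exact mul_nonneg ((abs_nonneg _).trans (hc x)) measureReal_nonneg
      · have : D.survival M 0 x = 1 := by
          have : {ω : ℕ → A × S | ¬ D.StopsBy 0 x.1 (wordOf ω)} = Set.univ := by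
            ext ω; simp [StopsBy, hs]
          rw [survival, this, probReal_univ]
        rw [this, mul_one]; exact hc x
    | succ n ih =>
      intro x hx
      by_cases hs : D.halt x.1 = true
      · rw [h0 x hx hs, abs_zero]
        exact mul_nonneg ((abs_nonneg _).trans (hc x)) measureReal_nonneg
      · rw [h1 x hx hs, D.survival_succ M n x hs, Finset.mul_sum]
        refine (Finset.abs_sum_le_sum_abs _ _).trans (Finset.sum_le_sum fun e _ => ?_)
        rw [abs_mul, abs_of_nonneg (M.edge_nonneg _ _)]
        rcases (M.edge_nonneg x.2 e).eq_or_lt with h2 | h2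
        · rw [← h2]; simp
        · have := mul_le_mul_of_nonneg_left (ih _ (hG.closed x hx hs e h2)) h2.le
          linarith
  intro x hx
  have := ge_of_tendsto' ((hG.tendsto_survival hx).const_mul c) fun n => key n x hx
  rw [mul_zero] at this
  exact abs_eq_zero.1 (le_antisymm this (abs_nonneg _))

variable (D M) in
/-- Solutions of the equations of the total reward exist up to the gain. -/
theorem exists_poisson (v : Z × S → ℝ) (hv : ∀ x, D.halt x.1 = true → v x = 0) :
    ∃ g h : Z × S → ℝ, D.stoppedOp M g = g ∧ g + h = v + D.stoppedOp M h ∧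
      (∀ x, D.halt x.1 = true → g x = 0) ∧ ∀ x, D.halt x.1 = true → h x = 0 := by
  obtain ⟨g, h0, hg, hv'⟩ := (D.supContraction_stoppedOp M).exists_decomposition v
  -- The second decomposition normalizes the bias: subtracting the fixed point `p` does not change
  -- `h0 - T h0`, and the remainder `q - T q` vanishes at halted states, where `T` is the identity.
  obtain ⟨p, q, hp, hh⟩ := (D.supContraction_stoppedOp M).exists_decomposition h0
  have hT : h0 - p - D.stoppedOp M (h0 - p) = h0 - D.stoppedOp M h0 := by
    rw [map_sub, hp]; abel
  refine ⟨g, h0 - p, hg, ?_, fun x hx => ?_, fun x hx => ?_⟩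
  · rw [hv', add_assoc]
    congr 1
    rw [← hT]; abel
  · have h1 := congrFun hv' x
    simp only [Pi.add_apply, Pi.sub_apply, stoppedOp_apply, hx, if_true, sub_self, add_zero,
      hv x hx] at h1
    exact h1.symm
  · have h1 := congrFun hh x
    simp only [Pi.add_apply, Pi.sub_apply, stoppedOp_apply, hx, if_true, sub_self, add_zero] at h1
    simp [h1]

/-- Take the Poisson equation for reward `1` per step. Its gain vanishes on `G`, being harmonic and
zero where `D` has halted, so the bias satisfies the required recursion. Adding a constant makes it
nonnegative and preserves the recursion, which is imposed only at non-halted states. -/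
theorem Good.exists_expected_steps (hG : D.Good M G) : ∃ f : Z × S → ℝ, (∀ x, 0 ≤ f x) ∧
    ∀ x ∈ G, ¬ D.halt x.1 = true → f x = 1 + ∑ e, M.edge x.2 e * f (D.next x.1 e.1, e.2) := by
  obtain ⟨g, h, hg, hh, hg0, -⟩ := D.exists_poisson M
    (fun x => if D.halt x.1 then 0 else 1) (fun x hx => by simp [hx])
  have hgG := hG.eq_zero (f := g) (fun x _ hx => hg0 x hx) (fun x _ hs => by
    have := congrFun hg x
    rw [stoppedOp_apply, if_neg hs] at this
    exact this.symm)
  obtain ⟨c, hc⟩ : ∃ c, ∀ x, |h x| ≤ c := by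
    obtain ⟨c, hc⟩ := (Set.finite_range fun x => |h x|).bddAbove
    exact ⟨c, fun x => hc ⟨x, rfl⟩⟩
  refine ⟨fun x => h x + c, fun x => by linarith [neg_abs_le (h x), hc x], fun x hx hs => ?_⟩
  have h1 := congrFun hh x
  simp only [Pi.add_apply, stoppedOp_apply, if_neg hs, hgG x hx, zero_add] at h1
  simp only [mul_add, Finset.sum_add_distrib, ← Finset.sum_mul, M.sum_edge, one_mul]
  rw [h1]; ring

end RewardSystem



theorem integrable_of_measurable_of_abs_le {Ω : Type} [MeasurableSpace Ω] {μ : Measure Ω}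
    [IsFiniteMeasure μ] {f : Ω → ℝ} (hf : Measurable f) {c : ℝ} (hc : ∀ ω, |f ω| ≤ c) :
    Integrable f μ :=
  Integrable.of_bound hf.aestronglyMeasurable c (ae_of_all _ hc)

theorem exists_abs_le {X : Type} [Finite X] (f : X → ℝ) : ∃ c, 0 ≤ c ∧ ∀ x, |f x| ≤ c := by
  obtain ⟨c, hc⟩ := (Set.finite_range fun x => |f x|).bddAbove
  exact ⟨max c 0, le_max_right _ _, fun x => (hc ⟨x, rfl⟩).trans (le_max_left _ _)⟩

namespace MarkovChain

variable {A S : Type} [Fintype A] [Fintype S] [MeasurableSpace A] [MeasurableSpace S]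
  [MeasurableSingletonClass S] [MeasurableSingletonClass A] (M : MarkovChain A S)

theorem memLp_pathFrom (s : S) {F : (ℕ → A × S) → ℝ} (hF : Measurable F)
    (hi : ∀ e, 0 < M.edge s e → MemLp (fun ω => F (consSeq e ω)) 2 (M.pathFrom e.2)) :
    MemLp F 2 (M.pathFrom s) := by
  rw [memLp_two_iff_integrable_sq hF.aestronglyMeasurable]
  exact (M.integral_pathFrom s (F := fun ω => F ω ^ 2) (hF.pow_const 2)
    fun e he => (hi e he).integrable_sq).1

theorem sum_edge_congr (s : S) {f g : A × S → ℝ} (h : ∀ e, 0 < M.edge s e → f e = g e) :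
    ∑ e, M.edge s e * f e = ∑ e, M.edge s e * g e := by
  refine Finset.sum_congr rfl fun e _ => ?_
  rcases (M.edge_nonneg s e).eq_or_lt with h0 | h0
  · rw [← h0, zero_mul, zero_mul]
  · rw [h e h0]

theorem sum_edge_le (s : S) {f g : A × S → ℝ} (h : ∀ e, 0 < M.edge s e → f e ≤ g e) :
    ∑ e, M.edge s e * f e ≤ ∑ e, M.edge s e * g e := by
  refine Finset.sum_le_sum fun e _ => ?_
  rcases (M.edge_nonneg s e).eq_or_lt with h0 | h0
  · rw [← h0, zero_mul, zero_mul]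
  · exact mul_le_mul_of_nonneg_left (h e h0) h0.le

theorem sum_edge_const (s : S) (c : ℝ) : ∑ e, M.edge s e * c = c := by
  rw [← Finset.sum_mul, M.sum_edge, one_mul]

end MarkovChain

/-! ### Second moments and expectation of the total reward. -/

namespace RewardSystem

variable {A S Z : Type} [Fintype A] [Fintype S] [Fintype Z] [MeasurableSpace A]
  [MeasurableSpace S] [MeasurableSingletonClass S] [MeasurableSingletonClass A]
  {D : RewardSystem A Z} {M : MarkovChain A S} {G : Set (Z × S)}

/-- The truncated time is `1 + τ` with `τ` the truncated time of the successor. In the square, `1 +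
2 * E τ + E (τ ^ 2) ≤ (1 + 2 * f) + c * f ≤ c + c * f` at the successor, and averaging `c * (1 + f)`
over successors returns `c * f`. The bounds do not depend on `n`. -/
theorem Good.integral_stepsUpTo_le (hG : D.Good M G) {f : Z × S → ℝ} (hf0 : ∀ x, 0 ≤ f x)
    (hf : ∀ x ∈ G, ¬ D.halt x.1 = true → f x = 1 + ∑ e, M.edge x.2 e * f (D.next x.1 e.1, e.2))
    {c : ℝ} (hc0 : 0 ≤ c) (hc : ∀ x, 1 + 2 * f x ≤ c) (n : ℕ) : ∀ x ∈ G,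
    ∫ ω, (D.stepsUpTo n x.1 (wordOf ω) : ℝ) ∂M.pathFrom x.2 ≤ f x ∧
    ∫ ω, (D.stepsUpTo n x.1 (wordOf ω) : ℝ) ^ 2 ∂M.pathFrom x.2 ≤ c * f x := by
  have hm : ∀ n z, Measurable fun ω : ℕ → A × S => (D.stepsUpTo n z (wordOf ω) : ℝ) :=
    fun n z => measurable_from_top.comp ((measurable_stepsUpTo n z).comp measurable_wordOf)
  have hi : ∀ n z s, Integrable (fun ω => (D.stepsUpTo n z (wordOf ω) : ℝ)) (M.pathFrom s) :=
    fun n z s => integrable_of_measurable_of_abs_le (hm n z) (c := n) fun ω => by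
      rw [Nat.abs_cast]; exact_mod_cast stepsUpTo_le n z _
  have hi2 : ∀ n z s, Integrable (fun ω => (D.stepsUpTo n z (wordOf ω) : ℝ) ^ 2) (M.pathFrom s) :=
    fun n z s => integrable_of_measurable_of_abs_le ((hm n z).pow_const 2) (c := (n : ℝ) ^ 2)
      fun ω => by
        rw [abs_pow, Nat.abs_cast]
        exact pow_le_pow_left₀ (Nat.cast_nonneg _) (by exact_mod_cast stepsUpTo_le n z _) 2
  induction n with
  | zero =>
    intro x _
    simp only [stepsUpTo, Nat.cast_zero, integral_zero, ne_eq, OfNat.ofNat_ne_zero,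
      not_false_eq_true, zero_pow]
    exact ⟨hf0 x, mul_nonneg hc0 (hf0 x)⟩
  | succ n ih =>
    intro x hx
    by_cases hs : D.halt x.1 = true
    · simp only [stepsUpTo, hs, if_true, Nat.cast_zero, integral_zero, ne_eq, OfNat.ofNat_ne_zero,
        not_false_eq_true, zero_pow]
      exact ⟨hf0 x, mul_nonneg hc0 (hf0 x)⟩
    · have hcons : ∀ (e : A × S) (ω : ℕ → A × S), (D.stepsUpTo (n + 1) x.1 (wordOf (consSeq e ω)) : ℝ) =
          1 + (D.stepsUpTo n (D.next x.1 e.1) (wordOf ω) : ℝ) := by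
        intro e ω
        simp only [stepsUpTo, hs, wordOf_consSeq, consSeq_zero, tailSeq_consSeq]
        push_cast
        rfl
      have h1 := (M.integral_pathFrom x.2 (hm (n + 1) x.1) fun e _ => by
        simp_rw [hcons]; exact (integrable_const _).add (hi n _ _)).2
      have h2 := (M.integral_pathFrom x.2 ((hm (n + 1) x.1).pow_const 2) fun e _ => by
        simp_rw [hcons, add_sq, one_pow, mul_one]
        exact ((integrable_const _).add ((hi n _ _).const_mul 2)).add (hi2 n _ _)).2
      rw [h1, h2]
      simp_rw [hcons]
      constructor
      · have e1 : f x = ∑ e, M.edge x.2 e * (1 + f (D.next x.1 e.1, e.2)) := by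
          rw [hf x hx hs]
          simp_rw [mul_add]
          rw [Finset.sum_add_distrib, M.sum_edge_const]
        rw [e1]
        refine M.sum_edge_le x.2 fun e he => ?_
        rw [integral_add (integrable_const _) (hi n _ _)]
        have := (ih _ (hG.closed x hx hs e he)).1
        simpa using this
      · have e1 : c * f x = ∑ e, M.edge x.2 e * (c + c * f (D.next x.1 e.1, e.2)) := by
          rw [hf x hx hs, mul_add, mul_one, Finset.mul_sum]
          simp_rw [mul_add]
          rw [Finset.sum_add_distrib, M.sum_edge_const]
          simp_rw [mul_left_comm]
        rw [e1]
        refine M.sum_edge_le x.2 fun e he => ?_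
        simp_rw [add_sq, one_pow, mul_one]
        have i2 : Integrable (fun ω => 1 + 2 * (D.stepsUpTo n (D.next x.1 e.1) (wordOf ω) : ℝ))
            (M.pathFrom e.2) := (integrable_const _).add ((hi n _ _).const_mul 2)
        rw [integral_add i2 (hi2 n _ _),
          integral_add (integrable_const _) ((hi n _ _).const_mul 2), integral_const_mul]
        have := ih _ (hG.closed x hx hs e he)
        simp only [integral_const, probReal_univ, one_smul]
        have h3 := hc (D.next x.1 e.1, e.2)
        linarith [this.1, this.2]

/-- Truncated rewards are at most a constant times the truncated number of steps, so their second
moments are bounded uniformly in `n`; Fatou's lemma passes to the total. -/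
theorem Good.memLp_total (hG : D.Good M G) : ∀ x ∈ G,
    MemLp (fun ω => D.total x.1 (wordOf ω)) 2 (M.pathFrom x.2) := by
  intro x hx
  obtain ⟨f, hf0, hf⟩ := hG.exists_expected_steps
  obtain ⟨c', hc0', hc'⟩ := exists_abs_le f
  have hmom := hG.integral_stepsUpTo_le hf0 hf (c := 1 + 2 * c') (by linarith)
    (fun x => by linarith [le_abs_self (f x), hc' x])
  obtain ⟨r, hr0, hr⟩ := exists_abs_le fun p : Z × A => D.reward p.1 p.2
  have hmt : Measurable fun ω : ℕ → A × S => D.total x.1 (wordOf ω) :=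
    (measurable_total x.1).comp measurable_wordOf
  have hmr : ∀ n, Measurable fun ω : ℕ → A × S => D.rewardUpTo n x.1 (wordOf ω) :=
    fun n => (measurable_rewardUpTo n x.1).comp measurable_wordOf
  rw [memLp_two_iff_integrable_sq hmt.aestronglyMeasurable]
  refine ⟨(hmt.pow_const 2).aestronglyMeasurable, ?_⟩
  rw [hasFiniteIntegral_iff_ofReal (ae_of_all _ fun ω => sq_nonneg _)]
  have hae : (fun ω => ENNReal.ofReal (D.total x.1 (wordOf ω) ^ 2)) =ᵐ[M.pathFrom x.2]
      fun ω => liminf (fun n => ENNReal.ofReal (D.rewardUpTo n x.1 (wordOf ω) ^ 2)) atTop := by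
    filter_upwards [hG.ae x hx] with ω ⟨n, hn⟩
    refine (Tendsto.liminf_eq ?_).symm
    refine tendsto_const_nhds.congr' ?_
    filter_upwards [eventually_ge_atTop n] with m hm
    rw [(hn.mono hm).total_eq]
  rw [lintegral_congr_ae hae]
  refine (lintegral_liminf_le fun n => ((hmr n).pow_const 2).ennreal_ofReal).trans_lt ?_
  refine lt_of_le_of_lt (b := ENNReal.ofReal (r ^ 2 * ((1 + 2 * c') * f x))) ?_
    ENNReal.ofReal_lt_top
  refine Filter.liminf_le_of_frequently_le' (Eventually.frequently (Eventually.of_forall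
    fun n => ?_))
  have hms : Measurable fun ω : ℕ → A × S => (D.stepsUpTo n x.1 (wordOf ω) : ℝ) :=
    measurable_from_top.comp ((measurable_stepsUpTo n x.1).comp measurable_wordOf)
  have hi2 : Integrable (fun ω => r ^ 2 * (D.stepsUpTo n x.1 (wordOf ω) : ℝ) ^ 2)
      (M.pathFrom x.2) :=
    (integrable_of_measurable_of_abs_le (hms.pow_const 2) (c := (n : ℝ) ^ 2) fun ω => by
      rw [abs_pow, Nat.abs_cast]
      exact pow_le_pow_left₀ (Nat.cast_nonneg _) (by exact_mod_cast stepsUpTo_le n x.1 _) 2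
      ).const_mul _
  calc ∫⁻ ω, ENNReal.ofReal (D.rewardUpTo n x.1 (wordOf ω) ^ 2) ∂M.pathFrom x.2
      ≤ ∫⁻ ω, ENNReal.ofReal (r ^ 2 * (D.stepsUpTo n x.1 (wordOf ω) : ℝ) ^ 2) ∂M.pathFrom x.2 := by
        refine lintegral_mono fun ω => ENNReal.ofReal_le_ofReal ?_
        rw [← mul_pow, ← sq_abs]
        exact pow_le_pow_left₀ (abs_nonneg _)
          (abs_rewardUpTo_le (fun z a => hr (z, a)) n x.1 (wordOf ω)) 2
    _ = ENNReal.ofReal (∫ ω, r ^ 2 * (D.stepsUpTo n x.1 (wordOf ω) : ℝ) ^ 2 ∂M.pathFrom x.2) :=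
        (ofReal_integral_eq_lintegral_ofReal hi2 (ae_of_all _ fun ω => by positivity)).symm
    _ ≤ _ := by
        refine ENNReal.ofReal_le_ofReal ?_
        rw [integral_const_mul]
        exact mul_le_mul_of_nonneg_left (hmom n x hx).2 (sq_nonneg r)

variable (D M) in
/-- The expected total reward. -/
def expectedTotal (x : Z × S) : ℝ := ∫ ω, D.total x.1 (wordOf ω) ∂M.pathFrom x.2

/-- The one-step recursion can fail on words on which the system never stops, where the total is `0`
by convention; these are null on a good set. -/
theorem total_consSeq_ae (hG : D.Good M G) {x : Z × S} (hx : x ∈ G) (hs : ¬ D.halt x.1 = true)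
    {e : A × S} (he : 0 < M.edge x.2 e) :
    (fun ω => D.total x.1 (wordOf (consSeq e ω))) =ᵐ[M.pathFrom e.2]
      fun ω => D.reward x.1 e.1 + D.total (D.next x.1 e.1) (wordOf ω) := by
  have h0 : ∀ᵐ ω ∂M.pathFrom e.2, D.Terminates (D.next x.1 e.1) (wordOf ω) :=
    hG.ae (D.next x.1 e.1, e.2) (hG.closed x hx hs e he)
  filter_upwards [h0] with ω hω
  rw [wordOf_consSeq]
  exact total_step (w := consSeq e.1 (wordOf ω)) hs hω

theorem Good.expectedTotal_eq (hG : D.Good M G) {x : Z × S} (hx : x ∈ G)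
    (hs : ¬ D.halt x.1 = true) : D.expectedTotal M x =
      ∑ e, M.edge x.2 e * (D.reward x.1 e.1 + D.expectedTotal M (D.next x.1 e.1, e.2)) := by
  have hi : ∀ e, 0 < M.edge x.2 e →
      Integrable (fun ω => D.total (D.next x.1 e.1) (wordOf ω)) (M.pathFrom e.2) := fun e he =>
    (hG.memLp_total _ (hG.closed x hx hs e he)).integrable one_le_two
  rw [expectedTotal, (M.integral_pathFrom x.2
    (F := fun ω => D.total x.1 (wordOf ω)) ((measurable_total x.1).comp measurable_wordOf)
    fun e he => (integrable_congr (total_consSeq_ae hG hx hs he)).2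
      ((integrable_const _).add (hi e he))).2]
  refine M.sum_edge_congr x.2 fun e he => ?_
  refine (integral_congr_ae (total_consSeq_ae hG hx hs he)).trans ?_
  rw [integral_add (integrable_const _) (hi e he)]
  simp [expectedTotal]

/-- Every solution of the equations of the total reward that vanishes where `D` has stopped gives
the expected total reward on good sets. -/
theorem Good.expectedTotal_unique (hG : D.Good M G) {g h : Z × S → ℝ}
    (hg0 : ∀ x ∈ G, D.halt x.1 = true → g x = 0 ∧ h x = 0)
    (hg : ∀ x ∈ G, ¬ D.halt x.1 = true → g x = ∑ e, M.edge x.2 e * g (D.next x.1 e.1, e.2))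
    (hh : ∀ x ∈ G, ¬ D.halt x.1 = true → g x + h x =
      ∑ e, M.edge x.2 e * (D.reward x.1 e.1 + h (D.next x.1 e.1, e.2))) :
    ∀ x ∈ G, h x = D.expectedTotal M x := by
  have hgG := hG.eq_zero (fun x hx hs => (hg0 x hx hs).1) hg
  have := hG.eq_zero (f := fun x => h x - D.expectedTotal M x) (fun x hx hs => by
      simp only [(hg0 x hx hs).2, expectedTotal, total_of_stop hs, integral_zero, sub_zero])
    (fun x hx hs => by
      have h1 := hh x hx hs
      rw [hgG x hx, zero_add] at h1
      rw [h1, hG.expectedTotal_eq hx hs, ← Finset.sum_sub_distrib]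
      exact Finset.sum_congr rfl fun e _ => by ring)
  intro x hx
  exact sub_eq_zero.1 (this x hx)

end RewardSystem



/-! ### Devices that start a reward system in every step -/

/-- A finite-state device that reads a word and, in every step in which it is active, receives a
reward and starts a reward system on the rest of the word. -/
structure Launcher (A Y Z : Type) where
  next : Y → A → Y
  active : Y → A → Bool
  start : Y → A → Z
  reward : Y → A → ℝ

namespace Launcher

variable {A S Y Z : Type} (H : Launcher A Y Z)

/-- The successor of a pair of states along an edge of the chain. -/
def step (x : Y × S) (e : A × S) : Y × S := (H.next x.1 e.1, e.2)

/-- The function `F` of the current pair of states and the rest of the path, at time `i`. -/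
def later {α : Type} (F : Y × S → (ℕ → A × S) → α) : ℕ → Y × S → (ℕ → A × S) → α
  | 0, x, ω => F x ω
  | i + 1, x, ω => later F i (H.step x (ω 0)) (tailSeq ω)

/-- The pair of states at time `i`. -/
def pos (i : ℕ) (x : Y × S) (ω : ℕ → A × S) : Y × S := H.later (fun x _ => x) i x ω

/-- The recursion of `later` consumes the path from the front, which suits first step
decompositions; this form, with the current position and the shifted path, suits arguments along a
fixed path. -/
theorem later_eq {α : Type} (F : Y × S → (ℕ → A × S) → α) (i : ℕ) : ∀ x ω,
    H.later F i x ω = F (H.pos i x ω) (fun n => ω (n + i)) := by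
  induction i with
  | zero => intro x ω; rfl
  | succ i ih =>
    intro x ω
    simp only [later, ih]
    rfl

theorem pos_succ (i : ℕ) : ∀ (x : Y × S) (ω : ℕ → A × S),
    H.pos (i + 1) x ω = H.step (H.pos i x ω) (ω i) := by
  induction i with
  | zero => intro x ω; rfl
  | succ i ih =>
    intro x ω
    have h1 : H.pos (i + 1 + 1) x ω = H.pos (i + 1) (H.step x (ω 0)) (tailSeq ω) := rfl
    have h2 : H.pos (i + 1) x ω = H.pos i (H.step x (ω 0)) (tailSeq ω) := rfl
    rw [h1, ih, h2]
    rfl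

variable [Fintype A] [Fintype S] [MeasurableSpace A] [MeasurableSpace S]
  [MeasurableSingletonClass S] [MeasurableSingletonClass A]

theorem measurable_later {α : Type} [MeasurableSpace α] {F : Y × S → (ℕ → A × S) → α}
    (hF : ∀ x, Measurable (F x)) (i : ℕ) : ∀ x, Measurable (H.later F i x) := by
  induction i with
  | zero => exact hF
  | succ i ih =>
    intro x
    exact measurable_first_tail (F := fun e ω => H.later F i (H.step x e) ω) fun e => ih _

theorem measurable_pos_comp {α : Type} [MeasurableSpace α] (f : Y × S → α) (i : ℕ) (x : Y × S) :
    Measurable fun ω : ℕ → A × S => f (H.pos i x ω) := by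
  have := H.measurable_later (F := fun x _ => f x) (fun x => measurable_const) i x
  have e : H.later (fun x _ => f x) i x = fun ω : ℕ → A × S => f (H.pos i x ω) := by
    funext ω; rw [later_eq]
  rwa [e] at this

variable (M : MarkovChain A S)

/-- A set of pairs of states is closed under transitions of positive probability. -/
def IsClosedSet (R : Set (Y × S)) : Prop :=
  ∀ x ∈ R, ∀ e, 0 < M.edge x.2 e → H.step x e ∈ R

variable {M H} {R : Set (Y × S)}

theorem IsClosedSet.ae_later (hR : H.IsClosedSet M R) {p : Y × S → (ℕ → A × S) → Prop}
    (hp : ∀ x ∈ R, ∀ᵐ ω ∂M.pathFrom x.2, p x ω) (i : ℕ) :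
    ∀ x ∈ R, ∀ᵐ ω ∂M.pathFrom x.2, H.later p i x ω := by
  induction i with
  | zero => exact hp
  | succ i ih =>
    intro x hx
    rw [M.ae_pathFrom_iff]
    exact fun e he => ih (H.step x e) (hR x hx e he)

/-- The expected edge rewards up to time `n`, from a solution of the Poisson equation. -/
theorem IsClosedSet.sum_integral_later (hR : H.IsClosedSet M R) [Finite Y]
    {F : Y × S → A × S → ℝ} {g h : Y × S → ℝ}
    (hg : ∀ x ∈ R, g x = ∑ e, M.edge x.2 e * g (H.step x e))
    (hh : ∀ x ∈ R, g x + h x = ∑ e, M.edge x.2 e * (F x e + h (H.step x e))) (n : ℕ) :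
    ∀ x ∈ R, ∑ k ∈ Finset.range n, ∫ ω, H.later (fun x ω => F x (ω 0)) k x ω ∂M.pathFrom x.2 +
      ∫ ω, h (H.pos n x ω) ∂M.pathFrom x.2 = n * g x + h x := by
  obtain ⟨c, -, hc⟩ := exists_abs_le fun p : (Y × S) × (A × S) => F p.1 p.2
  obtain ⟨d, -, hd⟩ := exists_abs_le h
  have mF : ∀ k x, Measurable (H.later (fun x (ω : ℕ → A × S) => F x (ω 0)) k x) :=
    H.measurable_later fun x => (measurable_of_countable (F x)).comp (measurable_pi_apply 0)
  have bF : ∀ k x ω, |H.later (fun x (ω : ℕ → A × S) => F x (ω 0)) k x ω| ≤ c := fun k x ω => by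
    rw [later_eq]; exact hc (_, _)
  have iF : ∀ k x s, Integrable (H.later (fun x (ω : ℕ → A × S) => F x (ω 0)) k x)
      (M.pathFrom s) := fun k x s => integrable_of_measurable_of_abs_le (mF k x) (bF k x)
  have ih' : ∀ k x s, Integrable (fun ω : ℕ → A × S => h (H.pos k x ω)) (M.pathFrom s) :=
    fun k x s => integrable_of_measurable_of_abs_le (H.measurable_pos_comp h k x) fun ω => hd _
  induction n with
  | zero =>
    intro x _
    simp [pos, later]
  | succ n ih =>
    intro x hx
    have e0 : ∫ ω, F x (ω 0) ∂M.pathFrom x.2 = ∑ e, M.edge x.2 e * F x e := by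
      refine (M.integral_pathFrom x.2 (mF 0 x) fun e _ => by simp [later]).2.trans ?_
      simp [later]
    have e1 : ∀ k, ∫ ω, H.later (fun x ω => F x (ω 0)) (k + 1) x ω ∂M.pathFrom x.2 =
        ∑ e, M.edge x.2 e * ∫ ω, H.later (fun x ω => F x (ω 0)) k (H.step x e) ω
          ∂M.pathFrom e.2 := fun k =>
      (M.integral_pathFrom x.2 (mF (k + 1) x) fun e _ => iF k (H.step x e) e.2).2
    have e2 : ∫ ω, h (H.pos (n + 1) x ω) ∂M.pathFrom x.2 =
        ∑ e, M.edge x.2 e * ∫ ω, h (H.pos n (H.step x e) ω) ∂M.pathFrom e.2 :=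
      (M.integral_pathFrom x.2 (H.measurable_pos_comp h (n + 1) x) fun e _ => ih' n (H.step x e) e.2).2
    rw [Finset.sum_range_succ']
    simp_rw [e1, e2]
    rw [Finset.sum_comm, show ∫ ω, H.later (fun x ω => F x (ω 0)) 0 x ω ∂M.pathFrom x.2 =
      ∑ e, M.edge x.2 e * F x e from e0]
    have e3 : ∑ e, M.edge x.2 e * ((n : ℝ) * g (H.step x e) + h (H.step x e)) =
        ∑ e, M.edge x.2 e * (∑ k ∈ Finset.range n,
          ∫ ω, H.later (fun x ω => F x (ω 0)) k (H.step x e) ω ∂M.pathFrom e.2 +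
          ∫ ω, h (H.pos n (H.step x e) ω) ∂M.pathFrom e.2) :=
      M.sum_edge_congr x.2 fun e he => (ih (H.step x e) (hR x hx e he)).symm
    have e4 := hh x hx
    simp_rw [mul_add, Finset.sum_add_distrib, Finset.mul_sum] at e3 e4
    have e5 : ∑ e, M.edge x.2 e * ((n : ℝ) * g (H.step x e)) = n * g x := by
      rw [hg x hx, Finset.mul_sum]
      exact Finset.sum_congr rfl fun e _ => by ring
    push_cast
    linarith

/-- A harmonic function is eventually constant along almost all paths. -/
theorem IsClosedSet.eventually_const (hR : H.IsClosedSet M R) [Finite Y] {g : Y × S → ℝ}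
    (hg : ∀ x ∈ R, g x = ∑ e, M.edge x.2 e * g (H.step x e)) :
    ∀ x ∈ R, ∀ᵐ ω ∂M.pathFrom x.2, ∃ c, ∀ᶠ n in atTop, g (H.pos n x ω) = c := by
  intro x hx
  obtain ⟨c, hc0, hc⟩ := exists_abs_le g
  let F : Y × S → A × S → ℝ := fun x e => (g (H.step x e) - g x) ^ 2
  let Φ : Y × S → (ℕ → A × S) → ℝ≥0∞ := fun x ω => ENNReal.ofReal (F x (ω 0))
  have mΦ : ∀ k x, Measurable (H.later Φ k x) := H.measurable_later fun x =>
    (measurable_of_countable fun e => ENNReal.ofReal (F x e)).comp (measurable_pi_apply 0)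
  -- Energy bound: for harmonic `g` the expected square of an increment is the growth of the
  -- expectation of `g ^ 2`, so the sum telescopes below `c ^ 2 - g x ^ 2`.
  have key : ∀ n, ∀ x ∈ R, ∑ k ∈ Finset.range n, ∫⁻ ω, H.later Φ k x ω ∂M.pathFrom x.2 ≤
      ENNReal.ofReal (c ^ 2 - g x ^ 2) := by
    intro n
    induction n with
    | zero => intro x _; simp
    | succ n ih =>
      intro x hx
      have hsq : ∀ y, 0 ≤ c ^ 2 - g y ^ 2 := fun y => by
        have := pow_le_pow_left₀ (abs_nonneg _) (hc y) 2
        rw [sq_abs] at this; linarith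
      have e1 : ∀ k, ∫⁻ ω, H.later Φ (k + 1) x ω ∂M.pathFrom x.2 =
          ∑ e, M.stepPMF x.2 e * ∫⁻ ω, H.later Φ k (H.step x e) ω ∂M.pathFrom e.2 := fun k =>
        M.lintegral_pathFrom x.2 (mΦ (k + 1) x)
      have e0 : ∫⁻ ω, H.later Φ 0 x ω ∂M.pathFrom x.2 =
          ∑ e, M.stepPMF x.2 e * ENNReal.ofReal (F x e) := by
        rw [M.lintegral_pathFrom x.2 (mΦ 0 x)]
        simp [later, Φ]
      rw [Finset.sum_range_succ', e0]
      simp_rw [e1]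
      rw [Finset.sum_comm, ← Finset.sum_add_distrib]
      simp_rw [← Finset.mul_sum, ← mul_add]
      have e2 : c ^ 2 - g x ^ 2 = ∑ e, M.edge x.2 e * ((c ^ 2 - g (H.step x e) ^ 2) + F x e) := by
        have : ∀ e, M.edge x.2 e * ((c ^ 2 - g (H.step x e) ^ 2) + F x e) =
            M.edge x.2 e * (c ^ 2 + g x ^ 2) - 2 * g x * (M.edge x.2 e * g (H.step x e)) :=
          fun e => by simp only [F]; ring
        simp_rw [this]
        rw [Finset.sum_sub_distrib, M.sum_edge_const, ← Finset.mul_sum, ← hg x hx]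
        ring
      rw [e2, ENNReal.ofReal_sum_of_nonneg fun e _ => mul_nonneg (M.edge_nonneg _ _)
        (add_nonneg (hsq _) (sq_nonneg _))]
      refine Finset.sum_le_sum fun e _ => ?_
      rw [ENNReal.ofReal_mul (M.edge_nonneg _ _), M.stepPMF_apply,
        ENNReal.ofReal_add (hsq _) (sq_nonneg _)]
      rcases (M.edge_nonneg x.2 e).eq_or_lt with h0 | h0
      · rw [← h0]; simp
      · gcongr
        exact ih (H.step x e) (hR x hx e h0)
  have hsum : ∫⁻ ω, ∑' k, H.later Φ k x ω ∂M.pathFrom x.2 ≠ ⊤ := by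
    rw [lintegral_tsum fun k => (mΦ k x).aemeasurable]
    refine ne_top_of_le_ne_top (ENNReal.ofReal_ne_top (r := c ^ 2 - g x ^ 2)) ?_
    rw [ENNReal.tsum_eq_iSup_nat]
    exact iSup_le fun n => key n x hx
  filter_upwards [ae_lt_top (Measurable.tsum fun k => mΦ k x) hsum] with ω hω
  have ht := ENNReal.tendsto_atTop_zero_of_tsum_ne_top hω.ne
  -- Squared increments tend to `0` and take only finitely many values, so they are eventually `0`.
  let V : Set ℝ≥0∞ := Set.range fun p : (Y × S) × (Y × S) => ENNReal.ofReal ((g p.2 - g p.1) ^ 2)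
  have hV : (V \ {0}).Finite := (Set.finite_range _).subset Set.sdiff_subset
  have hmem : (V \ {0})ᶜ ∈ nhds (0 : ℝ≥0∞) := hV.isClosed.isOpen_compl.mem_nhds fun h => h.2 rfl
  obtain ⟨N, hN⟩ := eventually_atTop.1 (ht.eventually hmem)
  have hconst : ∀ n ≥ N, g (H.pos (n + 1) x ω) = g (H.pos n x ω) := by
    intro n hn
    have h1 := hN n hn
    have h2 : H.later Φ n x ω = ENNReal.ofReal ((g (H.pos (n + 1) x ω) - g (H.pos n x ω)) ^ 2) := by
      rw [later_eq, pos_succ]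
      simp only [Φ, F, zero_add]
    have h3 : H.later Φ n x ω = 0 := by
      by_contra h0
      exact h1 ⟨⟨(H.pos n x ω, H.pos (n + 1) x ω), h2.symm⟩, h0⟩
    rw [h2, ENNReal.ofReal_eq_zero] at h3
    have := le_antisymm h3 (sq_nonneg _)
    exact sub_eq_zero.1 (pow_eq_zero_iff two_ne_zero |>.1 this)
  refine ⟨g (H.pos N x ω), eventually_atTop.2 ⟨N, fun n hn => ?_⟩⟩
  induction n, hn using Nat.le_induction with
  | base => rfl
  | succ n hn ih => rw [hconst n hn, ih]

/-- The probability that a harmonic function is eventually at most `0` is the gain of the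
indicator function of the set on which it is at most `0`. -/
theorem IsClosedSet.measureReal_eventually_nonpos (hR : H.IsClosedSet M R) [Finite Y]
    {f g h : Y × S → ℝ}
    (hf : ∀ x ∈ R, f x = ∑ e, M.edge x.2 e * f (H.step x e))
    (hg : ∀ x ∈ R, g x = ∑ e, M.edge x.2 e * g (H.step x e))
    (hh : ∀ x ∈ R, g x + h x = (if f x ≤ 0 then 1 else 0) + ∑ e, M.edge x.2 e * h (H.step x e)) :
    ∀ x ∈ R, (M.pathFrom x.2).real {ω | ∀ᶠ n in atTop, f (H.pos n x ω) ≤ 0} = g x := by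
  intro x hx
  have h1 := fun n => hR.sum_integral_later (F := fun x _ => if f x ≤ 0 then 1 else 0) hg
    (fun x hx => by
      rw [hh x hx]
      simp_rw [mul_add, Finset.sum_add_distrib, M.sum_edge_const]) n x hx
  obtain ⟨d, -, hd⟩ := exists_abs_le h
  let E : Set (ℕ → A × S) := {ω | ∀ᶠ n in atTop, f (H.pos n x ω) ≤ 0}
  have hE : MeasurableSet E := by
    have : E = ⋃ N, ⋂ n ≥ N, {ω | f (H.pos n x ω) ≤ 0} := by
      ext ω; simp [E, eventually_atTop]
    rw [this]
    refine MeasurableSet.iUnion fun N => MeasurableSet.iInter fun n => MeasurableSet.iInter fun _ => ?_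
    exact H.measurable_pos_comp f n x measurableSet_Iic
  -- As `f` is eventually constant along the path, the indicators converge pointwise to that of `E`.
  -- Their expectations then have the same Cesàro limit, which the Poisson equation identifies as `g
  -- x`.
  have hlim : Tendsto (fun n => ∫ ω, H.later (fun x _ => if f x ≤ 0 then (1 : ℝ) else 0) n x ω
      ∂M.pathFrom x.2) atTop (nhds ((M.pathFrom x.2).real E)) := by
    rw [← integral_indicator_one hE]
    refine tendsto_integral_of_dominated_convergence (fun _ => 1)
      (fun n => (H.measurable_later (fun x => measurable_const) n x).aestronglyMeasurable)
      (integrable_const _) (fun n => ae_of_all _ fun ω => ?_) ?_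
    · rw [later_eq]; split_ifs <;> simp
    · filter_upwards [hR.eventually_const hf x hx] with ω ⟨c, hcω⟩
      refine tendsto_const_nhds.congr' ?_
      filter_upwards [hcω] with n hn
      rw [later_eq, hn]
      by_cases h0 : c ≤ 0
      · have : ω ∈ E := by
          filter_upwards [hcω] with m hm
          rwa [hm]
        simp [this, h0]
      · have : ω ∉ E := by
          intro h'
          obtain ⟨m, hm, hm'⟩ := (h'.and hcω).exists
          rw [hm'] at hm
          exact h0 hm
        simp [this, h0]
  have hces := hlim.cesaro
  have hces2 : Tendsto (fun n : ℕ => (n : ℝ)⁻¹ * ∑ k ∈ Finset.range n,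
      ∫ ω, H.later (fun x _ => if f x ≤ 0 then (1 : ℝ) else 0) k x ω ∂M.pathFrom x.2) atTop
      (nhds (g x)) := by
    have hb : ∀ n, |h x - ∫ ω, h (H.pos n x ω) ∂M.pathFrom x.2| ≤ 2 * d := fun n => by
      have : |∫ ω, h (H.pos n x ω) ∂M.pathFrom x.2| ≤ d := by
        have := norm_integral_le_of_norm_le_const (μ := M.pathFrom x.2) (C := d)
          (f := fun ω => h (H.pos n x ω)) (ae_of_all _ fun ω => hd _)
        simpa using this
      have h2 := abs_sub (h x) (∫ ω, h (H.pos n x ω) ∂M.pathFrom x.2)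
      linarith [hd x]
    have hz : Tendsto (fun n : ℕ => (n : ℝ)⁻¹ * (h x - ∫ ω, h (H.pos n x ω) ∂M.pathFrom x.2))
        atTop (nhds 0) := by
      refine squeeze_zero_norm (a := fun n : ℕ => (n : ℝ)⁻¹ * (2 * d)) (fun n => ?_) ?_
      · rw [norm_mul, Real.norm_eq_abs, Real.norm_eq_abs, abs_of_nonneg (by positivity)]
        exact mul_le_mul_of_nonneg_left (hb n) (by positivity)
      · have := (tendsto_inv_atTop_nhds_zero_nat (𝕜 := ℝ)).mul_const (2 * d)
        simpa using this
    have := hz.const_add (g x)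
    rw [add_zero] at this
    refine this.congr' ?_
    filter_upwards [eventually_ge_atTop 1] with n hn
    have hn' : (n : ℝ) ≠ 0 := by positivity
    have h2 := h1 n
    rw [← eq_sub_iff_add_eq] at h2
    rw [h2]
    field_simp
    ring
  exact tendsto_nhds_unique hces hces2

/-- If almost all paths have infinitely many active steps, the gain of the active steps does not
vanish. -/
theorem IsClosedSet.gain_ne_zero (hR : H.IsClosedSet M R) [Finite Y] {g h : Y × S → ℝ}
    (hg : ∀ x ∈ R, g x = ∑ e, M.edge x.2 e * g (H.step x e))
    (hh : ∀ x ∈ R, g x + h x =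
      ∑ e, M.edge x.2 e * ((if H.active x.1 e.1 then 1 else 0) + h (H.step x e)))
    (hinf : ∀ x ∈ R, ∀ᵐ ω ∂M.pathFrom x.2,
      ∃ᶠ n in atTop, H.later (fun x ω => H.active x.1 (ω 0).1 = true) n x ω) :
    ∀ x ∈ R, g x ≠ 0 := by
  intro x hx hgx
  have h1 := fun n => hR.sum_integral_later hg hh n x hx
  obtain ⟨d, hd0, hd⟩ := exists_abs_le h
  let s : ℕ → Set (ℕ → A × S) := fun n =>
    {ω | H.later (fun x ω => H.active x.1 (ω 0).1 = true) n x ω}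
  have hs : ∀ n, MeasurableSet (s n) := fun n => (H.measurable_later (fun x =>
    (measurable_of_countable fun e : A × S => H.active x.1 e.1 = true).comp
      (measurable_pi_apply 0)) n x).setOf
  have hint : ∀ n, ENNReal.ofReal (∫ ω, H.later (fun x (ω : ℕ → A × S) =>
      if H.active x.1 (ω 0).1 then (1 : ℝ) else 0) n x ω ∂M.pathFrom x.2) = M.pathFrom x.2 (s n) := by
    intro n
    have e : H.later (fun x (ω : ℕ → A × S) => if H.active x.1 (ω 0).1 then (1 : ℝ) else 0) n x =
        (s n).indicator 1 := by
      funext ω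
      simp only [s, Set.indicator, Set.mem_ofPred_eq, later_eq]
      rfl
    rw [e, integral_indicator_one (hs n), ofReal_measureReal]
  -- With zero gain at `x`, the expected number of active steps before time `n` equals `h x` minus
  -- the expectation of `h` at time `n`, hence is at most `2 * d`. Borel-Cantelli then excludes
  -- infinitely many active steps.
  have hsum : ∑' n, M.pathFrom x.2 (s n) ≠ ⊤ := by
    refine ne_top_of_le_ne_top (ENNReal.ofReal_ne_top (r := 2 * d)) ?_
    rw [ENNReal.tsum_eq_iSup_nat]
    refine iSup_le fun n => ?_
    simp_rw [← hint]
    rw [← ENNReal.ofReal_sum_of_nonneg fun k _ => integral_nonneg fun ω => by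
      rw [later_eq]; simp only [Pi.zero_apply]; split_ifs <;> simp]
    refine ENNReal.ofReal_le_ofReal ?_
    have h2 := h1 n
    rw [hgx, mul_zero, zero_add] at h2
    have h3 : |∫ ω, h (H.pos n x ω) ∂M.pathFrom x.2| ≤ d := by
      have := norm_integral_le_of_norm_le_const (μ := M.pathFrom x.2) (C := d)
        (f := fun ω => h (H.pos n x ω)) (ae_of_all _ fun ω => hd _)
      simpa using this
    linarith [neg_abs_le (∫ ω, h (H.pos n x ω) ∂M.pathFrom x.2), le_abs_self (h x), hd x]
  have hbc := measure_limsup_atTop_eq_zero hsum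
  have h0 : ∀ᵐ ω ∂M.pathFrom x.2, ω ∉ limsup s atTop := measure_eq_zero_iff_ae_notMem.1 hbc
  obtain ⟨ω, hω1, hω2⟩ := (h0.and (hinf x hx)).exists
  exact hω1 (Filter.mem_limsup_iff_frequently_mem.2 hω2)

end Launcher



/-! ### The strong law for payoffs that depend on the future. -/

namespace Launcher

variable {A S Y Z : Type} (H : Launcher A Y Z) (D : RewardSystem A Z)

/-- What is received at the beginning of the word: the reward of the step and the total reward of
the system that is started. -/
def payoff (y : Y) (w : ℕ → A) : ℝ :=
  if H.active y (w 0) then H.reward y (w 0) + D.total (H.start y (w 0)) (tailSeq w) else 0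

variable [Fintype A] [Fintype S] [Fintype Y] [Fintype Z] [MeasurableSpace A] [MeasurableSpace S]
  [MeasurableSingletonClass S] [MeasurableSingletonClass A] (M : MarkovChain A S)

/-- The pairs of states in `R` are closed under transitions, and the systems that are started
from them are in the good set `G`. -/
structure Sound (R : Set (Y × S)) (G : Set (Z × S)) : Prop where
  good : D.Good M G
  closed : H.IsClosedSet M R
  start : ∀ x ∈ R, ∀ e, 0 < M.edge x.2 e → H.active x.1 e.1 = true → (H.start x.1 e.1, e.2) ∈ G

/-- `g` and `h` solve the Poisson equation for the expected payoffs. -/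
structure IsGain (R : Set (Y × S)) (g h : Y × S → ℝ) : Prop where
  harmonic : ∀ x ∈ R, g x = ∑ e, M.edge x.2 e * g (H.step x e)
  poisson : ∀ x ∈ R, g x + h x = ∑ e, M.edge x.2 e *
    ((if H.active x.1 e.1 then H.reward x.1 e.1 + D.expectedTotal M (H.start x.1 e.1, e.2) else 0)
      + h (H.step x e))

/-- The difference of the payoff and its prediction, for a path with first edge `e`. -/
def devFrom (g h : Y × S → ℝ) (x : Y × S) (e : A × S) (ω : ℕ → A × S) : ℝ :=
  (if H.active x.1 e.1 then D.total (H.start x.1 e.1) (wordOf ω) else 0) +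
    ((if H.active x.1 e.1 then H.reward x.1 e.1 else 0) + h (H.step x e) - g x - h x)

/-- The launched total depends on arbitrarily late letters, so these deviations are not adapted to
the past, and martingale arguments do not apply. -/
def dev (g h : Y × S → ℝ) (x : Y × S) (ω : ℕ → A × S) : ℝ :=
  H.devFrom D g h x (ω 0) (tailSeq ω)

theorem dev_eq (g h : Y × S → ℝ) (x : Y × S) (ω : ℕ → A × S) :
    H.dev D g h x ω = H.payoff D x.1 (wordOf ω) + h (H.step x (ω 0)) - g x - h x := by
  have e1 : tailSeq (wordOf ω) = wordOf (tailSeq ω) := rfl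
  have e2 : wordOf ω 0 = (ω 0).1 := rfl
  simp only [dev, devFrom, payoff, e1, e2]
  split_ifs <;> ring

/-- The sum of the first `n` differences. -/
def devSum (g h : Y × S → ℝ) : ℕ → Y × S → (ℕ → A × S) → ℝ
  | 0, _, _ => 0
  | n + 1, x, ω =>
    H.devFrom D g h x (ω 0) (tailSeq ω) + devSum g h n (H.step x (ω 0)) (tailSeq ω)

theorem devSum_eq (g h : Y × S → ℝ) (n : ℕ) : ∀ x ω,
    H.devSum D g h n x ω = ∑ i ∈ Finset.range n, H.later (H.dev D g h) i x ω := by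
  induction n with
  | zero => intro x ω; simp [devSum]
  | succ n ih =>
    intro x ω
    rw [Finset.sum_range_succ']
    simp only [devSum, ih]
    exact add_comm _ _

theorem measurable_devFrom (g h : Y × S → ℝ) (x : Y × S) (e : A × S) :
    Measurable (H.devFrom D g h x e) := by
  unfold devFrom
  split_ifs
  · exact ((RewardSystem.measurable_total _).comp measurable_wordOf).add_const _
  · exact measurable_const

theorem measurable_dev (g h : Y × S → ℝ) (x : Y × S) : Measurable (H.dev D g h x) :=
  measurable_first_tail (F := H.devFrom D g h x) fun e => H.measurable_devFrom D g h x e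

theorem measurable_devSum (g h : Y × S → ℝ) (n : ℕ) : ∀ x, Measurable (H.devSum D g h n x) := by
  induction n with
  | zero => intro x; exact measurable_const
  | succ n ih =>
    intro x
    exact measurable_first_tail
      (F := fun e ω => H.devFrom D g h x e ω + H.devSum D g h n (H.step x e) ω)
      fun e => (H.measurable_devFrom D g h x e).add (ih _)

variable {H D M} {R : Set (Y × S)} {G : Set (Z × S)} {g h : Y × S → ℝ}

theorem Sound.memLp_devFrom (hs : H.Sound D M R G) (g h : Y × S → ℝ) {x : Y × S} (hx : x ∈ R)
    {e : A × S} (he : 0 < M.edge x.2 e) :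
    MemLp (H.devFrom D g h x e) 2 (M.pathFrom e.2) := by
  unfold devFrom
  by_cases ha : H.active x.1 e.1 = true
  · simp only [ha, if_true]
    exact (hs.good.memLp_total (H.start x.1 e.1, e.2) (hs.start x hx e he ha)).add
      (memLp_const _)
  · simp only [ha, Bool.false_eq_true, if_false]
    exact memLp_const _

theorem Sound.memLp_devSum (hs : H.Sound D M R G) (g h : Y × S → ℝ) (n : ℕ) : ∀ x ∈ R,
    MemLp (H.devSum D g h n x) 2 (M.pathFrom x.2) := by
  induction n with
  | zero => intro x _; exact memLp_const 0
  | succ n ih =>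
    intro x hx
    refine M.memLp_pathFrom x.2 (H.measurable_devSum D g h (n + 1) x) fun e he => ?_
    exact (hs.memLp_devFrom g h hx he).add (ih (H.step x e) (hs.closed x hx e he))

theorem Sound.memLp_later_dev (hs : H.Sound D M R G) (g h : Y × S → ℝ) (n : ℕ) : ∀ x ∈ R,
    MemLp (H.later (H.dev D g h) n x) 2 (M.pathFrom x.2) := by
  induction n with
  | zero =>
    intro x hx
    exact M.memLp_pathFrom x.2 (H.measurable_dev D g h x) fun e he => hs.memLp_devFrom g h hx he
  | succ n ih =>
    intro x hx
    refine M.memLp_pathFrom x.2 (H.measurable_later (H.measurable_dev D g h) (n + 1) x)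
      fun e he => ?_
    exact ih (H.step x e) (hs.closed x hx e he)

theorem Sound.integral_devFrom (hs : H.Sound D M R G) {x : Y × S} (hx : x ∈ R) {e : A × S}
    (he : 0 < M.edge x.2 e) : ∫ ω, H.devFrom D g h x e ω ∂M.pathFrom e.2 =
      (if H.active x.1 e.1 then H.reward x.1 e.1 + D.expectedTotal M (H.start x.1 e.1, e.2) else 0)
        + h (H.step x e) - g x - h x := by
  unfold devFrom
  by_cases ha : H.active x.1 e.1 = true
  · simp only [ha, if_true]
    rw [integral_add ((hs.good.memLp_total (H.start x.1 e.1, e.2)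
      (hs.start x hx e he ha)).integrable one_le_two) (integrable_const _)]
    simp only [integral_const, probReal_univ, one_smul, RewardSystem.expectedTotal]
    ring
  · simp [ha]

/-- The Poisson equation says precisely that one deviation has mean zero given the current pair; the
first step decomposition carries this to sums. -/
theorem Sound.integral_devSum (hs : H.Sound D M R G) (hg : H.IsGain D M R g h) (n : ℕ) :
    ∀ x ∈ R, ∫ ω, H.devSum D g h n x ω ∂M.pathFrom x.2 = 0 := by
  induction n with
  | zero => intro x _; simp [devSum]
  | succ n ih =>
    intro x hx
    have hi := fun e (he : 0 < M.edge x.2 e) => (hs.memLp_devFrom g h hx he).integrable one_le_two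
    have hi2 := fun e (he : 0 < M.edge x.2 e) =>
      (hs.memLp_devSum g h n (H.step x e) (hs.closed x hx e he)).integrable one_le_two
    rw [(M.integral_pathFrom x.2 (H.measurable_devSum D g h (n + 1) x)
      fun e he => (hi e he).add (hi2 e he)).2]
    have e1 : ∀ e, 0 < M.edge x.2 e →
        ∫ ω, H.devSum D g h (n + 1) x (consSeq e ω) ∂M.pathFrom e.2 =
        (if H.active x.1 e.1 then H.reward x.1 e.1 + D.expectedTotal M (H.start x.1 e.1, e.2)
          else 0) + h (H.step x e) + (- (g x + h x)) := fun e he => by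
      refine (integral_add (hi e he) (hi2 e he)).trans ?_
      rw [hs.integral_devFrom hx he]
      have := ih (H.step x e) (hs.closed x hx e he)
      rw [show M.pathFrom e.2 = M.pathFrom (H.step x e).2 from rfl, this]
      ring
    rw [M.sum_edge_congr x.2 e1]
    simp_rw [mul_add _ _ (-(g x + h x))]
    rw [Finset.sum_add_distrib, M.sum_edge_const, ← hg.poisson x hx]
    ring

/-- The total reward and later differences have bounded correlations. -/
theorem Sound.exists_abs_integral_total_mul_le (hs : H.Sound D M R G) (hg : H.IsGain D M R g h) :
    ∃ K : ℝ, 0 ≤ K ∧ ∀ n, ∀ (z : Z) (y : Y) (s : S), (z, s) ∈ G → (y, s) ∈ R →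
      |∫ ω, D.total z (wordOf ω) * H.devSum D g h n (y, s) ω ∂M.pathFrom s| ≤ K := by
  obtain ⟨f, hf0, hf⟩ := hs.good.exists_expected_steps
  obtain ⟨c, hc0, hc⟩ := exists_abs_le f
  obtain ⟨K, hK0, hK⟩ := exists_abs_le fun p : Z × Y × S =>
    ∫ ω, D.total p.1 (wordOf ω) * H.dev D g h p.2 ω ∂M.pathFrom p.2.2
  have mt : ∀ z, Measurable fun ω : ℕ → A × S => D.total z (wordOf ω) := fun z =>
    (RewardSystem.measurable_total z).comp measurable_wordOf
  -- Every step before the system stops costs at most `K`, and `f` satisfies the recursion of the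
  -- expected number of such steps.
  have key : ∀ n, ∀ (z : Z) (y : Y) (s : S), (z, s) ∈ G → (y, s) ∈ R →
      |∫ ω, D.total z (wordOf ω) * H.devSum D g h n (y, s) ω ∂M.pathFrom s| ≤ K * f (z, s) := by
    intro n
    induction n with
    | zero =>
      intro z y s _ _
      simp only [devSum, mul_zero, integral_zero, abs_zero]
      exact mul_nonneg hK0 (hf0 _)
    | succ n ih =>
      intro z y s hz hy
      by_cases hst : D.halt z = true
      · simp only [RewardSystem.total_of_stop hst, zero_mul, integral_zero, abs_zero]
        exact mul_nonneg hK0 (hf0 _)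
      have hL := hs.good.memLp_total (z, s) hz
      have hL0 := hs.memLp_later_dev g h 0 (y, s) hy
      have i1 : Integrable (fun ω => D.total z (wordOf ω) * H.dev D g h (y, s) ω)
          (M.pathFrom s) := hL.integrable_mul hL0
      let rest : (ℕ → A × S) → ℝ := fun ω => H.devSum D g h n (H.step (y, s) (ω 0)) (tailSeq ω)
      have mrest : Measurable rest := measurable_first_tail
        (F := fun e ω => H.devSum D g h n (H.step (y, s) e) ω)
        fun e => H.measurable_devSum D g h n _
      have hLr : ∀ e, 0 < M.edge s e →
          MemLp (H.devSum D g h n (H.step (y, s) e)) 2 (M.pathFrom e.2) := fun e he =>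
        hs.memLp_devSum g h n (H.step (y, s) e) (hs.closed (y, s) hy e he)
      have hLrest : MemLp rest 2 (M.pathFrom s) := M.memLp_pathFrom s mrest hLr
      have i2 : Integrable (fun ω => D.total z (wordOf ω) * rest ω) (M.pathFrom s) :=
        hL.integrable_mul hLrest
      have esum : ∫ ω, D.total z (wordOf ω) * H.devSum D g h (n + 1) (y, s) ω ∂M.pathFrom s =
          ∫ ω, D.total z (wordOf ω) * H.dev D g h (y, s) ω ∂M.pathFrom s +
          ∫ ω, D.total z (wordOf ω) * rest ω ∂M.pathFrom s := by
        rw [← integral_add i1 i2]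
        refine integral_congr_ae (ae_of_all _ fun ω => ?_)
        simp only [devSum, dev, rest]
        ring
      have hae : ∀ e, 0 < M.edge s e →
          (fun ω => D.total z (wordOf (consSeq e ω)) * rest (consSeq e ω)) =ᵐ[M.pathFrom e.2]
          fun ω => D.reward z e.1 * H.devSum D g h n (H.step (y, s) e) ω +
            D.total (D.next z e.1) (wordOf ω) * H.devSum D g h n (H.step (y, s) e) ω :=
        fun e he => by
          filter_upwards [RewardSystem.total_consSeq_ae hs.good hz hst he] with ω hω
          rw [hω, add_mul]
          rfl
      have hz' : ∀ e, 0 < M.edge s e → (D.next z e.1, e.2) ∈ G := fun e he =>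
        hs.good.closed (z, s) hz hst e he
      have i3 : ∀ e, 0 < M.edge s e → Integrable
          (fun ω => D.reward z e.1 * H.devSum D g h n (H.step (y, s) e) ω) (M.pathFrom e.2) :=
        fun e he => ((hLr e he).integrable one_le_two).const_mul _
      have i4 : ∀ e, 0 < M.edge s e → Integrable
          (fun ω => D.total (D.next z e.1) (wordOf ω) * H.devSum D g h n (H.step (y, s) e) ω)
          (M.pathFrom e.2) :=
        fun e he => (hs.good.memLp_total (D.next z e.1, e.2) (hz' e he)).integrable_mul (hLr e he)
      -- After the first edge the total splits into a constant and the total of the successor. The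
      -- constant disappears, because it multiplies a sum of mean zero.
      have erest : ∫ ω, D.total z (wordOf ω) * rest ω ∂M.pathFrom s =
          ∑ e, M.edge s e * ∫ ω, D.total (D.next z e.1) (wordOf ω) *
            H.devSum D g h n (H.step (y, s) e) ω ∂M.pathFrom e.2 := by
        refine (M.integral_pathFrom s ((mt z).mul mrest) fun e he =>
          (integrable_congr (hae e he)).2 ((i3 e he).add (i4 e he))).2.trans ?_
        refine M.sum_edge_congr s fun e he => ?_
        refine (integral_congr_ae (hae e he)).trans ?_
        rw [integral_add (i3 e he) (i4 e he), integral_const_mul]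
        have := hs.integral_devSum hg n (H.step (y, s) e) (hs.closed (y, s) hy e he)
        rw [show M.pathFrom e.2 = M.pathFrom (H.step (y, s) e).2 from rfl, this, mul_zero, zero_add]
      rw [esum, erest]
      refine (abs_add_le _ _).trans ?_
      have b1 := hK (z, (y, s))
      have b2 : |∑ e, M.edge s e * ∫ ω, D.total (D.next z e.1) (wordOf ω) *
          H.devSum D g h n (H.step (y, s) e) ω ∂M.pathFrom e.2| ≤
          ∑ e, M.edge s e * (K * f (D.next z e.1, e.2)) := by
        refine (Finset.abs_sum_le_sum_abs _ _).trans ?_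
        simp_rw [abs_mul, abs_of_nonneg (M.edge_nonneg _ _)]
        exact M.sum_edge_le s fun e he =>
          ih (D.next z e.1) (H.next y e.1) e.2 (hz' e he) (hs.closed (y, s) hy e he)
      have e2 := hf (z, s) hz hst
      have e3 : ∑ e, M.edge s e * (K * f (D.next z e.1, e.2)) =
          K * ∑ e, M.edge s e * f (D.next z e.1, e.2) := by
        rw [Finset.mul_sum]; exact Finset.sum_congr rfl fun e _ => by ring
      rw [e3] at b2
      rw [e2, mul_add, mul_one]
      exact add_le_add b1 b2
  exact ⟨K * c, mul_nonneg hK0 hc0, fun n z y s hz hy => (key n z y s hz hy).trans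
    (mul_le_mul_of_nonneg_left ((le_abs_self _).trans (hc _)) hK0)⟩

/-- Expand the square of first deviation plus rest. Given the first edge, the deviation is a
constant plus possibly a launched total: the constant is uncorrelated with the rest, which has mean
zero, and the total contributes at most `K`. Each step thus adds at most `B + 2 * K`. -/
theorem Sound.exists_second_moment_le (hs : H.Sound D M R G) (hg : H.IsGain D M R g h) :
    ∃ C : ℝ, ∀ n : ℕ, ∀ x ∈ R,
      ∫ ω, H.devSum D g h n x ω ^ 2 ∂M.pathFrom x.2 ≤ C * n ∧
      ∫ ω, H.later (H.dev D g h) n x ω ^ 2 ∂M.pathFrom x.2 ≤ C := by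
  obtain ⟨K, hK0, hK⟩ := hs.exists_abs_integral_total_mul_le hg
  obtain ⟨B, hB0, hB⟩ := exists_abs_le fun x : Y × S =>
    ∫ ω, H.dev D g h x ω ^ 2 ∂M.pathFrom x.2
  refine ⟨B + 2 * K, fun n => ?_⟩
  induction n with
  | zero =>
    intro x _
    simp only [devSum, ne_eq, OfNat.ofNat_ne_zero, not_false_eq_true, zero_pow, integral_zero,
      Nat.cast_zero, mul_zero, le_refl, true_and, later]
    linarith [le_abs_self (∫ ω, H.dev D g h x ω ^ 2 ∂M.pathFrom x.2), hB x]
  | succ n ih =>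
    intro x hx
    constructor
    swap
    · have m1 := (H.measurable_later (H.measurable_dev D g h) (n + 1) x).pow_const 2
      have i1 := fun e (he : 0 < M.edge x.2 e) =>
        (hs.memLp_later_dev g h n (H.step x e) (hs.closed x hx e he)).integrable_sq
      refine (M.integral_pathFrom x.2 m1 i1).2.trans_le ?_
      rw [← M.sum_edge_const x.2 (B + 2 * K)]
      exact M.sum_edge_le x.2 fun e he => (ih (H.step x e) (hs.closed x hx e he)).2
    let rest : (ℕ → A × S) → ℝ := fun ω => H.devSum D g h n (H.step x (ω 0)) (tailSeq ω)
    have mrest : Measurable rest := measurable_first_tail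
      (F := fun e ω => H.devSum D g h n (H.step x e) ω) fun e => H.measurable_devSum D g h n _
    have hLr : ∀ e, 0 < M.edge x.2 e →
        MemLp (H.devSum D g h n (H.step x e)) 2 (M.pathFrom e.2) := fun e he =>
      hs.memLp_devSum g h n (H.step x e) (hs.closed x hx e he)
    have hLrest : MemLp rest 2 (M.pathFrom x.2) := M.memLp_pathFrom x.2 mrest hLr
    have hLd : MemLp (H.dev D g h x) 2 (M.pathFrom x.2) := hs.memLp_later_dev g h 0 x hx
    have i1 := hLd.integrable_sq
    have i2 : Integrable (fun ω => 2 * (H.dev D g h x ω * rest ω)) (M.pathFrom x.2) :=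
      (hLd.integrable_mul hLrest).const_mul 2
    have i3 := hLrest.integrable_sq
    have esum : ∫ ω, H.devSum D g h (n + 1) x ω ^ 2 ∂M.pathFrom x.2 =
        ∫ ω, H.dev D g h x ω ^ 2 ∂M.pathFrom x.2 +
        2 * ∫ ω, H.dev D g h x ω * rest ω ∂M.pathFrom x.2 +
        ∫ ω, rest ω ^ 2 ∂M.pathFrom x.2 := by
      have i12 : Integrable (fun ω => H.dev D g h x ω ^ 2 + 2 * (H.dev D g h x ω * rest ω))
          (M.pathFrom x.2) := i1.add i2
      rw [← integral_const_mul, ← integral_add i1 i2, ← integral_add i12 i3]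
      refine integral_congr_ae (ae_of_all _ fun ω => ?_)
      simp only [devSum, dev, rest]
      ring
    have b1 := (le_abs_self _).trans (hB x)
    have b3 : ∫ ω, rest ω ^ 2 ∂M.pathFrom x.2 ≤ (B + 2 * K) * n := by
      refine (M.integral_pathFrom x.2 (mrest.pow_const 2)
        fun e he => (hLr e he).integrable_sq).2.trans_le ?_
      rw [← M.sum_edge_const x.2 ((B + 2 * K) * n)]
      exact M.sum_edge_le x.2 fun e he => (ih (H.step x e) (hs.closed x hx e he)).1
    have b2 : ∫ ω, H.dev D g h x ω * rest ω ∂M.pathFrom x.2 ≤ K := by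
      refine (M.integral_pathFrom x.2 ((H.measurable_dev D g h x).mul mrest) fun e he =>
        (hs.memLp_devFrom g h hx he).integrable_mul (hLr e he)).2.trans_le ?_
      rw [← M.sum_edge_const x.2 K]
      refine M.sum_edge_le x.2 fun e he => ?_
      change ∫ ω, H.devFrom D g h x e ω * H.devSum D g h n (H.step x e) ω ∂M.pathFrom e.2 ≤ K
      have hz : ∫ ω, H.devSum D g h n (H.step x e) ω ∂M.pathFrom e.2 = 0 :=
        hs.integral_devSum hg n (H.step x e) (hs.closed x hx e he)
      have ic : ∀ c : ℝ, Integrable (fun ω => c * H.devSum D g h n (H.step x e) ω)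
          (M.pathFrom e.2) := fun c => ((hLr e he).integrable one_le_two).const_mul c
      unfold devFrom
      by_cases ha : H.active x.1 e.1 = true
      · simp only [ha, if_true, add_mul]
        have it : Integrable (fun ω => D.total (H.start x.1 e.1) (wordOf ω) *
            H.devSum D g h n (H.step x e) ω) (M.pathFrom e.2) :=
          (hs.good.memLp_total (H.start x.1 e.1, e.2) (hs.start x hx e he ha)).integrable_mul
            (hLr e he)
        rw [integral_add it (ic _), integral_const_mul, hz, mul_zero, add_zero]
        exact (le_abs_self _).trans (hK n (H.start x.1 e.1) (H.next x.1 e.1) e.2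
          (hs.start x hx e he ha) (hs.closed x hx e he))
      · simp only [ha, Bool.false_eq_true, if_false, zero_add]
        rw [integral_const_mul, hz, mul_zero]
        exact hK0
    rw [esum]
    push_cast
    linarith

/-- The average payoff converges almost surely to the eventual value of the gain. -/
theorem Sound.tendsto_average (hs : H.Sound D M R G) (hg : H.IsGain D M R g h) : ∀ x ∈ R,
    ∀ᵐ ω ∂M.pathFrom x.2, ∃ c, (∀ᶠ n in atTop, g (H.pos n x ω) = c) ∧
      Tendsto (fun n : ℕ => (∑ i ∈ Finset.range n,
        H.later (fun x ω => H.payoff D x.1 (wordOf ω)) i x ω) / n) atTop (nhds c) := by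
  intro x hx
  obtain ⟨C, hC⟩ := hs.exists_second_moment_le hg
  have hslln := tendsto_average_of_second_moments (μ := M.pathFrom x.2) (C := C)
    (ζ := fun i => H.later (H.dev D g h) i x)
    (fun i => H.measurable_later (H.measurable_dev D g h) i x) (fun i => by
      rw [← ofReal_integral_eq_lintegral_ofReal (hs.memLp_later_dev g h i x hx).integrable_sq
        (ae_of_all _ fun ω => sq_nonneg _)]
      exact ENNReal.ofReal_le_ofReal (hC i x hx).2) (fun n => by
      simp_rw [← devSum_eq]
      rw [← ofReal_integral_eq_lintegral_ofReal (hs.memLp_devSum g h n x hx).integrable_sq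
        (ae_of_all _ fun ω => sq_nonneg _)]
      exact ENNReal.ofReal_le_ofReal (hC n x hx).1)
  obtain ⟨d, -, hd⟩ := exists_abs_le h
  filter_upwards [hslln, hs.closed.eventually_const hg.harmonic x hx] with ω h1 ⟨c, hc⟩
  refine ⟨c, hc, ?_⟩
  have hces : Tendsto (fun n : ℕ => (n : ℝ)⁻¹ * ∑ i ∈ Finset.range n, g (H.pos i x ω)) atTop
      (nhds c) := Tendsto.cesaro (tendsto_const_nhds.congr' (by
        filter_upwards [hc] with n hn; exact hn.symm))
  have hz : Tendsto (fun n : ℕ => (n : ℝ)⁻¹ * (h x - h (H.pos n x ω))) atTop (nhds 0) := by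
    refine squeeze_zero_norm (a := fun n : ℕ => (n : ℝ)⁻¹ * (2 * d)) (fun n => ?_) ?_
    · rw [norm_mul, Real.norm_eq_abs, Real.norm_eq_abs, abs_of_nonneg (by positivity)]
      refine mul_le_mul_of_nonneg_left ?_ (by positivity)
      linarith [abs_sub (h x) (h (H.pos n x ω)), hd x, hd (H.pos n x ω)]
    · have := (tendsto_inv_atTop_nhds_zero_nat (𝕜 := ℝ)).mul_const (2 * d)
      simpa using this
  have := (h1.add hces).add hz
  rw [zero_add, add_zero] at this
  refine this.congr fun n => ?_
  -- The biases telescope, so deviations and payoffs differ by a bounded term and the sum of the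
  -- gains along the path.
  have tel : ∑ i ∈ Finset.range n, H.later (H.dev D g h) i x ω =
      ∑ i ∈ Finset.range n, H.later (fun x ω => H.payoff D x.1 (wordOf ω)) i x ω +
      (h (H.pos n x ω) - h x) - ∑ i ∈ Finset.range n, g (H.pos i x ω) := by
    have : ∀ i, H.later (H.dev D g h) i x ω =
        H.later (fun x ω => H.payoff D x.1 (wordOf ω)) i x ω +
        (h (H.pos (i + 1) x ω) - h (H.pos i x ω)) - g (H.pos i x ω) := fun i => by
      rw [later_eq, later_eq, dev_eq, pos_succ]
      simp only [zero_add]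
      ring
    simp_rw [this]
    rw [Finset.sum_sub_distrib, Finset.sum_add_distrib,
      Finset.sum_range_sub fun i => h (H.pos i x ω)]
    rfl
  rw [tel]
  ring

end Launcher


/-! ### Computing the value functions with an accumulator -/

namespace FinVal

/-- The accumulator after reading the weight `x`. -/
def upd : FinVal → ℤ → ℤ → ℤ
  | .max, c, x => Max.max c x
  | .min, c, x => Min.min c x
  | .boundedSum B, c, x =>
    Max.max (-((B : ℤ) + 1)) (Min.min ((B : ℤ) + 1) (c + if |c| ≤ (B : ℤ) then x else 0))
  | .absSum, _, _ => 0
  | .sum, _, _ => 0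

/-- The part of the value that is given by the accumulator. -/
def accVal : FinVal → ℤ → ℤ
  | .max, c => c
  | .min, c => c
  | .boundedSum B, c => Max.max (-(B : ℤ)) (Min.min (B : ℤ) c)
  | .absSum, _ => 0
  | .sum, _ => 0

/-- The part of the value that is added for the weight `x`. -/
def extra : FinVal → ℤ → ℤ
  | .absSum, x => |x|
  | .sum, x => x
  | _, _ => 0

/-- The initial accumulator for weights of absolute value at most `K`. -/
def initAcc (K : ℕ) : FinVal → ℤ
  | .max => -K
  | .min => K
  | _ => 0

/-- The bound of a bounded sum. -/
def bound : FinVal → ℕ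
  | .boundedSum B => B
  | _ => 0

/-- The increment of the value when the weight `x` is read. -/
def increment (g : FinVal) (c x : ℤ) : ℤ := g.accVal (g.upd c x) - g.accVal c + g.extra x

def increments (g : FinVal) : ℤ → List ℤ → ℤ
  | _, [] => 0
  | c, x :: l => g.increment c x + g.increments (g.upd c x) l

/-- Accumulators of a bounded sum are clipped to `[-(B + 1), B + 1]`, which is why `K` has to exceed
`B`. -/
theorem abs_upd_le {g : FinVal} {K : ℕ} {c x : ℤ} (hg : g.bound + 1 ≤ K) (hc : |c| ≤ K)
    (hx : |x| ≤ K) : |g.upd c x| ≤ K := by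
  rw [abs_le] at *
  cases g with
  | max => simp only [upd]; omega
  | min => simp only [upd]; omega
  | boundedSum B =>
    simp only [upd, bound] at *
    generalize c + (if |c| ≤ (B : ℤ) then x else 0) = t
    omega
  | absSum => simp [upd]
  | sum => simp [upd]

theorem abs_initAcc_le (g : FinVal) (K : ℕ) : |g.initAcc K| ≤ K := by
  cases g <;> simp [initAcc]

/-- `accVal` is a potential whose differences telescope, and `extra` collects the purely additive
part. -/
theorem accVal_add_increments (g : FinVal) (l : List ℤ) : ∀ c,
    g.accVal c + g.increments c l = g.accVal (l.foldl g.upd c) + (l.map g.extra).sum := by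
  induction l with
  | nil => intro c; simp [increments]
  | cons x l ih =>
    intro c
    have := ih (g.upd c x)
    simp only [increments, increment, List.foldl_cons, List.map_cons, List.sum_cons]
    linarith

/-- The accumulators `B + 1` and `-(B + 1)` record on which side a partial sum has left `[-B, B]`;
they are absorbing, because no weight is added to them any more. -/
theorem foldl_upd_frozen (B : ℕ) (l : List ℤ) : ∀ c : ℤ, |c| = B + 1 →
    l.foldl (FinVal.boundedSum B).upd c = c := by
  induction l with
  | nil => intro c _; rfl
  | cons x l ih =>
    intro c hc
    have : (FinVal.boundedSum B).upd c x = c := by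
      have h' : ¬ |c| ≤ (B : ℤ) := by omega
      simp only [upd, h', if_false, add_zero]
      rcases abs_eq (by positivity) |>.1 hc with h | h <;> omega
    rw [List.foldl_cons, this, ih c hc]

/-- Inside `[-B, B]` the accumulator is the partial sum. The first exit is clipped to `B + 1` with
its sign and frozen, and `accVal` turns this into `B` with that sign. -/
theorem accVal_foldl_boundedSum (B : ℕ) (l : List ℤ) : ∀ c : ℤ, |c| ≤ B →
    (FinVal.boundedSum B).accVal (l.foldl (FinVal.boundedSum B).upd c) = boundedSumFrom B c l := by
  induction l with
  | nil =>
    intro c hc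
    rw [abs_le] at hc
    simp only [List.foldl_nil, accVal, boundedSumFrom]
    omega
  | cons x l ih =>
    intro c hc
    rw [List.foldl_cons, boundedSumFrom]
    split_ifs with h
    · have : (FinVal.boundedSum B).upd c x = c + x := by
        rw [abs_le] at h
        simp only [upd, hc, if_true]
        omega
      rw [this, ih _ h]
    · have h1 : (FinVal.boundedSum B).upd c x = (c + x).sign * (B + 1) := by
        simp only [upd, hc, if_true]
        rcases lt_trichotomy (c + x) 0 with h2 | h2 | h2
        · rw [abs_of_neg h2] at h
          rw [Int.sign_eq_neg_one_of_neg h2]; omega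
        · rw [h2] at h; simp at h
        · rw [abs_of_pos h2] at h
          rw [Int.sign_eq_one_of_pos h2]; omega
      have hne : c + x ≠ 0 := by rintro h2; rw [h2] at h; simp at h
      have h3 : |(c + x).sign * ((B : ℤ) + 1)| = B + 1 := by
        rw [abs_mul, Int.abs_sign_of_ne_zero hne, one_mul, abs_of_nonneg (by positivity)]
      rw [h1, foldl_upd_frozen B l _ h3]
      simp only [accVal]
      rcases lt_or_gt_of_ne hne with h2 | h2
      · rw [Int.sign_eq_neg_one_of_neg h2]; omega
      · rw [Int.sign_eq_one_of_pos h2]; omega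

/-- The value of a nonempty sequence of bounded weights is the sum of the increments. -/
theorem eval_eq_increments (g : FinVal) {K : ℕ} {l : List ℤ} (hl : l ≠ [])
    (hK : ∀ x ∈ l, |x| ≤ (K : ℤ)) :
    g.eval l = g.accVal (g.initAcc K) + g.increments (g.initAcc K) l := by
  rw [accVal_add_increments]
  obtain ⟨x, l, rfl⟩ := List.exists_cons_of_ne_nil hl
  have hx := abs_le.1 (hK x (by simp))
  cases g with
  | max =>
    have h0 : ∀ l : List ℤ, (l.map FinVal.max.extra).sum = 0 := fun l => by
      induction l with
      | nil => rfl
      | cons x l ih => simpa [extra] using ih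
    rw [h0]
    simp only [accVal, initAcc, List.foldl_cons, eval, add_zero]
    -- The start `-K` is a lower bound for all weights, so the first weight replaces it; here it
    -- matters that the sequence is nonempty.
    rw [show FinVal.max.upd (-(K : ℤ)) x = x from max_eq_right hx.1]
    rfl
  | min =>
    have h0 : ∀ l : List ℤ, (l.map FinVal.min.extra).sum = 0 := fun l => by
      induction l with
      | nil => rfl
      | cons x l ih => simpa [extra] using ih
    rw [h0]
    simp only [accVal, initAcc, List.foldl_cons, eval, add_zero]
    rw [show FinVal.min.upd (K : ℤ) x = x from min_eq_right hx.2]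
    rfl
  | boundedSum B =>
    have h0 : ∀ l : List ℤ, (l.map (FinVal.boundedSum B).extra).sum = 0 := fun l => by
      induction l with
      | nil => rfl
      | cons x l ih => simpa [extra] using ih
    rw [h0, add_zero, accVal_foldl_boundedSum B _ _ (by simp [initAcc])]
    rfl
  | absSum => simp only [accVal, eval]; rw [zero_add]; rfl
  | sum =>
    simp only [accVal, eval]
    rw [zero_add, show FinVal.sum.extra = id from rfl, List.map_id]

end FinVal

namespace RewardSystem

variable {A Z : Type}

/-- The same device with other rewards. -/
def withReward (D : RewardSystem A Z) (r : Z → A → ℝ) : RewardSystem A Z := { D with reward := r }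

theorem stopsBy_withReward (D : RewardSystem A Z) (r : Z → A → ℝ) (n : ℕ) : ∀ z w,
    (D.withReward r).StopsBy n z w ↔ D.StopsBy n z w := by
  induction n with
  | zero => intro z w; rfl
  | succ n ih => intro z w; exact or_congr Iff.rfl (ih _ _)

theorem terminates_withReward (D : RewardSystem A Z) (r : Z → A → ℝ) (z : Z) (w : ℕ → A) :
    (D.withReward r).Terminates z w ↔ D.Terminates z w :=
  exists_congr fun n => D.stopsBy_withReward r n z w

theorem rewardUpTo_withReward (D : RewardSystem A Z) (c : ℝ) (n : ℕ) : ∀ z w,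
    (D.withReward fun z a => c * D.reward z a).rewardUpTo n z w = c * D.rewardUpTo n z w := by
  induction n with
  | zero => intro z w; simp [rewardUpTo]
  | succ n ih =>
    intro z w
    simp only [rewardUpTo, ih]
    change (if D.halt z then 0 else c * D.reward z (w 0) +
      c * D.rewardUpTo n (D.next z (w 0)) (tailSeq w)) = _
    split_ifs <;> ring

theorem total_withReward (D : RewardSystem A Z) (c : ℝ) (z : Z) (w : ℕ → A) :
    (D.withReward fun z a => c * D.reward z a).total z w = c * D.total z w := by
  by_cases h : D.Terminates z w
  · obtain ⟨n, hn⟩ := h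
    rw [hn.total_eq, ((D.stopsBy_withReward _ n z w).2 hn).total_eq, rewardUpTo_withReward]
  · rw [total_of_not_terminates h, total_of_not_terminates (by rwa [terminates_withReward]),
      mul_zero]

end RewardSystem

/-! ### The accumulator device of a nested weighted automaton -/

/-- A reward system that simulates the slave automata of `N`, with accumulators in `[-K, K]`. -/
structure SlaveModel {A Q : Type} {k : ℕ} {P : Fin k → Type} (N : DetNWA A Q k P) (g : FinVal)
    (K : ℕ) (Z : Type) where
  sys : RewardSystem A Z
  enc : (j : Fin k) → P j → ℤ → Z
  bound_le : g.bound + 1 ≤ K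
  weight_le : ∀ j p a, |(N.slave j).label p a| ≤ (K : ℤ)
  stop_enc : ∀ j p c, |c| ≤ (K : ℤ) → sys.halt (enc j p c) = (N.slave j).accept p
  next_enc : ∀ j p c a, |c| ≤ (K : ℤ) → ¬ (N.slave j).accept p = true →
    sys.next (enc j p c) a = enc j ((N.slave j).next p a) (g.upd c ((N.slave j).label p a))
  reward_enc : ∀ j p c a, |c| ≤ (K : ℤ) → ¬ (N.slave j).accept p = true →
    sys.reward (enc j p c) a = (g.increment c ((N.slave j).label p a) : ℝ)

theorem factor_succ {B : Type} (w : ℕ → B) (n : ℕ) :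
    factor w 0 (n + 1) = w 0 :: factor (tailSeq w) 0 n := by
  simp only [factor, List.ofFn_succ]
  simp [tailSeq]

theorem factor_shift {B : Type} (w : ℕ → B) (i n : ℕ) :
    factor w i n = factor (fun m => w (m + i)) 0 n := by
  simp only [factor]
  congr 1
  funext j
  congr 1
  omega

theorem factor_prefix {B : Type} (w : ℕ → B) {m n : ℕ} (h : m ≤ n) :
    factor w 0 m <+: factor w 0 n := by
  induction n, h using Nat.le_induction with
  | base => exact List.prefix_refl _
  | succ n _ ih => rw [factor_snoc]; exact ih.trans (List.prefix_append _ _)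

theorem length_factor {B : Type} (w : ℕ → B) (i n : ℕ) : (factor w i n).length = n := by
  simp [factor]

namespace SlaveModel

variable {A Q Z : Type} {k : ℕ} {P : Fin k → Type} {N : DetNWA A Q k P} {g : FinVal} {K : ℕ}
  (m : SlaveModel N g K Z)

theorem terminates_enc (j : Fin k) (n : ℕ) : ∀ (p : P j) (c : ℤ) (w : ℕ → A), |c| ≤ (K : ℤ) →
    (N.slave j).accept ((factor w 0 n).foldl (N.slave j).next p) = true →
    m.sys.Terminates (m.enc j p c) w := by
  induction n with
  | zero =>
    intro p c w hc h
    refine RewardSystem.terminates_of_stop ?_ w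
    rw [m.stop_enc j p c hc]
    simpa [factor] using h
  | succ n ih =>
    intro p c w hc h
    by_cases hp : (N.slave j).accept p = true
    · exact RewardSystem.terminates_of_stop (by rw [m.stop_enc j p c hc, hp]) w
    · rw [RewardSystem.terminates_iff (by rw [m.stop_enc j p c hc]; exact hp),
        m.next_enc j p c _ hc hp]
      refine ih _ _ _ (FinVal.abs_upd_le m.bound_le hc (m.weight_le j p _)) ?_
      rwa [factor_succ, List.foldl_cons] at h

/-- The device stops at the first accepting state, so no shorter prefix may be accepted. -/
theorem total_enc (j : Fin k) (n : ℕ) : ∀ (p : P j) (c : ℤ) (w : ℕ → A), |c| ≤ (K : ℤ) →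
    (N.slave j).accept ((factor w 0 n).foldl (N.slave j).next p) = true →
    (∀ i < n, ¬ (N.slave j).accept ((factor w 0 i).foldl (N.slave j).next p) = true) →
    m.sys.total (m.enc j p c) w =
      (g.increments c ((N.slave j).labelsFrom p (factor w 0 n)) : ℝ) := by
  induction n with
  | zero =>
    intro p c w hc h _
    rw [RewardSystem.total_of_stop]
    · simp [factor, DetAutomaton.labelsFrom, FinVal.increments]
    · rw [m.stop_enc j p c hc]
      simpa [factor] using h
  | succ n ih =>
    intro p c w hc h hn
    have hp : ¬ (N.slave j).accept p = true := by simpa [factor] using hn 0 (by omega)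
    have hc' := FinVal.abs_upd_le m.bound_le hc (m.weight_le j p (w 0))
    rw [factor_succ, List.foldl_cons] at h
    have hT := m.terminates_enc j n ((N.slave j).next p (w 0)) _ (tailSeq w) hc' h
    rw [← m.next_enc j p c _ hc hp] at hT
    rw [RewardSystem.total_step (by rw [m.stop_enc j p c hc]; exact hp) hT,
      m.next_enc j p c _ hc hp, m.reward_enc j p c _ hc hp, ih _ _ _ hc' h, factor_succ,
      DetAutomaton.labelsFrom, FinVal.increments]
    · push_cast; rfl
    · intro i hi
      have := hn (i + 1) (by omega)
      rwa [factor_succ, List.foldl_cons] at this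

/-- The launcher that runs the master automaton. -/
def launcher : Launcher A Q Z where
  next := N.master.next
  active q a := !(N.slave (N.master.label q a)).accept (N.slave (N.master.label q a)).init
  -- The letter of the launching step is already the first letter of the slave. Hence the slave is
  -- started one transition later, and the reward of its first transition is paid at once, together
  -- with the initial `accVal`.
  start q a := m.sys.next
    (m.enc (N.master.label q a) (N.slave (N.master.label q a)).init (g.initAcc K)) a
  reward q a := g.accVal (g.initAcc K) + m.sys.reward
    (m.enc (N.master.label q a) (N.slave (N.master.label q a)).init (g.initAcc K)) a

theorem labelsFrom_le (m : SlaveModel N g K Z) (j : Fin k) (u : List A) : ∀ p, ∀ x ∈ (N.slave j).labelsFrom p u,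
    |x| ≤ (K : ℤ) := by
  induction u with
  | nil => intro p x hx; simp [DetAutomaton.labelsFrom] at hx
  | cons a u ih =>
    intro p x hx
    rw [DetAutomaton.labelsFrom, List.mem_cons] at hx
    rcases hx with rfl | hx
    · exact m.weight_le j p a
    · exact ih _ x hx

/-- Whether the slave automaton that is invoked in position `i` is not silent. -/
def isActive (w : ℕ → A) (i : ℕ) : Bool := m.launcher.active (N.master.stateAt w i) (w i)

/-- The payoff in position `i`. -/
def payoffAt (w : ℕ → A) (i : ℕ) : ℝ :=
  m.launcher.payoff m.sys (N.master.stateAt w i) (fun n => w (n + i))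

/-- Two accepted factors at the same position are prefixes of one another, so by prefix-freeness
they have equal length. Consequently the slave is silent exactly if its initial state accepts, and
otherwise the device stops exactly at the end of the factor, having collected the returned value. -/
theorem accepted_at {w : ℕ → A} {i n : ℕ}
    (h : factor w i n ∈ (N.slave (N.invoked w i)).language) :
    (m.isActive w i = true ↔ 0 < n) ∧
    (0 < n → m.sys.Terminates (m.launcher.start (N.master.stateAt w i) (w i))
        (fun l => w (l + (i + 1))) ∧
      m.payoffAt w i =
        (g.eval ((N.slave (N.invoked w i)).labels (factor w i n)) : ℝ)) ∧
    ∀ n', factor w i n' ∈ (N.slave (N.invoked w i)).language → n' = n := by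
  set j := N.invoked w i with hj
  set v : ℕ → A := fun l => w (l + i) with hv
  have huniq : ∀ n', factor w i n' ∈ (N.slave j).language → n' = n := by
    intro n' h'
    rcases le_total n' n with hle | hle
    · have := N.prefixFree j _ h' _ h (by
        rw [factor_shift, factor_shift w i n]; exact factor_prefix _ hle)
      simpa [length_factor] using congrArg List.length this
    · have := N.prefixFree j _ h _ h' (by
        rw [factor_shift, factor_shift w i n']; exact factor_prefix _ hle)
      simpa [length_factor] using (congrArg List.length this).symm
  have e0 : factor w i 0 = [] := by simp [factor]
  have hact : m.isActive w i = true ↔ 0 < n := by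
    have e : m.isActive w i = !(N.slave j).accept (N.slave j).init := rfl
    rw [e]
    constructor
    · intro h1
      by_contra h2
      obtain rfl : n = 0 := by omega
      rw [e0] at h
      have : (N.slave j).accept (N.slave j).init = true := h
      simp [this] at h1
    · intro h1
      by_contra h2
      have h3 : (N.slave j).accept (N.slave j).init = true := by simpa using h2
      have h4 : factor w i 0 ∈ (N.slave j).language := by rw [e0]; exact h3
      have := huniq 0 h4
      omega
  refine ⟨hact, fun hn => ?_, huniq⟩
  have hc := FinVal.abs_initAcc_le g K
  have hacc : (N.slave j).accept ((factor v 0 n).foldl (N.slave j).next (N.slave j).init) = true := by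
    rw [← factor_shift]; exact h
  have hT := m.terminates_enc j n _ _ v hc hacc
  have hna : ¬ (N.slave j).accept (N.slave j).init = true := by
    have : (!(N.slave j).accept (N.slave j).init) = true := hact.2 hn
    simpa using this
  have hns : ¬ m.sys.halt (m.enc j (N.slave j).init (g.initAcc K)) = true := by
    rw [m.stop_enc _ _ _ hc]; exact hna
  rw [RewardSystem.terminates_iff hns] at hT
  have hv0 : v 0 = w i := by simp [hv]
  have hvt : tailSeq v = fun l => w (l + (i + 1)) := by
    funext l; simp only [tailSeq, hv]; congr 1; omega
  have hT' : m.sys.Terminates (m.launcher.start (N.master.stateAt w i) (w i))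
      (fun l => w (l + (i + 1))) := by
    rw [← hvt, ← hv0]; rw [hv0]; rw [hv0] at hT; exact hT
  refine ⟨hT', ?_⟩
  have htot := m.total_enc j n _ _ v hc hacc fun i' hi' h' => by
    have : factor w i i' ∈ (N.slave j).language := by rw [factor_shift]; exact h'
    have := huniq i' this
    omega
  rw [RewardSystem.total_step hns hT] at htot
  have hpay : m.payoffAt w i = (g.accVal (g.initAcc K) : ℝ) +
      (m.sys.reward (m.enc j (N.slave j).init (g.initAcc K)) (v 0) +
        m.sys.total (m.sys.next (m.enc j (N.slave j).init (g.initAcc K)) (v 0)) (tailSeq v)) := by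
    have h1 : m.launcher.active (N.master.stateAt w i) (v 0) = true := by
      rw [hv0]; exact hact.2 hn
    change (if m.launcher.active (N.master.stateAt w i) (v 0) = true then
      m.launcher.reward (N.master.stateAt w i) (v 0) +
        m.sys.total (m.launcher.start (N.master.stateAt w i) (v 0)) (tailSeq v) else 0) = _
    rw [if_pos h1, ← add_assoc, hv0]
    rfl
  rw [hpay, htot, DetAutomaton.labels,
    FinVal.eval_eq_increments g (K := K) ?_ (m.labelsFrom_le j _ _)]
  · rw [factor_shift w i n, Int.cast_add]
  · rw [factor_shift w i n]
    obtain ⟨n', rfl⟩ : ∃ n', n = n' + 1 := ⟨n - 1, by omega⟩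
    rw [factor_succ]
    simp [DetAutomaton.labelsFrom]

end SlaveModel



/-! ### The limit average with silent moves -/

open Classical in
theorem sum_getD_eq_sum_nth (v : ℕ → Option ℤ) (n : ℕ) :
    ∑ t ∈ Finset.range n, (((v t).getD 0 : ℤ) : ℝ) =
      ∑ i ∈ Finset.range (Nat.count (fun i => (v i).isSome = true) n),
        (((v (Nat.nth (fun i => (v i).isSome = true) i)).getD 0 : ℤ) : ℝ) := by
  induction n with
  | zero => simp
  | succ n ih =>
    rw [Finset.sum_range_succ, ih, Nat.count_succ]
    by_cases h : (v n).isSome = true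
    · rw [if_pos h, Finset.sum_range_succ, Nat.nth_count (p := fun i => (v i).isSome = true) h]
    · have : v n = none := by simpa using h
      rw [if_neg h, this]
      simp

-- At the time of the `n`-th non-silent position, the count of earlier ones is `n`. So the averages
-- with silent moves removed form a subsequence of the ratios, and convergence of the ratios turns
-- the limit superior into a limit.
open Classical in
theorem silentLimAvg_eq {v : ℕ → Option ℤ} (hv : ∃ᶠ i in atTop, (v i).isSome = true) {r : ℝ}
    (h : Tendsto (fun n => (∑ t ∈ Finset.range n, (((v t).getD 0 : ℤ) : ℝ)) /
      (Nat.count (fun i => (v i).isSome = true) n : ℝ)) atTop (nhds r)) :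
    silentLimAvg v = (r : EReal) := by
  have hinf : {i | (v i).isSome = true}.Infinite := Nat.frequently_atTop_iff_infinite.1 hv
  have ht := h.comp (Nat.nth_strictMono hinf).tendsto_atTop
  rw [silentLimAvg, limAvg]
  refine Tendsto.limsup_eq ?_
  refine (continuous_coe_real_ereal.tendsto r).comp (ht.congr fun n => ?_)
  simp only [Function.comp_apply]
  rw [sum_getD_eq_sum_nth, Nat.count_nth_of_infinite hinf]

/-! ### Affine payoffs, live pairs of states, and limits per active step. -/

namespace Launcher

variable {A S Y Z : Type} (H : Launcher A Y Z) (D : RewardSystem A Z)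

/-- All rewards are multiplied by `a`, and `b` is added in active steps. -/
def aff (a b : ℝ) : Launcher A Y Z := { H with reward := fun y l => a * H.reward y l + b }

/-- Two instances are used: `aff 0 1` counts active steps, and `aff den (-num)` compares the payoff
per active step with the threshold `num / den` without division. -/
theorem payoff_aff (a b : ℝ) (y : Y) (w : ℕ → A) :
    (H.aff a b).payoff (D.withReward fun z l => a * D.reward z l) y w =
      a * H.payoff D y w + b * (if H.active y (w 0) then 1 else 0) := by
  simp only [payoff, aff, RewardSystem.total_withReward]
  split_ifs <;> ring

theorem later_aff {α : Type} (a b : ℝ) (F : Y × S → (ℕ → A × S) → α) (i : ℕ) : ∀ x ω,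
    (H.aff a b).later F i x ω = H.later F i x ω := by
  induction i with
  | zero => intro x ω; rfl
  | succ i ih => intro x ω; exact ih _ _

theorem pos_aff (a b : ℝ) (i : ℕ) (x : Y × S) (ω : ℕ → A × S) :
    (H.aff a b).pos i x ω = H.pos i x ω := H.later_aff a b _ i x ω

variable [Fintype A] [Fintype S] [Fintype Y] [Fintype Z] [MeasurableSpace A] [MeasurableSpace S]
  [MeasurableSingletonClass S] [MeasurableSingletonClass A] (M : MarkovChain A S)

/-- The pairs of states from which `D` stops almost surely. -/
def goodSet : Set (Z × S) := {x | ∀ᵐ ω ∂M.pathFrom x.2, D.Terminates x.1 (wordOf ω)}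

theorem good_goodSet : D.Good M (goodSet D M) where
  closed x hx hs e he := by
    have := (M.ae_pathFrom_iff x.2).1 hx e he
    change ∀ᵐ ω ∂M.pathFrom e.2, D.Terminates (D.next x.1 e.1) (wordOf ω)
    filter_upwards [this] with ω hω
    rw [wordOf_consSeq] at hω
    exact (RewardSystem.terminates_iff (w := consSeq e.1 (wordOf ω)) hs).1 hω
  ae x hx := hx

/-- The system that is started in the first step stops. -/
def LaunchStops (x : Y × S) (ω : ℕ → A × S) : Prop :=
  H.active x.1 (ω 0).1 = true → D.Terminates (H.start x.1 (ω 0).1) (wordOf (tailSeq ω))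

/-- The pairs of states from which almost surely all the systems that are started halt, and there
are infinitely many active steps. -/
def liveSet : Set (Y × S) := {x | ∀ᵐ ω ∂M.pathFrom x.2, (∀ i, H.later (H.LaunchStops D) i x ω) ∧
  ∃ᶠ n in atTop, H.later (fun x ω => H.active x.1 (ω 0).1 = true) n x ω}

/-- Both sets are defined by almost sure behaviour, and the first step decomposition transfers such
statements to every successor of positive probability. No analysis of the transition graph is
required. -/
theorem sound_liveSet : H.Sound D M (H.liveSet D M) (goodSet D M) where
  good := good_goodSet D M
  closed x hx e he := by
    have := (M.ae_pathFrom_iff x.2).1 hx e he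
    change ∀ᵐ ω ∂M.pathFrom e.2, _
    filter_upwards [this] with ω hω
    refine ⟨fun i => hω.1 (i + 1), ?_⟩
    have h2 := hω.2
    rw [frequently_atTop] at h2 ⊢
    intro n
    obtain ⟨l, hl, hl'⟩ := h2 (n + 1)
    obtain ⟨l, rfl⟩ : ∃ l', l = l' + 1 := ⟨l - 1, by omega⟩
    exact ⟨l, by omega, hl'⟩
  start x hx e he ha := by
    have := (M.ae_pathFrom_iff x.2).1 hx e he
    change ∀ᵐ ω ∂M.pathFrom e.2, D.Terminates (H.start x.1 e.1) (wordOf ω)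
    filter_upwards [this] with ω hω
    exact hω.1 0 ha

variable {H D M} in
theorem Sound.aff {R : Set (Y × S)} {G : Set (Z × S)} (hs : H.Sound D M R G) (a b : ℝ) :
    (H.aff a b).Sound (D.withReward fun z l => a * D.reward z l) M R G where
  good := ⟨hs.good.closed, fun x hx => by
    filter_upwards [hs.good.ae x hx] with ω hω
    rwa [RewardSystem.terminates_withReward]⟩
  closed := hs.closed
  start := hs.start

/-- For a device that never halts, `stoppedOp` is the transition operator of the product, so the
decomposition of the expected payoff is the Poisson equation on all pairs. -/
theorem exists_isGain (R : Set (Y × S)) : ∃ g h : Y × S → ℝ,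
    (∀ x, g x = ∑ e, M.edge x.2 e * g (H.step x e)) ∧ H.IsGain D M R g h := by
  let T : RewardSystem A Y := ⟨H.next, fun _ => false, fun _ _ => 0⟩
  obtain ⟨g, h, hg, hv⟩ := (T.supContraction_stoppedOp M).exists_decomposition
    fun x => ∑ e, M.edge x.2 e * (if H.active x.1 e.1 then
      H.reward x.1 e.1 + D.expectedTotal M (H.start x.1 e.1, e.2) else 0)
  have hg' : ∀ x, g x = ∑ e, M.edge x.2 e * g (H.step x e) := fun x => (congrFun hg x).symm
  refine ⟨g, h, hg', fun x _ => hg' x, fun x _ => ?_⟩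
  have h1 : ∑ e, M.edge x.2 e * _ = g x + (h x - ∑ e, M.edge x.2 e * h (H.step x e)) :=
    congrFun hv x
  simp_rw [mul_add _ _ (h _), Finset.sum_add_distrib]
  rw [h1]
  ring

/-- A harmonic function is constant on an irreducible closed set. -/
theorem harmonic_const {f : Y × S → ℝ} (hf : ∀ x, f x = ∑ e, M.edge x.2 e * f (H.step x e))
    {E : Y × S → Y × S → Prop} (hE : ∀ x y, E x y ↔ ∃ e, 0 < M.edge x.2 e ∧ H.step x e = y)
    {C : Set (Y × S)} (hne : C.Nonempty)
    (hconn : ∀ x ∈ C, ∀ y ∈ C, Relation.ReflTransGen E x y)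
    (hcl : ∀ x ∈ C, ∀ y, E x y → y ∈ C) : ∃ c, ∀ x ∈ C, f x = c := by
  -- Maximum principle: at a maximizer the average over successors equals the maximum, so each
  -- successor of positive probability is a maximizer; this spreads along paths over all of `C`.
  obtain ⟨x0, hx0, hmax⟩ := Set.exists_max_image C f C.toFinite hne
  refine ⟨f x0, fun y hy => ?_⟩
  have hxy := hconn x0 hx0 y hy
  suffices y ∈ C ∧ f y = f x0 from this.2
  clear hy
  induction hxy with
  | refl => exact ⟨hx0, rfl⟩
  | @tail y z _ hyz ih =>
    obtain ⟨hy, hfy⟩ := ih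
    have hz := hcl y hy z hyz
    refine ⟨hz, ?_⟩
    obtain ⟨e, he, rfl⟩ := (hE y z).1 hyz
    by_contra hne
    have hlt : f (H.step y e) < f x0 := lt_of_le_of_ne (hmax _ hz) hne
    have h1 : ∑ e, M.edge y.2 e * f (H.step y e) < ∑ e, M.edge y.2 e * f x0 := by
      refine Finset.sum_lt_sum (fun e' _ => ?_) ⟨e, Finset.mem_univ _, mul_lt_mul_of_pos_left hlt he⟩
      rcases (M.edge_nonneg y.2 e').eq_or_lt with h0 | h0
      · rw [← h0, zero_mul, zero_mul]
      · exact mul_le_mul_of_nonneg_left (hmax _ (hcl y hy _ ((hE y _).2 ⟨e', h0, rfl⟩))) h0.le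
    rw [M.sum_edge_const, ← hf y, hfy] at h1
    exact lt_irrefl _ h1

variable {H D M} in
/-- The averages of payoffs per active step converge. -/
theorem Sound.tendsto_ratio {G : Set (Z × S)} (hs : H.Sound D M (H.liveSet D M) G)
    {ρ hρ η hη : Y × S → ℝ}
    (h1 : H.IsGain D M (H.liveSet D M) ρ hρ)
    (h2 : (H.aff 0 1).IsGain (D.withReward fun z l => 0 * D.reward z l) M (H.liveSet D M) η hη) :
    ∀ x ∈ H.liveSet D M, ∀ᵐ ω ∂M.pathFrom x.2, ∃ r c, 0 < c ∧
      (∀ᶠ n in atTop, ρ (H.pos n x ω) = r) ∧ (∀ᶠ n in atTop, η (H.pos n x ω) = c) ∧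
      Tendsto (fun n : ℕ => (∑ i ∈ Finset.range n,
        H.later (fun x ω => H.payoff D x.1 (wordOf ω)) i x ω) / n) atTop (nhds r) ∧
      Tendsto (fun n : ℕ => (∑ i ∈ Finset.range n,
        H.later (fun x ω => if H.active x.1 (ω 0).1 then (1 : ℝ) else 0) i x ω) / n)
        atTop (nhds c) := by
  intro x hx
  have hex : ∀ x, (D.withReward fun z l => 0 * D.reward z l).expectedTotal M x = 0 := fun x => by
    have h0 : ∀ z w, (D.withReward fun z l => 0 * D.reward z l).total z w = 0 := fun z w => by
      rw [RewardSystem.total_withReward, zero_mul]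
    simp only [RewardSystem.expectedTotal, h0, integral_zero]
  -- Live paths have infinitely many active steps, so the gain of active steps does not vanish. Its
  -- eventual value is a limit of frequencies and hence positive.
  have hne : ∀ x ∈ H.liveSet D M, η x ≠ 0 := by
    refine hs.closed.gain_ne_zero (h := hη) h2.harmonic (fun x hx => ?_) fun x hx => ?_
    · rw [h2.poisson x hx]
      refine Finset.sum_congr rfl fun e _ => ?_
      have hr : (H.aff 0 1).reward x.1 e.1 = 1 := by simp [Launcher.aff]
      rw [hex, add_zero, hr]
      rfl
    · exact Eventually.mono hx fun ω hω => hω.2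
  have hR : ∀ n, ∀ᵐ ω ∂M.pathFrom x.2, H.pos n x ω ∈ H.liveSet D M := fun n => by
    filter_upwards [hs.closed.ae_later (p := fun x _ => x ∈ H.liveSet D M)
      (fun x hx => ae_of_all _ fun _ => hx) n x hx] with ω hω
    rwa [later_eq] at hω
  filter_upwards [hs.tendsto_average h1 x hx, (hs.aff 0 1).tendsto_average h2 x hx,
    ae_all_iff.2 hR] with ω ⟨r, hr, hr'⟩ ⟨c, hc, hc'⟩ hω
  have hc'' : Tendsto (fun n : ℕ => (∑ i ∈ Finset.range n,
        H.later (fun x ω => if H.active x.1 (ω 0).1 then (1 : ℝ) else 0) i x ω) / n)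
        atTop (nhds c) := by
    refine hc'.congr fun n => ?_
    congr 1
    refine Finset.sum_congr rfl fun i _ => ?_
    rw [later_aff, later_eq, later_eq, payoff_aff]
    simp [wordOf]
  simp_rw [pos_aff] at hc
  refine ⟨r, c, ?_, hr, hc, hr', hc''⟩
  have hc0 : 0 ≤ c := ge_of_tendsto' hc'' fun n => by
    refine div_nonneg (Finset.sum_nonneg fun i _ => ?_) (Nat.cast_nonneg n)
    rw [later_eq]; split_ifs <;> simp
  obtain ⟨n, hn⟩ := hc.exists
  refine lt_of_le_of_ne hc0 fun h0 => hne _ (hω n) ?_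
  rw [hn, h0]

end Launcher

/-! ### Almost sure values of words, end SCCs, and the distribution as a gain. -/

namespace SlaveModel

variable {A S Q Z : Type} {k : ℕ} {P : Fin k → Type} {N : DetNWA A Q k P} {g : FinVal} {K : ℕ}
  (m : SlaveModel N g K Z)

/-- The sum of the payoffs divided by the number of active steps. -/
def ratio (w : ℕ → A) (n : ℕ) : ℝ :=
  (∑ i ∈ Finset.range n, m.payoffAt w i) /
    (∑ i ∈ Finset.range n, if m.isActive w i then (1 : ℝ) else 0)

/-- The accepting run is unique, so the infimum has a single term; its non-silent positions are the
active ones, and the sums of returned values are sums of payoffs. -/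
theorem value_eq {w : ℕ → A} (hw : ∃ len, N.IsAcceptingRun w len) {r : ℝ}
    (hr : Tendsto (m.ratio w) atTop (nhds r)) : N.value g w = (r : EReal) := by
  classical
  obtain ⟨len, hlen⟩ := hw
  have key : ∀ len', N.IsAcceptingRun w len' → len' = len := fun len' h' => by
    funext i
    exact (m.accepted_at (hlen.2.1 i)).2.2 _ (h'.2.1 i)
  have hval : N.value g w = silentLimAvg fun i => N.slaveValue g w i (len i) := by
    rw [DetNWA.value]
    refine le_antisymm (iInf₂_le len hlen) (le_iInf₂ fun len' h' => ?_)
    rw [key len' h']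
  rw [hval]
  have hsome : ∀ i, (N.slaveValue g w i (len i)).isSome = true ↔ m.isActive w i = true := by
    intro i
    rw [(m.accepted_at (hlen.2.1 i)).1, DetNWA.slaveValue]
    split_ifs with h
    · simp [h]
    · simp; omega
  refine silentLimAvg_eq ?_ (hr.congr fun n => ?_)
  · refine hlen.2.2.mono fun i hi => ?_
    rw [hsome, (m.accepted_at (hlen.2.1 i)).1]
    exact hi
  · rw [ratio]
    congr 1
    · refine Finset.sum_congr rfl fun i _ => ?_
      rw [DetNWA.slaveValue]
      split_ifs with h
      · have : ¬ m.isActive w i = true := by rw [(m.accepted_at (hlen.2.1 i)).1]; omega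
        have h2 : ¬ m.launcher.active (N.master.stateAt w i) (w (0 + i)) = true := by
          rw [zero_add]; exact this
        rw [payoffAt, Launcher.payoff, if_neg h2]
        simp
      · rw [((m.accepted_at (hlen.2.1 i)).2.1 (by omega)).2]
        simp
    · rw [Nat.count_eq_card_filter_range, Finset.card_eq_sum_ones, Nat.cast_sum,
        Finset.sum_filter]
      refine Finset.sum_congr rfl fun i _ => ?_
      by_cases h : m.isActive w i = true
      · rw [if_pos h, if_pos ((hsome i).2 h), Nat.cast_one]
      · rw [if_neg h, if_neg fun h' => h ((hsome i).1 h')]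

theorem stateAt_succ (w : ℕ → A) (i : ℕ) :
    N.master.stateAt w (i + 1) = N.master.next (N.master.stateAt w i) (w i) := by
  rw [DetAutomaton.stateAt, factor_snoc, DetAutomaton.stateAfter, List.foldl_append]
  rfl

variable [Fintype A] [Fintype S] [MeasurableSpace A]
  [MeasurableSpace S] [MeasurableSingletonClass S] [MeasurableSingletonClass A]
  (M : MarkovChain A S)

theorem pos_launcher (i : ℕ) (ω : ℕ → A × S) : m.launcher.pos i (N.master.init, M.init) ω =
    (N.master.stateAt (wordOf ω) i, M.chainState ω i) := by
  induction i with
  | zero => simp [Launcher.pos, Launcher.later, DetAutomaton.stateAt, factor,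
      DetAutomaton.stateAfter, MarkovChain.chainState]
  | succ i ih =>
    rw [Launcher.pos_succ, ih, stateAt_succ]
    rfl

theorem later_payoff (i : ℕ) (ω : ℕ → A × S) :
    m.launcher.later (fun x ω => m.launcher.payoff m.sys x.1 (wordOf ω)) i
      (N.master.init, M.init) ω = m.payoffAt (wordOf ω) i := by
  rw [Launcher.later_eq, pos_launcher]
  rfl

theorem later_active (i : ℕ) (ω : ℕ → A × S) :
    m.launcher.later (fun x ω => m.launcher.active x.1 (ω 0).1) i
      (N.master.init, M.init) ω = m.isActive (wordOf ω) i := by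
  rw [Launcher.later_eq, pos_launcher, isActive]
  simp [wordOf]

section Measurability

variable [Finite Q]

theorem measurableSet_stateAt (i : ℕ) : ∀ q, MeasurableSet {w : ℕ → A | N.master.stateAt w i = q} := by
  induction i with
  | zero => intro q; simp [DetAutomaton.stateAt, factor]
  | succ i ih =>
    intro q
    have : {w : ℕ → A | N.master.stateAt w (i + 1) = q} = ⋃ p : Q × A,
        ⋃ _ : N.master.next p.1 p.2 = q, {w | N.master.stateAt w i = p.1} ∩ {w | w i = p.2} := by
      ext w
      simp only [stateAt_succ, Set.mem_ofPred_eq, Set.mem_iUnion, Set.mem_inter_iff, Prod.exists]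
      constructor
      · exact fun h => ⟨_, _, h, rfl, rfl⟩
      · rintro ⟨q', a, h, rfl, rfl⟩; exact h
    rw [this]
    exact MeasurableSet.iUnion fun p => MeasurableSet.iUnion fun _ =>
      (ih p.1).inter (measurable_pi_apply i (measurableSet_singleton _))

theorem measurable_of_stateAt {E : Type} [MeasurableSpace E] (i : ℕ) {F : Q → (ℕ → A) → E}
    (hF : ∀ q, Measurable (F q)) : Measurable fun w => F (N.master.stateAt w i) w := by
  intro s hs
  have : (fun w => F (N.master.stateAt w i) w) ⁻¹' s =
      ⋃ q, {w | N.master.stateAt w i = q} ∩ F q ⁻¹' s := by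
    ext w; simp
  rw [this]
  exact MeasurableSet.iUnion fun q => (measurableSet_stateAt i q).inter (hF q hs)

theorem measurable_payoffAt (i : ℕ) : Measurable fun w => m.payoffAt w i := by
  refine measurable_of_stateAt i (F := fun q w => m.launcher.payoff m.sys q fun n => w (n + i))
    fun q => ?_
  have : Measurable (m.launcher.payoff m.sys q) := by
    refine measurable_first_tail (F := fun a w => if m.launcher.active q a then
      m.launcher.reward q a + m.sys.total (m.launcher.start q a) w else 0) fun a => ?_
    split_ifs
    · exact (RewardSystem.measurable_total _).const_add _
    · exact measurable_const
  exact this.comp (measurable_pi_lambda _ fun n => measurable_pi_apply (n + i))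

theorem measurable_isActive (i : ℕ) : Measurable fun w : ℕ → A => m.isActive w i :=
  measurable_of_stateAt i (F := fun q w => m.launcher.active q (w i)) fun q =>
    (measurable_of_countable (m.launcher.active q)).comp (measurable_pi_apply i)

theorem measurable_ratio (n : ℕ) : Measurable fun w : ℕ → A => m.ratio w n := by
  refine (Finset.measurable_sum _ fun i _ => m.measurable_payoffAt i).div
    (Finset.measurable_sum _ fun i _ => ?_)
  exact Measurable.ite (m.measurable_isActive i (measurableSet_singleton true)) measurable_const
    measurable_const

/-- The value is an infimum over all runs, whose measurability is not evident. It agrees almost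
surely with this limit superior, which replaces it when the distribution is moved to the space of
paths. -/
theorem measurable_limsup_ratio :
    Measurable fun w : ℕ → A => limsup (fun n => (m.ratio w n : EReal)) atTop :=
  Measurable.limsup fun n => (m.measurable_ratio n).coe_real_ereal

end Measurability

variable [Fintype Q] [Fintype Z]

/-- On a word with an accepting run all launched devices stop, and infinitely many nonempty factors
mean infinitely many active steps. -/
theorem init_mem_liveSet (hM : ∀ᵐ w ∂M.wordMeasure, ∃ len, N.IsAcceptingRun w len) :
    (N.master.init, M.init) ∈ m.launcher.liveSet m.sys M := by
  have h := ae_of_ae_map measurable_wordOf.aemeasurable hM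
  change ∀ᵐ ω ∂M.pathFrom M.init, _
  rw [M.pathFrom_init]
  filter_upwards [h] with ω ⟨len, hlen⟩
  constructor
  · intro i
    rw [Launcher.later_eq, pos_launcher]
    intro ha
    have ha' : m.isActive (wordOf ω) i = true := by
      have e : m.isActive (wordOf ω) i =
        m.launcher.active (N.master.stateAt (wordOf ω) i) (wordOf ω (0 + i)) := by
          rw [zero_add]; rfl
      rw [e]; exact ha
    have h0 := m.accepted_at (hlen.2.1 i)
    have h1 := (h0.2.1 (h0.1.1 ha')).1
    have e1 : (ω (0 + i)).1 = wordOf ω i := by rw [zero_add]; rfl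
    change m.sys.Terminates (m.launcher.start (N.master.stateAt (wordOf ω) i) (ω (0 + i)).1) _
    rw [e1]
    convert h1 using 1
    funext l
    simp only [wordOf, tailSeq]
    rw [add_assoc, add_comm 1 i]
  · refine hlen.2.2.mono fun i hi => ?_
    have h0 := (m.accepted_at (hlen.2.1 i)).1.2 hi
    rw [Launcher.later_eq, pos_launcher]
    have e : m.launcher.active (N.master.stateAt (wordOf ω) i) (wordOf ω (0 + i)) = true := by
      rw [zero_add]; exact h0
    exact e

/-- The value of almost all words is a ratio of gains. -/
theorem ae_value (hM : ∀ᵐ w ∂M.wordMeasure, ∃ len, N.IsAcceptingRun w len)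
    {ρ hρ η hη : Q × S → ℝ}
    (h1 : m.launcher.IsGain m.sys M (m.launcher.liveSet m.sys M) ρ hρ)
    (h2 : (m.launcher.aff 0 1).IsGain (m.sys.withReward fun z l => 0 * m.sys.reward z l) M
      (m.launcher.liveSet m.sys M) η hη) :
    ∀ᵐ ω ∂M.pathMeasure, ∃ r c, 0 < c ∧
      (∀ᶠ n in atTop, ρ (N.master.stateAt (wordOf ω) n, M.chainState ω n) = r) ∧
      (∀ᶠ n in atTop, η (N.master.stateAt (wordOf ω) n, M.chainState ω n) = c) ∧
      Tendsto (fun n : ℕ => (∑ i ∈ Finset.range n, m.payoffAt (wordOf ω) i) / n) atTop (nhds r) ∧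
      Tendsto (fun n : ℕ => (∑ i ∈ Finset.range n,
        if m.isActive (wordOf ω) i then (1 : ℝ) else 0) / n) atTop (nhds c) ∧
      Tendsto (m.ratio (wordOf ω)) atTop (nhds (r / c)) ∧
      N.value g (wordOf ω) = ((r / c : ℝ) : EReal) := by
  have h := ae_of_ae_map measurable_wordOf.aemeasurable hM
  have h3 := (m.launcher.sound_liveSet m.sys M).tendsto_ratio h1 h2 _ (m.init_mem_liveSet M hM)
  change ∀ᵐ ω ∂M.pathFrom M.init, _ at h3
  rw [M.pathFrom_init] at h3
  filter_upwards [h, h3] with ω hω ⟨r, c, hc, hr1, hc1, hr2, hc2⟩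
  simp_rw [pos_launcher] at hr1 hc1
  simp_rw [later_payoff] at hr2
  have hact : ∀ i, m.launcher.later (fun x ω => if m.launcher.active x.1 (ω 0).1 then (1 : ℝ) else 0) i
      (N.master.init, M.init) ω = if m.isActive (wordOf ω) i then (1 : ℝ) else 0 := fun i => by
    rw [← m.later_active M i ω, Launcher.later_eq, Launcher.later_eq]
  simp_rw [hact] at hc2
  have hratio : Tendsto (m.ratio (wordOf ω)) atTop (nhds (r / c)) := by
    refine (hr2.div hc2 hc.ne').congr' ?_
    filter_upwards [eventually_ge_atTop 1] with n hn
    have hn' : (n : ℝ) ≠ 0 := by positivity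
    simp only [Pi.div_apply, ratio]
    rw [div_div_div_cancel_right₀ hn']
  exact ⟨r, c, hc, hr1, hc1, hr2, hc2, hratio, m.value_eq hω hratio⟩

/-- The gains of payoffs and of active steps are harmonic, hence constant on an end SCC. Paths that
end up there have the quotient of these constants as value, so the value is almost surely constant
and equals its mean. -/
theorem integrable_value_and_ae_eq (m : SlaveModel N g K Z)
    (hM : ∀ᵐ w ∂M.wordMeasure, ∃ len, N.IsAcceptingRun w len)
    {C : Set (Q × S)} (hC : IsEndSCC N.master M C)
    (hpos : M.pathMeasure (endsIn N.master M C) ≠ 0) :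
    Integrable (fun ω => (N.value g (wordOf ω)).toReal)
        (ProbabilityTheory.cond M.pathMeasure (endsIn N.master M C)) ∧
      ∀ᵐ ω ∂(ProbabilityTheory.cond M.pathMeasure (endsIn N.master M C)),
        N.value g (wordOf ω) = ((∫ ω', (N.value g (wordOf ω')).toReal
            ∂(ProbabilityTheory.cond M.pathMeasure (endsIn N.master M C)) : ℝ) : EReal) := by
  obtain ⟨ρ, hρ, hρ', h1⟩ := m.launcher.exists_isGain m.sys M (m.launcher.liveSet m.sys M)
  obtain ⟨η, hη, hη', h2⟩ := (m.launcher.aff 0 1).exists_isGain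
    (m.sys.withReward fun z l => 0 * m.sys.reward z l) M (m.launcher.liveSet m.sys M)
  have hedge : ∀ x y : Q × S, ProductEdge N.master M x y ↔
      ∃ e, 0 < M.edge x.2 e ∧ m.launcher.step x e = y := by
    intro x y
    constructor
    · rintro ⟨a, ha, hp⟩
      exact ⟨(a, y.2), by unfold MarkovChain.edge; exact_mod_cast hp, Prod.ext ha rfl⟩
    · rintro ⟨e, he, rfl⟩
      exact ⟨e.1, rfl, by unfold MarkovChain.edge at he; exact_mod_cast he⟩
  obtain ⟨r, hr⟩ := m.launcher.harmonic_const M hρ' hedge hC.1 hC.2.1 hC.2.2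
  obtain ⟨c, hc⟩ := m.launcher.harmonic_const (f := η) M hη' hedge hC.1 hC.2.1 hC.2.2
  have hmeas : MeasurableSet (endsIn N.master M C) := by
    have : endsIn N.master M C = ⋃ n, ⋂ i ≥ n,
        {ω | m.launcher.pos i (N.master.init, M.init) ω ∈ C} := by
      ext ω; simp [endsIn, eventually_atTop, pos_launcher]
    rw [this]
    refine MeasurableSet.iUnion fun n => MeasurableSet.iInter fun i => MeasurableSet.iInter fun _ => ?_
    exact (m.launcher.measurable_pos_comp (fun x => x ∈ C) i (N.master.init, M.init)).setOf
  have hprob := ProbabilityTheory.cond_isProbabilityMeasure hpos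
  have hae : ∀ᵐ ω ∂(ProbabilityTheory.cond M.pathMeasure (endsIn N.master M C)),
      N.value g (wordOf ω) = ((r / c : ℝ) : EReal) := by
    filter_upwards [ProbabilityTheory.cond_absolutelyContinuous (m.ae_value M hM h1 h2),
      ProbabilityTheory.ae_cond_mem hmeas] with ω ⟨r', c', hc', hr1, hc1, _, _, _, hv⟩ hω
    obtain ⟨n, hn, hn1, hn2⟩ := (Eventually.and hω (hr1.and hc1)).exists
    rw [hv, ← hn1, ← hn2, hr _ hn, hc _ hn]
  have hae' : (fun ω => (N.value g (wordOf ω)).toReal) =ᵐ[ProbabilityTheory.cond M.pathMeasure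
      (endsIn N.master M C)] fun _ => r / c := by
    filter_upwards [hae] with ω hω
    rw [hω, EReal.toReal_coe]
  refine ⟨(integrable_congr hae').2 (integrable_const _), ?_⟩
  rw [integral_congr_ae hae']
  simpa using hae

set_option maxHeartbeats 1000000 in
/-- The cumulative distribution is a gain. -/
theorem measureReal_value_le (hM : ∀ᵐ w ∂M.wordMeasure, ∃ len, N.IsAcceptingRun w len)
    {lam num den : ℝ} (hden : 0 < den) (hlam : lam = num / den) {ν hν f hf : Q × S → ℝ}
    (h1 : (m.launcher.aff den (-num)).IsGain
      (m.sys.withReward fun z l => den * m.sys.reward z l) M (m.launcher.liveSet m.sys M) ν hν)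
    (h2 : ∀ x ∈ m.launcher.liveSet m.sys M,
      f x = ∑ e, M.edge x.2 e * f (m.launcher.step x e))
    (h3 : ∀ x ∈ m.launcher.liveSet m.sys M, f x + hf x =
      (if ν x ≤ 0 then 1 else 0) + ∑ e, M.edge x.2 e * hf (m.launcher.step x e)) :
    M.wordMeasure.real {w | N.value g w ≤ (lam : EReal)} = f (N.master.init, M.init) := by
  obtain ⟨ρ, hρ, -, hg1⟩ := m.launcher.exists_isGain m.sys M (m.launcher.liveSet m.sys M)
  obtain ⟨η, hη, -, hg2⟩ := (m.launcher.aff 0 1).exists_isGain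
    (m.sys.withReward fun z l => 0 * m.sys.reward z l) M (m.launcher.liveSet m.sys M)
  have hlive := m.init_mem_liveSet M hM
  have hsound := m.launcher.sound_liveSet m.sys M
  have hval := m.ae_value M hM hg1 hg2
  let φ : (ℕ → A) → EReal := fun w => limsup (fun n => (m.ratio w n : EReal)) atTop
  have hconv : ∀ᵐ w ∂M.wordMeasure, ∃ r, Tendsto (m.ratio w) atTop (nhds r) := by
    rw [MarkovChain.wordMeasure, ae_map_iff measurable_wordOf.aemeasurable
      (measurableSet_exists_tendsto fun n => m.measurable_ratio n)]
    filter_upwards [hval] with ω ⟨r, c, _, _, _, _, _, h, _⟩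
    exact ⟨_, h⟩
  have hφ : ∀ᵐ w ∂M.wordMeasure, N.value g w = φ w := by
    filter_upwards [hM, hconv] with w hw ⟨r, hr⟩
    rw [m.value_eq hw hr]
    exact (((continuous_coe_real_ereal.tendsto r).comp hr).limsup_eq).symm
  have e1 : M.wordMeasure.real {w | N.value g w ≤ (lam : EReal)} =
      M.wordMeasure.real {w | φ w ≤ (lam : EReal)} := by
    refine measureReal_congr ?_
    filter_upwards [hφ] with w hw
    exact propext (by change N.value g w ≤ _ ↔ φ w ≤ _; rw [hw])
  have e2 : M.wordMeasure.real {w | φ w ≤ (lam : EReal)} =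
      M.pathMeasure.real {ω | φ (wordOf ω) ≤ (lam : EReal)} := by
    have hms : MeasurableSet {w : ℕ → A | φ w ≤ (lam : EReal)} :=
      m.measurable_limsup_ratio (measurableSet_Iic (a := (lam : EReal)))
    rw [MarkovChain.wordMeasure, map_measureReal_apply measurable_wordOf hms]
    rfl
  have h4 := (hsound.aff den (-num)).tendsto_average h1 _ hlive
  change ∀ᵐ ω ∂M.pathFrom M.init, _ at h4
  rw [M.pathFrom_init] at h4
  have e3 : M.pathMeasure.real {ω | φ (wordOf ω) ≤ (lam : EReal)} =
      (M.pathFrom M.init).real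
        {ω | ∀ᶠ n in atTop, ν (m.launcher.pos n (N.master.init, M.init) ω) ≤ 0} := by
    rw [M.pathFrom_init]
    refine measureReal_congr ?_
    filter_upwards [hval, h4] with ω ⟨r, c, hc, _, _, hr2, hc2, h, _⟩ ⟨n0, hn0, hn0'⟩
    refine propext ?_
    change φ (wordOf ω) ≤ (lam : EReal) ↔ ∀ᶠ n in atTop, _
    have hφω : φ (wordOf ω) = ((r / c : ℝ) : EReal) :=
      ((continuous_coe_real_ereal.tendsto _).comp h).limsup_eq
    -- The average of the affine payoff is `den` times the average payoff minus `num` times the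
    -- frequency of active steps. As `c` and `den` are positive, its limit is nonpositive exactly
    -- when `r / c ≤ num / den`.
    have hn : n0 = den * r - num * c := by
      refine tendsto_nhds_unique hn0' (((hr2.const_mul den).sub (hc2.const_mul num)).congr fun n => ?_)
      rw [← mul_div_assoc, ← mul_div_assoc, ← sub_div, Finset.mul_sum, Finset.mul_sum,
        ← Finset.sum_sub_distrib]
      congr 1
      refine Finset.sum_congr rfl fun i _ => ?_
      rw [Launcher.later_aff, Launcher.later_eq, Launcher.payoff_aff, pos_launcher]
      have e5 : m.launcher.active (N.master.stateAt (wordOf ω) i)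
          (wordOf (fun n => ω (n + i)) 0) = m.isActive (wordOf ω) i := by
        simp [wordOf, isActive]
      simp only [e5]
      have e6 : m.launcher.payoff m.sys (N.master.stateAt (wordOf ω) i)
          (wordOf fun n => ω (n + i)) = m.payoffAt (wordOf ω) i := rfl
      rw [e6]; ring
    simp_rw [Launcher.pos_aff] at hn0
    rw [hφω, EReal.coe_le_coe_iff, hlam, div_le_div_iff₀ hc hden]
    constructor
    · intro hle
      filter_upwards [hn0] with n hn'
      rw [hn', hn]; linarith
    · intro hle
      obtain ⟨n, h5, h6⟩ := (hle.and hn0).exists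
      rw [h6, hn] at h5; linarith
  rw [e1, e2, e3]
  have h0 : ∀ x ∈ m.launcher.liveSet m.sys M,
      ν x = ∑ e, M.edge x.2 e * ν (m.launcher.step x e) := h1.harmonic
  have h5 := hsound.closed.measureReal_eventually_nonpos h0 h2 h3 (N.master.init, M.init) hlive
  exact h5

end SlaveModel


/-! ### Fraction-free elimination -/

open Matrix in
/-- The effect of the exchange of a column on Cramer's rule. -/
theorem det_mul_cramer_updateCol {n R : Type} [Fintype n] [DecidableEq n] [CommRing R] [IsDomain R]
    (B : Matrix n n R) (r : n) (a v : n → R) (hp : B.cramer a r ≠ 0) {i : n} (hi : i ≠ r) :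
    B.det * (B.updateCol r a).cramer v i =
      B.cramer a r * B.cramer v i - B.cramer a i * B.cramer v r := by
  set m := B.cramer a with hm
  set x := B.cramer v with hx
  have hdet : (B.updateCol r a).det = m r := by rw [hm, cramer_apply]
  -- Since `B x = det B • v` and `B m = det B • a`, this combination is mapped by the matrix with
  -- exchanged column to `(m r * det B) • v`.
  let y : n → R := m r • x - x r • m + (B.det * x r) • Pi.single r 1
  have hyr : y r = B.det * x r := by simp [y]; ring
  have hyi : y i = m r * x i - m i * x r := by
    simp [y, hi]
    ring
  have hB' : ∀ y : n → R, (B.updateCol r a) *ᵥ y = B *ᵥ y + y r • (a - fun k => B k r) := by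
    intro y
    funext k
    simp only [mulVec, dotProduct, updateCol_apply, Pi.add_apply, Pi.smul_apply, Pi.sub_apply,
      smul_eq_mul]
    rw [← Finset.add_sum_erase _ _ (Finset.mem_univ r),
      ← Finset.add_sum_erase Finset.univ (fun j => B k j * y j) (Finset.mem_univ r), if_pos rfl,
      Finset.sum_congr rfl fun j hj => by rw [if_neg (Finset.ne_of_mem_erase hj)]]
    ring
  have hBy : (B.updateCol r a) *ᵥ y = (m r * B.det) • v := by
    rw [hB', hyr]
    simp only [y, mulVec_add, mulVec_sub, mulVec_smul, hx, hm, mulVec_cramer]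
    rw [mulVec_single_one]
    funext k
    simp [Matrix.col]
    ring
  -- The determinant after the exchange is `m r`, which appears on both sides and is cancelled.
  have h := congrArg (fun u => (B.updateCol r a).adjugate *ᵥ u) hBy
  simp only [mulVec_mulVec, adjugate_mul, smul_mulVec, one_mulVec, mulVec_smul, hdet] at h
  have h2 := congrFun h i
  simp only [Pi.smul_apply, smul_eq_mul, hyi] at h2
  rw [cramer_eq_adjugate_mulVec, eq_comm]
  rw [mul_assoc] at h2
  exact mul_left_cancel₀ hp h2

/-- The state of the elimination: the transformed matrix, the column (plus one) for which a row
has been used as pivot row, and the last pivot. -/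
structure Elim where
  entry : ℕ → ℕ → ℤ
  used : ℕ → ℕ
  pivot : ℤ

namespace Elim

/-- Step `t` of the elimination, which deals with column `t / N` and row `t % N`. -/
def next (N t : ℕ) (s : Elim) : Elim :=
  if s.used (t % N) = 0 ∧ s.entry (t % N) (t / N) ≠ 0 then
    { entry := fun i j => if i = t % N then s.entry i j else
        (s.entry (t % N) (t / N) * s.entry i j - s.entry i (t / N) * s.entry (t % N) j) / s.pivot
      used := fun i => if i = t % N then t / N + 1 else s.used i
      pivot := s.entry (t % N) (t / N) }
  else s

/-- The state after `t` steps, for the matrix with entries `a i j`. -/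
def run (N : ℕ) (a : ℕ → ℕ → ℤ) : ℕ → Elim
  | 0 => ⟨a, fun _ => 0, 1⟩
  | t + 1 => (run N a t).next N t

variable {N : ℕ} {a : ℕ → ℕ → ℤ}

/-- A column of the matrix. -/
def column (N : ℕ) (a : ℕ → ℕ → ℤ) (j : ℕ) : Fin N → ℤ := fun i => a i j

/-- The matrix of the selected columns. -/
def basis (N : ℕ) (a : ℕ → ℕ → ℤ) (s : Elim) : Matrix (Fin N) (Fin N) ℤ := fun i r =>
  if s.used r = 0 then (1 : Matrix (Fin N) (Fin N) ℤ) i r else a i (s.used r - 1)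

/-- Gauss-Jordan elimination in Cramer form: the pivot is the determinant of the selected columns
(unit columns for unused rows), and the entries are the Cramer numerators of the original columns.
Positions are visited column by column, and an unused row is zero at all visited positions. -/
structure Inv (N : ℕ) (a : ℕ → ℕ → ℤ) (t : ℕ) (s : Elim) : Prop where
  pivot_eq : s.pivot = (s.basis N a).det
  pivot_ne : s.pivot ≠ 0
  entry_eq : ∀ (i : Fin N) j, s.entry i j = (s.basis N a).cramer (column N a j) i
  used_le : ∀ r, s.used r ≤ N
  entry_zero : ∀ r < N, s.used r = 0 → ∀ c, (c < t / N ∨ c = t / N ∧ r < t % N) → s.entry r c = 0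

/-- A pivot step exchanges one column of the basis, and `det_mul_cramer_updateCol` shows that the
division by the previous pivot is exact and yields the Cramer numerators of the new basis. -/
theorem Inv.next {t : ℕ} {s : Elim} (h : Inv N a t s) (ht : t < N * N) :
    Inv N a (t + 1) (s.next N t) := by
  have hN : 0 < N := Nat.pos_of_ne_zero (by rintro rfl; simp at ht)
  have hr : t % N < N := Nat.mod_lt _ hN
  have hc : t / N < N := Nat.div_lt_of_lt_mul ht
  -- Passing from `t` to `t + 1` adds exactly the position of row `t % N` and column `t / N`, also
  -- when a column is completed.
  have hstep : ∀ r < N, ∀ c, (c < (t + 1) / N ∨ c = (t + 1) / N ∧ r < (t + 1) % N) →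
      c < t / N ∨ c = t / N ∧ r ≤ t % N := by
    intro r hrN c h1
    have e1 := Nat.div_add_mod t N
    have e2 := Nat.div_add_mod (t + 1) N
    have h2 := Nat.mod_lt (t + 1) hN
    rcases lt_or_ge ((t + 1) / N) (t / N + 1) with h3 | h3
    · have h4 : (t + 1) / N = t / N := le_antisymm (by omega) (Nat.div_le_div_right (by omega))
      rw [h4] at e2 h1
      omega
    · have h4 : (t + 1) / N = t / N + 1 := by
        refine le_antisymm ?_ h3
        have : N * ((t + 1) / N) ≤ N * (t / N + 1) := by rw [mul_add]; omega
        exact Nat.le_of_mul_le_mul_left this hN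
      rw [h4, mul_add] at e2
      have : t % N = N - 1 := by omega
      omega
  unfold Elim.next
  split_ifs with hpiv
  · obtain ⟨hu, hp⟩ := hpiv
    set r : Fin N := ⟨t % N, hr⟩ with hrdef
    have hrv : (r : ℕ) = t % N := rfl
    set s' : Elim := { entry := fun i j => if i = t % N then s.entry i j else
        (s.entry (t % N) (t / N) * s.entry i j - s.entry i (t / N) * s.entry (t % N) j) / s.pivot
                       used := fun i => if i = t % N then t / N + 1 else s.used i
                       pivot := s.entry (t % N) (t / N) } with hs'
    have hB : s'.basis N a = (s.basis N a).updateCol r (column N a (t / N)) := by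
      funext i l
      rw [Matrix.updateCol_apply]
      by_cases hl : l = r
      · subst hl
        simp [basis, hs', hrv, column]
      · have : ¬ (l : ℕ) = t % N := fun h => hl (Fin.ext h)
        simp [basis, hs', this, hl]
    have hpc : s.entry (t % N) (t / N) = (s.basis N a).cramer (column N a (t / N)) r :=
      h.entry_eq r _
    have hp' : (s.basis N a).cramer (column N a (t / N)) r ≠ 0 := hpc ▸ hp
    refine ⟨?_, hp, fun i j => ?_, fun l => ?_, fun l hl hlu c hlc => ?_⟩
    · rw [hB, ← Matrix.cramer_apply, ← hpc]
    · change (if (i : ℕ) = t % N then s.entry i j else _) = _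
      rw [hB]
      split_ifs with hi
      · have : i = r := Fin.ext hi
        subst this
        rw [h.entry_eq, Matrix.cramer_apply, Matrix.cramer_apply, Matrix.updateCol_idem]
      · have hi' : i ≠ r := fun h => hi (congrArg Fin.val h)
        have := det_mul_cramer_updateCol (s.basis N a) r (column N a (t / N)) (column N a j) hp' hi'
        rw [hpc, h.entry_eq i, h.entry_eq i, show s.entry (t % N) j = _ from h.entry_eq r j, ← this,
          h.pivot_eq, Int.mul_ediv_cancel_left]
        rw [← h.pivot_eq]; exact h.pivot_ne
    · change (if l = t % N then t / N + 1 else s.used l) ≤ N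
      split_ifs
      · omega
      · exact h.used_le l
    · change (if l = t % N then s.entry l c else _) = 0
      have hl' : ¬ l = t % N := by
        intro h'
        have : s'.used l = t / N + 1 := if_pos h'
        exact absurd (this.symm.trans hlu) (Nat.succ_ne_zero _)
      rw [if_neg hl']
      have hlu' : s.used l = 0 := by
        have : s'.used l = s.used l := if_neg hl'
        rw [← this]; exact hlu
      rcases hstep l hl c hlc with h1 | ⟨rfl, h1⟩
      · rw [h.entry_zero l hl hlu' c (Or.inl h1), h.entry_zero (t % N) hr hu c (Or.inl h1)]
        simp
      -- In the pivot column the two cross products coincide.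
      · rw [mul_comm, sub_self, Int.zero_ediv]
  · refine ⟨h.pivot_eq, h.pivot_ne, h.entry_eq, h.used_le, fun l hl hlu c hlc => ?_⟩
    rcases hstep l hl c hlc with h1 | ⟨rfl, h1⟩
    · exact h.entry_zero l hl hlu c (Or.inl h1)
    · rcases h1.lt_or_eq with h2 | h2
      · exact h.entry_zero l hl hlu _ (Or.inr ⟨rfl, h2⟩)
      · subst h2
        by_contra h3
        exact hpiv ⟨hlu, h3⟩

theorem inv_run (t : ℕ) (ht : t ≤ N * N) : Inv N a t (run N a t) := by
  induction t with
  | zero =>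
    have hB : (run N a 0).basis N a = 1 := by
      funext i r
      simp [basis, run]
    refine ⟨?_, one_ne_zero, fun i j => ?_, fun _ => Nat.zero_le _, fun r _ _ c hc => ?_⟩
    · rw [hB, Matrix.det_one]; rfl
    · rw [hB, Matrix.cramer_one]; rfl
    · simp at hc
  | succ t ih => exact (ih (by omega)).next (by omega)

/-- The entries of the transformed matrices are minors. -/
theorem abs_entry_run_le {b : ℤ} (hb1 : 1 ≤ b) {t : ℕ} (ht : t ≤ N * N) {m : ℕ} (hm : N ≤ m)
    (hb : ∀ i < N, ∀ j < m, |a i j| ≤ b) {i j : ℕ} (hi : i < N) (hj : j < m) :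
    |(run N a t).entry i j| ≤ N.factorial * b ^ N := by
  have h := inv_run (a := a) t ht
  have h1 := h.entry_eq ⟨i, hi⟩ j
  simp only at h1
  rw [h1, Matrix.cramer_apply]
  have := Matrix.det_le (R := ℤ) (S := ℤ) (abv := AbsoluteValue.abs) (x := b)
    (A := ((run N a t).basis N a).updateCol ⟨i, hi⟩ (column N a j)) fun k l => by
      change |_| ≤ b
      rw [Matrix.updateCol_apply]
      split_ifs
      · exact hb k k.2 j hj
      · rw [basis]
        split_ifs with h0
        · rw [Matrix.one_apply]
          split_ifs <;> simp <;> omega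
        · exact hb k k.2 _ (by have := h.used_le l; omega)
  simpa [nsmul_eq_mul] using this

theorem abs_pivot_run_le {b : ℤ} (hb1 : 1 ≤ b) {t : ℕ} (ht : t ≤ N * N)
    (hb : ∀ i < N, ∀ j < N, |a i j| ≤ b) :
    |(run N a t).pivot| ≤ N.factorial * b ^ N := by
  have h := inv_run (a := a) t ht
  rw [h.pivot_eq]
  have := Matrix.det_le (R := ℤ) (S := ℤ) (abv := AbsoluteValue.abs) (x := b)
    (A := (run N a t).basis N a) fun k l => by
      change |_| ≤ b
      rw [basis]
      split_ifs with h0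
      · rw [Matrix.one_apply]
        split_ifs <;> simp <;> omega
      · exact hb k k.2 _ (by have := h.used_le l; omega)
  simpa [nsmul_eq_mul] using this

/-- The matrix is extended by the unit matrix. -/
def extend (N : ℕ) (a : ℕ → ℕ → ℤ) (i j : ℕ) : ℤ :=
  if j < N then a i j else if j = N + i then 1 else 0

/-- The elimination solves consistent systems of linear equations. -/
theorem solves (b : ℕ → ℝ)
    (hx : ∃ x : ℕ → ℝ, ∀ i < N, ∑ c ∈ Finset.range N, (a i c : ℝ) * x c = b i) {s : Elim}
    (hs : s = run N (extend N a) (N * N)) : ∀ i < N,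
    ∑ c ∈ Finset.range N, (a i c : ℝ) * ((∑ r ∈ Finset.range N, if s.used r = c + 1 then
      ∑ k ∈ Finset.range N, (s.entry r (N + k) : ℝ) * b k else 0) / (s.pivot : ℝ)) = b i := by
  intro i hi
  have hN : 0 < N := by omega
  have h := inv_run (N := N) (a := extend N a) (N * N) le_rfl
  rw [← hs] at h
  obtain ⟨x, hx⟩ := hx
  set B := s.basis N (extend N a) with hB
  -- The appended unit columns are transformed into the adjugate of the basis matrix.
  have hP : ∀ r k : Fin N, s.entry r (N + k) = B.adjugate r k := fun r k => by
    rw [h.entry_eq, Matrix.cramer_eq_adjugate_mulVec, Matrix.mulVec, dotProduct,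
      Finset.sum_eq_single k]
    · simp [column, extend, hB]
    · intro l _ hl
      have : ¬ ((k : ℕ) = l) := fun h' => hl (Fin.ext h'.symm)
      simp [column, extend, this]
    · simp
  have hM : ∀ (r : Fin N) (c : ℕ), c < N → s.entry r c = ∑ k : Fin N, B.adjugate r k * a k c := by
    intro r c hc
    rw [h.entry_eq, Matrix.cramer_eq_adjugate_mulVec, Matrix.mulVec, dotProduct]
    simp [column, extend, hc, hB]
  have hdR : (s.pivot : ℝ) ≠ 0 := by exact_mod_cast h.pivot_ne
  have hnn : N * N / N = N := Nat.mul_div_cancel _ hN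
  let y : Fin N → ℝ := fun r => ∑ k : Fin N, (B.adjugate r k : ℝ) * b k
  -- Consistency enters here: `b` is a combination of the columns of the matrix, and after the
  -- elimination an unused row is zero in all of them.
  have hy0 : ∀ r : Fin N, s.used r = 0 → y r = 0 := by
    intro r hr
    have : ∀ c < N, s.entry r c = 0 := fun c hc => h.entry_zero r r.2 hr c (by rw [hnn]; exact Or.inl hc)
    have e : y r = ∑ c ∈ Finset.range N, (s.entry r c : ℝ) * x c := by
      simp only [y]
      calc ∑ k : Fin N, (B.adjugate r k : ℝ) * b k
          = ∑ k : Fin N, ∑ c ∈ Finset.range N, (B.adjugate r k : ℝ) * ((a k c : ℝ) * x c) := by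
            refine Finset.sum_congr rfl fun k _ => ?_
            rw [← hx k k.2, Finset.mul_sum]
        _ = _ := by
            rw [Finset.sum_comm]
            refine Finset.sum_congr rfl fun c hc => ?_
            rw [hM r c (Finset.mem_range.1 hc)]
            push_cast
            rw [Finset.sum_mul]
            exact Finset.sum_congr rfl fun k _ => by ring
    rw [e]
    exact Finset.sum_eq_zero fun c hc => by rw [this c (Finset.mem_range.1 hc)]; simp
  -- This is `B * adj B = det B`. By `hy0` the unit columns of `B` contribute nothing, so only
  -- columns of the original matrix remain; unselected unknowns are set to `0`.
  have hBy : ∑ r : Fin N, (B ⟨i, hi⟩ r : ℝ) * y r = s.pivot * b i := by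
    simp only [y, Finset.mul_sum]
    rw [Finset.sum_comm]
    have e : ∀ k : Fin N, ∑ r : Fin N, (B ⟨i, hi⟩ r : ℝ) * ((B.adjugate r k : ℝ) * b k) =
        if k = ⟨i, hi⟩ then (s.pivot : ℝ) * b i else 0 := by
      intro k
      have h1 := congrFun (congrFun (Matrix.mul_adjugate B) ⟨i, hi⟩) k
      rw [Matrix.mul_apply, Matrix.smul_apply, Matrix.one_apply, ← h.pivot_eq, smul_eq_mul] at h1
      have h2 := congrArg (fun z : ℤ => (z : ℝ) * b k) h1
      simp only [Int.cast_sum, Int.cast_mul, Finset.sum_mul] at h2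
      simp only [← mul_assoc]
      rw [h2]
      by_cases hk : k = ⟨i, hi⟩
      · subst hk; simp
      · rw [if_neg hk, if_neg (Ne.symm hk)]; simp
    rw [Finset.sum_congr rfl fun k _ => e k, Finset.sum_ite_eq' Finset.univ, if_pos (Finset.mem_univ _)]
  have e1 : ∀ r : ℕ, r < N → ∑ k ∈ Finset.range N, (s.entry r (N + k) : ℝ) * b k =
      if hr : r < N then y ⟨r, hr⟩ else 0 := by
    intro r hr
    rw [dif_pos hr, Finset.sum_range]
    exact Finset.sum_congr rfl fun k _ => by rw [← hP ⟨r, hr⟩ k]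
  have e2 : ∑ c ∈ Finset.range N, (a i c : ℝ) * ((∑ r ∈ Finset.range N, if s.used r = c + 1 then
      ∑ k ∈ Finset.range N, (s.entry r (N + k) : ℝ) * b k else 0) / (s.pivot : ℝ)) =
      (∑ r : Fin N, (B ⟨i, hi⟩ r : ℝ) * y r) / s.pivot := by
    simp_rw [← mul_div_assoc]
    rw [← Finset.sum_div]
    congr 1
    simp_rw [Finset.mul_sum]
    rw [Finset.sum_comm, Finset.sum_range]
    refine Finset.sum_congr rfl fun r _ => ?_
    rw [Finset.sum_congr rfl fun c _ => by rw [e1 r r.2, dif_pos r.2]]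
    by_cases hu : s.used r = 0
    · rw [hy0 r hu, mul_zero]
      refine Finset.sum_eq_zero fun c _ => ?_
      simp
    · have hle := h.used_le r
      rw [Finset.sum_eq_single (s.used r - 1)]
      · rw [if_pos (by omega)]
        congr 2
        rw [hB, basis, if_neg hu, extend, if_pos (by omega)]
      · intro c _ hc
        rw [if_neg (by omega), mul_zero]
      · intro h'
        exact absurd (Finset.mem_range.2 (by omega)) h'
  rw [e2, hBy, mul_div_assoc, mul_comm, div_mul_cancel₀ _ hdR]

end Elim


/-! ### Polynomial bounds -/

/-- `f` is bounded by a polynomial in `sz`. -/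
def PolyBounded {X : Type} (sz f : X → ℕ) : Prop := ∃ p : Polynomial ℕ, ∀ x, f x ≤ p.eval (sz x)

namespace PolyBounded

variable {X : Type} {sz f g : X → ℕ}

theorem const (c : ℕ) : PolyBounded sz fun _ => c := ⟨Polynomial.C c, fun x => by simp⟩

theorem size : PolyBounded sz sz := ⟨Polynomial.X, fun x => by simp⟩

theorem mono (hg : PolyBounded sz g) (h : ∀ x, f x ≤ g x) : PolyBounded sz f := by
  obtain ⟨p, hp⟩ := hg
  exact ⟨p, fun x => (h x).trans (hp x)⟩

theorem add (hf : PolyBounded sz f) (hg : PolyBounded sz g) :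
    PolyBounded sz fun x => f x + g x := by
  obtain ⟨p, hp⟩ := hf
  obtain ⟨q, hq⟩ := hg
  exact ⟨p + q, fun x => by rw [Polynomial.eval_add]; exact add_le_add (hp x) (hq x)⟩

theorem mul (hf : PolyBounded sz f) (hg : PolyBounded sz g) :
    PolyBounded sz fun x => f x * g x := by
  obtain ⟨p, hp⟩ := hf
  obtain ⟨q, hq⟩ := hg
  exact ⟨p * q, fun x => by rw [Polynomial.eval_mul]; exact Nat.mul_le_mul (hp x) (hq x)⟩

end PolyBounded

/-! ### The length of integers -/

theorem bitLength_le_iff {z : ℤ} {n : ℕ} : bitLength z ≤ n ↔ |z| < 2 ^ n := by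
  rw [bitLength, Nat.size_le, Int.abs_eq_natAbs]
  exact_mod_cast Iff.rfl

theorem abs_lt_two_pow_bitLength (z : ℤ) : |z| < 2 ^ bitLength z := bitLength_le_iff.1 le_rfl

theorem bitLength_mono {y z : ℤ} (h : |y| ≤ |z|) : bitLength y ≤ bitLength z :=
  bitLength_le_iff.2 (h.trans_lt (abs_lt_two_pow_bitLength z))

theorem bitLength_le_natAbs (z : ℤ) : bitLength z ≤ z.natAbs := by
  rw [bitLength, Nat.size_le]
  exact Nat.lt_two_pow_self

theorem bitLength_zero : bitLength 0 = 0 := by simp [bitLength]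

theorem bitLength_mul_le (y z : ℤ) : bitLength (y * z) ≤ bitLength y + bitLength z := by
  rw [bitLength_le_iff, abs_mul, pow_add]
  exact mul_lt_mul'' (abs_lt_two_pow_bitLength y) (abs_lt_two_pow_bitLength z) (abs_nonneg _)
    (abs_nonneg _)

theorem bitLength_add_le (y z : ℤ) : bitLength (y + z) ≤ bitLength y + bitLength z + 1 := by
  rw [bitLength_le_iff]
  have h1 : (2 : ℤ) ^ bitLength y ≤ 2 ^ (bitLength y + bitLength z) :=
    pow_le_pow_right₀ (by norm_num) (by omega)
  have h2 : (2 : ℤ) ^ bitLength z ≤ 2 ^ (bitLength y + bitLength z) :=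
    pow_le_pow_right₀ (by norm_num) (by omega)
  have := abs_add_le y z
  rw [pow_succ]
  linarith [abs_lt_two_pow_bitLength y, abs_lt_two_pow_bitLength z]

theorem bitLength_neg (z : ℤ) : bitLength (-z) = bitLength z := by simp [bitLength]

theorem bitLength_sub_le (y z : ℤ) : bitLength (y - z) ≤ bitLength y + bitLength z + 1 := by
  rw [sub_eq_add_neg, ← bitLength_neg z]
  exact bitLength_add_le _ _

theorem bitLength_div_le (y z : ℤ) : bitLength (y / z) ≤ bitLength y := by
  refine bitLength_mono ?_
  rw [Int.abs_eq_natAbs, Int.abs_eq_natAbs]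
  exact_mod_cast Int.natAbs_ediv_le_natAbs y z

/-! ### Expressions -/

namespace RamExpr

instance : Add RamExpr := ⟨.add⟩
instance : Sub RamExpr := ⟨.sub⟩
instance : Mul RamExpr := ⟨.mul⟩
instance : Div RamExpr := ⟨.div⟩
instance {n : ℕ} : OfNat RamExpr n := ⟨.const n⟩

/-- The names of the arrays that occur. -/
def arrays : RamExpr → List ℕ
  | .const _ => []
  | .read a i => a :: i.arrays
  | .add e f => e.arrays ++ f.arrays
  | .sub e f => e.arrays ++ f.arrays
  | .mul e f => e.arrays ++ f.arrays
  | .div e f => e.arrays ++ f.arrays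

theorem eval_congr {σ τ : Store} (e : RamExpr) (h : ∀ a ∈ e.arrays, σ a = τ a) :
    e.eval σ = e.eval τ := by
  induction e with
  | const z => rfl
  | read a i ih =>
    simp only [arrays, List.mem_cons] at h
    simp only [eval]
    rw [ih fun b hb => h b (Or.inr hb), h a (Or.inl rfl)]
  | add e f he hf | sub e f he hf | mul e f he hf | div e f he hf =>
    simp only [arrays, List.mem_append] at h
    simp only [eval]
    rw [he fun b hb => h b (Or.inl hb), hf fun b hb => h b (Or.inr hb)]

/-- For a fixed expression the cost is linear in the bit length of the memory; the length of the
value has to be carried along for the induction. -/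
theorem exists_cost_le (e : RamExpr) : ∃ c : ℕ, ∀ (σ : Store) (n : ℕ),
    (∀ a i, bitLength (σ a i) ≤ n) → e.cost σ ≤ c * (n + 1) ∧ bitLength (e.eval σ) ≤ c * (n + 1) := by
  induction e with
  | const z =>
    refine ⟨1 + bitLength z, fun σ n _ => ⟨?_, ?_⟩⟩
    · exact Nat.le_mul_of_pos_right _ (by omega)
    · exact le_trans (by simp only [eval]; omega) (Nat.le_mul_of_pos_right _ (by omega))
  | read a i ih =>
    obtain ⟨c, hc⟩ := ih
    refine ⟨c + 1, fun σ n h => ?_⟩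
    have h1 := (hc σ n h).1
    have h2 := h a (i.eval σ)
    simp only [cost, eval]
    constructor <;> nlinarith
  | add e f he hf =>
    obtain ⟨c, hc⟩ := he
    obtain ⟨d, hd⟩ := hf
    refine ⟨2 * (c + d + 1), fun σ n h => ?_⟩
    have := bitLength_add_le (e.eval σ) (f.eval σ)
    have h1 := hc σ n h
    have h2 := hd σ n h
    simp only [cost, eval]
    constructor <;> nlinarith
  | sub e f he hf =>
    obtain ⟨c, hc⟩ := he
    obtain ⟨d, hd⟩ := hf
    refine ⟨2 * (c + d + 1), fun σ n h => ?_⟩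
    have := bitLength_sub_le (e.eval σ) (f.eval σ)
    have h1 := hc σ n h
    have h2 := hd σ n h
    simp only [cost, eval]
    constructor <;> nlinarith
  | mul e f he hf =>
    obtain ⟨c, hc⟩ := he
    obtain ⟨d, hd⟩ := hf
    refine ⟨2 * (c + d + 1), fun σ n h => ?_⟩
    have := bitLength_mul_le (e.eval σ) (f.eval σ)
    have h1 := hc σ n h
    have h2 := hd σ n h
    simp only [cost, eval]
    constructor <;> nlinarith
  | div e f he hf =>
    obtain ⟨c, hc⟩ := he
    obtain ⟨d, hd⟩ := hf
    refine ⟨2 * (c + d + 1), fun σ n h => ?_⟩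
    have := bitLength_div_le (e.eval σ) (f.eval σ)
    have h1 := hc σ n h
    have h2 := hd σ n h
    simp only [cost, eval]
    constructor <;> nlinarith

/-- The value of the counter. -/
def ctr : RamExpr := .read 1 0

/-- `1` if the values are equal, and otherwise `0`. -/
def eqE (e f : RamExpr) : RamExpr := 1 / (1 + (e - f) * (e - f))

/-- `1` if the first value is less than the second value, and otherwise `0`. -/
def ltE (e f : RamExpr) : RamExpr := 0 - (e - f) / ((e - f) * (e - f) + 1)

/-- The value of `e` if the value of `c` is `1`, the value of `f` if the value of `c` is `0`. -/
def iteE (c e f : RamExpr) : RamExpr := c * e + (1 - c) * f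

/-- The remainder. -/
def modE (e f : RamExpr) : RamExpr := e - f * (e / f)

variable (σ : Store) (e f : RamExpr)

@[simp] theorem eval_add : (e + f).eval σ = e.eval σ + f.eval σ := rfl
@[simp] theorem eval_sub : (e - f).eval σ = e.eval σ - f.eval σ := rfl
@[simp] theorem eval_mul : (e * f).eval σ = e.eval σ * f.eval σ := rfl
@[simp] theorem eval_div : (e / f).eval σ = e.eval σ / f.eval σ := rfl
@[simp] theorem eval_zero : (0 : RamExpr).eval σ = 0 := rfl
@[simp] theorem eval_one : (1 : RamExpr).eval σ = 1 := rfl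
@[simp] theorem eval_two : (2 : RamExpr).eval σ = 2 := rfl
@[simp] theorem eval_three : (3 : RamExpr).eval σ = 3 := rfl
@[simp] theorem eval_four : (4 : RamExpr).eval σ = 4 := rfl
@[simp] theorem eval_five : (5 : RamExpr).eval σ = 5 := rfl
@[simp] theorem eval_six : (6 : RamExpr).eval σ = 6 := rfl

@[simp] theorem eval_modE : (modE e f).eval σ = e.eval σ % f.eval σ := by
  rw [modE, eval_sub, eval_mul, eval_div, Int.emod_def]

@[simp] theorem eval_eqE : (eqE e f).eval σ = if e.eval σ = f.eval σ then 1 else 0 := by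
  simp only [eqE, eval_div, eval_add, eval_one, eval_mul, eval_sub]
  split_ifs with h
  · simp [h]
  · have : e.eval σ - f.eval σ ≠ 0 := sub_ne_zero.2 h
    have : 0 < (e.eval σ - f.eval σ) * (e.eval σ - f.eval σ) := mul_self_pos.2 this
    exact Int.ediv_eq_zero_of_lt (by norm_num) (by omega)

@[simp] theorem eval_ltE : (ltE e f).eval σ = if e.eval σ < f.eval σ then 1 else 0 := by
  simp only [ltE, eval_div, eval_add, eval_one, eval_mul, eval_sub, eval_zero]
  generalize hz : e.eval σ - f.eval σ = z
  split_ifs with h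
  -- Integer division rounds down, so the quotient is `-1` for negative `z` and `0` otherwise.
  · have : z / (z * z + 1) = -1 := by
      rw [Int.ediv_eq_iff_of_pos (by nlinarith [mul_self_nonneg z])]
      constructor <;> nlinarith
    omega
  · have : z / (z * z + 1) = 0 := Int.ediv_eq_zero_of_lt (by omega) (by nlinarith)
    omega

theorem eval_iteE (c : RamExpr) {p : Prop} [Decidable p] (hc : c.eval σ = if p then 1 else 0) :
    (iteE c e f).eval σ = if p then e.eval σ else f.eval σ := by
  simp only [iteE, eval_add, eval_mul, eval_sub, eval_one, hc]
  split_ifs <;> ring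

@[simp] theorem eval_iteE_eqE (c d : RamExpr) : (iteE (eqE c d) e f).eval σ =
    if c.eval σ = d.eval σ then e.eval σ else f.eval σ := eval_iteE σ e f _ (eval_eqE σ c d)

@[simp] theorem eval_iteE_ltE (c d : RamExpr) : (iteE (ltE c d) e f).eval σ =
    if c.eval σ < d.eval σ then e.eval σ else f.eval σ := eval_iteE σ e f _ (eval_ltE σ c d)

end RamExpr

open RamExpr

/-! ### Programs that fill arrays one after the other -/

/-- The memory with counter `t` and arrays `σ`. -/
def memory (σ : Store) (t : ℤ) : Store := fun a j => if a = 1 then (if j = 0 then t else 0) else σ a j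

@[simp] theorem eval_ctr (σ : Store) (t : ℤ) : ctr.eval (memory σ t) = t := by
  simp [ctr, RamExpr.eval, memory]

theorem eval_read {a : ℕ} (ha : a ≠ 1) (i : RamExpr) (σ : Store) (t : ℤ) :
    (RamExpr.read a i).eval (memory σ t) = σ a (i.eval (memory σ t)) := by
  simp [RamExpr.eval, memory, ha]

/-- A loop that fills an array: the number of cells, and the value of the cell whose address is
given by the counter. -/
structure Stage where
  size : RamExpr
  val : RamExpr

namespace Stage

/-- The loop that fills the array `m`. -/
def code (s : Stage) (m : ℕ) : RamProg :=
  .seq (.loop (s.size - ctr) (.seq (.write m ctr s.val) (.write 1 0 (ctr + 1)))) (.write 1 0 0)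

/-- The contents of the array `m` after `t` steps. -/
def part (s : Stage) (m : ℕ) (σ : Store) : ℕ → ℤ → ℤ
  | 0 => fun _ => 0
  | t + 1 => Function.update (s.part m σ t) t
      (s.val.eval (memory (Function.update σ m (s.part m σ t)) t))

/-- The number of cells that are filled. -/
def count (s : Stage) (σ : Store) : ℕ := (s.size.eval σ).toNat

/-- The memory after the loop. -/
def result (s : Stage) (m : ℕ) (σ : Store) : Store :=
  Function.update σ m (s.part m σ (s.count σ))

/-- Step `t` writes only cell `t`: earlier cells are final and later ones are still `0`. Bounds on
the final array therefore hold throughout the loop. -/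
theorem part_eq_of_le (s : Stage) (m : ℕ) (σ : Store) {t n : ℕ} (h : t ≤ n) (i : ℤ) :
    s.part m σ t i = if i < t then s.part m σ n i else 0 := by
  induction n, h using Nat.le_induction with
  | base =>
    split_ifs with hi
    · rfl
    · induction t with
      | zero => rfl
      | succ t ih =>
        rw [part, Function.update_of_ne (by push_cast at hi; omega)]
        exact ih (by push_cast at hi; omega)
  | succ n hn ih =>
    rw [ih]
    split_ifs with hi
    · rw [part, Function.update_of_ne (by omega)]
    · rfl

/-- Bounds for the length of the values in the memory. -/
theorem exists_exec (s : Stage) : ∃ c : ℕ, ∀ (m : ℕ) (σ : Store) (n : ℕ), m ≠ 1 → m ∉ s.size.arrays →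
    1 ∉ s.size.arrays → σ 1 = 0 → σ m = 0 → (∀ a i, bitLength (σ a i) ≤ n) →
    (∀ i, bitLength (s.part m σ (s.count σ) i) ≤ n) → s.count σ ≤ n →
    ∃ t ≤ c * (n + 1) * (n + 1), Exec (s.code m) σ (s.result m σ) t := by
  obtain ⟨c1, hc1⟩ := exists_cost_le (s.size - ctr)
  obtain ⟨c2, hc2⟩ := exists_cost_le s.val
  obtain ⟨c3, hc3⟩ := exists_cost_le ctr
  obtain ⟨c4, hc4⟩ := exists_cost_le (ctr + 1)
  obtain ⟨c5, hc5⟩ := exists_cost_le (0 : RamExpr)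
  set d := c1 + c2 + c3 + c4 + 2 * c5 + 10 with hd
  refine ⟨2 * d, fun m σ n hm hs1 hs2 hσ1 hσm hσ hp hn => ?_⟩
  set N := s.count σ with hN
  -- The loop invariant: the memory after `t` iterations.
  let st : ℕ → Store := fun t => memory (Function.update σ m (s.part m σ t)) t
  have hst : ∀ t ≤ N, ∀ a i, bitLength (st t a i) ≤ n := by
    intro t ht a i
    simp only [st, memory]
    split_ifs
    · exact (bitLength_le_natAbs _).trans (by simpa using ht.trans hn)
    · simp [bitLength_zero]
    · by_cases ham : a = m
      · subst ham
        rw [Function.update_self, s.part_eq_of_le _ σ ht]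
        split_ifs
        · exact hp i
        · simp [bitLength_zero]
      · rw [Function.update_of_ne ham]; exact hσ a i
  have hsize : ∀ t, s.size.eval (st t) = s.size.eval σ := fun t => by
    refine eval_congr _ fun a ha => ?_
    have h1 : a ≠ 1 := by rintro rfl; exact hs2 ha
    have h2 : a ≠ m := by rintro rfl; exact hs1 ha
    funext i
    simp [st, memory, h1, h2]
  have hguard : ∀ t, (s.size - ctr).eval (st t) = s.size.eval σ - t := fun t => by
    rw [eval_sub, hsize]
    simp only [st, eval_ctr]
  have hloop : ∀ l t, t + l = N → ∃ T ≤ (l + 1) * (d * (n + 1)),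
      Exec (.loop (s.size - ctr) (.seq (.write m ctr s.val) (.write 1 0 (ctr + 1)))) (st t) (st N) T := by
    intro l
    induction l with
    | zero =>
      intro t ht
      obtain ht : t = N := by omega
      have hle := (hc1 _ n (hst t ht.le)).1
      rw [← ht]
      refine ⟨_, ?_, Exec.loop_stop ?_⟩
      · nlinarith
      · rw [hguard]
        have : N = (s.size.eval σ).toNat := rfl
        omega
    | succ l ih =>
      intro t ht
      obtain ⟨T, hT, hE⟩ := ih (t + 1) (by omega)
      have hpos : 0 < (s.size - ctr).eval (st t) := by
        rw [hguard]
        have : N = (s.size.eval σ).toNat := rfl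
        omega
      have e1 := Exec.write (st t) m ctr s.val
      set τ := Function.update (st t) m (Function.update (st t m) (ctr.eval (st t)) (s.val.eval (st t)))
        with hτ
      have hτ' : τ = memory (Function.update σ m (s.part m σ (t + 1))) t := by
        funext a i
        by_cases ham : a = m
        · subst ham
          have hmem : st t a = s.part a σ t := by funext i; simp [st, memory, hm]
          rw [hτ, Function.update_self, hmem]
          simp only [memory, if_neg hm, Function.update_self, part, st, eval_ctr]
        · simp only [hτ, memory, Function.update_of_ne ham, st]
      have hctr : ctr.eval τ = t := by rw [hτ', eval_ctr]
      have e2 := Exec.write τ 1 0 (ctr + 1)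
      have hτ2 : Function.update τ 1 (Function.update (τ 1) ((0 : RamExpr).eval τ) ((ctr + 1).eval τ))
          = st (t + 1) := by
        funext a i
        by_cases ha1 : a = 1
        · subst ha1
          simp only [Function.update_self, eval_zero, eval_add, eval_one, hctr, st, memory, if_true]
          by_cases hi : i = 0
          · subst hi; simp
          · simp [hi, hτ', memory]
        · simp only [Function.update_of_ne ha1, hτ', st, memory, if_neg ha1]
      rw [hτ2] at e2
      have hτn : ∀ a i, bitLength (τ a i) ≤ n := by
        intro a i
        by_cases ha1 : a = 1
        · have : τ a i = st t a i := by
            subst ha1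
            rw [hτ', memory, if_pos rfl]
            simp [st, memory]
          rw [this]; exact hst t (by omega) a i
        · have : τ a i = st (t + 1) a i := by rw [hτ']; simp [st, memory, ha1]
          rw [this]; exact hst (t + 1) (by omega) a i
      refine ⟨_, ?_, Exec.loop_step hpos (Exec.seq e1 e2) hE⟩
      have h1 := (hc1 _ n (hst t (by omega))).1
      have h2 := (hc2 _ n (hst t (by omega))).1
      have h3 := (hc3 _ n (hst t (by omega))).1
      have h4 := (hc4 _ n hτn).1
      have h5 := (hc5 _ n hτn).1
      have : d * (n + 1) = c1 * (n + 1) + c2 * (n + 1) + c3 * (n + 1) + c4 * (n + 1) +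
        2 * (c5 * (n + 1)) + 10 * (n + 1) := by rw [hd]; ring
      have h6 : (l + 1 + 1) * (d * (n + 1)) = (l + 1) * (d * (n + 1)) + d * (n + 1) := by ring
      omega
  obtain ⟨T, hT, hE⟩ := hloop N 0 (by omega)
  have h0 : st 0 = σ := by
    funext a i
    simp only [st, memory]
    split_ifs with h1 h2
    · subst h1; rw [hσ1]; simp
    · subst h1; rw [hσ1]; simp
    · by_cases ham : a = m
      · subst ham; rw [Function.update_self, hσm]; rfl
      · rw [Function.update_of_ne ham]
  rw [h0] at hE
  have e3 := Exec.write (st N) 1 0 0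
  have hfin : Function.update (st N) 1 (Function.update (st N 1) ((0 : RamExpr).eval (st N))
      ((0 : RamExpr).eval (st N))) = s.result m σ := by
    funext a i
    by_cases ha1 : a = 1
    · subst ha1
      rw [Function.update_self, result, Function.update_of_ne (Ne.symm hm), hσ1]
      by_cases hi : i = 0
      · subst hi; simp
      · simp [hi, st, memory]
    · simp [ha1, st, memory, result, hN]
  rw [hfin] at e3
  refine ⟨_, ?_, Exec.seq hE e3⟩
  have h5 := (hc5 _ n (hst N le_rfl)).1
  have h6 : d * (n + 1) ≥ 2 * (c5 * (n + 1)) + 10 * (n + 1) := by rw [hd]; nlinarith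
  have h7 : (N + 1) * (d * (n + 1)) ≤ (n + 1) * (d * (n + 1)) := Nat.mul_le_mul_right _ (by omega)
  have h8 : d * (n + 1) ≤ (n + 1) * (d * (n + 1)) := Nat.le_mul_of_pos_left _ (by omega)
  have h9 : 2 * d * (n + 1) * (n + 1) = 2 * ((n + 1) * (d * (n + 1))) := by ring
  omega

end Stage

/-- The memories before the stages; stage `i` fills the array `i + 2`. -/
def stores (P : ℕ → Stage) (σ : Store) : ℕ → Store
  | 0 => σ
  | i + 1 => (P i).result (i + 2) (stores P σ i)

/-- The program that consists of the first stages. -/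
def stagesCode (P : ℕ → Stage) : ℕ → RamProg
  | 0 => .skip
  | i + 1 => .seq (stagesCode P i) ((P i).code (i + 2))

/-- The final contents of the arrays. -/
def arr (P : ℕ → Stage) (σ : Store) : Store := fun a => stores P σ a a

/-- A stage changes only its own array and leaves the counter reset to `0`, so all arrays below `i +
2` are final before stage `i`. This lets programs be described by their final arrays alone. -/
theorem stores_eq_arr (P : ℕ → Stage) (σ : Store) {i a : ℕ} (h : a < i + 2) :
    stores P σ i a = arr P σ a := by
  have key : ∀ i, a < i + 2 → stores P σ (i + 1) a = stores P σ i a := fun i hi => by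
    rw [stores, Stage.result, Function.update_of_ne (by omega)]
  rcases Nat.lt_or_ge i a with hi | hi
  · obtain rfl : a = i + 1 := by omega
    exact (key i (by omega)).symm
  · induction i, hi using Nat.le_induction with
    | base => rfl
    | succ i hi ih => rw [key i (by omega), ih (by omega)]

theorem stores_eq_init (P : ℕ → Stage) (σ : Store) {i a : ℕ} (h : i + 2 ≤ a ∨ a ≤ 1) :
    stores P σ i a = σ a := by
  induction i with
  | zero => rfl
  | succ i ih => rw [stores, Stage.result, Function.update_of_ne (by omega), ih (by omega)]

/-- The number of cells of array `i + 2`. -/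
def cells (P : ℕ → Stage) (σ : Store) (i : ℕ) : ℕ := ((P i).size.eval (arr P σ)).toNat

theorem count_eq_cells {P : ℕ → Stage} {σ : Store} {i : ℕ}
    (hs : ∀ a ∈ (P i).size.arrays, a < i + 2) : (P i).count (stores P σ i) = cells P σ i := by
  rw [Stage.count, cells, eval_congr _ fun a ha => stores_eq_arr P σ (hs a ha)]

theorem arr_stage {P : ℕ → Stage} {σ : Store} {i : ℕ}
    (hs : ∀ a ∈ (P i).size.arrays, a < i + 2) :
    arr P σ (i + 2) = (P i).part (i + 2) (stores P σ i) (cells P σ i) := by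
  rw [← stores_eq_arr P σ (i := i + 1) (a := i + 2) (by omega), stores, Stage.result,
    Function.update_self, count_eq_cells hs]

/-- The values in an array that is filled by a stage which may read the cells filled before. -/
theorem arr_eq_of_scan {P : ℕ → Stage} {σ : Store} {i : ℕ}
    (hs : ∀ a ∈ (P i).size.arrays, a < i + 2) (hv : ∀ a ∈ (P i).val.arrays, a < i + 3) {F : ℤ → ℤ}
    (hF : ∀ t : ℕ, t < cells P σ i → (P i).val.eval (memory (Function.update (arr P σ) (i + 2)
      fun j : ℤ => if 0 ≤ j ∧ j < (t : ℤ) then F j else 0) t) = F t) (j : ℤ) :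
    arr P σ (i + 2) j = if 0 ≤ j ∧ j < cells P σ i then F j else 0 := by
  rw [arr_stage hs]
  have : ∀ t ≤ cells P σ i, (P i).part (i + 2) (stores P σ i) t =
      fun j : ℤ => if 0 ≤ j ∧ j < (t : ℤ) then F j else 0 := by
    intro t ht
    induction t with
    | zero =>
      funext j
      simp only [Stage.part]
      split_ifs <;> first | rfl | omega
    | succ t ih =>
      rw [Stage.part, ih (by omega)]
      have e : (P i).val.eval (memory (Function.update (stores P σ i) (i + 2)
          fun j : ℤ => if 0 ≤ j ∧ j < (t : ℤ) then F j else 0) t) = F t := by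
        rw [← hF t (by omega)]
        refine eval_congr _ fun a ha => ?_
        funext j
        simp only [memory]
        split_ifs
        · rfl
        · rfl
        · by_cases h : a = i + 2
          · subst h; simp
          · rw [Function.update_of_ne h, Function.update_of_ne h,
              stores_eq_arr P σ (by have := hv a ha; omega)]
      rw [e]
      funext j
      by_cases hj : j = t
      · subst hj
        rw [Function.update_self, if_pos ⟨by omega, by push_cast; omega⟩]
      · rw [Function.update_of_ne hj]
        by_cases h1 : 0 ≤ j ∧ j < t
        · rw [if_pos h1, if_pos ⟨h1.1, by push_cast; omega⟩]
        · rw [if_neg h1, if_neg (by push_cast; omega)]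
  rw [this _ le_rfl]

/-- The values in an array that is filled by a stage which does not read this array. -/
theorem arr_eq_of_fill {P : ℕ → Stage} {σ : Store} {i : ℕ}
    (hs : ∀ a ∈ (P i).size.arrays, a < i + 2) (hv : ∀ a ∈ (P i).val.arrays, a < i + 2) (j : ℤ) :
    arr P σ (i + 2) j =
      if 0 ≤ j ∧ j < cells P σ i then (P i).val.eval (memory (arr P σ) j) else 0 := by
  refine arr_eq_of_scan hs (fun a ha => (hv a ha).trans (by omega))
    (F := fun j => (P i).val.eval (memory (arr P σ) j)) (fun t _ => ?_) j
  refine eval_congr _ fun a ha => ?_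
  funext j
  simp only [memory]
  rw [Function.update_of_ne (by have := hv a ha; omega)]

section PolyTime

variable {X : Type} {sz : X → ℕ} {P : ℕ → Stage} {σ : X → Store}

/-- The length of the values in the memory is bounded by a polynomial. -/
def ShortStore (sz : X → ℕ) (σ : X → Store) : Prop :=
  ∃ n, PolyBounded sz n ∧ ∀ x a i, bitLength (σ x a i) ≤ n x

/-- The length of the values of an expression for all values of the counter up to a bound. -/
theorem ShortStore.eval_memory {i : ℕ} (h : ShortStore sz fun x => stores P (σ x) i) {e : RamExpr}
    (he : ∀ a ∈ e.arrays, a < i + 2) {N : X → ℕ} (hN : PolyBounded sz N) :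
    ∃ n, PolyBounded sz n ∧ ∀ x (t : ℤ), 0 ≤ t → t ≤ N x →
      bitLength (e.eval (memory (arr P (σ x)) t)) ≤ n x := by
  obtain ⟨n, hn, h⟩ := h
  obtain ⟨c, hc⟩ := exists_cost_le e
  refine ⟨fun x => c * (n x + N x + 1), (PolyBounded.const c).mul ((hn.add hN).add
    (PolyBounded.const 1)), fun x t h0 ht => ?_⟩
  have e1 : e.eval (memory (arr P (σ x)) t) = e.eval (memory (stores P (σ x) i) t) := by
    refine eval_congr _ fun a ha => ?_
    funext j
    simp only [memory, stores_eq_arr P (σ x) (he a ha)]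
  rw [e1]
  refine (hc _ _ fun a j => ?_).2
  simp only [memory]
  split_ifs
  · refine (bitLength_le_natAbs _).trans ?_
    omega
  · simp [bitLength_zero]
  · exact (h x a j).trans (by omega)

/-- The length of the numbers in the array `a` is bounded by a polynomial. -/
def ShortArray (sz : X → ℕ) (P : ℕ → Stage) (σ : X → Store) (a : ℕ) : Prop :=
  ∃ n, PolyBounded sz n ∧ ∀ x i, bitLength (arr P (σ x) a i) ≤ n x

theorem shortArray_of_fill {i : ℕ} (h : ShortStore sz fun x => stores P (σ x) i)
    (hs : ∀ a ∈ (P i).size.arrays, a < i + 2) (hv : ∀ a ∈ (P i).val.arrays, a < i + 2)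
    (hN : PolyBounded sz fun x => cells P (σ x) i) : ShortArray sz P σ (i + 2) := by
  obtain ⟨n, hn, h⟩ := h.eval_memory hv hN
  refine ⟨n, hn, fun x j => ?_⟩
  rw [arr_eq_of_fill hs hv]
  split_ifs with hj
  · exact h x j hj.1 hj.2.le
  · simp [bitLength_zero]

theorem ShortStore.next {i : ℕ} (h : ShortStore sz fun x => stores P (σ x) i)
    (hA : ShortArray sz P σ (i + 2)) : ShortStore sz fun x => stores P (σ x) (i + 1) := by
  obtain ⟨n, hn, h⟩ := h
  obtain ⟨l, hl, hA⟩ := hA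
  refine ⟨fun x => n x + l x, hn.add hl, fun x a j => ?_⟩
  dsimp only
  by_cases ha : a = i + 2
  · subst ha
    rw [stores_eq_arr P (σ x) (by omega)]
    exact (hA x j).trans (Nat.le_add_left _ _)
  · have : stores P (σ x) (i + 1) a = stores P (σ x) i a := by
      rw [stores, Stage.result, Function.update_of_ne ha]
    rw [this]
    exact (h x a j).trans (Nat.le_add_right _ _)

/-- The first `n` stages run in polynomial time and keep all numbers short. -/
def RunsTo (sz : X → ℕ) (P : ℕ → Stage) (σ : X → Store) (n : ℕ) : Prop :=
  ShortStore sz (fun x => stores P (σ x) n) ∧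
  ∃ T, PolyBounded sz T ∧ ∀ x, ∃ t ≤ T x, Exec (stagesCode P n) (σ x) (stores P (σ x) n) t

/-- The cost of a stage is polynomial in its number of cells and in the bit lengths before and after
it. So only the size and the lengths of the new array need a bound. -/
theorem RunsTo.next {i : ℕ} (h : RunsTo sz P σ i) (h0 : ∀ x a, 0 < a → σ x a = 0)
    (hs : ∀ a ∈ (P i).size.arrays, a < i + 2 ∧ a ≠ 1)
    (hN : PolyBounded sz fun x => cells P (σ x) i) (hA : ShortArray sz P σ (i + 2)) :
    RunsTo sz P σ (i + 1) := by
  have hs' : ∀ a ∈ (P i).size.arrays, a < i + 2 := fun a ha => (hs a ha).1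
  obtain ⟨h1, T, hT, hE⟩ := h
  refine ⟨h1.next hA, ?_⟩
  obtain ⟨n, hn, h1⟩ := h1
  obtain ⟨l, hl, hA⟩ := hA
  obtain ⟨c, hc⟩ := (P i).exists_exec
  let b : X → ℕ := fun x => n x + l x + cells P (σ x) i
  have hb : PolyBounded sz b := (hn.add hl).add hN
  have hb1 : PolyBounded sz fun x => b x + 1 := hb.add (PolyBounded.const 1)
  refine ⟨fun x => T x + c * (b x + 1) * (b x + 1) + 1,
    (hT.add (((PolyBounded.const c).mul hb1).mul hb1)).add (PolyBounded.const 1), fun x => ?_⟩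
  obtain ⟨t1, ht1, hE1⟩ := hE x
  obtain ⟨t2, ht2, hE2⟩ := hc (i + 2) (stores P (σ x) i) (b x) (by omega)
    (fun h => absurd (hs _ h).1 (lt_irrefl _)) (fun h => (hs _ h).2 rfl)
    (by rw [stores_eq_init P _ (Or.inr le_rfl)]; exact h0 x 1 one_pos)
    (by rw [stores_eq_init P _ (Or.inl le_rfl)]; exact h0 x _ (by omega))
    (fun a j => (h1 x a j).trans (by simp only [b]; omega))
    (fun j => by
      rw [count_eq_cells hs', ← arr_stage hs']
      exact (hA x j).trans (by simp only [b]; omega))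
    (by rw [count_eq_cells hs']; simp only [b]; omega)
  exact ⟨_, by dsimp only; omega, Exec.seq hE1 hE2⟩

end PolyTime


open RamExpr

/-! ### Stages that compute sums -/

theorem bitLength_sum_le {n : ℕ} (m : ℕ) {f : ℕ → ℤ} (hf : ∀ l < m, bitLength (f l) ≤ n) :
    bitLength (∑ l ∈ Finset.range m, f l) ≤ m + n := by
  rw [bitLength_le_iff]
  have h1 : |∑ l ∈ Finset.range m, f l| ≤ m * 2 ^ n := by
    refine (Finset.abs_sum_le_sum_abs _ _).trans ?_
    have := Finset.sum_le_card_nsmul (Finset.range m) (fun l => |f l|) (2 ^ n) fun l hl =>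
      (bitLength_le_iff.1 (hf l (Finset.mem_range.1 hl))).le
    simpa using this
  have h2 : (m : ℤ) < 2 ^ m := by exact_mod_cast Nat.lt_two_pow_self
  rw [pow_add]
  exact h1.trans_lt (mul_lt_mul_of_pos_right h2 (by positivity))

theorem bitLength_prod_le {n : ℕ} (m : ℕ) {f : ℕ → ℤ} (hf : ∀ l < m, bitLength (f l) ≤ n) :
    bitLength (∏ l ∈ Finset.range m, f l) ≤ m * n + 1 := by
  induction m with
  | zero => simp [bitLength]
  | succ m ih =>
    rw [Finset.prod_range_succ]
    have h1 := ih fun l hl => hf l (by omega)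
    have h2 := bitLength_mul_le (∏ l ∈ Finset.range m, f l) (f m)
    have h3 := hf m (by omega)
    rw [add_mul]
    omega

/-- The array `m` holds the partial sums of the values of `e` over blocks of length `w`. -/
def sumE (m : ℕ) (w e : RamExpr) : RamExpr :=
  iteE (eqE (modE ctr w) 0) 0 (.read m (ctr - 1)) + e

/-- The sum of the values of `e` up to address `t` in the block of `t`. -/
def blockSum (w : ℕ) (e : ℤ → ℤ) (t : ℤ) : ℤ :=
  ∑ l ∈ Finset.range ((t % w).toNat + 1), e (t - l)

theorem blockSum_last {w : ℕ} (hw : 0 < w) (e : ℤ → ℤ) (a : ℕ) :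
    blockSum w e (a * w + (w - 1)) = ∑ l ∈ Finset.range w, e (a * w + l) := by
  have h1 : ((a : ℤ) * w + (w - 1)) % w = w - 1 := by
    rw [add_comm, Int.add_mul_emod_self_right]
    exact Int.emod_eq_of_lt (by omega) (by omega)
  rw [blockSum, h1, show ((w : ℤ) - 1).toNat + 1 = w by omega,
    ← Finset.sum_range_reflect (fun l => e (a * w + l))]
  refine Finset.sum_congr rfl fun l hl => ?_
  have := Finset.mem_range.1 hl
  congr 1
  omega

section

variable {P : ℕ → Stage} {i : ℕ} {w e : RamExpr}

/-- Each cell adds its own term to the preceding cell, except at the start of a block, where the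
running sum begins anew. -/
theorem arr_eq_blockSum {σ : Store} (hs : ∀ a ∈ (P i).size.arrays, a < i + 2)
    (hval : (P i).val = sumE (i + 2) w e) (hw : ∀ a ∈ w.arrays, a < i + 2)
    (hw1 : 1 ∉ w.arrays) (he : ∀ a ∈ e.arrays, a < i + 2) {m : ℕ} (hm : 0 < m)
    (hwm : w.eval (arr P σ) = m) (j : ℤ) :
    arr P σ (i + 2) j = if 0 ≤ j ∧ j < cells P σ i then
      blockSum m (fun t => e.eval (memory (arr P σ) t)) j else 0 := by
  refine arr_eq_of_scan hs ?_ ?_ j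
  · intro a ha
    rw [hval] at ha
    simp only [sumE, iteE, eqE, modE, ctr, arrays, HAdd.hAdd, Add.add, HMul.hMul, Mul.mul, HSub.hSub,
      Sub.sub, HDiv.hDiv, Div.div, OfNat.ofNat, List.mem_append, List.mem_cons, List.not_mem_nil,
      or_false, false_or] at ha
    have h1 := hw a
    have h2 := he a
    change a < i.succ.succ.succ
    have h3 : a = i.succ.succ → a < i.succ.succ.succ := by omega
    change a ∈ w.arrays → a < i.succ.succ at h1
    change a ∈ e.arrays → a < i.succ.succ at h2
    have h4 : a = 1 → a < i.succ.succ.succ := by omega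
    have h5 : a < i.succ.succ → a < i.succ.succ.succ := by omega
    change _ at ha
    tauto
  · intro t ht
    rw [hval]
    set f : ℤ → ℤ := fun j => if 0 ≤ j ∧ j < (t : ℤ) then
      blockSum m (fun t => e.eval (memory (arr P σ) t)) j else 0 with hf
    have e1 : w.eval (memory (Function.update (arr P σ) (i + 2) f) t) = m := by
      rw [← hwm]
      refine eval_congr _ fun a ha => ?_
      have h1 : a ≠ 1 := fun h => hw1 (h ▸ ha)
      have h2 : a ≠ i + 2 := by have := hw a ha; omega
      funext l
      simp [memory, h1, h2]
    have e2 : e.eval (memory (Function.update (arr P σ) (i + 2) f) t) =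
        e.eval (memory (arr P σ) t) := by
      refine eval_congr _ fun a ha => ?_
      have h2 : a ≠ i + 2 := by have := he a ha; omega
      funext l
      simp [memory, h2]
    rw [sumE, eval_add, e2, eval_iteE_eqE, eval_modE, e1, eval_ctr, eval_zero,
      eval_read (by omega), Function.update_self, eval_sub, eval_ctr, eval_one]
    have h0 : (0 : ℤ) ≤ t % m := Int.emod_nonneg _ (by omega)
    have h1 : (t : ℤ) % m < m := Int.emod_lt_of_pos _ (by omega)
    split_ifs with hz
    · rw [blockSum, hz]
      simp
    · have ht0 : t ≠ 0 := by rintro rfl; simp at hz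
      have e3 : ((t : ℤ) - 1) % m = t % m - 1 := by
        rw [show (t : ℤ) - 1 = (t % m - 1) + m * (t / m) by
            have := Int.emod_add_mul_ediv t m; omega,
          Int.add_mul_emod_self_left, Int.emod_eq_of_lt (by omega) (by omega)]
      rw [hf]
      simp only
      rw [if_pos ⟨by omega, by omega⟩, blockSum, blockSum, e3,
        show ((t : ℤ) % m - 1).toNat + 1 = ((t : ℤ) % m).toNat by omega,
        Finset.sum_range_succ' _ ((t : ℤ) % m).toNat]
      simp only [Nat.cast_zero, sub_zero]
      congr 1
      refine Finset.sum_congr rfl fun l _ => ?_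
      congr 2
      push_cast
      ring

/-- The last cells of the blocks hold the sums over the blocks. -/
theorem arr_sum {σ : Store} (hs : ∀ a ∈ (P i).size.arrays, a < i + 2)
    (hval : (P i).val = sumE (i + 2) w e) (hw : ∀ a ∈ w.arrays, a < i + 2)
    (hw1 : 1 ∉ w.arrays) (he : ∀ a ∈ e.arrays, a < i + 2) {m n : ℕ} (hm : 0 < m)
    (hwm : w.eval (arr P σ) = m) (hn : cells P σ i = n * m) {a : ℕ} (ha : a < n) :
    arr P σ (i + 2) (a * m + (m - 1)) =
      ∑ l ∈ Finset.range m, e.eval (memory (arr P σ) (a * m + l)) := by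
  rw [arr_eq_blockSum hs hval hw hw1 he hm hwm, if_pos, blockSum_last hm]
  rw [hn]
  have : (a + 1) * m ≤ n * m := Nat.mul_le_mul_right _ ha
  rw [add_mul, one_mul] at this
  constructor
  · have := Int.natCast_nonneg (a * m)
    push_cast at *
    omega
  · have : ((a * m + m : ℕ) : ℤ) ≤ (n * m : ℕ) := by exact_mod_cast this
    push_cast at *
    omega

theorem shortArray_of_sum {X : Type} {sz : X → ℕ} {σ : X → Store}
    (h : ShortStore sz fun x => stores P (σ x) i)
    (hs : ∀ a ∈ (P i).size.arrays, a < i + 2)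
    (hval : (P i).val = sumE (i + 2) w e) (hw : ∀ a ∈ w.arrays, a < i + 2)
    (hw1 : 1 ∉ w.arrays) (he : ∀ a ∈ e.arrays, a < i + 2) {m : X → ℕ} (hm : ∀ x, 0 < m x)
    (hwm : ∀ x, w.eval (arr P (σ x)) = m x)
    (hN : PolyBounded sz fun x => cells P (σ x) i) : ShortArray sz P σ (i + 2) := by
  obtain ⟨n, hn, h⟩ := h.eval_memory he hN
  refine ⟨fun x => cells P (σ x) i + n x, hN.add hn, fun x j => ?_⟩
  rw [arr_eq_blockSum hs hval hw hw1 he (hm x) (hwm x)]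
  split_ifs with hj
  · have h0 : 0 ≤ j % (m x) := Int.emod_nonneg _ (by have := hm x; omega)
    have h1 : j % (m x) ≤ j := by
      have h2 := Int.emod_add_mul_ediv j (m x)
      have h3 : 0 ≤ (m x : ℤ) * (j / m x) :=
        mul_nonneg (by omega) (Int.ediv_nonneg hj.1 (by omega))
      omega
    refine (bitLength_sum_le (n := n x) _ fun l hl => ?_).trans (by dsimp only; omega)
    exact h x _ (by omega) (by omega)
  · simp [bitLength_zero]

end

/-! ### Addresses in lists -/

/-- The list `s` occurs in the list `l` at position `n`. -/
def OccursAt {α : Type} (l : List α) (n : ℕ) (s : List α) : Prop := s <+: l.drop n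

namespace OccursAt

variable {α : Type} {l s t : List α} {n : ℕ}

theorem refl (l : List α) : OccursAt l 0 l := by simp [OccursAt]

theorem left (h : OccursAt l n (s ++ t)) : OccursAt l n s := (List.prefix_append s t).trans h

theorem right {m : ℕ} (h : OccursAt l n (s ++ t)) (hm : m = n + s.length) : OccursAt l m t := by
  obtain ⟨r, hr⟩ := h
  refine ⟨r, ?_⟩
  rw [hm, ← List.drop_drop, ← hr, List.append_assoc, List.drop_left]

theorem getElem? {x : α} (h : OccursAt l n (x :: s)) : l[n]? = some x := by
  obtain ⟨r, hr⟩ := h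
  have := congrArg (fun l => l[0]?) hr
  simpa using this.symm

theorem tail {x : α} (h : OccursAt l n (x :: s)) : OccursAt l (n + 1) s :=
  right (s := [x]) h rfl

theorem length_le (h : OccursAt l n s) : s.length ≤ l.length - n := by
  have := List.IsPrefix.length_le h
  rwa [List.length_drop] at this

theorem mem {m : ℕ} (h : OccursAt l n s) (h1 : n ≤ m) (h2 : m < n + s.length) :
    ∃ x ∈ s, l[m]? = some x := by
  obtain ⟨r, hr⟩ := h
  have h3 : m - n < s.length := by omega
  refine ⟨s[m - n], List.getElem_mem _, ?_⟩
  have := congrArg (fun l => l[m - n]?) hr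
  simp only [List.getElem?_drop, List.getElem?_append_left h3] at this
  rw [show n + (m - n) = m by omega] at this
  rw [← this, List.getElem?_eq_getElem h3]

/-- The lengths are a function on all natural numbers, so offsets are sums over `Finset.range` and
shift easily in the induction. -/
theorem flatMap {k : ℕ} {f : Fin k → List α} {len : ℕ → ℕ} (hf : ∀ i, (f i).length = len i)
    (h : OccursAt l n ((List.finRange k).flatMap f)) (j : Fin k) :
    OccursAt l (n + ∑ i ∈ Finset.range j, len i) (f j) := by
  induction k generalizing n len with
  | zero => exact j.elim0
  | succ k ih =>
    rw [List.finRange_succ, List.flatMap_cons, List.flatMap_map] at h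
    cases j using Fin.cases with
    | zero => simpa using h.left
    | succ j =>
      have := ih (f := fun i => f i.succ) (len := fun i => len (i + 1)) (fun i => hf i.succ)
        (h.right rfl) j
      rw [Fin.val_succ, Finset.sum_range_succ', add_comm (∑ _ ∈ _, _), ← add_assoc]
      have h0 : (f 0).length = len 0 := hf 0
      rwa [h0] at this

theorem flatMap_const {k : ℕ} {f : Fin k → List α} {m : ℕ} (hf : ∀ i, (f i).length = m)
    (h : OccursAt l n ((List.finRange k).flatMap f)) (j : Fin k) :
    OccursAt l (n + j * m) (f j) := by
  simpa using h.flatMap (len := fun _ => m) hf j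

end OccursAt

theorem length_flatMap_finRange {α : Type} {k : ℕ} {f : Fin k → List α} {len : ℕ → ℕ}
    (hf : ∀ i, (f i).length = len i) :
    ((List.finRange k).flatMap f).length = ∑ i ∈ Finset.range k, len i := by
  rw [List.length_flatMap, Finset.sum_range, ← List.ofFn_eq_map, List.sum_ofFn]
  exact Finset.sum_congr rfl fun i _ => hf i

theorem length_flatMap_finRange_const {α : Type} {k : ℕ} {f : Fin k → List α} {m : ℕ}
    (hf : ∀ i, (f i).length = m) : ((List.finRange k).flatMap f).length = k * m := by
  rw [length_flatMap_finRange (len := fun _ => m) hf]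
  simp

theorem inputStore_eq {l : List InputNumber} {n : ℕ} {x : InputNumber} (h : l[n]? = some x) :
    inputStore l 0 n = x.val := by
  simp [inputStore, h]

theorem inputStore_mem (l : List InputNumber) (i : ℤ) :
    inputStore l 0 i = 0 ∨ ∃ x ∈ l, inputStore l 0 i = x.val := by
  by_cases hi : 0 ≤ i
  · rcases h : l[i.toNat]? with _ | x
    · left; simp [inputStore, h]
    · right
      refine ⟨x, List.mem_of_getElem? h, ?_⟩
      simp [inputStore, h, hi]
  · left; simp [inputStore, hi]

theorem InputNumber.size_le {l : List InputNumber} {x : InputNumber} (h : x ∈ l) :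
    x.size ≤ (l.map InputNumber.size).sum :=
  List.single_le_sum (by simp) _ (List.mem_map_of_mem h)

theorem InputNumber.bitLength_le (x : InputNumber) : bitLength x.val ≤ x.size := by
  cases x with
  | binary z => simp [InputNumber.val, InputNumber.size]
  | unary z =>
    have := bitLength_le_natAbs z
    simp only [InputNumber.val, InputNumber.size]
    omega

theorem length_le_size (l : List InputNumber) : l.length ≤ (l.map InputNumber.size).sum := by
  induction l with
  | nil => simp
  | cons x l ih =>
    have : 1 ≤ x.size := by cases x <;> simp [InputNumber.size]
    simp only [List.length_cons, List.map_cons, List.sum_cons]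
    omega


open RamExpr

/-! ### The layout of the input -/

section Layout

variable {a n : ℕ} {X : Type} (enc : X → InputNumber) (D : DetAutomaton (Fin a) (Fin n) X)

theorem length_encodeAutomaton : (encodeAutomaton enc D).length = 1 + n * (1 + 2 * a) := by
  rw [encodeAutomaton, List.length_cons, length_flatMap_finRange_const (m := 1 + 2 * a), add_comm]
  intro q
  rw [List.length_cons, length_flatMap_finRange_const (m := 2) (fun _ => rfl)]
  ring

variable {enc D} {l : List InputNumber} {m : ℕ}

theorem automaton_init (h : OccursAt l m (encodeAutomaton enc D)) :
    inputStore l 0 m = (D.init : ℕ) := inputStore_eq h.getElem?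

theorem automaton_row (h : OccursAt l m (encodeAutomaton enc D)) (q : Fin n) :
    OccursAt l (m + 1 + q * (1 + 2 * a)) (.binary (if D.accept q then 1 else 0) ::
        (List.finRange a).flatMap fun b => [.binary (D.next q b : ℕ), enc (D.label q b)]) := by
  refine OccursAt.flatMap_const (m := 1 + 2 * a) (f := fun q => .binary (if D.accept q then 1 else 0) ::
    (List.finRange a).flatMap fun b => [.binary (D.next q b : ℕ), enc (D.label q b)])
    (fun q => ?_) h.tail q
  rw [List.length_cons, length_flatMap_finRange_const (m := 2) (fun _ => rfl)]
  ring

theorem automaton_accept (h : OccursAt l m (encodeAutomaton enc D)) (q : Fin n) :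
    inputStore l 0 (m + 1 + q * (1 + 2 * a)) = if D.accept q then 1 else 0 := by
  have := inputStore_eq (automaton_row h q).getElem?
  push_cast at this
  exact this

theorem automaton_edge (h : OccursAt l m (encodeAutomaton enc D)) (q : Fin n) (b : Fin a) :
    OccursAt l (m + 1 + q * (1 + 2 * a) + 1 + b * 2)
      [.binary (D.next q b : ℕ), enc (D.label q b)] :=
  OccursAt.flatMap_const (f := fun b => [.binary (D.next q b : ℕ), enc (D.label q b)])
    (fun _ => rfl) (automaton_row h q).tail b

theorem automaton_next (h : OccursAt l m (encodeAutomaton enc D)) (q : Fin n) (b : Fin a) :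
    inputStore l 0 (m + 1 + q * (1 + 2 * a) + 1 + 2 * b) = (D.next q b : ℕ) := by
  have := inputStore_eq (automaton_edge h q b).getElem?
  rw [mul_comm (b : ℕ)] at this
  push_cast at this
  exact this

theorem automaton_label (h : OccursAt l m (encodeAutomaton enc D)) (q : Fin n) (b : Fin a) :
    inputStore l 0 (m + 1 + q * (1 + 2 * a) + 2 + 2 * b) = (enc (D.label q b)).val := by
  have := inputStore_eq (automaton_edge h q b).tail.getElem?
  rw [show m + 1 + q * (1 + 2 * a) + 1 + b * 2 + 1 = m + 1 + q * (1 + 2 * a) + 2 + 2 * b by ring] at this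
  push_cast at this
  exact this

end Layout

namespace DistributionInput

variable (I : DistributionInput)

/-- The length of a row of the table of an automaton. -/
def row : ℕ := 1 + 2 * I.letters

/-- The position of the master automaton. -/
def masterPos : ℕ := 5 + 2 * (I.chainStates * (I.letters * I.chainStates))

/-- The number of states of a slave automaton, as a function on all natural numbers. -/
def statesOf (j : ℕ) : ℕ := if h : j < I.slaves then I.slaveStates ⟨j, h⟩ else 0

/-- The position of a slave automaton. -/
def slavePos (j : ℕ) : ℕ :=
  I.masterPos + 1 + I.masterStates * I.row + ∑ i ∈ Finset.range j, (2 + I.statesOf i * I.row)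

/-- The position of the value function. -/
def endPos : ℕ := I.slavePos I.slaves

/-- The part of the input that contains the slave automata and the value function. -/
def slaveList : List InputNumber :=
  ((List.finRange I.slaves).flatMap fun j =>
    .unary (I.slaveStates j) :: encodeAutomaton (fun z : ℤ => .unary z) (I.nwa.slave j)) ++
  encodeFinVal I.g

theorem statesOf_fin (j : Fin I.slaves) : I.statesOf j = I.slaveStates j := dif_pos j.2

theorem length_encodeChain : (encodeChain I.chain).length =
    1 + 2 * (I.chainStates * (I.letters * I.chainStates)) := by
  rw [encodeChain, List.length_cons, length_flatMap_finRange_const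
    (m := I.letters * (I.chainStates * 2))]
  · ring
  · intro s
    rw [length_flatMap_finRange_const (m := I.chainStates * 2)]
    intro b
    rw [length_flatMap_finRange_const (m := 2)]
    intro s'
    rfl

theorem length_slave (j : Fin I.slaves) :
    (InputNumber.unary (I.slaveStates j) ::
      encodeAutomaton (fun z : ℤ => .unary z) (I.nwa.slave j)).length =
      2 + I.statesOf j * I.row := by
  rw [List.length_cons, length_encodeAutomaton, statesOf_fin, row]
  ring

theorem length_encodeFinVal (g : FinVal) : (encodeFinVal g).length = 2 := by cases g <;> rfl

theorem length_slaveList : I.slaveList.length = I.endPos + 2 - I.slavePos 0 := by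
  rw [slaveList, List.length_append, length_flatMap_finRange (len := fun i => 2 + I.statesOf i * I.row) I.length_slave, length_encodeFinVal,
    endPos, slavePos, slavePos]
  simp
  omega

theorem encode_eq : I.encode =
    ([.unary I.letters, .unary I.chainStates, .unary I.masterStates, .unary I.slaves] :
      List InputNumber) ++
    (encodeChain I.chain ++
    (encodeAutomaton (fun j : Fin I.slaves => .binary (j : ℕ)) I.nwa.master ++
    (I.slaveList ++ encodeRat I.threshold))) := by
  simp only [encode, slaveList, List.append_assoc]

/-- The input cells. -/
def cell (i : ℤ) : ℤ := inputStore I.encode 0 i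

theorem occursAt_header : OccursAt I.encode 0
    [.unary I.letters, .unary I.chainStates, .unary I.masterStates, .unary I.slaves] := by
  have h := OccursAt.refl I.encode
  nth_rw 2 [encode_eq] at h
  exact h.left

theorem occursAt_tail : OccursAt I.encode 4 (encodeChain I.chain ++
    (encodeAutomaton (fun j : Fin I.slaves => .binary (j : ℕ)) I.nwa.master ++
    (I.slaveList ++ encodeRat I.threshold))) := by
  have h := OccursAt.refl I.encode
  nth_rw 2 [encode_eq] at h
  exact h.right rfl

theorem occursAt_master : OccursAt I.encode I.masterPos
    (encodeAutomaton (fun j : Fin I.slaves => .binary (j : ℕ)) I.nwa.master) :=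
  (I.occursAt_tail.right (m := I.masterPos) (by rw [length_encodeChain, masterPos]; ring)).left

theorem occursAt_slaveList : OccursAt I.encode (I.slavePos 0)
    (I.slaveList ++ encodeRat I.threshold) := by
  refine (I.occursAt_tail.right (m := I.masterPos) (by rw [length_encodeChain, masterPos]; ring)).right ?_
  rw [length_encodeAutomaton, slavePos, row]
  simp
  ring

theorem occursAt_slave (j : Fin I.slaves) : OccursAt I.encode (I.slavePos j)
    (.unary (I.slaveStates j) :: encodeAutomaton (fun z : ℤ => .unary z) (I.nwa.slave j)) := by
  have := OccursAt.flatMap (len := fun i => 2 + I.statesOf i * I.row) I.length_slave I.occursAt_slaveList.left.left j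
  rw [slavePos] at this ⊢
  simpa using this

theorem occursAt_finVal : OccursAt I.encode I.endPos (encodeFinVal I.g) := by
  refine I.occursAt_slaveList.left.right ?_
  rw [length_flatMap_finRange (len := fun i => 2 + I.statesOf i * I.row) I.length_slave, endPos, slavePos, slavePos]
  simp

theorem occursAt_threshold : OccursAt I.encode (I.endPos + 2) (encodeRat I.threshold) := by
  refine I.occursAt_slaveList.right ?_
  rw [length_slaveList]
  have : I.slavePos 0 ≤ I.endPos := by
    rw [endPos, slavePos, slavePos]; simp
  omega

theorem cell_letters : I.cell 0 = I.letters := inputStore_eq I.occursAt_header.getElem?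
theorem cell_chainStates : I.cell 1 = I.chainStates := inputStore_eq I.occursAt_header.tail.getElem?
theorem cell_masterStates : I.cell 2 = I.masterStates :=
  inputStore_eq I.occursAt_header.tail.tail.getElem?
theorem cell_slaves : I.cell 3 = I.slaves := inputStore_eq I.occursAt_header.tail.tail.tail.getElem?

theorem cell_chainInit : I.cell 4 = (I.chain.init : ℕ) := inputStore_eq I.occursAt_tail.left.getElem?

theorem occursAt_prob (s : Fin I.chainStates) (b : Fin I.letters) (s' : Fin I.chainStates) :
    OccursAt I.encode (5 + 2 * ((s * I.letters + b) * I.chainStates + s'))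
      (encodeRat (I.chain.prob s b s')) := by
  have h1 : OccursAt I.encode 5 _ := I.occursAt_tail.left.tail
  have h2 := h1.flatMap_const (m := I.letters * (I.chainStates * 2)) (fun s => by
    rw [length_flatMap_finRange_const (m := I.chainStates * 2)]
    intro b
    rw [length_flatMap_finRange_const (m := 2)]
    intro s'
    rfl) s
  have h3 := h2.flatMap_const (m := I.chainStates * 2) (fun b => by
    rw [length_flatMap_finRange_const (m := 2)]
    intro s'
    rfl) b
  have h4 := h3.flatMap_const (m := 2) (fun s' => rfl) s'
  convert h4 using 1
  ring

theorem cell_num (s : Fin I.chainStates) (b : Fin I.letters) (s' : Fin I.chainStates) :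
    I.cell (5 + 2 * ((s * I.letters + b) * I.chainStates + s')) = (I.chain.prob s b s').num := by
  have := inputStore_eq (I.occursAt_prob s b s').getElem?
  push_cast at this
  exact this

theorem cell_den (s : Fin I.chainStates) (b : Fin I.letters) (s' : Fin I.chainStates) :
    I.cell (6 + 2 * ((s * I.letters + b) * I.chainStates + s')) = (I.chain.prob s b s').den := by
  have := inputStore_eq (I.occursAt_prob s b s').tail.getElem?
  push_cast at this
  rw [show (5 + 2 * (((s : ℤ) * I.letters + b) * I.chainStates + s') + 1) =
    6 + 2 * ((s * I.letters + b) * I.chainStates + s') by ring] at this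
  exact this

theorem cell_masterInit : I.cell I.masterPos = (I.nwa.master.init : ℕ) :=
  automaton_init I.occursAt_master

theorem cell_masterNext (q : Fin I.masterStates) (b : Fin I.letters) :
    I.cell (I.masterPos + 1 + q * I.row + 1 + 2 * b) = (I.nwa.master.next q b : ℕ) := by
  have := automaton_next I.occursAt_master q b
  rw [row]; push_cast; exact this

theorem cell_masterLabel (q : Fin I.masterStates) (b : Fin I.letters) :
    I.cell (I.masterPos + 1 + q * I.row + 2 + 2 * b) = (I.nwa.master.label q b : ℕ) := by
  have := automaton_label I.occursAt_master q b
  rw [row]; push_cast; exact this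

theorem cell_slaveStates (j : Fin I.slaves) : I.cell (I.slavePos j) = I.slaveStates j :=
  inputStore_eq (I.occursAt_slave j).getElem?

theorem cell_slaveInit (j : Fin I.slaves) :
    I.cell (I.slavePos j + 1) = ((I.nwa.slave j).init : ℕ) := by
  have := automaton_init (I.occursAt_slave j).tail
  push_cast at this
  exact this

theorem cell_slaveAccept (j : Fin I.slaves) (p : Fin (I.slaveStates j)) :
    I.cell (I.slavePos j + 2 + p * I.row) = if (I.nwa.slave j).accept p then 1 else 0 := by
  rw [← automaton_accept (I.occursAt_slave j).tail p, cell, row]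
  congr 1

theorem cell_slaveNext (j : Fin I.slaves) (p : Fin (I.slaveStates j)) (b : Fin I.letters) :
    I.cell (I.slavePos j + 2 + p * I.row + 1 + 2 * b) = ((I.nwa.slave j).next p b : ℕ) := by
  rw [← automaton_next (I.occursAt_slave j).tail p b, cell, row]
  congr 1

theorem cell_slaveLabel (j : Fin I.slaves) (p : Fin (I.slaveStates j)) (b : Fin I.letters) :
    I.cell (I.slavePos j + 2 + p * I.row + 2 + 2 * b) = (I.nwa.slave j).label p b := by
  rw [show (I.nwa.slave j).label p b = (InputNumber.unary ((I.nwa.slave j).label p b)).val from rfl,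
    ← automaton_label (I.occursAt_slave j).tail p b, cell, row]
  congr 1

theorem cell_bound : I.cell (I.endPos + 1) = I.g.bound := by
  have h := I.occursAt_finVal
  cases hg : I.g <;> rw [hg] at h <;> exact inputStore_eq h.tail.getElem?

/-- The tag of a value function. -/
def tag : FinVal → ℤ
  | .max => 0
  | .min => 1
  | .boundedSum _ => 2
  | .absSum => 3
  | .sum => 4

theorem cell_tag : I.cell I.endPos = tag I.g := by
  have h := I.occursAt_finVal
  cases hg : I.g <;> rw [hg] at h <;> exact inputStore_eq h.getElem?

theorem cell_thresholdNum : I.cell (I.endPos + 2) = I.threshold.num := by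
  have := inputStore_eq I.occursAt_threshold.getElem?
  push_cast at this
  exact this

theorem cell_thresholdDen : I.cell (I.endPos + 3) = I.threshold.den := by
  have := inputStore_eq I.occursAt_threshold.tail.getElem?
  push_cast at this
  rw [add_assoc] at this
  exact this

/-! ### The size of the input -/

/-- The size of the input. -/
def inputSize : ℕ := (I.encode.map InputNumber.size).sum

theorem endPos_le : I.endPos + 4 ≤ I.inputSize := by
  refine le_trans ?_ (length_le_size _)
  have := I.occursAt_threshold.tail.tail.length_le
  have h2 := I.occursAt_threshold.length_le
  simp only [encodeRat, List.length_cons, List.length_nil] at h2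
  omega

theorem bitLength_cell_le (i : ℤ) : bitLength (I.cell i) ≤ I.inputSize := by
  rcases inputStore_mem I.encode i with h | ⟨x, hx, h⟩
  · rw [cell, h, bitLength_zero]; exact Nat.zero_le _
  · rw [cell, h]
    exact x.bitLength_le.trans (InputNumber.size_le hx)

theorem natAbs_le_of_unary {z : ℤ} (h : InputNumber.unary z ∈ I.encode) :
    z.natAbs ≤ I.inputSize := by
  have := InputNumber.size_le h
  simp only [InputNumber.size] at this
  exact le_trans (by omega) this

theorem letters_le : I.letters ≤ I.inputSize :=
  I.natAbs_le_of_unary (z := I.letters) (by simp [encode])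
theorem chainStates_le : I.chainStates ≤ I.inputSize :=
  I.natAbs_le_of_unary (z := I.chainStates) (by simp [encode])
theorem masterStates_le : I.masterStates ≤ I.inputSize :=
  I.natAbs_le_of_unary (z := I.masterStates) (by simp [encode])
theorem slaves_le : I.slaves ≤ I.inputSize :=
  I.natAbs_le_of_unary (z := I.slaves) (by simp [encode])

theorem slaveList_subset {x : InputNumber} (h : x ∈ I.slaveList) : x ∈ I.encode := by
  rw [encode_eq]
  simp only [List.mem_append]
  tauto

/-- The values themselves, and not just their lengths, are bounded: weights, numbers of states and
the bound `B` are in unary, and the binary numbers in this part are states, acceptance flags, or a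
tag up to `4`. -/
theorem natAbs_slaveList_le {x : InputNumber} (h : x ∈ I.slaveList) :
    x.val.natAbs ≤ I.inputSize := by
  have hin := I.slaveList_subset h
  cases x with
  | unary z => exact I.natAbs_le_of_unary hin
  | binary z =>
    have hst : ∀ j : Fin I.slaves, I.slaveStates j ≤ I.inputSize := fun j => by
      refine I.natAbs_le_of_unary (z := I.slaveStates j) (I.slaveList_subset ?_)
      rw [slaveList, List.mem_append, List.mem_flatMap]
      exact Or.inl ⟨j, List.mem_finRange j, List.mem_cons_self⟩
    have h4 : 4 ≤ I.inputSize := by have := I.endPos_le; omega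
    rw [slaveList, List.mem_append, List.mem_flatMap] at h
    simp only [InputNumber.val]
    rcases h with ⟨j, -, h⟩ | h
    · have := hst j
      simp only [encodeAutomaton, List.mem_cons, List.mem_flatMap, reduceCtorEq, false_or,
        InputNumber.binary.injEq, List.mem_finRange, true_and, List.not_mem_nil, or_false] at h
      rcases h with h | ⟨q, h | ⟨b, h⟩⟩
      · have := (I.nwa.slave j).init.2
        omega
      · split_ifs at h <;> omega
      · have := ((I.nwa.slave j).next q b).2
        omega
    · cases hg : I.g <;> rw [hg] at h <;>
        simp only [encodeFinVal, List.mem_cons, reduceCtorEq, or_false, List.not_mem_nil,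
          InputNumber.binary.injEq] at h <;> omega

theorem cell_slaveList_le (t : ℕ) (ht : t < I.endPos + 2 - I.slavePos 0) :
    (I.cell (I.slavePos 0 + t)).natAbs ≤ I.inputSize := by
  obtain ⟨x, hx, h⟩ := I.occursAt_slaveList.left.mem (m := I.slavePos 0 + t) (by omega)
    (by rw [length_slaveList]; omega)
  have := inputStore_eq h
  push_cast at this
  rw [cell, this]
  exact I.natAbs_slaveList_le hx

theorem slavePos_succ (j : ℕ) : I.slavePos (j + 1) = I.slavePos j + (2 + I.statesOf j * I.row) := by
  rw [slavePos, slavePos, Finset.sum_range_succ]; ring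

theorem slavePos_mono {i j : ℕ} (h : i ≤ j) : I.slavePos i ≤ I.slavePos j := by
  induction j, h using Nat.le_induction with
  | base => rfl
  | succ j _ ih => rw [slavePos_succ]; omega

theorem statesOf_le_endPos (j : Fin I.slaves) : I.slaveStates j ≤ I.endPos := by
  have h1 := I.slavePos_succ j
  have h2 : I.slavePos (j + 1) ≤ I.endPos := I.slavePos_mono j.2
  rw [statesOf_fin] at h1
  have : I.slaveStates j ≤ I.slaveStates j * I.row := Nat.le_mul_of_pos_right _ (by rw [row]; omega)
  omega

theorem letters_pos : 0 < I.letters := by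
  rcases Nat.eq_zero_or_pos I.letters with h | h
  · have := I.chain.prob_sum I.chain.init
    have he : IsEmpty (Fin I.letters) := by rw [h]; infer_instance
    simp at this
  · exact h

theorem chainStates_pos : 0 < I.chainStates := lt_of_le_of_lt (Nat.zero_le _) I.chain.init.2

theorem masterStates_pos : 0 < I.masterStates := lt_of_le_of_lt (Nat.zero_le _) I.nwa.master.init.2

end DistributionInput


open RamExpr

/-! ### The program -/

namespace Program

def inp (e : RamExpr) : RamExpr := .read 0 e
def nA : RamExpr := inp 0
def nS : RamExpr := inp 1
def nQ : RamExpr := inp 2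
def nK : RamExpr := inp 3
def rowE : RamExpr := 1 + 2 * nA
def masterE : RamExpr := 5 + 2 * (nS * (nA * nS))
def slavesE : RamExpr := masterE + 1 + nQ * rowE

/-- The end of the part of the input that contains the slave automata. -/
def endE : RamExpr := .read 2 nK
def tagE : RamExpr := inp endE
def boundE : RamExpr := inp (endE + 1)
def numE : RamExpr := inp (endE + 2)
def denE : RamExpr := inp (endE + 3)

/-- The product of all denominators. -/
def scaleE : RamExpr := .read 3 (nS * (nA * nS))

/-- The bound for accumulators. -/
def accE : RamExpr := .read 6 0
def widthE : RamExpr := 2 * accE + 1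
def nZ : RamExpr := nQ + nK * endE * widthE
def nX : RamExpr := .read 7 0

/-- The index of the configuration of slave `j` with state `p` and accumulator `c`. -/
def configE (j p c : RamExpr) : RamExpr := nQ + (j * endE + p) * widthE + (c + accE)

/-- The three mixed radix digits of a configuration index. The digit of the state has base `endE`,
which is at least the number of states of every slave, and the digit of the accumulator is shifted
by `accE`. -/
def slaveE (z : RamExpr) : RamExpr := (z - nQ) / widthE / endE
def stateE (z : RamExpr) : RamExpr := modE ((z - nQ) / widthE) endE
def counterE (z : RamExpr) : RamExpr := modE (z - nQ) widthE - accE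
-- The offset `2` skips the number of states and the initial state of the slave automaton.
def posE (z : RamExpr) : RamExpr := .read 2 (slaveE z) + 2 + stateE z * rowE
def weightE (z b : RamExpr) : RamExpr := inp (posE z + 2 + 2 * b)

def minE (e f : RamExpr) : RamExpr := iteE (ltE e f) e f
def maxE (e f : RamExpr) : RamExpr := iteE (ltE e f) f e

/-- A case distinction on the value function. -/
def tagCases (e0 e1 e2 e3 e4 : RamExpr) : RamExpr :=
  iteE (eqE tagE 0) e0 (iteE (eqE tagE 1) e1 (iteE (eqE tagE 2) e2 (iteE (eqE tagE 3) e3 e4)))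

def updE (c x : RamExpr) : RamExpr :=
  tagCases (maxE c x) (minE c x)
    (maxE (0 - (boundE + 1)) (minE (boundE + 1)
      -- The two comparisons test that `c` lies in `[-B, B]`; otherwise the accumulator is frozen.
      (c + iteE (ltE c (boundE + 1)) (iteE (ltE (0 - boundE - 1) c) x 0) 0))) 0 0

def accValE (c : RamExpr) : RamExpr :=
  tagCases c c (maxE (0 - boundE) (minE boundE c)) 0 0

def extraE (x : RamExpr) : RamExpr := tagCases 0 0 0 (maxE x (0 - x)) x

def initAccE : RamExpr := tagCases (0 - accE) accE 0 0 0

/-- The configuration and the letter of an address in a table of transitions. -/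
def zE : RamExpr := ctr / nA
def bE : RamExpr := modE ctr nA

def stopE (z : RamExpr) : RamExpr := .read 8 z

/-- The address of the transition with letter `b` from the start of a slave automaton. -/
def launchE : RamExpr := .read 12 ctr * nA + bE

def probE (s l : RamExpr) : RamExpr := .read 4 (s * (nA * nS) + l)

/-- The indices of the row and of the column, and the letter, in the tables of transitions. -/
def rowIdxE : RamExpr := zE / nX
def colIdxE : RamExpr := modE zE nX
def transE : RamExpr := rowIdxE / nS * nA + bE
def transProbE : RamExpr := probE (modE rowIdxE nS) (bE * nS + modE colIdxE nS)

def nN : RamExpr := 2 * nX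
-- Array 16 holds running sums over the letters, so the total is in the last cell of a block.
def tE (x y : RamExpr) : RamExpr := .read 16 ((x * nX + y) * nA + (nA - 1))
def cE (x y : RamExpr) : RamExpr := .read 17 ((x * nX + y) * nA + (nA - 1))

/-- The entries of the matrix of the system of linear equations. -/
def matrixE (r c : RamExpr) : RamExpr :=
  iteE (ltE r nX)
    (iteE (ltE c nX) ((1 - stopE (r / nS)) * (scaleE * eqE r c - tE r c))
      (stopE (r / nS) * scaleE * eqE r (c - nX)))
    (iteE (ltE c nX) (scaleE * eqE (r - nX) c)
      (scaleE * eqE (r - nX) (c - nX) - (1 - stopE ((r - nX) / nS)) * tE (r - nX) (c - nX) -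
        cE (r - nX) (c - nX)))

/-- The size of the representation of a state of the elimination. -/
def blockE : RamExpr := nN * (2 * nN) + nN + 1
def entryE (t i j : RamExpr) : RamExpr := .read 20 (t * blockE + (i * (2 * nN) + j))
def usedE (t i : RamExpr) : RamExpr := .read 20 (t * blockE + (nN * (2 * nN) + i))
def pivotE (t : RamExpr) : RamExpr := .read 20 (t * blockE + (nN * (2 * nN) + nN))

def elimInitE (u : RamExpr) : RamExpr :=
  iteE (ltE u (nN * (2 * nN)))
    (iteE (ltE (modE u (2 * nN)) nN) (.read 19 (u / (2 * nN) * nN + modE u (2 * nN)))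
      (eqE (modE u (2 * nN)) (nN + u / (2 * nN))))
    -- This gives `1` for the pivot, which is the last cell, and `0` for the flags of used rows.
    (eqE u (nN * (2 * nN) + nN))

def elimStepE (t u : RamExpr) : RamExpr :=
  iteE (eqE (usedE t (modE t nN)) 0 * (1 - eqE (entryE t (modE t nN) (t / nN)) 0))
    (iteE (ltE u (nN * (2 * nN)))
      (iteE (eqE (u / (2 * nN)) (modE t nN)) (entryE t (u / (2 * nN)) (modE u (2 * nN)))
        ((entryE t (modE t nN) (t / nN) * entryE t (u / (2 * nN)) (modE u (2 * nN)) -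
          entryE t (u / (2 * nN)) (t / nN) * entryE t (modE t nN) (modE u (2 * nN))) / pivotE t))
      (iteE (ltE u (nN * (2 * nN) + nN))
        (iteE (eqE (u - nN * (2 * nN)) (modE t nN)) (t / nN + 1) (usedE t (u - nN * (2 * nN))))
        (entryE t (modE t nN) (t / nN))))
    (.read 20 (t * blockE + u))

/-- The right-hand side for the gain of the value, and for the gain of the indicator function of
the states whose value is at most the threshold. -/
def rhsValueE (k : RamExpr) : RamExpr :=
  iteE (ltE k nX) 0
    ((1 - stopE ((k - nX) / nS)) * .read 18 ((k - nX) * (nA * nS) + (nA * nS - 1)))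

def rhsIndicatorE (k : RamExpr) : RamExpr :=
  iteE (ltE k nX) 0 (iteE (ltE ((k - nX) / nS) nQ)
    -- Numerator times pivot has the sign of the gain, which is their quotient.
    (iteE (ltE 0 (.read 22 ((k - nX) * nN + (nN - 1)) * pivotE (nN * nN))) 0 scaleE) 0)

/-- The address of a pair of a row and a column. -/
def riE : RamExpr := ctr / nN
def ciE : RamExpr := modE ctr nN

/-- The stages of the program. -/
def stages : ℕ → Stage
  | 0 => ⟨nK + 1, iteE (eqE ctr 0) slavesE
      (.read 2 (ctr - 1) + (2 + inp (.read 2 (ctr - 1)) * rowE))⟩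
  | 1 => ⟨nS * (nA * nS) + 1, iteE (eqE ctr 0) 1 (.read 3 (ctr - 1) * inp (4 + 2 * ctr))⟩
  -- The scale is the product of all denominators, so this division is exact and all scaled
  -- probabilities are integers.
  | 2 => ⟨nS * (nA * nS), inp (5 + 2 * ctr) * (scaleE / inp (6 + 2 * ctr))⟩
  -- A sum of squares of all numbers in the part with slaves and value function bounds every weight
  -- and `B` without computing absolute values.
  | 3 => ⟨endE + 2 - slavesE,
      sumE 5 (endE + 2 - slavesE) (inp (slavesE + ctr) * inp (slavesE + ctr))⟩
  | 4 => ⟨1, 1 + .read 5 (endE + 2 - slavesE - 1)⟩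
  | 5 => ⟨1, nZ * nS⟩
  -- Indices whose state digit exceeds the number of states of the slave are declared halted, which
  -- makes them harmless.
  | 6 => ⟨nZ, iteE (ltE ctr nQ) 0
      (iteE (ltE (stateE ctr) (inp (.read 2 (slaveE ctr)))) (inp (posE ctr)) 1)⟩
  | 7 => ⟨nZ * nA, updE (counterE zE) (weightE zE bE)⟩
  | 8 => ⟨nZ * nA, iteE (ltE zE nQ) (inp (masterE + 1 + zE * rowE + 1 + 2 * bE))
      (configE (slaveE zE) (inp (posE zE + 1 + 2 * bE)) (.read 9 ctr))⟩
  | 9 => ⟨nZ * nA, accValE (.read 9 ctr) - accValE (counterE zE) + extraE (weightE zE bE)⟩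
  | 10 => ⟨nQ * nA, configE (inp (masterE + 1 + zE * rowE + 2 + 2 * bE))
      (inp (.read 2 (inp (masterE + 1 + zE * rowE + 2 + 2 * bE)) + 1)) initAccE⟩
  -- A step of the master is active iff the launched slave has not already halted; slave
  -- configurations launch nothing.
  | 11 => ⟨nZ * nA, iteE (ltE zE nQ) (1 - stopE (.read 12 ctr)) 0⟩
  | 12 => ⟨nZ * nA, .read 10 launchE⟩
  | 13 => ⟨nZ * nA, iteE (ltE zE nQ)
      (.read 13 ctr * (denE * (accValE initAccE + .read 11 launchE) - numE)) (denE * .read 11 ctr)⟩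
  | 14 => ⟨nX * nX * nA, sumE 16 nA
      (iteE (eqE (.read 10 transE) (colIdxE / nS)) transProbE 0)⟩
  | 15 => ⟨nX * nX * nA, sumE 17 nA
      (iteE (eqE (.read 14 transE) (colIdxE / nS)) (transProbE * .read 13 transE) 0)⟩
  | 16 => ⟨nX * (nA * nS), sumE 18 (nA * nS)
      (probE (modE (ctr / (nA * nS)) nS) (modE ctr (nA * nS)) *
        .read 15 (ctr / (nA * nS) / nS * nA + modE ctr (nA * nS) / nS))⟩
  | 17 => ⟨nN * nN, matrixE riE ciE⟩
  -- The whole history of the elimination is stored, so that every cell is written once and depends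
  -- only on the preceding block.
  | 18 => ⟨(nN * nN + 1) * blockE, iteE (ltE ctr blockE) (elimInitE ctr)
      (elimStepE (ctr / blockE - 1) (modE ctr blockE))⟩
  | 19 => ⟨nN * nN, sumE 21 nN (entryE (nN * nN) riE (nN + ciE) * rhsValueE ciE)⟩
  | 20 => ⟨nX * nN, sumE 22 nN
      (iteE (eqE (usedE (nN * nN) ciE) (riE + 1)) (.read 21 (ciE * nN + (nN - 1))) 0)⟩
  | 21 => ⟨nN * nN, sumE 23 nN (entryE (nN * nN) riE (nN + ciE) * rhsIndicatorE ciE)⟩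
  | 22 => ⟨nX * nN, sumE 24 nN
      (iteE (eqE (usedE (nN * nN) ciE) (riE + 1)) (.read 23 (ciE * nN + (nN - 1))) 0)⟩
  -- Numerator and denominator are multiplied by the pivot, which makes the denominator positive.
  | 23 => ⟨2, iteE (eqE ctr 0)
      (.read 24 ((inp masterE * nS + inp 4) * nN + (nN - 1)) * pivotE (nN * nN))
      (pivotE (nN * nN) * pivotE (nN * nN))⟩
  | _ => ⟨0, 0⟩

-- The bound of a loop reads neither the counter nor the array being filled, so it is constant while
-- the loop runs.
set_option maxRecDepth 100000 in
theorem size_arrays : ∀ i < 24, ∀ a ∈ (stages i).size.arrays, a < i + 2 ∧ a ≠ 1 := by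
  decide

set_option maxRecDepth 100000 in
theorem val_arrays : ∀ i < 24, ∀ a ∈ (stages i).val.arrays, a < i + 3 := by
  decide

end Program


/-! ### Contents of the first arrays: positions, scale, accumulator bound, dimensions. -/

open RamExpr

theorem mul_add_ediv {q w a : ℤ} (h0 : 0 ≤ a) (h1 : a < w) : (q * w + a) / w = q := by
  rw [add_comm, Int.add_mul_ediv_right _ _ (by omega), Int.ediv_eq_zero_of_lt h0 h1, zero_add]

theorem mul_add_emod {q w a : ℤ} (h0 : 0 ≤ a) (h1 : a < w) : (q * w + a) % w = a := by
  rw [add_comm, Int.add_mul_emod_self_right, Int.emod_eq_of_lt h0 h1]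

theorem mul_add_lt {q w a n : ℕ} (hq : q < n) (ha : a < w) : q * w + a < n * w := by
  have : (q + 1) * w ≤ n * w := Nat.mul_le_mul_right _ hq
  rw [add_mul] at this
  omega

namespace DistributionInput

open Program

variable (I : DistributionInput)

/-- The contents of the arrays at the end of the program. -/
def mem : Store := arr stages (inputStore I.encode)

theorem mem_zero : I.mem 0 = I.cell := rfl

/-- The number of cells of the array `i + 2`. -/
def cellCount (i : ℕ) : ℕ := cells stages (inputStore I.encode) i

theorem eval_eq_memory {e : RamExpr} (h : 1 ∉ e.arrays) (σ : Store) (t : ℤ) :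
    e.eval σ = e.eval (memory σ t) := by
  refine eval_congr _ fun a ha => ?_
  have : a ≠ 1 := fun h' => h (h' ▸ ha)
  funext j
  simp [memory, this]

theorem cellCount_eq {i : ℕ} (hi : i < 24) :
    I.cellCount i = ((stages i).size.eval (memory I.mem 0)).toNat := by
  rw [cellCount, cells, eval_eq_memory fun h => (size_arrays i hi 1 h).2 rfl]
  rfl

theorem cellCount_of {i n : ℕ} (hi : i < 24)
    (h : (stages i).size.eval (memory I.mem 0) = n) : I.cellCount i = n := by
  rw [I.cellCount_eq hi, h, Int.toNat_natCast]

-- The excluded stages read the array that they fill: the two recursive tables, the running sums,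
-- and the history of the elimination.
set_option maxRecDepth 100000 in
theorem fill_arrays : ∀ i < 24, i ∉ [0, 1, 3, 14, 15, 16, 18, 19, 20, 21, 22] →
    ∀ a ∈ (stages i).val.arrays, a < i + 2 := by
  decide

theorem mem_fill {i : ℕ} (hi : i < 24) (hi' : i ∉ [0, 1, 3, 14, 15, 16, 18, 19, 20, 21, 22])
    {j : ℤ} (h0 : 0 ≤ j) (h1 : j < I.cellCount i) :
    I.mem (i + 2) j = (stages i).val.eval (memory I.mem j) := by
  rw [mem, arr_eq_of_fill (fun a ha => (size_arrays i hi a ha).1) (fill_arrays i hi hi'),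
    if_pos ⟨h0, h1⟩]

variable {I} in
theorem eval_inp {σ : Store} (h : σ 0 = I.cell) (e : RamExpr) (t : ℤ) :
    (inp e).eval (memory σ t) = I.cell (e.eval (memory σ t)) := by
  rw [inp, eval_read (by norm_num), h]

variable {I} in
theorem eval_nA' {σ : Store} (h : σ 0 = I.cell) (t : ℤ) : nA.eval (memory σ t) = I.letters := by
  rw [nA, eval_inp h, eval_zero, cell_letters]

variable {I} in
theorem eval_nS' {σ : Store} (h : σ 0 = I.cell) (t : ℤ) :
    nS.eval (memory σ t) = I.chainStates := by
  rw [nS, eval_inp h, eval_one, cell_chainStates]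

variable {I} in
theorem eval_nQ' {σ : Store} (h : σ 0 = I.cell) (t : ℤ) :
    nQ.eval (memory σ t) = I.masterStates := by
  rw [nQ, eval_inp h, eval_two, cell_masterStates]

variable {I} in
theorem eval_nK' {σ : Store} (h : σ 0 = I.cell) (t : ℤ) : nK.eval (memory σ t) = I.slaves := by
  rw [nK, eval_inp h, eval_three, cell_slaves]

variable {I} in
theorem eval_rowE' {σ : Store} (h : σ 0 = I.cell) (t : ℤ) : rowE.eval (memory σ t) = I.row := by
  simp [rowE, eval_nA' h, row]

variable {I} in
theorem eval_masterE' {σ : Store} (h : σ 0 = I.cell) (t : ℤ) :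
    masterE.eval (memory σ t) = I.masterPos := by
  simp [masterE, eval_nA' h, eval_nS' h, masterPos]

variable {I} in
theorem eval_slavesE' {σ : Store} (h : σ 0 = I.cell) (t : ℤ) :
    slavesE.eval (memory σ t) = I.slavePos 0 := by
  simp [slavesE, eval_masterE' h, eval_nQ' h, eval_rowE' h, slavePos]

section

variable (t : ℤ) (e : RamExpr)

@[simp] theorem eval_inp_mem : (inp e).eval (memory I.mem t) = I.cell (e.eval (memory I.mem t)) :=
  eval_inp I.mem_zero e t
@[simp] theorem eval_nA : nA.eval (memory I.mem t) = I.letters := eval_nA' I.mem_zero t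
@[simp] theorem eval_nS : nS.eval (memory I.mem t) = I.chainStates := eval_nS' I.mem_zero t
@[simp] theorem eval_nQ : nQ.eval (memory I.mem t) = I.masterStates := eval_nQ' I.mem_zero t
@[simp] theorem eval_nK : nK.eval (memory I.mem t) = I.slaves := eval_nK' I.mem_zero t
@[simp] theorem eval_rowE : rowE.eval (memory I.mem t) = I.row := eval_rowE' I.mem_zero t
@[simp] theorem eval_masterE : masterE.eval (memory I.mem t) = I.masterPos :=
  eval_masterE' I.mem_zero t
@[simp] theorem eval_slavesE : slavesE.eval (memory I.mem t) = I.slavePos 0 :=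
  eval_slavesE' I.mem_zero t

end

theorem cellCount_zero : I.cellCount 0 = I.slaves + 1 := by
  rw [I.cellCount_eq (by norm_num)]
  simp [stages]

theorem cellCount_one : I.cellCount 1 = I.chainStates * (I.letters * I.chainStates) + 1 := by
  exact I.cellCount_of (by norm_num) (by simp [stages])

theorem cellCount_two : I.cellCount 2 = I.chainStates * (I.letters * I.chainStates) := by
  exact I.cellCount_of (by norm_num) (by simp [stages])

theorem mem_two_eq (j : ℤ) : I.mem 2 j =
    if 0 ≤ j ∧ j < I.cellCount 0 then (I.slavePos j.toNat : ℤ) else 0 := by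
  refine arr_eq_of_scan (P := stages) (i := 0) (fun a ha => (size_arrays 0 (by norm_num) a ha).1)
    (val_arrays 0 (by norm_num)) (F := fun j => (I.slavePos j.toNat : ℤ)) (fun t ht => ?_) j
  change t < I.cellCount 0 at ht
  rw [cellCount_zero] at ht
  set f : ℤ → ℤ := fun j => if 0 ≤ j ∧ j < (t : ℤ) then (I.slavePos j.toNat : ℤ) else 0 with hf
  have h0 : Function.update (arr stages (inputStore I.encode)) 2 f 0 = I.cell := by
    rw [Function.update_of_ne (by norm_num)]; rfl
  simp only [stages, eval_iteE_eqE, eval_ctr, eval_zero, eval_slavesE' h0, eval_add, eval_two,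
    eval_mul, eval_inp h0, eval_rowE' h0, eval_read (a := 2) (by norm_num), eval_sub, eval_one]
  have h2 : Function.update (arr stages (inputStore I.encode)) (0 + 2) f 2 = f :=
    Function.update_self ..
  rw [h2]
  by_cases h : t = 0
  · subst h; simp
  · obtain ⟨t, rfl⟩ : ∃ u, t = u + 1 := ⟨t - 1, by omega⟩
    have e1 : f (((t + 1 : ℕ) : ℤ) - 1) = I.slavePos t := by
      rw [hf]
      simp
    rw [if_neg (by omega), e1, Int.toNat_natCast, slavePos_succ]
    have := I.cell_slaveStates ⟨t, by omega⟩
    simp only at this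
    rw [this, ← statesOf_fin]
    push_cast
    rfl

@[simp] theorem mem_two {j : ℕ} (hj : j ≤ I.slaves) : I.mem 2 j = I.slavePos j := by
  rw [mem_two_eq, if_pos ⟨by omega, by rw [cellCount_zero]; omega⟩, Int.toNat_natCast]

@[simp] theorem eval_endE (t : ℤ) : endE.eval (memory I.mem t) = I.endPos := by
  rw [endE, eval_read (by norm_num), eval_nK, mem_two I le_rfl, endPos]
@[simp] theorem eval_tagE (t : ℤ) : tagE.eval (memory I.mem t) = tag I.g := by
  simp [tagE, cell_tag]
@[simp] theorem eval_boundE (t : ℤ) : boundE.eval (memory I.mem t) = I.g.bound := by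
  simp [boundE, cell_bound]
@[simp] theorem eval_numE (t : ℤ) : numE.eval (memory I.mem t) = I.threshold.num := by
  simp [numE, cell_thresholdNum]
@[simp] theorem eval_denE (t : ℤ) : denE.eval (memory I.mem t) = I.threshold.den := by
  simp [denE, cell_thresholdDen]

/-- The product of the denominators of the first probabilities. -/
def denProd (n : ℕ) : ℤ := ∏ l ∈ Finset.range n, I.cell (6 + 2 * l)

theorem mem_three_eq (j : ℤ) : I.mem 3 j =
    if 0 ≤ j ∧ j < I.cellCount 1 then I.denProd j.toNat else 0 := by
  refine arr_eq_of_scan (P := stages) (i := 1) (fun a ha => (size_arrays 1 (by norm_num) a ha).1)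
    (val_arrays 1 (by norm_num)) (F := fun j => I.denProd j.toNat) (fun t ht => ?_) j
  set f : ℤ → ℤ := fun j => if 0 ≤ j ∧ j < (t : ℤ) then I.denProd j.toNat else 0 with hf
  have h0 : Function.update (arr stages (inputStore I.encode)) 3 f 0 = I.cell := by
    rw [Function.update_of_ne (by norm_num)]; rfl
  simp only [stages, eval_iteE_eqE, eval_ctr, eval_zero, eval_add, eval_two, eval_four,
    eval_mul, eval_inp h0, eval_read (a := 3) (by norm_num), eval_sub, eval_one]
  have h2 : Function.update (arr stages (inputStore I.encode)) (1 + 2) f 3 = f :=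
    Function.update_self ..
  rw [h2]
  by_cases h : t = 0
  · subst h; simp [denProd]
  · obtain ⟨t, rfl⟩ : ∃ u, t = u + 1 := ⟨t - 1, by omega⟩
    have e1 : f (((t + 1 : ℕ) : ℤ) - 1) = I.denProd t := by
      rw [hf]
      simp
    rw [if_neg (by omega), e1, Int.toNat_natCast, denProd, denProd, Finset.prod_range_succ]
    congr 2
    push_cast
    ring

/-- The product of the denominators of all probabilities. -/
def scale : ℤ := I.denProd (I.chainStates * (I.letters * I.chainStates))

@[simp] theorem eval_scaleE (t : ℤ) : scaleE.eval (memory I.mem t) = I.scale := by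
  rw [scaleE, eval_read (by norm_num), mem_three_eq]
  simp only [eval_mul, eval_nS, eval_nA]
  rw [if_pos ⟨by positivity, by rw [cellCount_one]; push_cast; omega⟩, scale]
  congr 1

theorem probIdx_lt (s : Fin I.chainStates) (b : Fin I.letters) (s' : Fin I.chainStates) :
    (s : ℕ) * (I.letters * I.chainStates) + (b * I.chainStates + s') <
      I.chainStates * (I.letters * I.chainStates) :=
  mul_add_lt s.2 (mul_add_lt b.2 s'.2)

theorem exists_probIdx {l : ℕ} (hl : l < I.chainStates * (I.letters * I.chainStates)) :
    ∃ (s : Fin I.chainStates) (b : Fin I.letters) (s' : Fin I.chainStates),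
      l = (s * I.letters + b) * I.chainStates + s' := by
  have hA := I.letters_pos
  have hS := I.chainStates_pos
  have h1 : l / I.chainStates < I.chainStates * I.letters :=
    Nat.div_lt_of_lt_mul (by rwa [mul_comm I.letters] at hl)
  have h2 : l / I.chainStates / I.letters < I.chainStates :=
    Nat.div_lt_of_lt_mul (by rw [mul_comm]; exact h1)
  refine ⟨⟨l / I.chainStates / I.letters, h2⟩, ⟨l / I.chainStates % I.letters, Nat.mod_lt _ hA⟩,
    ⟨l % I.chainStates, Nat.mod_lt _ hS⟩, ?_⟩
  simp only
  rw [Nat.div_add_mod', Nat.div_add_mod']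

theorem cell_den_pos {l : ℕ} (hl : l < I.chainStates * (I.letters * I.chainStates)) :
    0 < I.cell (6 + 2 * l) := by
  obtain ⟨s, b, s', rfl⟩ := I.exists_probIdx hl
  have := I.cell_den s b s'
  push_cast
  rw [this]
  exact_mod_cast (I.chain.prob s b s').den_pos

theorem scale_pos : 0 < I.scale :=
  Finset.prod_pos fun _ hl => I.cell_den_pos (Finset.mem_range.1 hl)

theorem mem_four (s : Fin I.chainStates) (b : Fin I.letters) (s' : Fin I.chainStates) :
    ((I.mem 4 (s * (I.letters * I.chainStates) + (b * I.chainStates + s')) : ℤ) : ℝ) =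
      I.scale * I.chain.edge s (b, s') := by
  have hlt := I.probIdx_lt s b s'
  have e0 : ((s : ℤ) * (I.letters * I.chainStates) + (b * I.chainStates + s')) =
      ((s * (I.letters * I.chainStates) + (b * I.chainStates + s') : ℕ) : ℤ) := by push_cast; ring
  rw [I.mem_fill (i := 2) (by norm_num) (by decide) (by positivity)
    (by rw [cellCount_two, e0]; exact_mod_cast hlt)]
  simp only [stages, eval_mul, eval_inp_mem, eval_div, eval_scaleE, eval_add, eval_two, eval_five,
    eval_six, eval_ctr]
  have e1 : (s : ℤ) * (I.letters * I.chainStates) + (b * I.chainStates + s') =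
    (s * I.letters + b) * I.chainStates + s' := by ring
  rw [e1, cell_num, cell_den]
  have hd : ((I.chain.prob s b s').den : ℤ) ∣ I.scale := by
    rw [← cell_den, scale, denProd]
    have := Finset.dvd_prod_of_mem (fun l : ℕ => I.cell (6 + 2 * l)) (Finset.mem_range.2 hlt)
    rw [← e0, e1] at this
    exact this
  have hne : ((I.chain.prob s b s').den : ℝ) ≠ 0 := by exact_mod_cast (I.chain.prob s b s').den_nz
  obtain ⟨c, hc⟩ := hd
  rw [hc, Int.mul_ediv_cancel_left _ (by exact_mod_cast (I.chain.prob s b s').den_nz),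
    MarkovChain.edge]
  simp only
  have : ((I.chain.prob s b s' : ℚ) : ℝ) =
      ((I.chain.prob s b s').num : ℝ) / ((I.chain.prob s b s').den : ℝ) := by
    rw [← Rat.cast_intCast, ← Rat.cast_natCast, ← Rat.cast_div, Rat.num_div_den]
  rw [this]
  push_cast
  field_simp

/-- The bound for accumulators that the program uses. -/
def accBound : ℕ := 1 + ∑ l ∈ Finset.range (I.endPos + 2 - I.slavePos 0),
  (I.cell (I.slavePos 0 + l)).natAbs * (I.cell (I.slavePos 0 + l)).natAbs

theorem slavePos_le_endPos : I.slavePos 0 ≤ I.endPos := I.slavePos_mono (Nat.zero_le _)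

theorem cellCount_three : I.cellCount 3 = I.endPos + 2 - I.slavePos 0 := by
  have hle := I.slavePos_le_endPos
  refine I.cellCount_of (by norm_num) ?_
  simp [stages]
  omega

theorem mem_six : I.mem 6 0 = I.accBound := by
  have hle := I.slavePos_le_endPos
  have hcc : I.cellCount 4 = 1 := by rw [I.cellCount_eq (by norm_num)]; simp [stages]
  rw [I.mem_fill (i := 4) (by norm_num) (by decide) le_rfl (by rw [hcc]; norm_num)]
  have hw : (endE + 2 - slavesE : RamExpr).eval (arr stages (inputStore I.encode)) =
      (I.endPos + 2 - I.slavePos 0 : ℕ) := by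
    rw [eval_eq_memory (by decide) _ 0]
    change (endE + 2 - slavesE : RamExpr).eval (memory I.mem 0) = _
    simp only [eval_sub, eval_add, eval_endE, eval_slavesE, eval_two]
    omega
  have := arr_sum (P := stages) (i := 3) (σ := inputStore I.encode)
    (fun a ha => (size_arrays 3 (by norm_num) a ha).1) rfl
    (by decide) (by decide) (by decide) (m := I.endPos + 2 - I.slavePos 0) (n := 1) (by omega) hw
    (by rw [one_mul]; exact I.cellCount_three) (a := 0) (by norm_num)
  change I.mem 5 _ = ∑ l ∈ _, RamExpr.eval (memory I.mem _) _ at this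
  simp only [stages, eval_add, eval_one, eval_read (a := 5) (by norm_num), eval_sub, eval_endE,
    eval_slavesE, eval_two]
  rw [show (I.endPos : ℤ) + 2 - I.slavePos 0 - 1 =
    ((0 : ℕ) : ℤ) * (I.endPos + 2 - I.slavePos 0 : ℕ) + ((I.endPos + 2 - I.slavePos 0 : ℕ) - 1) by
    push_cast; omega, this, accBound]
  push_cast
  congr 1
  refine Finset.sum_congr rfl fun l _ => ?_
  simp only [eval_mul, eval_inp_mem, eval_add, eval_slavesE, eval_ctr, zero_mul, zero_add,
    abs_mul_abs_self]

@[simp] theorem eval_accE (t : ℤ) : accE.eval (memory I.mem t) = I.accBound := by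
  rw [accE, eval_read (by norm_num), eval_zero, mem_six]

/-- A natural number is at most its square, which is one term of the sum; the extra `1` provides the
`B + 1` that bounded sums need. -/
theorem natAbs_cell_le_accBound (t : ℕ) (ht : t < I.endPos + 2 - I.slavePos 0) :
    (I.cell (I.slavePos 0 + t)).natAbs + 1 ≤ I.accBound := by
  have h1 := Finset.single_le_sum (f := fun l : ℕ => (I.cell (I.slavePos 0 + l)).natAbs *
    (I.cell (I.slavePos 0 + l)).natAbs) (fun _ _ => Nat.zero_le _) (Finset.mem_range.2 ht)
  have h2 := Nat.le_mul_self (I.cell (I.slavePos 0 + t)).natAbs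
  rw [accBound]
  omega

theorem bound_le_accBound : I.g.bound + 1 ≤ I.accBound := by
  have hle := I.slavePos_le_endPos
  have := I.natAbs_cell_le_accBound (I.endPos + 1 - I.slavePos 0) (by omega)
  rw [show (I.slavePos 0 : ℤ) + (I.endPos + 1 - I.slavePos 0 : ℕ) = I.endPos + 1 by omega,
    cell_bound] at this
  exact this

theorem weight_le_accBound (j : Fin I.slaves) (p : Fin (I.slaveStates j)) (b : Fin I.letters) :
    |(I.nwa.slave j).label p b| ≤ (I.accBound : ℤ) := by
  have h0 : I.slavePos 0 ≤ I.slavePos j := I.slavePos_mono (Nat.zero_le _)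
  have h1 : I.slavePos (j + 1) ≤ I.endPos := I.slavePos_mono j.2
  rw [slavePos_succ, statesOf_fin] at h1
  have h2 : (p : ℕ) * I.row + (1 + 2 * b) < I.slaveStates j * I.row :=
    mul_add_lt p.2 (by rw [row]; omega)
  have := I.natAbs_cell_le_accBound (I.slavePos j + 2 + p * I.row + 2 + 2 * b - I.slavePos 0)
    (by omega)
  have e : (I.slavePos 0 : ℤ) + (I.slavePos j + 2 + p * I.row + 2 + 2 * b - I.slavePos 0 : ℕ) =
    I.slavePos j + 2 + p * I.row + 2 + 2 * b := by
    rw [Nat.cast_sub (by omega)]; push_cast; ring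
  rw [e, cell_slaveLabel] at this
  rw [Int.abs_eq_natAbs]
  omega

/-- The number of accumulators. -/
def width : ℕ := 2 * I.accBound + 1

/-- The number of master states and configurations of slaves. -/
def configs : ℕ := I.masterStates + I.slaves * I.endPos * I.width

@[simp] theorem eval_widthE (t : ℤ) : widthE.eval (memory I.mem t) = I.width := by
  simp [widthE, width]

@[simp] theorem eval_nZ (t : ℤ) : nZ.eval (memory I.mem t) = I.configs := by
  simp [nZ, configs]

theorem mem_seven : I.mem 7 0 = I.configs * I.chainStates := by
  have hcc : I.cellCount 5 = 1 := by rw [I.cellCount_eq (by norm_num)]; simp [stages]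
  rw [I.mem_fill (i := 5) (by norm_num) (by decide) le_rfl (by rw [hcc]; norm_num)]
  simp [stages]

/-- The number of states of the product with the chain. -/
def dim : ℕ := I.configs * I.chainStates

@[simp] theorem eval_nX (t : ℤ) : nX.eval (memory I.mem t) = I.dim := by
  rw [nX, eval_read (by norm_num), eval_zero, mem_seven, dim]
  push_cast; rfl

@[simp] theorem eval_nN (t : ℤ) : nN.eval (memory I.mem t) = (2 * I.dim : ℕ) := by
  simp [nN]

end DistributionInput


open RamExpr

namespace DistributionInput

open Program

variable (I : DistributionInput)

/-! ### The tables of transitions -/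

section

variable (t : ℤ) (e f : RamExpr)

theorem eval_maxE (σ : Store) : (maxE e f).eval σ = max (e.eval σ) (f.eval σ) := by
  rw [maxE, eval_iteE_ltE]
  split_ifs <;> omega

theorem eval_minE (σ : Store) : (minE e f).eval σ = min (e.eval σ) (f.eval σ) := by
  rw [minE, eval_iteE_ltE]
  split_ifs <;> omega

@[simp] theorem eval_updE : (updE e f).eval (memory I.mem t) =
    I.g.upd (e.eval (memory I.mem t)) (f.eval (memory I.mem t)) := by
  have hb := I.eval_boundE t
  rw [updE, tagCases]
  simp only [eval_iteE_eqE, eval_tagE, eval_zero, eval_one, eval_two, eval_three, eval_maxE,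
    eval_minE, eval_sub, eval_add, hb, eval_iteE_ltE]
  cases I.g with
  | boundedSum B =>
    simp only [tag, FinVal.upd, FinVal.bound]
    norm_num
    simp only [abs_le]
    split_ifs <;> omega
  | _ => simp [tag, FinVal.upd]

@[simp] theorem eval_accValE : (accValE e).eval (memory I.mem t) =
    I.g.accVal (e.eval (memory I.mem t)) := by
  have hb := I.eval_boundE t
  rw [accValE, tagCases]
  simp only [eval_iteE_eqE, eval_tagE, eval_zero, eval_one, eval_two, eval_three, eval_maxE,
    eval_minE, eval_sub, hb]
  cases I.g <;> simp [tag, FinVal.accVal, FinVal.bound]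

@[simp] theorem eval_extraE : (extraE e).eval (memory I.mem t) =
    I.g.extra (e.eval (memory I.mem t)) := by
  rw [extraE, tagCases]
  simp only [eval_iteE_eqE, eval_tagE, eval_zero, eval_one, eval_two, eval_three, eval_maxE,
    eval_sub]
  cases I.g <;> simp [tag, FinVal.extra, abs]

@[simp] theorem eval_initAccE : initAccE.eval (memory I.mem t) = I.g.initAcc I.accBound := by
  rw [initAccE, tagCases]
  simp only [eval_iteE_eqE, eval_tagE, eval_zero, eval_one, eval_two, eval_three,
    eval_sub, eval_accE]
  cases I.g <;> simp [tag, FinVal.initAcc]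

end

/-- The index of a configuration of a slave automaton. -/
def config (j p c : ℤ) : ℤ := I.masterStates + (j * I.endPos + p) * I.width + (c + I.accBound)

@[simp] theorem eval_configE (e f g : RamExpr) (t : ℤ) : (configE e f g).eval (memory I.mem t) =
    I.config (e.eval (memory I.mem t)) (f.eval (memory I.mem t)) (g.eval (memory I.mem t)) := by
  simp only [configE, eval_add, eval_mul, eval_nQ, eval_endE, eval_widthE, eval_accE, config]

variable {I}

section Config

variable {j : Fin I.slaves} {p : Fin (I.slaveStates j)} {c : ℤ}

theorem acc_range (hc : |c| ≤ (I.accBound : ℤ)) :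
    0 ≤ c + I.accBound ∧ c + I.accBound < I.width := by
  rw [abs_le] at hc
  rw [width]
  push_cast
  omega

theorem config_div (hc : |c| ≤ (I.accBound : ℤ)) :
    (I.config j p c - I.masterStates) / I.width = (j : ℕ) * I.endPos + (p : ℕ) := by
  have h := acc_range hc
  rw [config, show ∀ a b d : ℤ, a + b + d - a = b + d by intros; ring, mul_add_ediv h.1 h.2]

theorem config_mod (hc : |c| ≤ (I.accBound : ℤ)) :
    (I.config j p c - I.masterStates) % I.width = c + I.accBound := by
  have h := acc_range hc
  rw [config, show ∀ a b d : ℤ, a + b + d - a = b + d by intros; ring, mul_add_emod h.1 h.2]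

theorem state_lt (p : Fin (I.slaveStates j)) : ((p : ℕ) : ℤ) < I.endPos := by
  have := I.statesOf_le_endPos j
  have := p.2
  omega

theorem config_nonneg (hc : |c| ≤ (I.accBound : ℤ)) : (I.masterStates : ℤ) ≤ I.config j p c := by
  have h := acc_range hc
  have : (0 : ℤ) ≤ ((j : ℕ) * I.endPos + (p : ℕ)) * I.width := by positivity
  rw [config]
  omega

theorem config_lt (hc : |c| ≤ (I.accBound : ℤ)) : I.config j p c < I.configs := by
  have h := acc_range hc
  obtain ⟨d, hd⟩ := Int.eq_ofNat_of_zero_le h.1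
  rw [hd] at h
  have h1 := mul_add_lt (mul_add_lt j.2 (lt_of_lt_of_le p.2 (I.statesOf_le_endPos j)))
    (show d < I.width by omega)
  rw [config, hd, configs]
  push_cast
  have h2 : (((j * I.endPos + p) * I.width + d : ℕ) : ℤ) < (I.slaves * I.endPos * I.width : ℕ) := by
    exact_mod_cast h1
  push_cast at h2
  omega

variable {t : ℤ} {e : RamExpr}

theorem eval_slaveE_config (hc : |c| ≤ (I.accBound : ℤ))
    (he : e.eval (memory I.mem t) = I.config j p c) :
    (slaveE e).eval (memory I.mem t) = (j : ℕ) := by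
  simp only [slaveE, eval_div, eval_sub, eval_nQ, eval_widthE, eval_endE, he]
  rw [config_div hc, mul_add_ediv (by positivity) (state_lt p)]

theorem eval_stateE_config (hc : |c| ≤ (I.accBound : ℤ))
    (he : e.eval (memory I.mem t) = I.config j p c) :
    (stateE e).eval (memory I.mem t) = (p : ℕ) := by
  simp only [stateE, eval_modE, eval_div, eval_sub, eval_nQ, eval_widthE, eval_endE, he]
  rw [config_div hc, mul_add_emod (by positivity) (state_lt p)]

theorem eval_counterE_config (hc : |c| ≤ (I.accBound : ℤ))
    (he : e.eval (memory I.mem t) = I.config j p c) :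
    (counterE e).eval (memory I.mem t) = c := by
  simp only [counterE, eval_modE, eval_sub, eval_nQ, eval_widthE, eval_accE, he]
  rw [config_mod hc]
  ring

theorem eval_posE_config (hc : |c| ≤ (I.accBound : ℤ))
    (he : e.eval (memory I.mem t) = I.config j p c) :
    (posE e).eval (memory I.mem t) = I.slavePos j + 2 + p * I.row := by
  rw [posE, eval_add, eval_add, eval_mul, eval_stateE_config hc he, eval_rowE,
    eval_read (by norm_num), eval_slaveE_config hc he, I.mem_two j.2.le, eval_two]

theorem eval_weightE_config (hc : |c| ≤ (I.accBound : ℤ))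
    (he : e.eval (memory I.mem t) = I.config j p c) {f : RamExpr} {b : Fin I.letters}
    (hf : f.eval (memory I.mem t) = (b : ℕ)) :
    (weightE e f).eval (memory I.mem t) = (I.nwa.slave j).label p b := by
  rw [weightE, eval_inp_mem, eval_add, eval_add, eval_mul, eval_posE_config hc he, hf, eval_two,
    cell_slaveLabel]

end Config

/-- A letter and its address. -/
theorem eval_zE {z : ℤ} (b : Fin I.letters) :
    zE.eval (memory I.mem (z * I.letters + (b : ℕ))) = z := by
  simp only [zE, eval_div, eval_ctr, eval_nA]
  exact mul_add_ediv (by positivity) (by exact_mod_cast b.2)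

theorem eval_bE {z : ℤ} (b : Fin I.letters) :
    bE.eval (memory I.mem (z * I.letters + (b : ℕ))) = (b : ℕ) := by
  simp only [bE, eval_modE, eval_ctr, eval_nA]
  exact mul_add_emod (by positivity) (by exact_mod_cast b.2)

theorem trans_range {z : ℤ} (h0 : 0 ≤ z) {n : ℕ} (h1 : z < n) (b : Fin I.letters) :
    0 ≤ z * I.letters + (b : ℕ) ∧ z * I.letters + (b : ℕ) < (n * I.letters : ℕ) := by
  obtain ⟨d, rfl⟩ := Int.eq_ofNat_of_zero_le h0
  exact ⟨by positivity, by exact_mod_cast mul_add_lt (by omega : d < n) b.2⟩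

theorem cellCount_six : I.cellCount 6 = I.configs := I.cellCount_of (by norm_num) (by simp [stages])
theorem cellCount_trans {i : ℕ} (hi : i ∈ [7, 8, 9, 11, 12, 13]) :
    I.cellCount i = I.configs * I.letters := by
  fin_cases hi <;> exact I.cellCount_of (by norm_num) (by simp [stages])
theorem cellCount_ten : I.cellCount 10 = I.masterStates * I.letters :=
  I.cellCount_of (by norm_num) (by simp [stages])

theorem master_lt_configs {z : ℤ} (h : z < I.masterStates) : z < I.configs := by
  rw [configs]; push_cast
  have : (0 : ℤ) ≤ I.slaves * I.endPos * I.width := by positivity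
  omega

theorem stop_master {z : ℤ} (h0 : 0 ≤ z) (h : z < I.masterStates) : I.mem 8 z = 0 := by
  rw [I.mem_fill (i := 6) (by norm_num) (by decide) h0
    (by rw [cellCount_six]; exact master_lt_configs h)]
  simp [stages, h]

section Config

variable {j : Fin I.slaves} {p : Fin (I.slaveStates j)} {c : ℤ}

theorem stop_config (hc : |c| ≤ (I.accBound : ℤ)) :
    I.mem 8 (I.config j p c) = if (I.nwa.slave j).accept p then 1 else 0 := by
  have h0 := config_nonneg (p := p) hc
  have he : ctr.eval (memory I.mem (I.config j p c)) = I.config j p c := eval_ctr _ _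
  rw [I.mem_fill (i := 6) (by norm_num) (by decide) (by omega)
    (by rw [cellCount_six]; exact config_lt hc)]
  simp only [stages, eval_iteE_ltE, eval_stateE_config hc he, eval_inp_mem, eval_posE_config hc he,
    eval_read (a := 2) (by norm_num), eval_slaveE_config hc he, mem_two I j.2.le, cell_slaveStates,
    cell_slaveAccept, he, eval_nQ, eval_one]
  rw [if_neg (by omega), if_pos (by exact_mod_cast p.2)]

variable (b : Fin I.letters)

theorem update_config (hc : |c| ≤ (I.accBound : ℤ)) :
    I.mem 9 (I.config j p c * I.letters + (b : ℕ)) = I.g.upd c ((I.nwa.slave j).label p b) := by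
  have h0 := config_nonneg (p := p) hc
  have h1 := trans_range (by omega) (config_lt (p := p) hc) b
  rw [I.mem_fill (i := 7) (by norm_num) (by decide) h1.1
    (by rw [cellCount_trans (by simp)]; exact h1.2)]
  have he := eval_zE (z := I.config j p c) b
  have hb := eval_bE (z := I.config j p c) b
  simp only [stages, eval_updE, eval_counterE_config hc he, eval_weightE_config hc he hb]

theorem next_config (hc : |c| ≤ (I.accBound : ℤ)) :
    I.mem 10 (I.config j p c * I.letters + (b : ℕ)) =
      I.config j ((I.nwa.slave j).next p b : ℕ) (I.g.upd c ((I.nwa.slave j).label p b)) := by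
  have h0 := config_nonneg (p := p) hc
  have h1 := trans_range (by omega) (config_lt (p := p) hc) b
  rw [I.mem_fill (i := 8) (by norm_num) (by decide) h1.1
    (by rw [cellCount_trans (by simp)]; exact h1.2)]
  have he := eval_zE (z := I.config j p c) b
  have hb := eval_bE (z := I.config j p c) b
  simp only [stages, eval_iteE_ltE, he, eval_nQ, eval_configE, eval_slaveE_config hc he,
    eval_inp_mem, eval_add, eval_posE_config hc he, eval_one, eval_mul, eval_two, hb,
    cell_slaveNext, eval_read (a := 9) (by norm_num), eval_ctr, update_config b hc]
  rw [if_neg (by omega)]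

theorem reward_config (hc : |c| ≤ (I.accBound : ℤ)) :
    I.mem 11 (I.config j p c * I.letters + (b : ℕ)) =
      I.g.increment c ((I.nwa.slave j).label p b) := by
  have h0 := config_nonneg (p := p) hc
  have h1 := trans_range (by omega) (config_lt (p := p) hc) b
  rw [I.mem_fill (i := 9) (by norm_num) (by decide) h1.1
    (by rw [cellCount_trans (by simp)]; exact h1.2)]
  have he := eval_zE (z := I.config j p c) b
  have hb := eval_bE (z := I.config j p c) b
  simp only [stages, eval_add, eval_sub, eval_accValE, eval_extraE, eval_counterE_config hc he,
    eval_weightE_config hc he hb, eval_read (a := 9) (by norm_num), eval_ctr, update_config b hc,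
    FinVal.increment]

end Config

/-- Every state that does not halt is a master state or a configuration. -/
theorem exists_config {z : ℤ} (h0 : I.masterStates ≤ z) (h1 : z < I.configs) (hz : I.mem 8 z ≠ 1) :
    ∃ (j : Fin I.slaves) (p : Fin (I.slaveStates j)) (c : ℤ), |c| ≤ (I.accBound : ℤ) ∧
      z = I.config j p c := by
  obtain ⟨u, hu⟩ := Int.eq_ofNat_of_zero_le (show 0 ≤ z - I.masterStates by omega)
  have hlt : u < I.slaves * I.endPos * I.width := by
    rw [configs] at h1
    push_cast at h1
    have : (u : ℤ) < I.slaves * I.endPos * I.width := by omega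
    exact_mod_cast this
  have hW : 0 < I.width := by rw [width]; omega
  have h2 : u / I.width < I.slaves * I.endPos := Nat.div_lt_of_lt_mul (by rwa [mul_comm])
  have hE : 0 < I.endPos := Nat.pos_of_ne_zero fun h => by simp [h] at h2
  have h3 : u / I.width / I.endPos < I.slaves := Nat.div_lt_of_lt_mul (by rwa [mul_comm])
  have h4 : u / I.width % I.endPos < I.endPos := Nat.mod_lt _ hE
  have h5 : u % I.width < I.width := Nat.mod_lt _ hW
  set j : Fin I.slaves := ⟨u / I.width / I.endPos, h3⟩ with hj
  have hcfg : z = I.config (j : ℕ) (u / I.width % I.endPos : ℕ) ((u % I.width : ℕ) - I.accBound) := by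
    have e1 := Nat.div_add_mod' u I.width
    have e2 := Nat.div_add_mod' (u / I.width) I.endPos
    rw [config]
    have : (u : ℤ) = ((u / I.width / I.endPos : ℕ) * I.endPos + (u / I.width % I.endPos : ℕ)) *
        I.width + (u % I.width : ℕ) := by
      have : u = (u / I.width / I.endPos * I.endPos + u / I.width % I.endPos) * I.width +
        u % I.width := by rw [e2, e1]
      exact_mod_cast this
    simp only [hj]
    omega
  -- Indices with a state digit out of range carry the halting flag `1` and are excluded by `hz`.
  have hp : u / I.width % I.endPos < I.slaveStates j := by
    by_contra hp
    apply hz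
    rw [I.mem_fill (i := 6) (by norm_num) (by decide) (by omega)
      (by rw [cellCount_six]; exact h1)]
    have e1 : (slaveE ctr).eval (memory I.mem z) = (j : ℕ) := by
      simp only [slaveE, eval_div, eval_sub, eval_nQ, eval_widthE, eval_endE, eval_ctr, hu, hj]
      exact_mod_cast rfl
    have e2 : (stateE ctr).eval (memory I.mem z) = (u / I.width % I.endPos : ℕ) := by
      simp only [stateE, eval_modE, eval_div, eval_sub, eval_nQ, eval_widthE, eval_endE, eval_ctr, hu]
      exact_mod_cast rfl
    simp only [stages, eval_iteE_ltE, e1, e2, eval_inp_mem, eval_read (a := 2) (by norm_num),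
      mem_two I j.2.le, cell_slaveStates, eval_ctr, eval_nQ, eval_one]
    rw [if_neg (by omega), if_neg (by exact_mod_cast hp)]
  refine ⟨j, ⟨_, hp⟩, (u % I.width : ℕ) - I.accBound, ?_, hcfg⟩
  have : I.width = 2 * I.accBound + 1 := rfl
  rw [abs_le]
  omega

/-! ### The transitions of the master automaton -/

section Master

variable (q : Fin I.masterStates) (b : Fin I.letters)

/-- The slave automaton that is started. -/
def started : Fin I.slaves := I.nwa.master.label q b

theorem abs_initAcc : |I.g.initAcc I.accBound| ≤ (I.accBound : ℤ) := FinVal.abs_initAcc_le _ _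

theorem master_range : 0 ≤ ((q : ℕ) : ℤ) * I.letters + (b : ℕ) ∧
    ((q : ℕ) : ℤ) * I.letters + (b : ℕ) < (I.configs * I.letters : ℕ) :=
  trans_range (by positivity) (master_lt_configs (by exact_mod_cast q.2)) b

theorem next_master : I.mem 10 (q * I.letters + b) = (I.nwa.master.next q b : ℕ) := by
  have h1 := master_range q b
  rw [I.mem_fill (i := 8) (by norm_num) (by decide) h1.1
    (by rw [cellCount_trans (by simp)]; exact h1.2)]
  simp only [stages, eval_iteE_ltE, eval_zE, eval_nQ, eval_inp_mem, eval_add, eval_masterE,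
    eval_one, eval_mul, eval_rowE, eval_two, eval_bE, cell_masterNext]
  rw [if_pos (by exact_mod_cast q.2)]

theorem launch_master : I.mem 12 (q * I.letters + b) =
    I.config (started q b : ℕ) ((I.nwa.slave (started q b)).init : ℕ) (I.g.initAcc I.accBound) := by
  have h1 := trans_range (z := (q : ℕ)) (by positivity) (by exact_mod_cast q.2) b
  rw [I.mem_fill (i := 10) (by norm_num) (by decide) h1.1 (by rw [cellCount_ten]; exact h1.2)]
  simp only [stages, eval_configE, eval_inp_mem, eval_add, eval_masterE, eval_one, eval_mul,
    eval_zE, eval_rowE, eval_two, eval_bE, cell_masterLabel, eval_read (a := 2) (by norm_num),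
    mem_two I (I.nwa.master.label q b).2.le, cell_slaveInit, eval_initAccE, started]

theorem active_master : I.mem 13 (q * I.letters + b) =
    if (I.nwa.slave (started q b)).accept (I.nwa.slave (started q b)).init then 0 else 1 := by
  have h1 := master_range q b
  rw [I.mem_fill (i := 11) (by norm_num) (by decide) h1.1
    (by rw [cellCount_trans (by simp)]; exact h1.2)]
  simp only [stages, eval_iteE_ltE, eval_zE, eval_nQ, eval_sub, eval_one, stopE,
    eval_read (a := 8) (by norm_num), eval_read (a := 12) (by norm_num), eval_ctr, launch_master,
    stop_config abs_initAcc]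
  rw [if_pos (by exact_mod_cast q.2)]
  split_ifs <;> rfl

theorem eval_launchE : launchE.eval (memory I.mem (q * I.letters + b)) =
    I.config (started q b : ℕ) ((I.nwa.slave (started q b)).init : ℕ) (I.g.initAcc I.accBound) *
      I.letters + (b : ℕ) := by
  simp only [launchE, eval_add, eval_mul, eval_read (a := 12) (by norm_num), eval_ctr,
    launch_master, eval_nA, eval_bE]

theorem start_master : I.mem 14 (q * I.letters + b) =
    I.config (started q b : ℕ)
      ((I.nwa.slave (started q b)).next (I.nwa.slave (started q b)).init b : ℕ)
      (I.g.upd (I.g.initAcc I.accBound)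
        ((I.nwa.slave (started q b)).label (I.nwa.slave (started q b)).init b)) := by
  have h1 := master_range q b
  rw [I.mem_fill (i := 12) (by norm_num) (by decide) h1.1
    (by rw [cellCount_trans (by simp)]; exact h1.2)]
  simp only [stages, eval_read (a := 10) (by norm_num), eval_launchE, next_config b abs_initAcc]

theorem payoff_master : I.mem 15 (q * I.letters + b) = I.mem 13 (q * I.letters + b) *
    (I.threshold.den * (I.g.accVal (I.g.initAcc I.accBound) + I.g.increment (I.g.initAcc I.accBound)
      ((I.nwa.slave (started q b)).label (I.nwa.slave (started q b)).init b)) - I.threshold.num) := by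
  have h1 := master_range q b
  rw [I.mem_fill (i := 13) (by norm_num) (by decide) h1.1
    (by rw [cellCount_trans (by simp)]; exact h1.2)]
  simp only [stages, eval_iteE_ltE, eval_zE, eval_nQ, eval_mul, eval_read (a := 13) (by norm_num),
    eval_ctr, eval_sub, eval_denE, eval_numE, eval_add, eval_accValE, eval_initAccE,
    eval_read (a := 11) (by norm_num), eval_launchE, reward_config b abs_initAcc]
  rw [if_pos (by exact_mod_cast q.2)]

end Master

theorem active_slave {z : ℤ} (h0 : I.masterStates ≤ z) (h1 : z < I.configs) (b : Fin I.letters) :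
    I.mem 13 (z * I.letters + (b : ℕ)) = 0 := by
  have h2 := trans_range (by omega) h1 b
  rw [I.mem_fill (i := 11) (by norm_num) (by decide) h2.1
    (by rw [cellCount_trans (by simp)]; exact h2.2)]
  simp only [stages, eval_iteE_ltE, eval_zE, eval_nQ, eval_zero]
  rw [if_neg (by omega)]

theorem payoff_slave {z : ℤ} (h0 : I.masterStates ≤ z) (h1 : z < I.configs) (b : Fin I.letters) :
    I.mem 15 (z * I.letters + (b : ℕ)) = I.threshold.den * I.mem 11 (z * I.letters + (b : ℕ)) := by
  have h2 := trans_range (by omega) h1 b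
  rw [I.mem_fill (i := 13) (by norm_num) (by decide) h2.1
    (by rw [cellCount_trans (by simp)]; exact h2.2)]
  simp only [stages, eval_iteE_ltE, eval_zE, eval_nQ, eval_mul, eval_denE,
    eval_read (a := 11) (by norm_num), eval_ctr]
  rw [if_neg (by omega)]

end DistributionInput


open RamExpr

/-! ### The table of the states of the elimination -/

namespace Elim

/-- The list of numbers that represents a state of the elimination. -/
def block (N : ℕ) (s : Elim) (u : ℕ) : ℤ :=
  if u < N * (2 * N) then s.entry (u / (2 * N)) (u % (2 * N))
  else if u < N * (2 * N) + N then s.used (u - N * (2 * N)) else s.pivot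

/-- The length of the representation. -/
def blockLength (N : ℕ) : ℕ := N * (2 * N) + N + 1

variable {N : ℕ} {s : Elim} {i j : ℕ}

theorem block_entry (hi : i < N) (hj : j < 2 * N) : s.block N (i * (2 * N) + j) = s.entry i j := by
  have h : 0 < 2 * N := by omega
  rw [block, if_pos (mul_add_lt hi hj), add_comm, Nat.add_mul_div_right _ _ h,
    Nat.add_mul_mod_self_right, Nat.div_eq_of_lt hj, Nat.mod_eq_of_lt hj, zero_add]

theorem block_used (hi : i < N) : s.block N (N * (2 * N) + i) = s.used i := by
  rw [block, if_neg (by omega), if_pos (by omega), Nat.add_sub_cancel_left]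

theorem block_pivot : s.block N (N * (2 * N) + N) = s.pivot := by
  rw [block, if_neg (by omega), if_neg (by omega)]

end Elim

namespace Program

theorem eval_blockE {σ : Store} {N : ℕ} (hN : nN.eval σ = N) :
    blockE.eval σ = Elim.blockLength N := by
  simp only [blockE, eval_add, eval_mul, eval_two, eval_one, hN, Elim.blockLength]
  push_cast; rfl

section

variable {σ : Store} {N : ℕ} {s : Elim} {t : ℕ} {et : RamExpr}

theorem eval_entryE (hN : nN.eval σ = N) (ht : et.eval σ = t)
    (hs : ∀ v < Elim.blockLength N, σ 20 (t * Elim.blockLength N + v) = s.block N v)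
    {ei ej : RamExpr} {i j : ℕ} (hi : ei.eval σ = i) (hj : ej.eval σ = j) (hiN : i < N)
    (hjN : j < 2 * N) : (entryE et ei ej).eval σ = s.entry i j := by
  have hlt : i * (2 * N) + j < N * (2 * N) := mul_add_lt hiN hjN
  rw [← Elim.block_entry hiN hjN, ← hs _ (by rw [Elim.blockLength]; omega)]
  change σ 20 _ = _
  simp only [eval_add, eval_mul, ht, eval_blockE hN, hi, hj, hN, eval_two]
  push_cast; rfl

theorem eval_usedE (hN : nN.eval σ = N) (ht : et.eval σ = t)
    (hs : ∀ v < Elim.blockLength N, σ 20 (t * Elim.blockLength N + v) = s.block N v)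
    {ei : RamExpr} {i : ℕ} (hi : ei.eval σ = i) (hiN : i < N) :
    (usedE et ei).eval σ = s.used i := by
  rw [← Elim.block_used hiN, ← hs _ (by rw [Elim.blockLength]; omega)]
  change σ 20 _ = _
  simp only [eval_add, eval_mul, ht, eval_blockE hN, hi, hN, eval_two]
  push_cast; rfl

theorem eval_pivotE (hN : nN.eval σ = N) (ht : et.eval σ = t)
    (hs : ∀ v < Elim.blockLength N, σ 20 (t * Elim.blockLength N + v) = s.block N v) :
    (pivotE et).eval σ = s.pivot := by
  rw [← Elim.block_pivot (N := N), ← hs _ (by rw [Elim.blockLength]; omega)]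
  change σ 20 _ = _
  simp only [eval_add, eval_mul, ht, eval_blockE hN, hN, eval_two]
  push_cast; rfl

theorem eval_elimStepE (hN : nN.eval σ = N) (ht : et.eval σ = t)
    (hs : ∀ v < Elim.blockLength N, σ 20 (t * Elim.blockLength N + v) = s.block N v)
    {eu : RamExpr} {u : ℕ} (hu : eu.eval σ = u) (htN : t < N * N)
    (huL : u < Elim.blockLength N) :
    (elimStepE et eu).eval σ = (s.next N t).block N u := by
  have hN0 : 0 < N := Nat.pos_of_ne_zero (by rintro rfl; simp at htN)
  have hr : t % N < N := Nat.mod_lt _ hN0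
  have hc : t / N < N := Nat.div_lt_of_lt_mul htN
  have er : (modE et nN).eval σ = (t % N : ℕ) := by rw [eval_modE, ht, hN]; rfl
  have ec : (et / nN).eval σ = (t / N : ℕ) := by rw [eval_div, ht, hN]; rfl
  have ei : (eu / (2 * nN)).eval σ = (u / (2 * N) : ℕ) := by
    rw [eval_div, eval_mul, eval_two, hu, hN]; rfl
  have ej : (modE eu (2 * nN)).eval σ = (u % (2 * N) : ℕ) := by
    rw [eval_modE, eval_mul, eval_two, hu, hN]; rfl
  have h1 := eval_entryE hN ht hs er ec hr (by omega)
  have h2 := eval_usedE hN ht hs er hr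
  have hcond : (eqE (usedE et (modE et nN)) 0 * (1 - eqE (entryE et (modE et nN) (et / nN)) 0)).eval σ
      = if s.used (t % N) = 0 ∧ s.entry (t % N) (t / N) ≠ 0 then 1 else 0 := by
    simp only [eval_mul, eval_sub, eval_eqE, eval_one, eval_zero, h1, h2]
    by_cases h3 : s.used (t % N) = 0 <;> by_cases h4 : s.entry (t % N) (t / N) = 0 <;> simp [h3, h4]
  rw [elimStepE, eval_iteE _ _ _ _ hcond, Elim.next]
  split_ifs with h
  · rw [eval_iteE_ltE, eval_iteE_ltE, hu]
    have e1 : (nN * (2 * nN)).eval σ = (N * (2 * N) : ℕ) := by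
      simp only [eval_mul, eval_two, hN]; push_cast; rfl
    have e2 : (nN * (2 * nN) + nN).eval σ = (N * (2 * N) + N : ℕ) := by
      simp only [eval_add, eval_mul, eval_two, hN]; push_cast; rfl
    rw [e1, e2]
    simp only [Nat.cast_lt, Elim.block]
    rcases lt_or_ge u (N * (2 * N)) with hu1 | hu1
    · rw [if_pos hu1, if_pos hu1]
      have hiN : u / (2 * N) < N := Nat.div_lt_of_lt_mul (by rwa [mul_comm] at hu1)
      have hjN : u % (2 * N) < 2 * N := Nat.mod_lt _ (by omega)
      rw [eval_iteE_eqE, er, ei, eval_entryE hN ht hs ei ej hiN hjN, eval_div, eval_sub, eval_mul,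
        eval_mul, h1, eval_entryE hN ht hs ei ej hiN hjN, eval_entryE hN ht hs ei ec hiN (by omega),
        eval_entryE hN ht hs er ej hr hjN, eval_pivotE hN ht hs]
      simp only [Nat.cast_inj]
    rw [if_neg hu1.not_gt, if_neg hu1.not_gt]
    rcases lt_or_ge u (N * (2 * N) + N) with hu2 | hu2
    · rw [if_pos hu2, if_pos hu2]
      have ek : (eu - nN * (2 * nN)).eval σ = (u - N * (2 * N) : ℕ) := by
        rw [eval_sub, hu, e1]; omega
      rw [eval_iteE_eqE, ek, er, eval_add, ec, eval_one, eval_usedE hN ht hs ek (by omega)]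
      simp only [Nat.cast_inj]
      split_ifs <;> simp
    · rw [if_neg hu2.not_gt, if_neg hu2.not_gt]
      exact h1
  · rw [← hs u huL]
    change σ 20 _ = _
    simp only [eval_add, eval_mul, ht, eval_blockE hN, hu]

end

end Program

namespace DistributionInput

open Program

variable (I : DistributionInput)

theorem configs_pos : 0 < I.configs := by
  have := I.masterStates_pos
  rw [configs]; omega

theorem dim_pos : 0 < I.dim := Nat.mul_pos I.configs_pos I.chainStates_pos

/-- The number of equations. -/
def order : ℕ := 2 * I.dim

theorem order_pos : 0 < I.order := Nat.mul_pos two_pos I.dim_pos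

/-- The matrix of the system of linear equations. -/
def system (r c : ℕ) : ℤ := I.mem 19 (r * I.order + c)

/-- The states of the elimination. -/
def elim (t : ℕ) : Elim := Elim.run I.order (Elim.extend I.order I.system) t

theorem cellCount_elim :
    I.cellCount 18 = (I.order * I.order + 1) * Elim.blockLength I.order := by
  refine I.cellCount_of (by norm_num) ?_
  simp only [stages, eval_mul, eval_add, eval_one, eval_blockE (I.eval_nN 0), eval_nN, order]
  push_cast; rfl

theorem mem_elim_eq (j : ℤ) : I.mem 20 j = if 0 ≤ j ∧ j < I.cellCount 18 then
    (I.elim (j.toNat / Elim.blockLength I.order)).block I.order (j.toNat % Elim.blockLength I.order)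
    else 0 := by
  set L := Elim.blockLength I.order with hL
  have hL0 : 0 < L := Nat.succ_pos _
  refine arr_eq_of_scan (P := stages) (i := 18) (fun a ha => (size_arrays 18 (by norm_num) a ha).1)
    (val_arrays 18 (by norm_num)) (F := fun j => (I.elim (j.toNat / L)).block I.order (j.toNat % L))
    (fun t ht => ?_) j
  change t < I.cellCount 18 at ht
  rw [cellCount_elim, ← hL] at ht
  set f : ℤ → ℤ := fun j => if 0 ≤ j ∧ j < (t : ℤ) then
    (I.elim (j.toNat / L)).block I.order (j.toNat % L) else 0 with hf
  change (stages 18).val.eval (memory (Function.update I.mem 20 f) t) = _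
  set σ := memory (Function.update I.mem 20 f) t with hσ
  have hN : nN.eval σ = I.order := by
    rw [order, ← I.eval_nN t]
    refine eval_congr _ fun a ha => ?_
    have : a ≠ 20 := fun h => absurd (h ▸ ha) (by decide)
    funext j
    simp [hσ, memory, this]
  have hctr : ctr.eval σ = t := eval_ctr _ _
  have h20 : ∀ j, σ 20 j = f j := fun j => by simp [hσ, memory]
  have h19 : ∀ j, σ 19 j = I.mem 19 j := fun j => by simp [hσ, memory]
  have heu : (modE ctr blockE).eval σ = (t % L : ℕ) := by
    rw [eval_modE, hctr, eval_blockE hN]; rfl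
  have hmod : t % L < L := Nat.mod_lt _ hL0
  have hdm := Nat.div_add_mod' t L
  simp only [stages, eval_iteE_ltE, hctr, eval_blockE hN, ← hL, Int.toNat_natCast, Nat.cast_lt]
  split_ifs with htL
  · rw [Nat.div_eq_of_lt htL, Nat.mod_eq_of_lt htL, elim, Elim.run, elimInitE, Elim.block]
    have e1 : (nN * (2 * nN)).eval σ = (I.order * (2 * I.order) : ℕ) := by
      simp only [eval_mul, eval_two, hN]; push_cast; rfl
    have ej : (modE ctr (2 * nN)).eval σ = (t % (2 * I.order) : ℕ) := by
      rw [eval_modE, eval_mul, eval_two, hctr, hN]; rfl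
    have ei : (ctr / (2 * nN)).eval σ = (t / (2 * I.order) : ℕ) := by
      rw [eval_div, eval_mul, eval_two, hctr, hN]; rfl
    rw [eval_iteE_ltE, eval_iteE_ltE, eval_eqE, eval_eqE, ej, eval_add, eval_add, e1, ei, hN, hctr]
    simp only [Nat.cast_lt]
    rcases lt_or_ge t (I.order * (2 * I.order)) with h1 | h1
    · rw [if_pos h1, if_pos h1]
      rw [Elim.extend]
      simp only [← Nat.cast_add, Nat.cast_inj]
      split_ifs
      · change σ 19 _ = _
        rw [h19, system, eval_add, eval_mul, ei, ej, hN]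
      · rfl
      · rfl
    · rw [if_neg h1.not_gt, if_neg h1.not_gt]
      simp only [← Nat.cast_add, Nat.cast_inj]
      have : L = I.order * (2 * I.order) + I.order + 1 := rfl
      split_ifs <;> first | rfl | (exfalso; omega)
  · have hd1 : 1 ≤ t / L := (Nat.one_le_div_iff hL0).2 (by omega)
    have hd2 : t / L < I.order * I.order + 1 := Nat.div_lt_of_lt_mul (by rwa [mul_comm])
    have het : (ctr / blockE - 1 : RamExpr).eval σ = (t / L - 1 : ℕ) := by
      rw [eval_sub, eval_div, hctr, eval_blockE hN, eval_one, Nat.cast_sub hd1]; rfl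
    rw [eval_elimStepE (s := I.elim (t / L - 1)) hN het ?_ heu (by omega) hmod]
    · conv_rhs => rw [elim, show t / L = t / L - 1 + 1 by omega, Elim.run]
      rfl
    -- The block that is read lies entirely below the address `t`, so it has already been filled.
    · intro v hv
      rw [h20, hf]
      have hlt : (t / L - 1) * L + v < t := by
        have : (t / L - 1 + 1) * L = t / L * L := by rw [Nat.sub_add_cancel hd1]
        rw [add_mul, one_mul] at this
        omega
      simp only
      rw [← hL, show (((t / L - 1 : ℕ) : ℤ) * L + v) = (((t / L - 1) * L + v : ℕ) : ℤ) by push_cast; rfl,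
        if_pos ⟨by positivity, by exact_mod_cast hlt⟩, Int.toNat_natCast, add_comm,
        Nat.add_mul_div_right _ _ hL0, Nat.add_mul_mod_self_right, Nat.div_eq_of_lt hv,
        Nat.mod_eq_of_lt hv, zero_add]

theorem mem_elim {t u : ℕ} (ht : t ≤ I.order * I.order) (hu : u < Elim.blockLength I.order) :
    I.mem 20 (t * Elim.blockLength I.order + u) = (I.elim t).block I.order u := by
  have hL0 : 0 < Elim.blockLength I.order := Nat.succ_pos _
  have hlt := mul_add_lt (show t < I.order * I.order + 1 by omega) hu
  rw [mem_elim_eq, show ((t : ℤ) * Elim.blockLength I.order + u) =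
    ((t * Elim.blockLength I.order + u : ℕ) : ℤ) by push_cast; rfl, cellCount_elim,
    if_pos ⟨by positivity, by exact_mod_cast hlt⟩, Int.toNat_natCast, add_comm,
    Nat.add_mul_div_right _ _ hL0, Nat.add_mul_mod_self_right, Nat.div_eq_of_lt hu,
    Nat.mod_eq_of_lt hu, zero_add]

/-- The final state of the elimination. -/
def solved : Elim := I.elim (I.order * I.order)

section

variable (t : ℤ)

theorem eval_order : nN.eval (memory I.mem t) = I.order := I.eval_nN t

theorem eval_order_sq : (nN * nN).eval (memory I.mem t) = (I.order * I.order : ℕ) := by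
  rw [eval_mul, eval_order]; push_cast; rfl

theorem eval_entry_solved {ei ej : RamExpr} {i j : ℕ} (hi : ei.eval (memory I.mem t) = i)
    (hj : ej.eval (memory I.mem t) = j) (hiN : i < I.order) (hjN : j < 2 * I.order) :
    (entryE (nN * nN) ei ej).eval (memory I.mem t) = I.solved.entry i j :=
  eval_entryE (I.eval_order t) (I.eval_order_sq t) (fun _ hv => I.mem_elim le_rfl hv) hi hj hiN hjN

theorem eval_used_solved {ei : RamExpr} {i : ℕ} (hi : ei.eval (memory I.mem t) = i)
    (hiN : i < I.order) :
    (usedE (nN * nN) ei).eval (memory I.mem t) = I.solved.used i :=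
  eval_usedE (I.eval_order t) (I.eval_order_sq t) (fun _ hv => I.mem_elim le_rfl hv) hi hiN

theorem eval_pivot_solved : (pivotE (nN * nN)).eval (memory I.mem t) = I.solved.pivot :=
  eval_pivotE (I.eval_order t) (I.eval_order_sq t) (fun _ hv => I.mem_elim le_rfl hv)

end

end DistributionInput


/-! ### The coefficients of the linear system. -/

open RamExpr

namespace DistributionInput

open Program

variable (I : DistributionInput)

theorem mem_sum {i : ℕ} (hi : i < 24) {w e : RamExpr} (hval : (stages i).val = sumE (i + 2) w e)
    (hw : ∀ a ∈ w.arrays, a < i + 2) (hw1 : 1 ∉ w.arrays) (he : ∀ a ∈ e.arrays, a < i + 2)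
    {m n : ℕ} (hm : 0 < m) (hwm : w.eval (memory I.mem 0) = m) (hn : I.cellCount i = n * m)
    {a : ℕ} (ha : a < n) : I.mem (i + 2) (a * m + (m - 1)) =
      ∑ l ∈ Finset.range m, e.eval (memory I.mem (a * m + l)) :=
  arr_sum (fun a ha => (size_arrays i hi a ha).1) hval hw hw1 he hm
    (by rw [eval_eq_memory hw1 _ 0]; exact hwm) hn ha

/-- The scaled probabilities as a table. -/
def weight (s : ℕ) (b : ℕ) (s' : ℕ) : ℤ :=
  I.mem 4 (s * (I.letters * I.chainStates) + (b * I.chainStates + s'))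

variable {I}

theorem eval_nat_div {e f : RamExpr} {σ : Store} {a b : ℕ} (he : e.eval σ = a) (hf : f.eval σ = b) :
    (e / f).eval σ = (a / b : ℕ) := by rw [eval_div, he, hf]; rfl

theorem eval_nat_mod {e f : RamExpr} {σ : Store} {a b : ℕ} (he : e.eval σ = a) (hf : f.eval σ = b) :
    (modE e f).eval σ = (a % b : ℕ) := by rw [eval_modE, he, hf]; rfl

theorem div_mul_add {q w a : ℕ} (ha : a < w) : (q * w + a) / w = q := by
  rw [add_comm, Nat.add_mul_div_right _ _ (by omega), Nat.div_eq_of_lt ha, zero_add]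

theorem mod_mul_add {q w a : ℕ} (ha : a < w) : (q * w + a) % w = a := by
  rw [add_comm, Nat.add_mul_mod_self_right, Nat.mod_eq_of_lt ha]

section Trans

variable {x y b : ℕ}

theorem eval_trans_indices (hy : y < I.dim) (hb : b < I.letters) {t : ℤ}
    (ht : t = ((x * I.dim + y) * I.letters + b : ℕ)) :
    rowIdxE.eval (memory I.mem t) = x ∧ colIdxE.eval (memory I.mem t) = y ∧
      bE.eval (memory I.mem t) = b := by
  have hz : zE.eval (memory I.mem t) = (x * I.dim + y : ℕ) := by
    rw [zE, eval_nat_div (by rw [eval_ctr, ht]) (I.eval_nA t), div_mul_add hb]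
  refine ⟨?_, ?_, ?_⟩
  · rw [rowIdxE, eval_nat_div hz (I.eval_nX t), div_mul_add hy]
  · rw [colIdxE, eval_nat_mod hz (I.eval_nX t), mod_mul_add hy]
  · rw [bE, eval_nat_mod (by rw [eval_ctr, ht]) (I.eval_nA t), mod_mul_add hb]

theorem eval_transE (hy : y < I.dim) (hb : b < I.letters) {t : ℤ}
    (ht : t = ((x * I.dim + y) * I.letters + b : ℕ)) :
    transE.eval (memory I.mem t) = (x / I.chainStates : ℕ) * I.letters + b := by
  obtain ⟨h1, _, h3⟩ := eval_trans_indices hy hb ht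
  rw [transE, eval_add, eval_mul, eval_nat_div h1 (I.eval_nS t), h3, eval_nA]

theorem eval_transProbE (hy : y < I.dim) (hb : b < I.letters) {t : ℤ}
    (ht : t = ((x * I.dim + y) * I.letters + b : ℕ)) :
    transProbE.eval (memory I.mem t) = I.weight (x % I.chainStates) b (y % I.chainStates) := by
  obtain ⟨h1, h2, h3⟩ := eval_trans_indices hy hb ht
  rw [transProbE, probE, eval_read (by norm_num)]
  simp only [eval_add, eval_mul, eval_nat_mod h1 (I.eval_nS t), eval_nat_mod h2 (I.eval_nS t), h3,
    eval_nA, eval_nS, weight]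

end Trans

theorem cellCount_table {i : ℕ} (hi : i ∈ [14, 15]) :
    I.cellCount i = I.dim * I.dim * I.letters := by
  fin_cases hi <;> exact I.cellCount_of (by norm_num) (by simp [stages])

/-- The number of transitions from one state to another state, weighted with the probabilities. -/
theorem mem_sixteen {x y : ℕ} (hx : x < I.dim) (hy : y < I.dim) :
    I.mem 16 ((x * I.dim + y) * I.letters + (I.letters - 1)) =
      ∑ b ∈ Finset.range I.letters,
        if I.mem 10 ((x / I.chainStates : ℕ) * I.letters + b) = (y / I.chainStates : ℕ) then
          I.weight (x % I.chainStates) b (y % I.chainStates) else 0 := by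
  have h := I.mem_sum (i := 14) (by norm_num) rfl (by decide) (by decide) (by decide) I.letters_pos
    (I.eval_nA 0) (cellCount_table (by simp)) (mul_add_lt hx hy)
  push_cast at h
  rw [h]
  refine Finset.sum_congr rfl fun b hb => ?_
  have hb := Finset.mem_range.1 hb
  have ht : (((x : ℤ) * I.dim + y) * I.letters + b) = ((x * I.dim + y) * I.letters + b : ℕ) := by
    push_cast; rfl
  rw [eval_iteE_eqE, eval_read (by norm_num), eval_transE hy hb ht, eval_transProbE hy hb ht,
    eval_nat_div (eval_trans_indices hy hb ht).2.1 (I.eval_nS _), eval_zero]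

/-- The same for the slave automata that are started. -/
theorem mem_seventeen {x y : ℕ} (hx : x < I.dim) (hy : y < I.dim) :
    I.mem 17 ((x * I.dim + y) * I.letters + (I.letters - 1)) =
      ∑ b ∈ Finset.range I.letters,
        if I.mem 14 ((x / I.chainStates : ℕ) * I.letters + b) = (y / I.chainStates : ℕ) then
          I.weight (x % I.chainStates) b (y % I.chainStates) *
            I.mem 13 ((x / I.chainStates : ℕ) * I.letters + b) else 0 := by
  have h := I.mem_sum (i := 15) (by norm_num) rfl (by decide) (by decide) (by decide) I.letters_pos
    (I.eval_nA 0) (cellCount_table (by simp)) (mul_add_lt hx hy)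
  push_cast at h
  rw [h]
  refine Finset.sum_congr rfl fun b hb => ?_
  have hb := Finset.mem_range.1 hb
  have ht : (((x : ℤ) * I.dim + y) * I.letters + b) = ((x * I.dim + y) * I.letters + b : ℕ) := by
    push_cast; rfl
  rw [eval_iteE_eqE, eval_mul, eval_read (by norm_num), eval_read (by norm_num),
    eval_transE hy hb ht, eval_transProbE hy hb ht,
    eval_nat_div (eval_trans_indices hy hb ht).2.1 (I.eval_nS _), eval_zero]

theorem mem_eighteen {x : ℕ} (hx : x < I.dim) :
    I.mem 18 (x * (I.letters * I.chainStates) + (I.letters * I.chainStates - 1)) =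
      ∑ l ∈ Finset.range (I.letters * I.chainStates),
        I.mem 4 ((x % I.chainStates : ℕ) * (I.letters * I.chainStates) + l) *
          I.mem 15 ((x / I.chainStates : ℕ) * I.letters + (l / I.chainStates : ℕ)) := by
  have hAS := Nat.mul_pos I.letters_pos I.chainStates_pos
  have hAS' : ∀ t, (nA * nS).eval (memory I.mem t) = (I.letters * I.chainStates : ℕ) := fun t => by
    rw [eval_mul, eval_nA, eval_nS]; push_cast; rfl
  have h := I.mem_sum (i := 16) (by norm_num) rfl (by decide) (by decide) (by decide) hAS
    (hAS' 0) (I.cellCount_of (by norm_num) (by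
      simp only [stages, eval_mul, eval_nA, eval_nS, eval_nX]; push_cast; rfl)) hx
  push_cast at h
  rw [h]
  refine Finset.sum_congr rfl fun l hl => ?_
  have hl := Finset.mem_range.1 hl
  have ht : ((x : ℤ) * (I.letters * I.chainStates) + l) =
    (x * (I.letters * I.chainStates) + l : ℕ) := by push_cast; rfl
  set t := ((x : ℤ) * (I.letters * I.chainStates) + l)
  have hc : ctr.eval (memory I.mem t) = (x * (I.letters * I.chainStates) + l : ℕ) := by
    rw [eval_ctr, ht]
  have hd : (ctr / (nA * nS)).eval (memory I.mem t) = x := by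
    rw [eval_nat_div hc (hAS' t), div_mul_add hl]
  have hm : (modE ctr (nA * nS)).eval (memory I.mem t) = l := by
    rw [eval_nat_mod hc (hAS' t), mod_mul_add hl]
  rw [eval_mul, probE, eval_read (by norm_num), eval_read (by norm_num)]
  simp only [eval_add, eval_mul, eval_nat_mod hd (I.eval_nS t), eval_nat_div hd (I.eval_nS t), hm,
    eval_nat_div hm (I.eval_nS t), eval_nA, eval_nS]

variable (I) in
/-- The table of transitions. -/
def moves (x y : ℕ) : ℤ := I.mem 16 ((x * I.dim + y) * I.letters + (I.letters - 1))

variable (I) in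
/-- The table of slave automata that are started. -/
def starts (x y : ℕ) : ℤ := I.mem 17 ((x * I.dim + y) * I.letters + (I.letters - 1))

variable (I) in
/-- Whether a state stops. -/
def stops (x : ℕ) : ℤ := I.mem 8 (x / I.chainStates : ℕ)

/-- The first `I.dim` unknowns are gains, the others biases. The first `I.dim` rows state that the
gain is harmonic at running states and that the bias is zero at halted ones; the others are the
Poisson equations, with the biases of launched slaves included. -/
theorem system_eq {r c : ℕ} (hr : r < I.order) (hc : c < I.order) : I.system r c =
    if r < I.dim then
      if c < I.dim then (1 - I.stops r) * (I.scale * (if r = c then 1 else 0) - I.moves r c)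
      else I.stops r * I.scale * (if r = c - I.dim then 1 else 0)
    else
      if c < I.dim then I.scale * (if r - I.dim = c then 1 else 0)
      else I.scale * (if r - I.dim = c - I.dim then 1 else 0) -
        (1 - I.stops (r - I.dim)) * I.moves (r - I.dim) (c - I.dim) -
        I.starts (r - I.dim) (c - I.dim) := by
  have hlt := mul_add_lt hr hc
  have ht : (r : ℤ) * I.order + c = (r * I.order + c : ℕ) := by push_cast; rfl
  rw [system, I.mem_fill (i := 17) (by norm_num) (by decide) (by positivity) (by
    rw [I.cellCount_of (n := I.order * I.order) (by norm_num) (by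
      rw [← eval_order_sq]; rfl), ht]; exact_mod_cast hlt)]
  set t := (r : ℤ) * I.order + c
  have e1 : riE.eval (memory I.mem t) = r := by
    rw [riE, eval_nat_div (by rw [eval_ctr, ht]) (I.eval_order t), div_mul_add hc]
  have e2 : ciE.eval (memory I.mem t) = c := by
    rw [ciE, eval_nat_mod (by rw [eval_ctr, ht]) (I.eval_order t), mod_mul_add hc]
  simp only [stages, matrixE, eval_iteE_ltE, e1, e2, eval_nX, Nat.cast_lt, eval_mul, eval_sub,
    eval_one, eval_scaleE, eval_eqE, tE, cE, stopE, eval_read (a := 16) (by norm_num),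
    eval_read (a := 17) (by norm_num), eval_read (a := 8) (by norm_num), eval_add, eval_nA, stops,
    moves, starts, eval_div, eval_nS]
  split_ifs <;> simp_all <;> omega

end DistributionInput


/-! ### Right-hand sides, numerators of solutions, and the answer. -/

open RamExpr

/-- The numerators of the solution that is given by the elimination. -/
def Elim.solution (s : Elim) (N : ℕ) (b : ℕ → ℤ) (c : ℕ) : ℤ :=
  ∑ r ∈ Finset.range N, if s.used r = c + 1 then
    ∑ k ∈ Finset.range N, s.entry r (N + k) * b k else 0

namespace DistributionInput

open Program

variable (I : DistributionInput)

/-- The right-hand side for the gain of the value. -/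
def rhsValue (k : ℕ) : ℤ :=
  if k < I.dim then 0 else (1 - I.stops (k - I.dim)) * I.mem 18 ((k - I.dim : ℕ) *
    (I.letters * I.chainStates) + (I.letters * I.chainStates - 1))

/-- The right-hand side for the gain of the indicator function of the states whose value is at
most the threshold. -/
def rhsIndicator (k : ℕ) : ℤ :=
  if k < I.dim then 0 else if (k - I.dim) / I.chainStates < I.masterStates then
    if 0 < I.solved.solution I.order I.rhsValue (k - I.dim) * I.solved.pivot then 0 else I.scale
  else 0

variable {I}

theorem eval_square {r k : ℕ} (hk : k < I.order) {t : ℤ} (ht : t = (r * I.order + k : ℕ)) :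
    riE.eval (memory I.mem t) = r ∧ ciE.eval (memory I.mem t) = k := by
  constructor
  · rw [riE, eval_nat_div (by rw [eval_ctr, ht]) (I.eval_order t), div_mul_add hk]
  · rw [ciE, eval_nat_mod (by rw [eval_ctr, ht]) (I.eval_order t), mod_mul_add hk]

theorem cellCount_square {i : ℕ} (hi : i ∈ [19, 21]) : I.cellCount i = I.order * I.order := by
  fin_cases hi <;> exact I.cellCount_of (by norm_num) (by rw [← eval_order_sq]; rfl)

theorem cellCount_rectangle {i : ℕ} (hi : i ∈ [20, 22]) : I.cellCount i = I.dim * I.order := by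
  fin_cases hi <;> exact I.cellCount_of (by norm_num) (by
    simp only [stages, eval_mul, eval_nX, eval_order]; push_cast; rfl)

theorem dim_le_order : I.dim ≤ I.order := by rw [order]; omega

theorem eval_sub_dim {e : RamExpr} {k : ℕ} (hk : ¬ k < I.dim) {t : ℤ}
    (he : e.eval (memory I.mem t) = k) :
    (e - nX).eval (memory I.mem t) = (k - I.dim : ℕ) := by
  rw [eval_sub, he, eval_nX]; omega

theorem eval_rhsValueE {e : RamExpr} {k : ℕ} {t : ℤ} (he : e.eval (memory I.mem t) = k) :
    (rhsValueE e).eval (memory I.mem t) = I.rhsValue k := by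
  rw [rhsValueE, eval_iteE_ltE, he, eval_nX, rhsValue]
  simp only [Nat.cast_lt]
  by_cases hk : k < I.dim
  · rw [if_pos hk, if_pos hk, eval_zero]
  · have h := eval_sub_dim hk he
    rw [if_neg hk, if_neg hk, stopE, eval_mul, eval_sub, eval_one, eval_read (by norm_num),
      eval_read (by norm_num), eval_nat_div h (I.eval_nS t), stops]
    simp only [eval_add, eval_mul, eval_sub (e := nA * nS), h, eval_nA, eval_nS, eval_one]

theorem sum_entry_mul {e : RamExpr} {b : ℕ → ℤ} {r : ℕ} (hr : r < I.order)
    (he : ∀ k < I.order, ∀ t : ℤ, ciE.eval (memory I.mem t) = k → e.eval (memory I.mem t) = b k) :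
    ∑ l ∈ Finset.range I.order,
      (entryE (nN * nN) riE (nN + ciE) * e).eval (memory I.mem (r * I.order + l)) =
    ∑ k ∈ Finset.range I.order, I.solved.entry r (I.order + k) * b k := by
  refine Finset.sum_congr rfl fun k hk => ?_
  have hk := Finset.mem_range.1 hk
  have ht : (r : ℤ) * I.order + k = (r * I.order + k : ℕ) := by push_cast; rfl
  obtain ⟨h1, h2⟩ := eval_square hk ht
  rw [eval_mul, he k hk _ h2, I.eval_entry_solved (i := r) (j := I.order + k) _ h1 (by
    rw [eval_add, h2, eval_order]; push_cast; rfl) hr (by omega)]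

theorem sum_used {e : RamExpr} {b : ℕ → ℤ} {c : ℕ}
    (he : ∀ r < I.order, ∀ t : ℤ, ciE.eval (memory I.mem t) = r → e.eval (memory I.mem t) =
      ∑ k ∈ Finset.range I.order, I.solved.entry r (I.order + k) * b k) :
    ∑ l ∈ Finset.range I.order,
      (iteE (eqE (usedE (nN * nN) ciE) (riE + 1)) e 0).eval (memory I.mem (c * I.order + l)) =
    I.solved.solution I.order b c := by
  refine Finset.sum_congr rfl fun r hr => ?_
  have hr := Finset.mem_range.1 hr
  have ht : (c : ℤ) * I.order + r = (c * I.order + r : ℕ) := by push_cast; rfl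
  obtain ⟨h1, h2⟩ := eval_square hr ht
  rw [eval_iteE_eqE, he r hr _ h2, I.eval_used_solved _ h2 hr, eval_add, h1, eval_one, eval_zero]
  refine if_congr ?_ rfl rfl
  omega

theorem mem_value_rows {r : ℕ} (hr : r < I.order) : I.mem 21 (r * I.order + (I.order - 1)) =
    ∑ k ∈ Finset.range I.order, I.solved.entry r (I.order + k) * I.rhsValue k := by
  have h := I.mem_sum (i := 19) (by norm_num) rfl (by decide) (by decide) (by decide) I.order_pos
    (I.eval_order 0) (cellCount_square (by simp)) hr
  exact h.trans (sum_entry_mul hr fun k _ t ht => eval_rhsValueE ht)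

theorem mem_value {c : ℕ} (hc : c < I.dim) : I.mem 22 (c * I.order + (I.order - 1)) =
    I.solved.solution I.order I.rhsValue c := by
  have h := I.mem_sum (i := 20) (by norm_num) rfl (by decide) (by decide) (by decide) I.order_pos
    (I.eval_order 0) (cellCount_rectangle (by simp)) hc
  refine h.trans (sum_used fun r hr t ht => ?_)
  rw [eval_read (by norm_num), ← mem_value_rows hr]
  simp only [eval_add, eval_mul, eval_sub, ht, eval_order, eval_one]

theorem eval_rhsIndicatorE {e : RamExpr} {k : ℕ} {t : ℤ} (he : e.eval (memory I.mem t) = k)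
    (hkN : k < I.order) : (rhsIndicatorE e).eval (memory I.mem t) = I.rhsIndicator k := by
  rw [rhsIndicatorE, eval_iteE_ltE, he, eval_nX, rhsIndicator]
  simp only [Nat.cast_lt]
  by_cases hk : k < I.dim
  · rw [if_pos hk, if_pos hk, eval_zero]
  · have h := eval_sub_dim hk he
    have hlt : k - I.dim < I.dim := by rw [order] at hkN; omega
    rw [if_neg hk, if_neg hk, eval_iteE_ltE, eval_iteE_ltE, eval_nat_div h (I.eval_nS t), eval_nQ,
      eval_mul, eval_pivot_solved, eval_read (by norm_num), eval_scaleE, eval_zero, ← mem_value hlt]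
    simp only [eval_add, eval_mul, eval_sub (e := nN), h, eval_order, eval_one, Nat.cast_lt]

set_option maxRecDepth 10000 in
theorem mem_indicator_rows {r : ℕ} (hr : r < I.order) : I.mem 23 (r * I.order + (I.order - 1)) =
    ∑ k ∈ Finset.range I.order, I.solved.entry r (I.order + k) * I.rhsIndicator k := by
  have h := I.mem_sum (i := 21) (by norm_num) rfl (by decide) (by decide) (by decide) I.order_pos
    (I.eval_order 0) (cellCount_square (by simp)) hr
  exact h.trans (sum_entry_mul hr fun k hk t ht => eval_rhsIndicatorE ht hk)

theorem mem_indicator {c : ℕ} (hc : c < I.dim) : I.mem 24 (c * I.order + (I.order - 1)) =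
    I.solved.solution I.order I.rhsIndicator c := by
  have h := I.mem_sum (i := 22) (by norm_num) rfl (by decide) (by decide) (by decide) I.order_pos
    (I.eval_order 0) (cellCount_rectangle (by simp)) hc
  refine h.trans (sum_used fun r hr t ht => ?_)
  rw [eval_read (by norm_num), ← mem_indicator_rows hr]
  simp only [eval_add, eval_mul, eval_sub, ht, eval_order, eval_one]

variable (I) in
/-- The index of the initial state. -/
def initIndex : ℕ := I.nwa.master.init * I.chainStates + I.chain.init

theorem initIndex_lt : I.initIndex < I.dim := by
  refine mul_add_lt (lt_of_lt_of_le I.nwa.master.init.2 ?_) I.chain.init.2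
  rw [configs]; omega

theorem cellCount_answer : I.cellCount 23 = 2 := I.cellCount_of (by norm_num) (by simp [stages])

theorem mem_answer_num : I.mem 25 0 =
    I.solved.solution I.order I.rhsIndicator I.initIndex * I.solved.pivot := by
  rw [I.mem_fill (i := 23) (by norm_num) (by decide) le_rfl (by rw [cellCount_answer]; norm_num),
    ← mem_indicator initIndex_lt]
  simp only [stages, eval_iteE_eqE, eval_ctr, eval_zero, if_true, eval_mul, eval_pivot_solved,
    eval_read (a := 24) (by norm_num), eval_add, eval_inp_mem, eval_masterE, eval_nS, eval_four,
    cell_masterInit, cell_chainInit, eval_order, eval_sub, eval_one, initIndex]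
  push_cast
  rfl

theorem mem_answer_den : I.mem 25 1 = I.solved.pivot * I.solved.pivot := by
  rw [I.mem_fill (i := 23) (by norm_num) (by decide) (by norm_num)
    (by rw [cellCount_answer]; norm_num)]
  simp only [stages, eval_iteE_eqE, eval_ctr, eval_zero, eval_mul, eval_pivot_solved]
  rw [if_neg (by norm_num)]

theorem pivot_solved_ne : I.solved.pivot ≠ 0 := (Elim.inv_run _ le_rfl).pivot_ne

end DistributionInput


/-! ### The joint system of linear equations -/

/-- A reward system some of whose states launch other states. -/
structure CoupledSystem (A Z : Type) where
  next : Z → A → Z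
  halt : Z → Bool
  start : Z → A → Z
  act : Z → A → ℝ

namespace CoupledSystem

variable {A S Z : Type} [Fintype A] [Fintype S] (D : CoupledSystem A Z) (M : MarkovChain A S)

/-- The equations for the gain `g` and the bias `h` of the payoff `β`. -/
structure IsSolution (β g h : Z × S → ℝ) : Prop where
  gain : ∀ x, ¬ D.halt x.1 = true → g x = ∑ e, M.edge x.2 e * g (D.next x.1 e.1, e.2)
  halt : ∀ x, D.halt x.1 = true → h x = 0
  bias : ∀ x, g x + h x = β x +
    (if D.halt x.1 then 0 else ∑ e, M.edge x.2 e * h (D.next x.1 e.1, e.2)) +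
    ∑ e, M.edge x.2 e * (D.act x.1 e.1 * h (D.start x.1 e.1, e.2))

variable {D M}

/-- The coupling is triangular. States in `V` stay in `V` until they halt and launch nothing, so
their equations form a stopped system of their own. Outside `V` nothing halts and only states in `V`
are launched, so their biases enter as a known additional payoff. -/
theorem exists_isSolution [Fintype Z] [MeasurableSpace A] [MeasurableSpace S]
    [MeasurableSingletonClass S] [MeasurableSingletonClass A] (V : Set Z)
    (h1 : ∀ z ∈ V, ¬ D.halt z = true → ∀ b, D.next z b ∈ V)
    (h2 : ∀ z, z ∉ V → ¬ D.halt z = true ∧ ∀ b, D.next z b ∉ V)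
    (h3 : ∀ z ∈ V, ∀ b, D.act z b = 0) (h4 : ∀ z, z ∉ V → ∀ b, D.start z b ∈ V)
    {β : Z × S → ℝ} (hβ : ∀ x, D.halt x.1 = true → β x = 0) :
    ∃ g h, D.IsSolution M β g h := by
  classical
  let T : RewardSystem A Z := ⟨D.next, D.halt, fun _ _ => 0⟩
  obtain ⟨g1, k1, a1, a2, a3, a4⟩ := T.exists_poisson M β hβ
  obtain ⟨g2, k2, b1, b2, -, -⟩ := T.exists_poisson M
    (fun x => if x.1 ∈ V then 0 else β x +
      ∑ e, M.edge x.2 e * (D.act x.1 e.1 * k1 (D.start x.1 e.1, e.2)))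
    (fun x hx => by
      have : x.1 ∈ V := by by_contra h; exact (h2 _ h).1 hx
      simp [this])
  have a1' := fun x => congrFun a1 x
  have a2' := fun x => congrFun a2 x
  have b1' := fun x => congrFun b1 x
  have b2' := fun x => congrFun b2 x
  simp only [RewardSystem.stoppedOp_apply, Pi.add_apply, T] at a1' a2' b1' b2'
  refine ⟨fun x => if x.1 ∈ V then g1 x else g2 x, fun x => if x.1 ∈ V then k1 x else k2 x,
    fun x hx => ?_, fun x hx => ?_, fun x => ?_⟩
  · by_cases hV : x.1 ∈ V
    · simp only [hV, if_true, h1 _ hV hx]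
      rw [← a1' x, if_neg hx]
    · simp only [hV, if_false, (h2 _ hV).2]
      rw [← b1' x, if_neg hx]
  · have : x.1 ∈ V := by by_contra h; exact (h2 _ h).1 hx
    simp only [this, if_true]
    exact a4 x hx
  · by_cases hV : x.1 ∈ V
    · simp only [hV, if_true, h3 _ hV, zero_mul, mul_zero, Finset.sum_const_zero, add_zero]
      rw [a2' x]
      by_cases hx : D.halt x.1 = true
      · simp only [hx, if_true, a4 x hx]
      · simp only [hx, h1 _ hV hx, if_true, Bool.false_eq_true, if_false]
    · simp only [hV, if_false, (h2 _ hV).2, (h2 _ hV).1, h4 _ hV, if_true]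
      have := b2' x
      simp only [hV, if_false, (h2 _ hV).1] at this
      rw [this]; simp only [Bool.false_eq_true, if_false]; ring

end CoupledSystem

/-! ### Sums over products of intervals -/

theorem sum_range_mul_fin {R : Type} [AddCommMonoid R] (m n : ℕ) (f : ℕ → R) :
    ∑ l ∈ Finset.range (m * n), f l = ∑ x : Fin m × Fin n, f (x.1 * n + x.2) := by
  rw [Finset.sum_range, ← finProdFinEquiv.sum_comp]
  refine Finset.sum_congr rfl fun x _ => ?_
  congr 1
  simp only [finProdFinEquiv_apply_val]
  ring

namespace DistributionInput

variable {I : DistributionInput}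

/-- The states of the joint system. -/
abbrev Node (I : DistributionInput) : Type := Fin I.configs × Fin I.chainStates

/-- The index of a state of the joint system. -/
def index (x : I.Node) : ℕ := x.1 * I.chainStates + x.2

theorem index_lt (x : I.Node) : index x < I.dim := mul_add_lt x.1.2 x.2.2
theorem index_div (x : I.Node) : index x / I.chainStates = x.1 := div_mul_add x.2.2
theorem index_mod (x : I.Node) : index x % I.chainStates = x.2 := mod_mul_add x.2.2

theorem sum_range_dim {R : Type} [AddCommMonoid R] (f : ℕ → R) :
    ∑ l ∈ Finset.range I.dim, f l = ∑ x : I.Node, f (index x) := sum_range_mul_fin _ _ f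

theorem exists_index {c : ℕ} (hc : c < I.dim) : ∃ x : I.Node, index x = c := by
  have h1 : c / I.chainStates < I.configs := Nat.div_lt_of_lt_mul (by rwa [mul_comm, ← dim])
  exact ⟨(⟨_, h1⟩, ⟨_, Nat.mod_lt c I.chainStates_pos⟩), Nat.div_add_mod' _ _⟩

theorem index_inj {x y : I.Node} : index x = index y ↔ x = y := by
  refine ⟨fun h => ?_, fun h => h ▸ rfl⟩
  have h1 := index_div x
  have h2 := index_mod x
  rw [h, index_div] at h1
  rw [h, index_mod] at h2
  exact Prod.ext (Fin.ext h1.symm) (Fin.ext h2.symm)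

/-- An integer as a state. -/
def toState (t : ℤ) : Fin I.configs :=
  if h : 0 ≤ t ∧ t < I.configs then ⟨t.toNat, by omega⟩ else ⟨0, I.configs_pos⟩

theorem coe_toState {t : ℤ} (h0 : 0 ≤ t) (h1 : t < I.configs) :
    (((toState t : Fin I.configs) : ℕ) : ℤ) = t := by
  rw [toState, dif_pos ⟨h0, h1⟩]
  simp [h0]

theorem toState_coe (z : Fin I.configs) : toState ((z : ℕ) : ℤ) = z := by
  rw [toState, dif_pos ⟨by positivity, by exact_mod_cast z.2⟩]
  simp

variable (I) in
/-- The tables of transitions as a system. -/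
def coupled : CoupledSystem (Fin I.letters) (Fin I.configs) where
  next z b := toState (I.mem 10 ((z : ℕ) * I.letters + (b : ℕ)))
  halt z := decide (I.mem 8 (z : ℕ) = 1)
  start z b := toState (I.mem 14 ((z : ℕ) * I.letters + (b : ℕ)))
  act z b := (I.mem 13 ((z : ℕ) * I.letters + (b : ℕ)) : ℤ)

variable (I) in
def slaveSet : Set (Fin I.configs) := {z | I.masterStates ≤ (z : ℕ)}

variable (I) in
def ofMaster (q : Fin I.masterStates) : Fin I.configs := ⟨q, by rw [configs]; have := q.2; omega⟩

theorem exists_ofMaster {z : Fin I.configs} (hz : z ∉ I.slaveSet) : ∃ q, z = I.ofMaster q :=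
  ⟨⟨z, not_le.1 hz⟩, rfl⟩

theorem ofMaster_notMem (q : Fin I.masterStates) : I.ofMaster q ∉ I.slaveSet := not_le.2 q.2

theorem exists_config_of_mem {z : Fin I.configs} (hz : z ∈ I.slaveSet)
    (hs : ¬ I.coupled.halt z = true) :
    ∃ (j : Fin I.slaves) (p : Fin (I.slaveStates j)) (c : ℤ), |c| ≤ (I.accBound : ℤ) ∧
      ((z : ℕ) : ℤ) = I.config j p c :=
  exists_config (by exact_mod_cast hz) (by exact_mod_cast z.2) fun h => hs (by simpa [coupled] using h)

theorem coe_toState_config {j : Fin I.slaves} {p : Fin (I.slaveStates j)} {c : ℤ}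
    (hc : |c| ≤ (I.accBound : ℤ)) :
    (((toState (I.config j p c) : Fin I.configs) : ℕ) : ℤ) = I.config j p c :=
  coe_toState ((Nat.cast_nonneg _).trans (config_nonneg hc)) (config_lt hc)

theorem toState_config_mem {j : Fin I.slaves} {p : Fin (I.slaveStates j)} {c : ℤ}
    (hc : |c| ≤ (I.accBound : ℤ)) : toState (I.config j p c) ∈ I.slaveSet := by
  have h := coe_toState_config (p := p) hc
  have h2 := config_nonneg (p := p) hc
  change I.masterStates ≤ _
  omega

theorem abs_upd_le {j : Fin I.slaves} {p : Fin (I.slaveStates j)} {c : ℤ}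
    (hc : |c| ≤ (I.accBound : ℤ)) (b : Fin I.letters) :
    |I.g.upd c ((I.nwa.slave j).label p b)| ≤ (I.accBound : ℤ) :=
  FinVal.abs_upd_le I.bound_le_accBound hc (I.weight_le_accBound j p b)

theorem coupled_next_mem {z : Fin I.configs} (hz : z ∈ I.slaveSet) (hs : ¬ I.coupled.halt z = true)
    (b : Fin I.letters) : I.coupled.next z b ∈ I.slaveSet ∧
      ((I.coupled.next z b : ℕ) : ℤ) = I.mem 10 ((z : ℕ) * I.letters + (b : ℕ)) := by
  obtain ⟨j, p, c, hc, h⟩ := exists_config_of_mem hz hs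
  simp only [coupled, h]
  rw [next_config b hc]
  exact ⟨toState_config_mem (abs_upd_le hc b), coe_toState_config (abs_upd_le hc b)⟩

theorem coupled_next_master (q : Fin I.masterStates) (b : Fin I.letters) :
    I.coupled.next (I.ofMaster q) b = I.ofMaster (I.nwa.master.next q b) := by
  have : I.coupled.next (I.ofMaster q) b = toState (I.mem 10 ((q : ℕ) * I.letters + (b : ℕ))) := rfl
  rw [this, next_master]
  exact toState_coe (I.ofMaster (I.nwa.master.next q b))

theorem coupled_stop_master (q : Fin I.masterStates) : ¬ I.coupled.halt (I.ofMaster q) = true := by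
  have : I.mem 8 (q : ℕ) = 0 := stop_master (by positivity) (by exact_mod_cast q.2)
  simp [coupled, ofMaster, this]

theorem coe_coupled_next {z : Fin I.configs} (hs : ¬ I.coupled.halt z = true) (b : Fin I.letters) :
    ((I.coupled.next z b : ℕ) : ℤ) = I.mem 10 ((z : ℕ) * I.letters + (b : ℕ)) := by
  by_cases hz : z ∈ I.slaveSet
  · exact (coupled_next_mem hz hs b).2
  · obtain ⟨q, rfl⟩ := exists_ofMaster hz
    rw [coupled_next_master]
    exact (next_master q b).symm

theorem coupled_start_master (q : Fin I.masterStates) (b : Fin I.letters) :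
    I.coupled.start (I.ofMaster q) b ∈ I.slaveSet ∧
      ((I.coupled.start (I.ofMaster q) b : ℕ) : ℤ) = I.mem 14 ((q : ℕ) * I.letters + (b : ℕ)) := by
  have : I.coupled.start (I.ofMaster q) b = toState (I.mem 14 ((q : ℕ) * I.letters + (b : ℕ))) := rfl
  rw [this, start_master]
  exact ⟨toState_config_mem (abs_upd_le abs_initAcc b), coe_toState_config (abs_upd_le abs_initAcc b)⟩

theorem coupled_act_slave {z : Fin I.configs} (hz : z ∈ I.slaveSet) (b : Fin I.letters) :
    I.mem 13 ((z : ℕ) * I.letters + (b : ℕ)) = 0 :=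
  active_slave (by exact_mod_cast hz) (by exact_mod_cast z.2) b

theorem coe_coupled_start {z : Fin I.configs} {b : Fin I.letters}
    (h : I.mem 13 ((z : ℕ) * I.letters + (b : ℕ)) ≠ 0) :
    ((I.coupled.start z b : ℕ) : ℤ) = I.mem 14 ((z : ℕ) * I.letters + (b : ℕ)) := by
  by_cases hz : z ∈ I.slaveSet
  · exact absurd (coupled_act_slave hz b) h
  · obtain ⟨q, rfl⟩ := exists_ofMaster hz
    exact (coupled_start_master q b).2

theorem exists_solution_coupled {β : I.Node → ℝ} (hβ : ∀ x, I.coupled.halt x.1 = true → β x = 0) :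
    ∃ g h, I.coupled.IsSolution I.chain β g h := by
  refine CoupledSystem.exists_isSolution I.slaveSet (fun z hz hs b => (coupled_next_mem hz hs b).1)
    (fun z hz => ?_) (fun z hz b => ?_) (fun z hz b => ?_) hβ
  · obtain ⟨q, rfl⟩ := exists_ofMaster hz
    exact ⟨coupled_stop_master q, fun b => by rw [coupled_next_master]; exact ofMaster_notMem _⟩
  · change ((I.mem 13 _ : ℤ) : ℝ) = 0
    rw [coupled_act_slave hz b, Int.cast_zero]
  · obtain ⟨q, rfl⟩ := exists_ofMaster hz
    exact (coupled_start_master q b).1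

theorem stops_index (x : I.Node) :
    (I.stops (index x) : ℝ) = if I.coupled.halt x.1 = true then 1 else 0 := by
  rw [stops, index_div]
  by_cases h : I.coupled.halt x.1 = true
  · rw [if_pos h]
    have : I.mem 8 (x.1 : ℕ) = 1 := by simpa [coupled] using h
    rw [this, Int.cast_one]
  · rw [if_neg h]
    by_cases hz : x.1 ∈ I.slaveSet
    · obtain ⟨j, p, c, hc, h'⟩ := exists_config_of_mem hz h
      have h1 : ¬ I.mem 8 (x.1 : ℕ) = 1 := by simpa [coupled] using h
      rw [h', stop_config hc] at h1 ⊢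
      split_ifs at h1 ⊢ <;> simp_all
    · have : I.mem 8 (x.1 : ℕ) = 0 := stop_master (by positivity) (by exact_mod_cast not_le.1 hz)
      rw [this, Int.cast_zero]

/-- Sums over tables of transitions. -/
theorem sum_table (s : Fin I.chainStates) (k : Fin I.letters → ℤ) (w : Fin I.letters → ℤ)
    (y : Fin I.letters → Fin I.configs) (hy : ∀ b, w b ≠ 0 → k b = (y b : ℕ)) (f : I.Node → ℝ) :
    ∑ x : I.Node, (∑ b : Fin I.letters, if k b = (x.1 : ℕ) then
      (I.weight s b x.2 : ℝ) * w b else 0) * f x =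
    I.scale * ∑ e, I.chain.edge s e * (w e.1 * f (y e.1, e.2)) := by
  have h1 : ∀ x : I.Node, (∑ b : Fin I.letters, if k b = (x.1 : ℕ) then
      (I.weight s b x.2 : ℝ) * w b else 0) * f x =
      ∑ b : Fin I.letters, if y b = x.1 then
        I.scale * (I.chain.edge s (b, x.2) * (w b * f (y b, x.2))) else 0 := by
    intro x
    rw [Finset.sum_mul]
    refine Finset.sum_congr rfl fun b _ => ?_
    by_cases hb : w b = 0
    · simp [hb]
    · have : k b = (x.1 : ℕ) ↔ y b = x.1 := by
        rw [hy b hb, Fin.ext_iff]; exact Nat.cast_inj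
      simp only [this]
      split_ifs with h
      · rw [weight, I.mem_four, h]; ring
      · rw [zero_mul]
  simp_rw [h1]
  rw [Fintype.sum_prod_type, Finset.mul_sum, Fintype.sum_prod_type]
  calc _ = ∑ z : Fin I.configs, ∑ b : Fin I.letters, ∑ s' : Fin I.chainStates, if y b = z then
        I.scale * (I.chain.edge s (b, s') * (w b * f (y b, s'))) else 0 :=
        Finset.sum_congr rfl fun z _ => Finset.sum_comm
    _ = ∑ b : Fin I.letters, ∑ z : Fin I.configs, ∑ s' : Fin I.chainStates, if y b = z then
        I.scale * (I.chain.edge s (b, s') * (w b * f (y b, s'))) else 0 := Finset.sum_comm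
    _ = _ := by
      refine Finset.sum_congr rfl fun b _ => ?_
      rw [Finset.sum_comm]
      refine Finset.sum_congr rfl fun s' _ => ?_
      rw [Finset.sum_ite_eq]
      simp

theorem sum_moves (x : I.Node) (hs : ¬ I.coupled.halt x.1 = true) (f : I.Node → ℝ) :
    ∑ y : I.Node, (I.moves (index x) (index y) : ℝ) * f y =
      I.scale * ∑ e, I.chain.edge x.2 e * f (I.coupled.next x.1 e.1, e.2) := by
  have h := sum_table x.2 (fun b => I.mem 10 ((x.1 : ℕ) * I.letters + (b : ℕ))) (fun _ => 1)
    (fun b => I.coupled.next x.1 b) (fun b _ => (coe_coupled_next hs b).symm) f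
  simp only [Int.cast_one, mul_one, one_mul] at h
  rw [← h]
  refine Finset.sum_congr rfl fun y _ => ?_
  rw [moves, mem_sixteen (index_lt x) (index_lt y), Finset.sum_range]
  simp only [index_div, index_mod]
  push_cast
  rfl

theorem sum_starts (x : I.Node) (f : I.Node → ℝ) :
    ∑ y : I.Node, (I.starts (index x) (index y) : ℝ) * f y =
      I.scale * ∑ e, I.chain.edge x.2 e *
        (I.coupled.act x.1 e.1 * f (I.coupled.start x.1 e.1, e.2)) := by
  have h := sum_table x.2 (fun b => I.mem 14 ((x.1 : ℕ) * I.letters + (b : ℕ)))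
    (fun b => I.mem 13 ((x.1 : ℕ) * I.letters + (b : ℕ)))
    (fun b => I.coupled.start x.1 b) (fun b hb => (coe_coupled_start hb).symm) f
  refine Eq.trans ?_ h
  refine Finset.sum_congr rfl fun y _ => ?_
  rw [starts, mem_seventeen (index_lt x) (index_lt y), Finset.sum_range]
  simp only [index_div, index_mod]
  push_cast
  rfl

end DistributionInput


/-! ### The solved system consists of gains and biases. -/

namespace DistributionInput

variable {I : DistributionInput}

/-- The left-hand side of the first equation for a state. -/
theorem sum_system_gain (x : I.Node) (u : ℕ → ℝ) :
    ∑ c ∈ Finset.range I.order, (I.system (index x) c : ℝ) * u c =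
      if I.coupled.halt x.1 = true then I.scale * u (I.dim + index x) else
        I.scale * (u (index x) - ∑ e, I.chain.edge x.2 e *
          u (index (I.coupled.next x.1 e.1, e.2))) := by
  have hx := index_lt x
  rw [show I.order = I.dim + I.dim by rw [order]; ring, Finset.sum_range_add, sum_range_dim,
    sum_range_dim]
  have h1 : ∀ y : I.Node, (I.system (index x) (index y) : ℝ) * u (index y) =
      (1 - I.stops (index x)) * ((if x = y then I.scale * u (index y) else 0) -
        I.moves (index x) (index y) * u (index y)) := by
    intro y
    rw [system_eq (hx.trans_le dim_le_order) ((index_lt y).trans_le dim_le_order), if_pos hx,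
      if_pos (index_lt y)]
    simp only [index_inj]
    split_ifs <;> push_cast <;> ring
  have h2 : ∀ y : I.Node, (I.system (index x) (I.dim + index y) : ℝ) * u (I.dim + index y) =
      (I.stops (index x)) * (if x = y then I.scale * u (I.dim + index y) else 0) := by
    intro y
    have := index_lt y
    rw [system_eq (hx.trans_le dim_le_order) (by rw [order]; omega), if_pos hx, if_neg (by omega),
      Nat.add_sub_cancel_left]
    simp only [index_inj]
    split_ifs <;> push_cast <;> ring
  simp_rw [h1, h2]
  rw [← Finset.mul_sum, ← Finset.mul_sum, Finset.sum_sub_distrib, Finset.sum_ite_eq,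
    Finset.sum_ite_eq, stops_index]
  simp only [Finset.mem_univ, if_true]
  by_cases hs : I.coupled.halt x.1 = true
  · simp only [if_pos hs]; ring
  · simp only [if_neg hs]
    rw [sum_moves x hs fun y => u (index y)]; ring

/-- The left-hand side of the second equation for a state. -/
theorem sum_system_bias (x : I.Node) (u : ℕ → ℝ) :
    ∑ c ∈ Finset.range I.order, (I.system (I.dim + index x) c : ℝ) * u c =
      I.scale * (u (index x) + u (I.dim + index x) -
        (if I.coupled.halt x.1 = true then 0 else ∑ e, I.chain.edge x.2 e *
          u (I.dim + index (I.coupled.next x.1 e.1, e.2))) -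
        ∑ e, I.chain.edge x.2 e * (I.coupled.act x.1 e.1 *
          u (I.dim + index (I.coupled.start x.1 e.1, e.2)))) := by
  have hx := index_lt x
  have hx' : I.dim + index x < I.order := by rw [order]; omega
  rw [show I.order = I.dim + I.dim by rw [order]; ring, Finset.sum_range_add, sum_range_dim,
    sum_range_dim]
  have h1 : ∀ y : I.Node, (I.system (I.dim + index x) (index y) : ℝ) * u (index y) =
      if x = y then I.scale * u (index y) else 0 := by
    intro y
    rw [system_eq hx' ((index_lt y).trans_le dim_le_order), if_neg (by omega), if_pos (index_lt y),
      Nat.add_sub_cancel_left]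
    simp only [index_inj]
    split_ifs <;> push_cast <;> ring
  have h2 : ∀ y : I.Node, (I.system (I.dim + index x) (I.dim + index y) : ℝ) * u (I.dim + index y) =
      (if x = y then I.scale * u (I.dim + index y) else 0) -
      (1 - I.stops (index x)) * (I.moves (index x) (index y) * u (I.dim + index y)) -
      I.starts (index x) (index y) * u (I.dim + index y) := by
    intro y
    have := index_lt y
    rw [system_eq hx' (by rw [order]; omega), if_neg (by omega), if_neg (by omega),
      Nat.add_sub_cancel_left, Nat.add_sub_cancel_left]
    simp only [index_inj]
    split_ifs <;> push_cast <;> ring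
  simp_rw [h1, h2]
  rw [Finset.sum_sub_distrib, Finset.sum_sub_distrib, ← Finset.mul_sum, Finset.sum_ite_eq,
    Finset.sum_ite_eq, stops_index, sum_starts x fun y => u (I.dim + index y)]
  simp only [Finset.mem_univ, if_true]
  by_cases hs : I.coupled.halt x.1 = true
  · simp only [if_pos hs]; ring
  · simp only [if_neg hs]
    rw [sum_moves x hs fun y => u (I.dim + index y)]; ring

theorem scale_pos' : (0 : ℝ) < I.scale := by exact_mod_cast I.scale_pos

/-- The system of linear equations expresses the equations for gain and bias. -/
theorem system_iff {b : ℕ → ℝ} {β : I.Node → ℝ} (hb0 : ∀ k < I.dim, b k = 0)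
    (hb : ∀ x : I.Node, b (I.dim + index x) = I.scale * β x) (u : ℕ → ℝ) :
    (∀ r < I.order, ∑ c ∈ Finset.range I.order, (I.system r c : ℝ) * u c = b r) ↔
      I.coupled.IsSolution I.chain β (fun x => u (index x)) (fun x => u (I.dim + index x)) := by
  have hsc := scale_pos' (I := I)
  constructor
  · intro h
    have e1 := fun x : I.Node => (sum_system_gain x u).symm.trans
      ((h _ ((index_lt x).trans_le dim_le_order)).trans (hb0 _ (index_lt x)))
    have e2 := fun x : I.Node => (sum_system_bias x u).symm.trans
      ((h (I.dim + index x) (by have := index_lt x; rw [order]; omega)).trans (hb x))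
    refine ⟨fun x hx => ?_, fun x hx => ?_, fun x => ?_⟩
    · have := e1 x
      rw [if_neg hx] at this
      exact sub_eq_zero.1 ((mul_eq_zero.1 this).resolve_left hsc.ne')
    · have := e1 x
      rw [if_pos hx] at this
      exact (mul_eq_zero.1 this).resolve_left hsc.ne'
    · have := mul_left_cancel₀ hsc.ne' (e2 x)
      rw [← this]; ring
  · intro h r hr
    rcases lt_or_ge r I.dim with hr' | hr'
    · obtain ⟨x, rfl⟩ := exists_index hr'
      rw [sum_system_gain, hb0 _ hr']
      split_ifs with hs
      · rw [h.halt x hs, mul_zero]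
      · have := h.gain x hs
        rw [this, sub_self, mul_zero]
    · obtain ⟨x, hx⟩ := exists_index (I := I) (c := r - I.dim) (by rw [order] at hr; omega)
      obtain rfl : r = I.dim + index x := by omega
      rw [sum_system_bias, hb]
      have := h.bias x
      rw [this]; ring

/-- The computed solution. -/
theorem isSolution_solved {b : ℕ → ℤ} {β : I.Node → ℝ} (hb0 : ∀ k < I.dim, b k = 0)
    (hb : ∀ x : I.Node, (b (I.dim + index x) : ℝ) = I.scale * β x)
    (hβ : ∀ x, I.coupled.halt x.1 = true → β x = 0) :
    I.coupled.IsSolution I.chain β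
      (fun x => (I.solved.solution I.order b (index x) : ℝ) / I.solved.pivot)
      (fun x => (I.solved.solution I.order b (I.dim + index x) : ℝ) / I.solved.pivot) := by
  have hb0' : ∀ k < I.dim, ((b k : ℤ) : ℝ) = 0 := fun k hk => by rw [hb0 k hk, Int.cast_zero]
  rw [← system_iff (b := fun k => (b k : ℝ)) hb0' hb
    (fun c => (I.solved.solution I.order b c : ℝ) / I.solved.pivot)]
  obtain ⟨g, h, hgh⟩ := exists_solution_coupled hβ
  classical
  -- The abstract solution, listed by indices, witnesses the consistency that the elimination
  -- requires.
  let v : ℕ → ℝ := fun c => if hc : c < I.dim then g (exists_index hc).choose else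
    if hc : c - I.dim < I.dim then h (exists_index hc).choose else 0
  have hv1 : ∀ x : I.Node, v (index x) = g x := fun x => by
    simp only [v]
    rw [dif_pos (index_lt x)]
    congr 1
    exact index_inj.1 (exists_index (index_lt x)).choose_spec
  have hv2 : ∀ x : I.Node, v (I.dim + index x) = h x := fun x => by
    have hx : I.dim + index x - I.dim < I.dim := by rw [Nat.add_sub_cancel_left]; exact index_lt x
    simp only [v]
    rw [dif_neg (by omega), dif_pos hx]
    congr 1
    refine index_inj.1 ((exists_index hx).choose_spec.trans ?_)
    exact Nat.add_sub_cancel_left ..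
  have hsol : I.coupled.IsSolution I.chain β (fun x => v (index x)) (fun x => v (I.dim + index x)) := by
    simp only [hv1, hv2]
    exact hgh
  have := Elim.solves (a := I.system) (fun k => (b k : ℝ))
    ⟨v, (system_iff (b := fun k => (b k : ℝ)) hb0' hb v).2 hsol⟩
    (s := I.solved) rfl
  intro r hr
  refine Eq.trans (Finset.sum_congr rfl fun c _ => ?_) (this r hr)
  rw [Elim.solution]
  push_cast
  rfl

/-- The expected payoff of the next step. -/
def payoffRate (x : I.Node) : ℝ := if I.coupled.halt x.1 = true then 0 else
  ∑ e, I.chain.edge x.2 e * (I.mem 15 ((x.1 : ℕ) * I.letters + (e.1 : ℕ)) : ℝ)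

theorem rhsValue_index (x : I.Node) : (I.rhsValue (I.dim + index x) : ℝ) = I.scale * payoffRate x := by
  rw [rhsValue, if_neg (by omega), Nat.add_sub_cancel_left, mem_eighteen (index_lt x),
    Int.cast_mul, Int.cast_sub, stops_index, index_div, index_mod, payoffRate, sum_range_mul_fin]
  split_ifs
  · simp
  · simp only [Int.cast_one, sub_zero, one_mul]
    push_cast
    rw [Finset.mul_sum]
    refine Finset.sum_congr rfl fun e _ => ?_
    rw [I.mem_four, mul_add_ediv (by positivity) (by exact_mod_cast e.2.2)]
    ring

/-- The gain of the value. -/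
def valueGain (x : I.Node) : ℝ :=
  (I.solved.solution I.order I.rhsValue (index x) : ℝ) / I.solved.pivot

theorem exists_valueBias : ∃ h, I.coupled.IsSolution I.chain payoffRate (valueGain (I := I)) h :=
  ⟨_, isSolution_solved (fun k hk => by rw [rhsValue, if_pos hk]) rhsValue_index
    fun x hx => by rw [payoffRate, if_pos hx]⟩

open Classical in
/-- The indicator function of the master states whose value is at most the threshold. -/
def indicatorRate (x : I.Node) : ℝ :=
  if x.1 ∉ I.slaveSet ∧ valueGain x ≤ 0 then 1 else 0

theorem rhsIndicator_index (x : I.Node) :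
    (I.rhsIndicator (I.dim + index x) : ℝ) = I.scale * indicatorRate x := by
  have hp : (I.solved.pivot : ℝ) ≠ 0 := by exact_mod_cast pivot_solved_ne
  rw [rhsIndicator, if_neg (by omega), Nat.add_sub_cancel_left, index_div, indicatorRate]
  have h1 : (x.1 : ℕ) < I.masterStates ↔ x.1 ∉ I.slaveSet := not_le.symm
  have h2 : 0 < I.solved.solution I.order I.rhsValue (index x) * I.solved.pivot ↔
      ¬ valueGain x ≤ 0 := by
    rw [not_le, valueGain, div_pos_iff, ← mul_pos_iff]
    exact_mod_cast Iff.rfl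
  by_cases h3 : x.1 ∈ I.slaveSet <;> by_cases h4 : valueGain x ≤ 0 <;> simp [h1, h2, h3, h4]

/-- The gain of the indicator function. -/
def indicatorGain (x : I.Node) : ℝ :=
  (I.solved.solution I.order I.rhsIndicator (index x) : ℝ) / I.solved.pivot

theorem exists_indicatorBias :
    ∃ h, I.coupled.IsSolution I.chain indicatorRate (indicatorGain (I := I)) h :=
  ⟨_, isSolution_solved (fun k hk => by rw [rhsIndicator, if_pos hk]) rhsIndicator_index
    fun x hx => by
      rw [indicatorRate, if_neg]
      rintro ⟨h, -⟩
      obtain ⟨q, hq⟩ := exists_ofMaster h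
      rw [hq] at hx
      exact coupled_stop_master q hx⟩

variable (I) in
/-- The configurations of the slave automata as a reward system. -/
def slaveModel : SlaveModel I.nwa I.g I.accBound (Fin I.configs) where
  sys :=
    { next := I.coupled.next
      halt := I.coupled.halt
      reward := fun z b => (I.mem 11 ((z : ℕ) * I.letters + (b : ℕ)) : ℤ) }
  enc j p c := toState (I.config j p c)
  bound_le := I.bound_le_accBound
  weight_le := I.weight_le_accBound
  stop_enc j p c hc := by
    change decide (I.mem 8 _ = 1) = _
    rw [coe_toState_config hc, stop_config hc]
    cases (I.nwa.slave j).accept p <;> simp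
  next_enc j p c b hc _ := by
    change toState (I.mem 10 _) = _
    rw [coe_toState_config hc, next_config b hc]
  reward_enc j p c b hc _ := by
    dsimp only
    rw [coe_toState_config hc, reward_config b hc]

end DistributionInput


/-! ### The computed gains are those of the automaton. -/

namespace DistributionInput

variable {I : DistributionInput}

/-- The states of slave automata from which the slave automata halt almost surely. -/
def goodSlaves (I : DistributionInput) : Set I.Node :=
  {x | x ∈ Launcher.goodSet I.slaveModel.sys I.chain ∧ x.1 ∈ I.slaveSet}

theorem good_goodSlaves (r : Fin I.configs → Fin I.letters → ℝ) :
    (I.slaveModel.sys.withReward r).Good I.chain I.goodSlaves where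
  closed x hx hs e he := ⟨(Launcher.good_goodSet I.slaveModel.sys I.chain).closed x hx.1 hs e he,
    (coupled_next_mem hx.2 hs e.1).1⟩
  ae x hx := by
    filter_upwards [(Launcher.good_goodSet I.slaveModel.sys I.chain).ae x hx.1] with ω hω
    rwa [RewardSystem.terminates_withReward]

/-- Slave configurations launch nothing, so on them the joint equations are those of a stopped
reward system. These determine the bias on good sets, although the joint system is singular. -/
theorem slave_equations {β g h : I.Node → ℝ} (hs : I.coupled.IsSolution I.chain β g h)
    {r : Fin I.configs → Fin I.letters → ℝ}
    (hβ : ∀ x : I.Node, x.1 ∈ I.slaveSet →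
      β x = if I.coupled.halt x.1 = true then 0 else ∑ e, I.chain.edge x.2 e * r x.1 e.1) :
    ∀ x ∈ I.goodSlaves, h x = (I.slaveModel.sys.withReward r).expectedTotal I.chain x := by
  have hb : ∀ x : I.Node, x.1 ∈ I.slaveSet → g x + h x = β x +
      (if I.coupled.halt x.1 = true then 0 else
        ∑ e, I.chain.edge x.2 e * h (I.coupled.next x.1 e.1, e.2)) := by
    intro x hx
    rw [hs.bias x]
    have : ∀ e : Fin I.letters × Fin I.chainStates, I.coupled.act x.1 e.1 = 0 := fun e => by
      change ((I.mem 13 _ : ℤ) : ℝ) = 0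
      rw [coupled_act_slave hx e.1, Int.cast_zero]
    simp only [this, zero_mul, mul_zero, Finset.sum_const_zero, add_zero]
  refine (good_goodSlaves r).expectedTotal_unique (g := g) (fun x hx hhalt => ?_)
    (fun x hx hhalt => hs.gain x hhalt) fun x hx hhalt => ?_
  · have h0 := hs.halt x hhalt
    have h1 := hb x hx.2
    rw [hβ x hx.2, if_pos (show I.coupled.halt x.1 = true from hhalt),
      if_pos (show I.coupled.halt x.1 = true from hhalt), h0, add_zero, add_zero] at h1
    exact ⟨h1, h0⟩
  · have hhalt' : ¬ I.coupled.halt x.1 = true := hhalt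
    rw [hb x hx.2, hβ x hx.2, if_neg hhalt', if_neg hhalt', ← Finset.sum_add_distrib]
    refine Finset.sum_congr rfl fun e _ => ?_
    rw [← mul_add]
    rfl

theorem launcher_start (q : Fin I.masterStates) (b : Fin I.letters) :
    I.slaveModel.launcher.start q b = I.coupled.start (I.ofMaster q) b := by
  change toState (I.mem 10 (((toState (I.config _ _ _) : Fin I.configs) : ℕ) * I.letters + (b : ℕ))) =
    toState (I.mem 14 ((q : ℕ) * I.letters + (b : ℕ)))
  rw [coe_toState_config abs_initAcc, next_config b abs_initAcc, start_master]
  rfl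

theorem coupled_act_master (q : Fin I.masterStates) (b : Fin I.letters) :
    I.coupled.act (I.ofMaster q) b = if I.slaveModel.launcher.active q b = true then 1 else 0 := by
  change ((I.mem 13 ((q : ℕ) * I.letters + (b : ℕ)) : ℤ) : ℝ) =
    if (!(I.nwa.slave (started q b)).accept (I.nwa.slave (started q b)).init) = true then 1 else 0
  rw [active_master]
  cases (I.nwa.slave (started q b)).accept (I.nwa.slave (started q b)).init <;> simp

theorem payoff_launcher (q : Fin I.masterStates) (b : Fin I.letters) :
    (I.mem 15 ((q : ℕ) * I.letters + (b : ℕ)) : ℝ) = I.coupled.act (I.ofMaster q) b *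
      (I.threshold.den * I.slaveModel.launcher.reward q b - I.threshold.num) := by
  have h : I.slaveModel.launcher.reward q b = (I.g.accVal (I.g.initAcc I.accBound) : ℝ) +
      I.g.increment (I.g.initAcc I.accBound)
        ((I.nwa.slave (started q b)).label (I.nwa.slave (started q b)).init b) := by
    change _ + ((I.mem 11 (((toState (I.config _ _ _) : Fin I.configs) : ℕ) * I.letters +
      (b : ℕ)) : ℤ) : ℝ) = _
    rw [coe_toState_config abs_initAcc, reward_config b abs_initAcc]
    rfl
  rw [payoff_master, h]
  push_cast
  rfl

variable (I) in
/-- The states in which almost surely all slave automata halt and infinitely many are active. -/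
def liveStates : Set (Fin I.masterStates × Fin I.chainStates) :=
  I.slaveModel.launcher.liveSet I.slaveModel.sys I.chain

theorem start_mem_goodSlaves {x : Fin I.masterStates × Fin I.chainStates} (hx : x ∈ I.liveStates)
    {e : Fin I.letters × Fin I.chainStates} (he : 0 < I.chain.edge x.2 e)
    (ha : I.slaveModel.launcher.active x.1 e.1 = true) :
    (I.coupled.start (I.ofMaster x.1) e.1, e.2) ∈ I.goodSlaves := by
  refine ⟨?_, (coupled_start_master x.1 e.1).1⟩
  rw [← launcher_start]
  exact (I.slaveModel.launcher.sound_liveSet I.slaveModel.sys I.chain).start x hx e he ha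

theorem master_equations {β g h : I.Node → ℝ} (hs : I.coupled.IsSolution I.chain β g h)
    (x : Fin I.masterStates × Fin I.chainStates) :
    g (I.ofMaster x.1, x.2) = ∑ e, I.chain.edge x.2 e * g (I.ofMaster (I.nwa.master.next x.1 e.1), e.2) ∧
    g (I.ofMaster x.1, x.2) + h (I.ofMaster x.1, x.2) = β (I.ofMaster x.1, x.2) +
      ∑ e, I.chain.edge x.2 e * h (I.ofMaster (I.nwa.master.next x.1 e.1), e.2) +
      ∑ e, I.chain.edge x.2 e * (I.coupled.act (I.ofMaster x.1) e.1 *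
        h (I.coupled.start (I.ofMaster x.1) e.1, e.2)) := by
  have h1 := hs.gain (I.ofMaster x.1, x.2) (coupled_stop_master x.1)
  have h2 := hs.bias (I.ofMaster x.1, x.2)
  simp only [coupled_next_master, if_neg (coupled_stop_master x.1)] at h1 h2
  exact ⟨h1, h2⟩

/-- From a live pair, an active edge of positive probability launches a slave that stops almost
surely. Its computed bias is then the expected total of the rewards scaled by the denominator, so
the master part of the solution satisfies the Poisson equation of the affine payoff. -/
theorem isGain_value : ∃ h, (I.slaveModel.launcher.aff (I.threshold.den : ℝ)
    (-(I.threshold.num : ℝ))).IsGain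
    (I.slaveModel.sys.withReward fun z b => (I.threshold.den : ℝ) * I.slaveModel.sys.reward z b)
    I.chain I.liveStates (fun x => valueGain (I := I) (I.ofMaster x.1, x.2)) h := by
  obtain ⟨h, hs⟩ := exists_valueBias (I := I)
  have hslave := slave_equations hs
    (r := fun z b => (I.threshold.den : ℝ) * I.slaveModel.sys.reward z b) (fun x hx => by
      rw [payoffRate]
      refine if_congr Iff.rfl rfl (Finset.sum_congr rfl fun e _ => ?_)
      rw [payoff_slave (by exact_mod_cast hx) (by exact_mod_cast x.1.2)]
      push_cast
      rfl)
  refine ⟨fun x => h (I.ofMaster x.1, x.2), fun x hx => (master_equations hs x).1, fun x hx => ?_⟩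
  rw [(master_equations hs x).2, payoffRate, if_neg (coupled_stop_master x.1),
    ← Finset.sum_add_distrib, ← Finset.sum_add_distrib]
  have key := I.chain.sum_edge_congr x.2 (f := fun e : Fin I.letters × Fin I.chainStates =>
      (I.mem 15 ((x.1 : ℕ) * I.letters + (e.1 : ℕ)) : ℝ) +
      h (I.ofMaster (I.nwa.master.next x.1 e.1), e.2) + I.coupled.act (I.ofMaster x.1) e.1 *
        h (I.coupled.start (I.ofMaster x.1) e.1, e.2))
    (g := fun e => (if I.slaveModel.launcher.active x.1 e.1 = true then
        (I.threshold.den : ℝ) * I.slaveModel.launcher.reward x.1 e.1 + -(I.threshold.num : ℝ) +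
        (I.slaveModel.sys.withReward fun z b =>
          (I.threshold.den : ℝ) * I.slaveModel.sys.reward z b).expectedTotal I.chain
            (I.slaveModel.launcher.start x.1 e.1, e.2) else 0) +
      h (I.ofMaster (I.nwa.master.next x.1 e.1), e.2)) fun e he => by
    rw [payoff_launcher, coupled_act_master]
    split_ifs with ha
    · rw [hslave _ (start_mem_goodSlaves hx he ha), launcher_start]
      ring
    · ring
  refine Eq.trans (Finset.sum_congr rfl fun e _ => ?_) key
  change I.chain.edge x.2 e * (I.mem 15 ((x.1 : ℕ) * I.letters + (e.1 : ℕ)) : ℝ) + _ + _ = _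
  ring

/-- The computed value gain decides the sign, and the computed indicator gain is the resulting
probability; neither solution has to be unique away from the live pairs. -/
theorem distribution_eq : I.distribution =
    indicatorGain (I := I) (I.ofMaster I.nwa.master.init, I.chain.init) := by
  obtain ⟨hν, h1⟩ := isGain_value (I := I)
  obtain ⟨h, hs⟩ := exists_indicatorBias (I := I)
  -- The indicator is charged only at master states, so launched slaves have expected total `0` and
  -- drop out of the master equations.
  have hslave : ∀ x ∈ I.goodSlaves, h x = 0 := by
    have h0 := slave_equations hs (r := fun z b => 0 * I.slaveModel.sys.reward z b) (fun x hx => by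
      rw [indicatorRate, if_neg (fun h => h.1 hx)]
      simp)
    intro x hx
    rw [h0 x hx, RewardSystem.expectedTotal]
    simp_rw [RewardSystem.total_withReward]
    simp only [zero_mul, integral_zero]
  have hden : (0 : ℝ) < I.threshold.den := by exact_mod_cast I.threshold.den_pos
  have hlam : ((I.threshold : ℚ) : ℝ) = (I.threshold.num : ℝ) / (I.threshold.den : ℝ) :=
    Rat.cast_def _
  refine I.slaveModel.measureReal_value_le (M := I.chain) I.accepts_ae hden hlam
    (f := fun x => indicatorGain (I := I) (I.ofMaster x.1, x.2))
    (hf := fun x => h (I.ofMaster x.1, x.2)) h1 (fun x hx => (master_equations hs x).1)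
    fun x hx => ?_
  rw [(master_equations hs x).2]
  have e1 : ∑ e, I.chain.edge x.2 e * (I.coupled.act (I.ofMaster x.1) e.1 *
      h (I.coupled.start (I.ofMaster x.1) e.1, e.2)) = 0 := by
    have := I.chain.sum_edge_congr x.2 (f := fun e : Fin I.letters × Fin I.chainStates =>
      I.coupled.act (I.ofMaster x.1) e.1 * h (I.coupled.start (I.ofMaster x.1) e.1, e.2))
      (g := fun _ => 0) fun e he => by
        rw [coupled_act_master]
        split_ifs with ha
        · rw [hslave _ (start_mem_goodSlaves hx he ha), mul_zero]
        · rw [zero_mul]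
    rw [this]
    simp
  rw [e1, add_zero, indicatorRate]
  congr 1
  classical
  refine if_congr ?_ rfl rfl
  exact and_iff_right (ofMaster_notMem x.1)

theorem distribution_eq_div : I.distribution = (I.mem 25 0 : ℝ) / (I.mem 25 1 : ℝ) := by
  have hp : (I.solved.pivot : ℝ) ≠ 0 := by exact_mod_cast pivot_solved_ne
  rw [distribution_eq, indicatorGain, mem_answer_num, mem_answer_den]
  push_cast
  rw [mul_div_mul_right _ _ hp]
  rfl

theorem mem_answer_pos : 0 < I.mem 25 1 := by
  rw [mem_answer_den]
  exact mul_self_pos.2 pivot_solved_ne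

end DistributionInput


open RamExpr

namespace DistributionInput

open Program

/-! ### The program runs in polynomial time -/

/-- Polynomially bounded functions of the input. -/
abbrev Poly (f : DistributionInput → ℕ) : Prop := PolyBounded inputSize f

theorem poly_letters : Poly letters := PolyBounded.size.mono letters_le
theorem poly_chainStates : Poly chainStates := PolyBounded.size.mono chainStates_le
theorem poly_masterStates : Poly masterStates := PolyBounded.size.mono masterStates_le
theorem poly_slaves : Poly slaves := PolyBounded.size.mono slaves_le
theorem poly_endPos : Poly endPos := PolyBounded.size.mono fun I => by have := I.endPos_le; omega

/-- This is where the unary notation of weights and of `B` is needed: the value of the bound, and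
with it the number of configurations, is polynomial. -/
theorem poly_accBound : Poly accBound := by
  refine ((PolyBounded.const 1).add ((PolyBounded.size (sz := inputSize)).mul
    ((PolyBounded.size).mul PolyBounded.size))).mono fun I => ?_
  have h := Finset.sum_le_card_nsmul (Finset.range (I.endPos + 2 - I.slavePos 0))
    (fun l => (I.cell (I.slavePos 0 + l)).natAbs * (I.cell (I.slavePos 0 + l)).natAbs)
    (I.inputSize * I.inputSize) fun l hl =>
      Nat.mul_le_mul (I.cell_slaveList_le l (Finset.mem_range.1 hl))
        (I.cell_slaveList_le l (Finset.mem_range.1 hl))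
  rw [Finset.card_range, smul_eq_mul] at h
  have h2 : I.endPos + 2 - I.slavePos 0 ≤ I.inputSize := by have := I.endPos_le; omega
  rw [accBound]
  exact Nat.add_le_add_left (h.trans (Nat.mul_le_mul_right _ h2)) 1

theorem poly_configs : Poly configs :=
  poly_masterStates.add ((poly_slaves.mul poly_endPos).mul
    (((PolyBounded.const 2).mul poly_accBound).add (PolyBounded.const 1)))

theorem poly_dim : Poly dim := poly_configs.mul poly_chainStates
theorem poly_order : Poly order := (PolyBounded.const 2).mul poly_dim
theorem poly_probs : Poly fun I => I.chainStates * (I.letters * I.chainStates) :=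
  poly_chainStates.mul (poly_letters.mul poly_chainStates)

theorem poly_of_eq {f g : DistributionInput → ℕ} (hg : Poly g) (h : ∀ I, f I = g I) : Poly f :=
  hg.mono fun I => (h I).le

theorem poly_blockLength : Poly fun I => Elim.blockLength I.order :=
  ((poly_order.mul ((PolyBounded.const 2).mul poly_order)).add poly_order).add (PolyBounded.const 1)

theorem poly_cellCount : ∀ i < 24, Poly fun I => I.cellCount i := by
  have hone := PolyBounded.const (sz := inputSize) 1
  have htrans := poly_configs.mul poly_letters
  have htable := (poly_dim.mul poly_dim).mul poly_letters
  have hsq := poly_order.mul poly_order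
  have hrect := poly_dim.mul poly_order
  intro i hi
  interval_cases i
  · exact poly_of_eq (poly_slaves.add hone) cellCount_zero
  · exact poly_of_eq (poly_probs.add hone) cellCount_one
  · exact poly_of_eq poly_probs cellCount_two
  · exact (poly_endPos.add (PolyBounded.const 2)).mono fun I => by rw [cellCount_three]; omega
  · exact poly_of_eq hone fun I => I.cellCount_of (by norm_num) (by simp [stages])
  · exact poly_of_eq hone fun I => I.cellCount_of (by norm_num) (by simp [stages])
  · exact poly_of_eq poly_configs fun I => cellCount_six
  · exact poly_of_eq htrans fun I => cellCount_trans (by simp)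
  · exact poly_of_eq htrans fun I => cellCount_trans (by simp)
  · exact poly_of_eq htrans fun I => cellCount_trans (by simp)
  · exact poly_of_eq (poly_masterStates.mul poly_letters) fun I => cellCount_ten
  · exact poly_of_eq htrans fun I => cellCount_trans (by simp)
  · exact poly_of_eq htrans fun I => cellCount_trans (by simp)
  · exact poly_of_eq htrans fun I => cellCount_trans (by simp)
  · exact poly_of_eq htable fun I => cellCount_table (by simp)
  · exact poly_of_eq htable fun I => cellCount_table (by simp)
  · exact poly_of_eq (poly_dim.mul (poly_letters.mul poly_chainStates)) fun I =>
      I.cellCount_of (by norm_num) (by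
        simp only [stages, eval_mul, eval_nA, eval_nS, eval_nX]; push_cast; rfl)
  · exact poly_of_eq hsq fun I => I.cellCount_of (by norm_num) (by rw [← eval_order_sq]; rfl)
  · exact poly_of_eq ((hsq.add hone).mul poly_blockLength) cellCount_elim
  · exact poly_of_eq hsq fun I => cellCount_square (by simp)
  · exact poly_of_eq hrect fun I => cellCount_rectangle (by simp)
  · exact poly_of_eq hsq fun I => cellCount_square (by simp)
  · exact poly_of_eq hrect fun I => cellCount_rectangle (by simp)
  · exact poly_of_eq (PolyBounded.const 2) fun I => cellCount_answer

/-- The numbers in the array `a` have polynomially bounded length. -/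
abbrev Short (a : ℕ) : Prop :=
  ShortArray inputSize stages (fun I : DistributionInput => inputStore I.encode) a

theorem short_two : Short 2 := by
  refine ⟨_, PolyBounded.size, fun I j => ?_⟩
  change bitLength (I.mem 2 j) ≤ _
  rw [mem_two_eq]
  split_ifs with h
  · refine (bitLength_le_natAbs _).trans ?_
    have h1 : j.toNat ≤ I.slaves := by rw [cellCount_zero] at h; omega
    have h2 : I.slavePos j.toNat ≤ I.endPos := I.slavePos_mono h1
    have := I.endPos_le
    omega
  · simp [bitLength_zero]

/-- A product of polynomially many numbers of the input: its value may be exponential, but its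
length is polynomial. -/
theorem short_three : Short 3 := by
  refine ⟨_, (poly_probs.mul PolyBounded.size).add (PolyBounded.const 1), fun I j => ?_⟩
  change bitLength (I.mem 3 j) ≤ _
  rw [mem_three_eq]
  split_ifs with h
  · refine (bitLength_prod_le _ fun l _ => I.bitLength_cell_le _).trans ?_
    rw [cellCount_one] at h
    exact Nat.add_le_add_right (Nat.mul_le_mul_right _ (by omega)) 1
  · simp [bitLength_zero]

/-- Here `N! ≤ N ^ N ≤ 2 ^ (N * N)`, so a Leibniz bound on minors gives a quadratic length in `N`.
-/
theorem bitLength_factorial_mul_pow_le {z : ℤ} {N n : ℕ}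
    (h : |z| ≤ N.factorial * ((2 : ℤ) ^ n) ^ N) : bitLength z ≤ N * N + n * N + 1 := by
  rw [bitLength_le_iff]
  have h1 : N.factorial ≤ (2 ^ N) ^ N :=
    (Nat.factorial_le_pow N).trans (Nat.pow_le_pow_left Nat.lt_two_pow_self.le _)
  have h2 : (N.factorial : ℤ) ≤ ((2 : ℤ) ^ N) ^ N := by exact_mod_cast h1
  calc |z| ≤ N.factorial * ((2 : ℤ) ^ n) ^ N := h
    _ ≤ ((2 : ℤ) ^ N) ^ N * ((2 : ℤ) ^ n) ^ N := mul_le_mul_of_nonneg_right h2 (by positivity)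
    _ = (2 : ℤ) ^ (N * N + n * N) := by rw [← pow_mul, ← pow_mul, ← pow_add]
    _ < (2 : ℤ) ^ (N * N + n * N + 1) := pow_lt_pow_right₀ (by norm_num) (Nat.lt_succ_self _)

/-- Repeated multiplication in the recursion could double the lengths in every step. It does not,
since entries and pivots at every time are minors of the extended matrix, and the remaining cells
are column numbers. -/
theorem short_elim (h : Short 19) : Short 20 := by
  obtain ⟨n, hn, h⟩ := h
  refine ⟨_, (((poly_order.mul poly_order).add (hn.mul poly_order)).add
    (PolyBounded.const 1)).add poly_order, fun I j => ?_⟩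
  change bitLength (I.mem 20 j) ≤ _
  rw [mem_elim_eq]
  split_ifs with hj
  swap
  · simp [bitLength_zero]
  have hL0 : 0 < Elim.blockLength I.order := Nat.succ_pos _
  have hb : ∀ r < I.order, ∀ c < 2 * I.order, |Elim.extend I.order I.system r c| ≤ (2 : ℤ) ^ n I := by
    intro r _ c _
    have h1 : (1 : ℤ) ≤ 2 ^ n I := one_le_pow₀ (by norm_num)
    rw [Elim.extend]
    split_ifs
    · exact (bitLength_le_iff.1 (h I _)).le
    · simpa using h1
    · simp
  have h1 : (1 : ℤ) ≤ 2 ^ n I := one_le_pow₀ (by norm_num)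
  have ht : j.toNat / Elim.blockLength I.order ≤ I.order * I.order := by
    rw [cellCount_elim] at hj
    refine Nat.lt_succ_iff.1 (Nat.div_lt_of_lt_mul ?_)
    rw [mul_comm]
    have := hj.2
    have h0 := hj.1
    rw [Nat.succ_eq_add_one]
    omega
  rw [Elim.block]
  split_ifs with hu hu'
  · have hN := I.order_pos
    refine (bitLength_factorial_mul_pow_le (Elim.abs_entry_run_le h1 ht (by omega) hb
      (Nat.div_lt_of_lt_mul (by rwa [mul_comm] at hu)) (Nat.mod_lt _ (by omega)))).trans ?_
    exact Nat.le_add_right _ _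
  · refine (bitLength_le_natAbs _).trans ?_
    rw [Int.natAbs_natCast]
    exact ((Elim.inv_run _ ht).used_le _).trans (Nat.le_add_left _ _)
  · refine (bitLength_factorial_mul_pow_le (Elim.abs_pivot_run_le h1 ht
      fun i hi c hc => hb i hi c (by omega))).trans ?_
    exact Nat.le_add_right _ _

/-- The statement that the first `i` stages run in polynomial time. -/
abbrev Runs (i : ℕ) : Prop :=
  RunsTo inputSize stages (fun I : DistributionInput => inputStore I.encode) i

theorem runs_zero : Runs 0 := by
  refine ⟨⟨_, PolyBounded.size, fun I a i => ?_⟩, _, PolyBounded.const 1, fun I =>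
    ⟨1, le_rfl, Exec.skip _⟩⟩
  change bitLength (inputStore I.encode a i) ≤ _
  by_cases ha : a = 0
  · subst ha; exact I.bitLength_cell_le i
  · simp [inputStore, ha, bitLength_zero]

theorem Runs.next {i : ℕ} (h : Runs i) (hi : i < 24) (hA : Short (i + 2)) : Runs (i + 1) :=
  RunsTo.next h (fun I a ha => by funext j; simp [inputStore, ha.ne']) (size_arrays i hi)
    (poly_cellCount i hi) hA

theorem Runs.fill {i : ℕ} (h : Runs i) (hi : i < 24)
    (hi' : i ∉ [0, 1, 3, 14, 15, 16, 18, 19, 20, 21, 22]) : Runs (i + 1) :=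
  h.next hi (shortArray_of_fill h.1 (fun a ha => (size_arrays i hi a ha).1) (fill_arrays i hi hi')
    (poly_cellCount i hi))

theorem Runs.sum {i : ℕ} (h : Runs i) (hi : i < 24) {w e : RamExpr}
    (hval : (stages i).val = sumE (i + 2) w e) (hw : ∀ a ∈ w.arrays, a < i + 2)
    (hw1 : 1 ∉ w.arrays) (he : ∀ a ∈ e.arrays, a < i + 2) {m : DistributionInput → ℕ}
    (hm : ∀ I, 0 < m I) (hwm : ∀ I, w.eval (memory I.mem 0) = m I) : Runs (i + 1) :=
  h.next hi (shortArray_of_sum h.1 (fun a ha => (size_arrays i hi a ha).1) hval hw hw1 he hm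
    (fun I => by rw [eval_eq_memory hw1 _ 0]; exact hwm I) (poly_cellCount i hi))

theorem short_of_runs {i a : ℕ} (h : Runs i) (ha : a < i + 2) : Short a := by
  obtain ⟨⟨n, hn, h⟩, -⟩ := h
  refine ⟨n, hn, fun I j => ?_⟩
  rw [← stores_eq_arr stages _ ha]
  exact h I a j

set_option maxRecDepth 10000 in
theorem runs_stages : Runs 24 := by
  have h4 : Runs 4 := by
    have h1 : Runs 1 := runs_zero.next (by norm_num) short_two
    have h2 : Runs 2 := h1.next (by norm_num) short_three
    have h3 : Runs 3 := h2.fill (by norm_num) (by decide)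
    refine h3.sum (by norm_num) rfl (by decide) (by decide) (by decide)
      (m := fun I => I.endPos + 2 - I.slavePos 0)
      (fun I => by have := I.slavePos_le_endPos; omega) fun I => ?_
    have := I.slavePos_le_endPos
    simp only [eval_sub, eval_add, eval_endE, eval_slavesE, eval_two]
    omega
  have h14 : Runs 14 := by
    refine Runs.fill ?_ (i := 13) (by norm_num) (by decide)
    refine Runs.fill ?_ (i := 12) (by norm_num) (by decide)
    refine Runs.fill ?_ (i := 11) (by norm_num) (by decide)
    refine Runs.fill ?_ (i := 10) (by norm_num) (by decide)
    refine Runs.fill ?_ (i := 9) (by norm_num) (by decide)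
    refine Runs.fill ?_ (i := 8) (by norm_num) (by decide)
    refine Runs.fill ?_ (i := 7) (by norm_num) (by decide)
    refine Runs.fill ?_ (i := 6) (by norm_num) (by decide)
    refine Runs.fill ?_ (i := 5) (by norm_num) (by decide)
    exact h4.fill (by norm_num) (by decide)
  have h15 : Runs 15 := h14.sum (by norm_num) rfl (by decide) (by decide) (by decide) letters_pos
    fun I => I.eval_nA 0
  have h16 : Runs 16 := h15.sum (by norm_num) rfl (by decide) (by decide) (by decide) letters_pos
    fun I => I.eval_nA 0
  have h17 : Runs 17 := h16.sum (by norm_num) rfl (by decide) (by decide) (by decide)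
    (m := fun I => I.letters * I.chainStates)
    (fun I => Nat.mul_pos I.letters_pos I.chainStates_pos)
    fun I => by rw [eval_mul, eval_nA, eval_nS]; push_cast; rfl
  have h18 : Runs 18 := h17.fill (by norm_num) (by decide)
  have h19 : Runs 19 := h18.next (by norm_num) (short_elim (short_of_runs h18 (by norm_num)))
  have h20 : Runs 20 := h19.sum (by norm_num) rfl (by decide) (by decide) (by decide) order_pos
    fun I => I.eval_order 0
  have h21 : Runs 21 := h20.sum (by norm_num) rfl (by decide) (by decide) (by decide) order_pos
    fun I => I.eval_order 0
  have h22 : Runs 22 := h21.sum (by norm_num) rfl (by decide) (by decide) (by decide) order_pos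
    fun I => I.eval_order 0
  have h23 : Runs 23 := h22.sum (by norm_num) rfl (by decide) (by decide) (by decide) order_pos
    fun I => I.eval_order 0
  exact h23.fill (by norm_num) (by decide)

/-- After the last stage the fraction is in array 25; two assignments move it to the output cells of
array 0, whose contents are no longer needed. -/
theorem polyTimeComputable_distribution :
    PolyTimeComputable DistributionInput.encode DistributionInput.distribution := by
  obtain ⟨⟨n, hn, hshort⟩, T, hT, hE⟩ := runs_stages
  obtain ⟨c1, hc1⟩ := RamExpr.exists_cost_le (.read 25 0)
  obtain ⟨c2, hc2⟩ := RamExpr.exists_cost_le (.read 25 1)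
  obtain ⟨c3, hc3⟩ := RamExpr.exists_cost_le 0
  obtain ⟨c4, hc4⟩ := RamExpr.exists_cost_le 1
  have hn1 := hn.add (PolyBounded.const 1)
  obtain ⟨p, hp⟩ := hT.add (((PolyBounded.const (c1 + c2 + c3 + c4)).mul hn1).add
    (PolyBounded.const 4))
  refine ⟨.seq (stagesCode stages 24) (.seq (.write 0 0 (.read 25 0)) (.write 0 1 (.read 25 1))), p,
    fun I => ?_⟩
  obtain ⟨t, ht, hE⟩ := hE I
  have hmem : stores stages (inputStore I.encode) 24 25 = I.mem 25 :=
    stores_eq_arr stages _ (by norm_num)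
  set σ := stores stages (inputStore I.encode) 24
  have e1 := Exec.write σ 0 0 (.read 25 0)
  set τ := Function.update σ 0 (Function.update (σ 0) (RamExpr.eval σ 0)
    ((RamExpr.read 25 0).eval σ)) with hτ
  have e2 := Exec.write τ 0 1 (.read 25 1)
  have h0 : (RamExpr.read 25 0).eval σ = I.mem 25 0 := congrFun hmem 0
  have hτ25 : τ 25 = I.mem 25 := by rw [hτ, Function.update_of_ne (by norm_num), hmem]
  have h1 : (RamExpr.read 25 1).eval τ = I.mem 25 1 := congrFun hτ25 1
  have hτs : ∀ a j, bitLength (τ a j) ≤ n I := by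
    intro a j
    by_cases ha : a = 0
    · subst ha
      rw [hτ, Function.update_self, show RamExpr.eval σ 0 = 0 from rfl]
      by_cases hj : j = 0
      · subst hj
        rw [Function.update_self]
        exact hshort I 25 0
      · rw [Function.update_of_ne hj]
        exact hshort I 0 j
    · rw [hτ, Function.update_of_ne ha]
      exact hshort I a j
  refine ⟨_, _, Exec.seq hE (Exec.seq e1 e2), ?_, ?_, ?_⟩
  · have k1 : (RamExpr.read 25 0).cost σ ≤ _ := (hc1 _ _ (hshort I)).1
    have k2 := (hc2 _ _ hτs).1
    have k3 : RamExpr.cost σ 0 ≤ _ := (hc3 _ _ (hshort I)).1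
    have k4 := (hc4 _ _ hτs).1
    refine le_trans ?_ (hp I)
    dsimp only
    rw [add_mul, add_mul, add_mul]
    change t + (RamExpr.cost σ 0 + (RamExpr.read 25 0).cost σ + 1 +
      (RamExpr.cost τ 1 + (RamExpr.read 25 1).cost τ + 1) + 1) + 1 ≤ _
    omega
  · rw [h1, Function.update_self, show RamExpr.eval τ 1 = 1 from rfl, Function.update_self]
    exact mem_answer_pos
  · rw [h1, Function.update_self, show RamExpr.eval τ 1 = 1 from rfl, Function.update_self,
      Function.update_of_ne (by norm_num), hτ, Function.update_self, h0,
      show RamExpr.eval σ 0 = 0 from rfl, Function.update_self]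
    exact distribution_eq_div

end DistributionInput

end NestedWeighted

end

open NestedWeighted in
theorem mainTheorem5 :
    PolyTimeComputable DistributionInput.encode DistributionInput.distribution ∧
    ∀ (I : DistributionInput) (C : Set (Fin I.masterStates × Fin I.chainStates)),
      IsEndSCC I.nwa.master I.chain C →
      I.chain.pathMeasure (endsIn I.nwa.master I.chain C) ≠ 0 →
      Integrable (fun ω => (I.value (wordOf ω)).toReal)
        (ProbabilityTheory.cond I.chain.pathMeasure (endsIn I.nwa.master I.chain C)) ∧
      ∀ᵐ ω ∂(ProbabilityTheory.cond I.chain.pathMeasure (endsIn I.nwa.master I.chain C)),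
        I.value (wordOf ω) =
          ((∫ ω', (I.value (wordOf ω')).toReal
            ∂(ProbabilityTheory.cond I.chain.pathMeasure
              (endsIn I.nwa.master I.chain C)) : ℝ) : EReal) :=
  ⟨DistributionInput.polyTimeComputable_distribution, fun I _ hC hpos =>
    I.slaveModel.integrable_value_and_ae_eq I.chain I.accepts_ae hC hpos⟩
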